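/- For $n\ge 0$ let $F(n)$ be the $\mathbb{Q}$-vector space generated by the finite connected graphs (loops and multiple edges allowed) whose vertices are trivalent or univalent, with exactly $n$ univalent vertices, labelled $1,\dots,n$, and with a cyclic order of the three half-edges at each trivalent vertex, modulo isomorphism, the relation (AS): reversing the cyclic order at one trivalent vertex changes the sign, and the relation (IHX): for an edge $e$ joining two distinct trivalent vertices with cyclic orders $(e,a,b)$ and $(e,c,d)$, the three graphs obtained by cyclically permuting what is attached at $a,b,c$ sum up to zero. Vogel's algebra $\Lambda$ is the subspace of those $a\in F(3)$ for which every transposition of two labels sends $a$ to $-a$. For $a\in\Lambda$ and a graph $G$ of $F(3)$ choose a trivalent vertex $v$ of $G$ whose half-edges are, in cyclic order, $h_1,h_2,h_3$, remove $v$ and glue, for each $k$, the univalent vertex $k$ of $a$ to the edge that entered $v$ along $h_k$. The resulting element of $F(3)$ does not depend on the choices, and extended linearly this makes $\Lambda$ a commutative $\mathbb{Q}$-algebra whose unit is the graph with one trivalent vertex and cyclic order $(1,2,3)$. An element of $\Lambda$ has degree $d$ if it is a linear combination of graphs with $2d+1$ trivalent vertices. Let $t$ be given by the triangle with trivalent vertices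 $v_1,v_2,v_3$, where $v_k$ is adjacent, in this cyclic order, to the univalent vertex $k$, to $v_{k+1}$ and to $v_{k-1}$ (indices modulo $3$). For $n\ge3$ let $x_n$ be given by the following graph with $2n+1$ trivalent vertices. There is a path $p_1,\dots,p_n$ and a cycle $c_1,\dots,c_{n+1}$; $p_1$ is also joined to the univalent vertex $1$, $p_n$ to the univalent vertex $3$, $c_{n+1}$ to the univalent vertex $2$, and $p_k$ to $c_k$ for $1\le k\le n$. The cyclic order at $p_k$ is (edge towards $p_{k-1}$ or, for $k=1$, the univalent vertex $1$; edge to $c_k$; edge towards $p_{k+1}$ or, for $k=n$, the univalent vertex $3$), and at $c_k$ it is (edge leaving the cycle; edge to $c_{k-1}$; edge to $c_{k+1}$), indices of the $c_k$ being taken modulo $n+1$. Put $x_1:=2t$ and $x_2:=t^2$. Define polynomials with rational coefficients in variables $t$ and $x_n$ $(n\ge1)$ by \begin{align*} P_{i,j} :={}& 3x_{i+2}x_{j+4}-3t\,x_{i+1}x_{j+4}-9t\,x_{i+2}x_{j+3}-6t^2x_ix_{j+4}+9t^2x_{i+1}x_{j+3}+18t^3x_ix_{j+3}\\ &-2(x_3+2t^3)x_{i+1}x_{j+2}+4t(x_3-4t^3)x_ix_{j+2}+8t^2(t^3-x_3)x_ix_{j+1}+3t^{i+2}x_{j+4}\\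 &-9t^{i+3}x_{j+3}+(7t^3-x_3)t^{i+1}x_{j+2}+3(x_3-t^3)t^{i+2}x_{j+1}+2(t^3-x_3)t^{i+3}x_j \end{align*} for $i,j\ge1$, and recursively, for $k,j\ge1$ and $i\ge0$, \begin{align*} Q^k_{-1,2}&:=t^k,\qquad Q^k_{0,j}:=x_{j+k},\\ Q^k_{i+1,j}&:=t\,Q^k_{i,j+1}-\tfrac12Q^k_{i,j+2}+\tfrac12t^jQ^k_{i,2}+\tfrac12(x_{j+2}-t^{j+2})\,Q^k_{i-1,2}. \end{align*} Theorem. The graphs above represent elements $t$ and $x_n$ $(n\ge3)$ of $\Lambda$, $t$ has degree $1$ and $x_n$ has degree $n$ for all $n\ge1$. The equations $P_{i,j}=P_{j,i}$ for all $i,j\ge1$, and $Q^1_{i,1}=Q^2_{i-1,2}$ for all $i\ge0$, are identities in $\Lambda$. If $t$ is given degree $1$ and $x_n$ degree $n$, then both sides of these equations are homogeneous of degree $i+j+6$ and $2i+2$, respectively, as polynomials and as elements of $\Lambda$. -/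

import Mathlib

open Relation

noncomputable section

namespace Vogel

/-- A perfect matching of a set `P`, given as an involution without fixed points. -/
@[ext]
structure Pairing (P : Type) where
  toFun : P → P
  invol : ∀ x, toFun (toFun x) = x
  ne : ∀ x, toFun x ≠ x

instance {P : Type} : CoeFun (Pairing P) (fun _ => P → P) := ⟨Pairing.toFun⟩

/-- Transport of a matching along a bijection. -/
def Pairing.map {P Q : Type} (p : Pairing P) (e : P ≃ Q) : Pairing Q where
  toFun x := e (p (e.symm x))
  invol x := by simp [p.invol]
  ne x h := p.ne (e.symm x) ((Equiv.eq_symm_apply e).2 h)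

/-- The transposition of `a` and `b`. -/
def sw {P : Type} (a b : P) : Equiv.Perm P := @Equiv.swap P (Classical.decEq P) a b

/-- The ends that are to be matched: each trivalent vertex `v : V` has three numbered half-edges
`Sum.inl (v, s)`, whose numbering fixes the orientation of `v` (the cyclic order `0, 1, 2`), and
each of the `n` labelled univalent vertices is one end `Sum.inr i`. -/
abbrev Pt (V : Type) (n : ℕ) : Type := (V × Fin 3) ⊕ Fin n

/-- One step in a graph: along an edge, or between two half-edges of a trivalent vertex. -/
inductive Step {V : Type} {n : ℕ} (p : Pairing (Pt V n)) : Pt V n → Pt V n → Prop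
  | edge (x : Pt V n) : Step p x (p x)
  | vert (v : V) (s s' : Fin 3) : Step p (Sum.inl (v, s)) (Sum.inl (v, s'))

/-- Connectedness of the graph given by a matching. -/
def Conn {V : Type} {n : ℕ} (p : Pairing (Pt V n)) : Prop :=
  Nonempty (Pt V n) ∧ ∀ x y, EqvGen (Step p) x y

/-- A connected uni-trivalent graph with oriented trivalent vertices and `n` univalent vertices,
labelled by `Fin n`. -/
structure Graph (n : ℕ) : Type 1 where
  V : Type
  [fin : Finite V]
  p : Pairing (Pt V n)
  conn : Conn p

attribute [instance] Graph.fin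

/-- A bijection of half-edges, extended by the identity on the univalent vertices. -/
def ext {V V' : Type} {n : ℕ} (θ : V × Fin 3 ≃ V' × Fin 3) : Pt V n ≃ Pt V' n :=
  Equiv.sumCongr θ (Equiv.refl (Fin n))

/-- A bijection of trivalent vertices, extended to half-edges. -/
def onV {V V' : Type} (e : V ≃ V') : V × Fin 3 ≃ V' × Fin 3 :=
  Equiv.prodCongr e (Equiv.refl (Fin 3))

/-- The cyclic permutation `(u, 1) ↦ (u, 2) ↦ (v, 1) ↦ (u, 1)` of half-edges. -/
def cyc {V : Type} (u v : V) : Equiv.Perm (V × Fin 3) :=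
  sw (u, 1) (v, 1) * sw (u, 1) (u, 2)

/-- The defining relations: isomorphic graphs are equal (`iso`), reversing the orientation of one
trivalent vertex changes the sign (`as`), and, for an edge joining the half-edges `(u, 0)` and
`(v, 0)` of distinct trivalent vertices, the three graphs obtained by cyclically permuting what is
attached to `(u, 1)`, `(u, 2)`, `(v, 1)` sum up to zero (`ihx`). -/
inductive Rel (n : ℕ) : (Graph n →₀ ℚ) → Prop
  | iso {V V' : Type} [Finite V] [Finite V'] (e : V ≃ V') (p : Pairing (Pt V n)) (h : Conn p)
      (h' : Conn (p.map (ext (onV e)))) :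
      Rel n (Finsupp.single ⟨V', p.map (ext (onV e)), h'⟩ 1 - Finsupp.single ⟨V, p, h⟩ 1)
  | as {V : Type} [Finite V] (p : Pairing (Pt V n)) (v : V) (s s' : Fin 3) (hs : s ≠ s')
      (h : Conn p) (h' : Conn (p.map (ext (sw (v, s) (v, s'))))) :
      Rel n (Finsupp.single ⟨V, p.map (ext (sw (v, s) (v, s'))), h'⟩ 1 + Finsupp.single ⟨V, p, h⟩ 1)
  | ihx {V : Type} [Finite V] (p : Pairing (Pt V n)) (u v : V) (huv : u ≠ v)
      (hp : p (Sum.inl (u, 0)) = Sum.inl (v, 0)) (h : Conn p)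
      (h' : Conn (p.map (ext (cyc u v)))) (h'' : Conn (p.map (ext (cyc u v).symm))) :
      Rel n (Finsupp.single ⟨V, p, h⟩ 1 + Finsupp.single ⟨V, p.map (ext (cyc u v)), h'⟩ 1
        + Finsupp.single ⟨V, p.map (ext (cyc u v).symm), h''⟩ 1)

/-- The space `F(n)` of connected graphs modulo (AS) and (IHX). -/
abbrev F (n : ℕ) : Type 1 := (Graph n →₀ ℚ) ⧸ Submodule.span ℚ {a | Rel n a}

/-- The class of a connected graph in `F(n)`. -/
def Graph.cls {n : ℕ} (G : Graph n) : F n := Submodule.Quotient.mk (Finsupp.single G 1)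

/-! ### Basic lemmas -/

section basic
variable {P Q R V V' : Type} {n : ℕ}

theorem Pairing.ext_coe {p q : Pairing P} (h : ∀ x, p x = q x) : p = q :=
  Pairing.ext (funext h)

theorem Pairing.map_apply (p : Pairing P) (e : P ≃ Q) (x : P) : p.map e (e x) = e (p x) := by
  simp [Pairing.map]

theorem Pairing.map_map (p : Pairing P) (e : P ≃ Q) (f : Q ≃ R) :
    (p.map e).map f = p.map (e.trans f) := rfl

theorem Pairing.map_refl (p : Pairing P) : p.map (Equiv.refl P) = p := rfl

theorem Pairing.eq_map {p : Pairing P} {q : Pairing Q} (e : P ≃ Q) (h : ∀ x, q (e x) = e (p x)) :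
    q = p.map e := by
  apply Pairing.ext_coe
  intro x
  obtain ⟨y, rfl⟩ := e.surjective x
  rw [h, Pairing.map_apply]

theorem sw_left (a b : P) : sw a b a = b := by
  unfold sw; exact @Equiv.swap_apply_left P (Classical.decEq P) a b
theorem sw_right (a b : P) : sw a b b = a := by
  unfold sw; exact @Equiv.swap_apply_right P (Classical.decEq P) a b
theorem sw_ne {a b x : P} (h : x ≠ a) (h' : x ≠ b) : sw a b x = x := by
  unfold sw; exact @Equiv.swap_apply_of_ne_of_ne P (Classical.decEq P) a b x h h'
theorem sw_symm (a b : P) : (sw a b).symm = sw a b := by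
  unfold sw; exact @Equiv.symm_swap P (Classical.decEq P) a b
theorem sw_sw (a b x : P) : sw a b (sw a b x) = x := by
  unfold sw; exact @Equiv.swap_apply_self P (Classical.decEq P) a b x
theorem sw_eq [DecidableEq P] (a b : P) : sw a b = Equiv.swap a b := by
  unfold sw; congr!
theorem sw_map (e : P → Q) (he : Function.Injective e) (a b x : P) :
    sw (e a) (e b) (e x) = e (sw a b x) := by
  by_cases h1 : x = a
  · subst h1; simp [sw_left]
  by_cases h2 : x = b
  · subst h2; simp [sw_right]
  rw [sw_ne h1 h2, sw_ne (he.ne h1) (he.ne h2)]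

@[simp] theorem ext_inl (θ : V × Fin 3 ≃ V' × Fin 3) (x : V × Fin 3) :
    (ext θ : Pt V n ≃ Pt V' n) (Sum.inl x) = Sum.inl (θ x) := rfl
@[simp] theorem ext_inr (θ : V × Fin 3 ≃ V' × Fin 3) (i : Fin n) :
    (ext θ : Pt V n ≃ Pt V' n) (Sum.inr i) = Sum.inr i := rfl
@[simp] theorem ext_symm (θ : V × Fin 3 ≃ V' × Fin 3) :
    (ext θ : Pt V n ≃ Pt V' n).symm = ext θ.symm := rfl

theorem ext_trans {V'' : Type} (θ : V × Fin 3 ≃ V' × Fin 3) (θ' : V' × Fin 3 ≃ V'' × Fin 3) :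
    (ext θ : Pt V n ≃ Pt V' n).trans (ext θ') = ext (θ.trans θ') := by
  ext1 x; rcases x with x | x <;> rfl

theorem ext_refl : (ext (Equiv.refl (V × Fin 3)) : Pt V n ≃ Pt V n) = Equiv.refl _ := by
  ext1 x; rcases x with x | x <;> rfl

theorem onV_symm (e : V ≃ V') : onV e.symm = (onV e).symm := rfl

theorem reach_vert (p : Pairing (Pt V n)) (v : V) (s s' : Fin 3) :
    EqvGen (Step p) (Sum.inl (v, s)) (Sum.inl (v, s')) := EqvGen.rel _ _ (Step.vert v s s')

theorem reach_edge (p : Pairing (Pt V n)) (x : Pt V n) :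
    EqvGen (Step p) x (p x) := EqvGen.rel _ _ (Step.edge x)

/-- Transfer of reachability. -/
theorem reach_transfer {n' : ℕ} {p : Pairing (Pt V n)} {q : Pairing (Pt V' n')}
    (f : Pt V n → Pt V' n')
    (he : ∀ x, EqvGen (Step q) (f x) (f (p x)))
    (hv : ∀ v s s', EqvGen (Step q) (f (Sum.inl (v, s))) (f (Sum.inl (v, s'))))
    {x y : Pt V n} (h : EqvGen (Step p) x y) : EqvGen (Step q) (f x) (f y) := by
  induction h with
  | rel x y h =>
    cases h with
    | edge => exact he _
    | vert v s s' => exact hv _ _ _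
  | refl => exact EqvGen.refl _
  | symm _ _ _ ih => exact EqvGen.symm _ _ ih
  | trans _ _ _ _ _ h1 h2 => exact EqvGen.trans _ _ _ h1 h2

theorem conn_map_of {p : Pairing (Pt V n)} (θ : Equiv.Perm (Pt V n))
    (h : ∀ x, EqvGen (Step (p.map θ)) x (θ x)) (hp : Conn p) : Conn (p.map θ) := by
  refine ⟨hp.1, fun x y => ?_⟩
  refine reach_transfer (fun x => x) ?_ ?_ (hp.2 x y)
  · intro x
    refine EqvGen.trans _ _ _ (h x) (EqvGen.trans _ (θ (p x)) _ ?_ (EqvGen.symm _ _ (h _)))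
    rw [← Pairing.map_apply]
    exact reach_edge _ _
  · intro v s s'; exact reach_vert _ _ _ _

theorem conn_onV {p : Pairing (Pt V n)} (e : V ≃ V') (hp : Conn p) :
    Conn (p.map (ext (onV e))) := by
  refine ⟨hp.1.map (ext (onV e)), fun x y => ?_⟩
  obtain ⟨x, rfl⟩ := (ext (onV e)).surjective x
  obtain ⟨y, rfl⟩ := (ext (onV e)).surjective y
  refine reach_transfer (ext (onV e)) ?_ ?_ (hp.2 x y)
  · intro x; rw [← Pairing.map_apply]; exact reach_edge _ _
  · intro v s s'; exact reach_vert _ _ _ _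

/-- A permutation of the labels, as a permutation of the ends. -/
def lg (σ : Equiv.Perm (Fin n)) : Pt V n ≃ Pt V n := Equiv.sumCongr (Equiv.refl _) σ

theorem conn_legs {p : Pairing (Pt V n)} (σ : Equiv.Perm (Fin n)) (hp : Conn p) :
    Conn (p.map (lg σ)) := by
  set e : Pt V n ≃ Pt V n := lg σ
  refine ⟨hp.1.map e, fun x y => ?_⟩
  obtain ⟨x, rfl⟩ := e.surjective x
  obtain ⟨y, rfl⟩ := e.surjective y
  refine reach_transfer e ?_ ?_ (hp.2 x y)
  · intro x; rw [← Pairing.map_apply]; exact reach_edge _ _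
  · intro v s s'; exact reach_vert _ _ _ _

theorem conn_as {p : Pairing (Pt V n)} (v : V) (s s' : Fin 3) (hp : Conn p) :
    Conn (p.map (ext (sw (v, s) (v, s')))) := by
  refine conn_map_of _ ?_ hp
  rintro (x | x)
  · rw [ext_inl]
    by_cases h : x = (v, s)
    · subst h; rw [sw_left]; exact reach_vert _ _ _ _
    by_cases h' : x = (v, s')
    · subst h'; rw [sw_right]; exact reach_vert _ _ _ _
    rw [sw_ne h h']; exact EqvGen.refl _
  · exact EqvGen.refl _

theorem cyc_1 {u v : V} : cyc u v (u, 1) = (u, 2) := by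
  rw [cyc, Equiv.Perm.mul_apply, sw_left, sw_ne (by simp) (by simp)]
theorem cyc_2 {u v : V} : cyc u v (u, 2) = (v, 1) := by
  rw [cyc, Equiv.Perm.mul_apply, sw_right, sw_left]
theorem cyc_3 {u v : V} (h : u ≠ v) : cyc u v (v, 1) = (u, 1) := by
  have h1 : sw (u, (1 : Fin 3)) (u, 2) (v, 1) = (v, 1) := sw_ne (by simp [h.symm]) (by simp)
  rw [cyc, Equiv.Perm.mul_apply, h1, sw_right]
theorem cyc_ne {u v : V} {x : V × Fin 3} (h1 : x ≠ (u, 1)) (h2 : x ≠ (u, 2)) (h3 : x ≠ (v, 1)) :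
    cyc u v x = x := by
  rw [cyc, Equiv.Perm.mul_apply, sw_ne h1 h2, sw_ne h1 h3]

/-- A permutation moving only half-edges of `u`, `v` other than number `0` preserves
connectedness, if the zeroth half-edges of `u`, `v` are joined. -/
theorem conn_perm {p : Pairing (Pt V n)} {u v : V} (hp0 : p (Sum.inl (u, 0)) = Sum.inl (v, 0))
    (θ : Equiv.Perm (V × Fin 3)) (h0 : θ (u, 0) = (u, 0)) (h1 : θ (v, 0) = (v, 0))
    (hθ : ∀ x, θ x ≠ x → (x.1 = u ∨ x.1 = v) ∧ ((θ x).1 = u ∨ (θ x).1 = v)) (hp : Conn p) :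
    Conn (p.map (ext θ)) := by
  refine conn_map_of _ ?_ hp
  have key : ∀ x y : V × Fin 3, (x.1 = u ∨ x.1 = v) → (y.1 = u ∨ y.1 = v) →
      EqvGen (Step (p.map (ext θ))) (Sum.inl x) (Sum.inl y) := by
    have base : EqvGen (Step (p.map (ext θ))) (Sum.inl (u, 0)) (Sum.inl (v, 0)) := by
      have := reach_edge (p.map (ext θ)) (ext θ (Sum.inl (u, 0)))
      rw [Pairing.map_apply, hp0, ext_inl, ext_inl, h0, h1] at this
      exact this
    have : ∀ x : V × Fin 3, (x.1 = u ∨ x.1 = v) →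
        EqvGen (Step (p.map (ext θ))) (Sum.inl x) (Sum.inl (u, 0)) := by
      rintro ⟨x, s⟩ (h | h)
      · simp only at h; subst h; exact reach_vert _ _ _ _
      · simp only at h; subst h
        exact EqvGen.trans _ _ _ (reach_vert _ _ _ _) (EqvGen.symm _ _ base)
    intro x y hx hy
    exact EqvGen.trans _ _ _ (this x hx) (EqvGen.symm _ _ (this y hy))
  rintro (x | x)
  · rw [ext_inl]
    by_cases h : θ x = x
    · rw [h]; exact EqvGen.refl _
    · exact key _ _ (hθ x h).1 (hθ x h).2
  · exact EqvGen.refl _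

theorem cyc_supp {u v : V} (huv : u ≠ v) (x : V × Fin 3) (hx : cyc u v x ≠ x) :
    (x.1 = u ∨ x.1 = v) ∧ ((cyc u v x).1 = u ∨ (cyc u v x).1 = v) := by
  by_cases h1 : x = (u, 1)
  · subst h1; rw [cyc_1]; simp
  by_cases h2 : x = (u, 2)
  · subst h2; rw [cyc_2]; simp
  by_cases h3 : x = (v, 1)
  · subst h3; rw [cyc_3 huv]; simp
  exact absurd (cyc_ne h1 h2 h3) hx

theorem conn_cyc {p : Pairing (Pt V n)} {u v : V} (huv : u ≠ v)
    (hp0 : p (Sum.inl (u, 0)) = Sum.inl (v, 0)) (hp : Conn p) : Conn (p.map (ext (cyc u v))) :=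
  conn_perm hp0 _ (cyc_ne (by simp) (by simp) (by simp)) (cyc_ne (by simp) (by simp) (by simp))
    (cyc_supp huv) hp

theorem conn_cyc' {p : Pairing (Pt V n)} {u v : V} (huv : u ≠ v)
    (hp0 : p (Sum.inl (u, 0)) = Sum.inl (v, 0)) (hp : Conn p) :
    Conn (p.map (ext (cyc u v).symm)) := by
  refine conn_perm hp0 _ ?_ ?_ ?_ hp
  · rw [Equiv.symm_apply_eq, cyc_ne (by simp) (by simp) (by simp)]
  · rw [Equiv.symm_apply_eq, cyc_ne (by simp) (by simp) (by simp)]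
  · intro x hx
    have := cyc_supp huv ((cyc u v).symm x) (by
      rw [Equiv.apply_symm_apply]; exact fun h => hx h.symm)
    rw [Equiv.apply_symm_apply] at this
    exact this.symm

end basic

/-! ### Classes of matchings, and linear maps out of `F(n)` -/

section classes
variable {V V' : Type} {n : ℕ}

open Classical in
/-- The class of the graph given by a matching; it is `0` if the graph is not connected. -/
def rcls [Finite V] (p : Pairing (Pt V n)) : F n :=
  if h : Conn p then Graph.cls ⟨V, p, h⟩ else 0

theorem rcls_of [Finite V] {p : Pairing (Pt V n)} (h : Conn p) :
    rcls p = Graph.cls ⟨V, p, h⟩ := dif_pos h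

theorem rcls_not [Finite V] {p : Pairing (Pt V n)} (h : ¬ Conn p) : rcls p = 0 := dif_neg h

theorem rcls_graph (G : Graph n) : rcls G.p = G.cls := rcls_of G.conn

theorem mk_rel {a : Graph n →₀ ℚ} (h : Rel n a) : (Submodule.Quotient.mk a : F n) = 0 :=
  (Submodule.Quotient.mk_eq_zero _).2 (Submodule.subset_span h)

theorem rcls_iso [Finite V] [Finite V'] (e : V ≃ V') (p : Pairing (Pt V n)) :
    rcls (p.map (ext (onV e))) = rcls p := by
  by_cases h : Conn p
  · have h' := conn_onV e h
    rw [rcls_of h, rcls_of h', ← sub_eq_zero]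
    exact mk_rel (Rel.iso e p h h')
  · rw [rcls_not h, rcls_not]
    intro h'
    have := conn_onV e.symm h'
    rw [Pairing.map_map, ext_trans, onV_symm, Equiv.self_trans_symm, ext_refl] at this
    exact h this

theorem map_sw_sw (p : Pairing (Pt V n)) (a b : V × Fin 3) :
    (p.map (ext (sw a b))).map (ext (sw a b)) = p := by
  rw [Pairing.map_map]
  conv_lhs => rw [ext_trans]; rw [← sw_symm]
  rw [sw_symm]
  nth_rewrite 2 [← sw_symm]
  rw [Equiv.self_trans_symm, ext_refl, Pairing.map_refl]

theorem rcls_as [Finite V] (p : Pairing (Pt V n)) (v : V) {s s' : Fin 3} (hs : s ≠ s') :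
    rcls (p.map (ext (sw (v, s) (v, s')))) = - rcls p := by
  by_cases h : Conn p
  · have h' := conn_as v s s' h
    rw [rcls_of h, rcls_of h', eq_neg_iff_add_eq_zero]
    exact mk_rel (Rel.as p v s s' hs h h')
  · rw [rcls_not h, rcls_not, neg_zero]
    intro h'
    have := conn_as v s s' h'
    rw [map_sw_sw] at this
    exact h this

theorem rcls_ihx [Finite V] (p : Pairing (Pt V n)) {u v : V} (huv : u ≠ v)
    (hp : p (Sum.inl (u, 0)) = Sum.inl (v, 0)) :
    rcls p + rcls (p.map (ext (cyc u v))) + rcls (p.map (ext (cyc u v).symm)) = 0 := by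
  by_cases h : Conn p
  · have h' := conn_cyc huv hp h
    have h'' := conn_cyc' huv hp h
    rw [rcls_of h, rcls_of h', rcls_of h'']
    exact mk_rel (Rel.ihx p u v huv hp h h' h'')
  · have e0 : cyc u v (u, 0) = (u, 0) := cyc_ne (by simp) (by simp) (by simp)
    have e1 : cyc u v (v, 0) = (v, 0) := cyc_ne (by simp) (by simp) (by simp)
    have e0' : (cyc u v).symm (u, 0) = (u, 0) := by rw [Equiv.symm_apply_eq, e0]
    have e1' : (cyc u v).symm (v, 0) = (v, 0) := by rw [Equiv.symm_apply_eq, e1]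
    rw [rcls_not h, rcls_not, rcls_not]
    · simp
    · intro h'
      have hh : (p.map (ext (cyc u v).symm)) (Sum.inl (u, 0)) = Sum.inl (v, 0) := by
        have := Pairing.map_apply p (ext (cyc u v).symm) (Sum.inl (u, 0))
        rwa [hp, ext_inl, ext_inl, e0', e1'] at this
      have := conn_cyc huv hh h'
      rw [Pairing.map_map, ext_trans, Equiv.symm_trans_self, ext_refl] at this
      exact h this
    · intro h'
      have hh : (p.map (ext (cyc u v))) (Sum.inl (u, 0)) = Sum.inl (v, 0) := by
        have := Pairing.map_apply p (ext (cyc u v)) (Sum.inl (u, 0))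
        rwa [hp, ext_inl, ext_inl, e0, e1] at this
      have := conn_cyc' huv hh h'
      rw [Pairing.map_map, ext_trans, Equiv.self_trans_symm, ext_refl] at this
      exact h this

/-- A function on graphs that respects the relations defines a linear map on `F(n)`. -/
def lift {M : Type*} [AddCommGroup M] [Module ℚ M] (f : Graph n → M)
    (h : ∀ a, Rel n a → Finsupp.linearCombination ℚ f a = 0) : F n →ₗ[ℚ] M :=
  Submodule.liftQ _ (Finsupp.linearCombination ℚ f) (Submodule.span_le.2 h)

theorem lift_cls {M : Type*} [AddCommGroup M] [Module ℚ M] (f : Graph n → M)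
    (h : ∀ a, Rel n a → Finsupp.linearCombination ℚ f a = 0) (G : Graph n) :
    lift f h G.cls = f G := by
  unfold lift Graph.cls
  rw [Submodule.liftQ_apply]
  simp

theorem F_induction {M : Type*} [AddCommGroup M] [Module ℚ M] {f g : F n →ₗ[ℚ] M}
    (h : ∀ G : Graph n, f G.cls = g G.cls) : f = g := by
  apply Submodule.linearMap_qext
  apply Finsupp.lhom_ext'
  intro G
  apply LinearMap.ext_ring
  exact h G

end classes

/-! ### Insertion of a graph with three univalent vertices at a trivalent vertex -/

section insertion
variable {U U' : Type} {n n' : ℕ}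

theorem leg_left (H : Graph 3) (i : Fin 3) : ∃ x, H.p (Sum.inr i) = Sum.inl x := by
  rcases hx : H.p (Sum.inr i) with x | j
  · exact ⟨x, rfl⟩
  exfalso
  have hj : H.p (Sum.inr j) = Sum.inr i := by rw [← hx, H.p.invol]
  have inv : ∀ x y, EqvGen (Step H.p) x y →
      ((x = Sum.inr i ∨ x = Sum.inr j) ↔ (y = Sum.inr i ∨ y = Sum.inr j)) := by
    intro x y h
    induction h with
    | rel x y h =>
      cases h with
      | edge =>
        constructor
        · rintro (rfl | rfl)
          · right; exact hx
          · left; exact hj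
        · rintro (h | h)
          · right; rw [← H.p.invol x, h, hx]
          · left; rw [← H.p.invol x, h, hj]
      | vert v s s' => simp
    | refl => rfl
    | symm _ _ _ ih => exact ih.symm
    | trans _ _ _ _ _ h1 h2 => exact h1.trans h2
  obtain ⟨k, h1, h2⟩ : ∃ k : Fin 3, k ≠ i ∧ k ≠ j := by
    clear inv hj hx; revert i j; decide
  have := (inv _ _ (H.conn.2 (Sum.inr i) (Sum.inr k))).1 (Or.inl rfl)
  simp [h1, h2] at this

/-- The half-edge to which the `i`-th univalent vertex is attached. -/
def att (H : Graph 3) (i : Fin 3) : H.V × Fin 3 := Classical.choose (leg_left H i)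

theorem att_spec (H : Graph 3) (i : Fin 3) : H.p (Sum.inr i) = Sum.inl (att H i) :=
  Classical.choose_spec (leg_left H i)

theorem att_spec' (H : Graph 3) (i : Fin 3) : H.p (Sum.inl (att H i)) = Sum.inr i := by
  rw [← att_spec, H.p.invol]

theorem att_eq {H : Graph 3} {i : Fin 3} {x : H.V × Fin 3} (h : H.p (Sum.inl x) = Sum.inr i) :
    att H i = x := by
  have := H.p.invol (Sum.inl x)
  rw [h, att_spec] at this
  exact Sum.inl.inj this

/-- Half-edges of the inserted graph, as half-edges of the result. -/
def kk {W : Type} (x : W × Fin 3) : Pt (U ⊕ W) n := Sum.inl (Sum.inr x.1, x.2)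

/-- Ends in a graph with the distinguished trivalent vertex `none`, as ends of the result of
inserting `H` at `none`: the half-edges of `none` are replaced by those half-edges of `H`
to which the univalent vertices of `H` were attached. -/
def jj (H : Graph 3) : Pt (Option U) n → Pt (U ⊕ H.V) n
  | Sum.inl (some u, s) => Sum.inl (Sum.inl u, s)
  | Sum.inl (none, s) => kk (att H s)
  | Sum.inr i => Sum.inr i

/-- The matching that results from inserting `H` at the trivalent vertex `none`. -/
def insFun (C : Pairing (Pt (Option U) n)) (H : Graph 3) : Pt (U ⊕ H.V) n → Pt (U ⊕ H.V) n
  | Sum.inl (Sum.inl u, s) => jj H (C (Sum.inl (some u, s)))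
  | Sum.inl (Sum.inr w, s) =>
    match H.p (Sum.inl (w, s)) with
    | Sum.inl x => kk x
    | Sum.inr i => jj H (C (Sum.inl (none, i)))
  | Sum.inr i => jj H (C (Sum.inr i))

theorem kk_inj {W : Type} : Function.Injective (kk : W × Fin 3 → Pt (U ⊕ W) n) := by
  rintro ⟨a, b⟩ ⟨c, d⟩ h
  simpa [kk] using h

theorem att_inj (H : Graph 3) : Function.Injective (att H) := by
  intro i j h
  have := att_spec' H i
  rw [h, att_spec'] at this
  exact (Sum.inr.inj this).symm

theorem jj_inj (H : Graph 3) : Function.Injective (jj H : Pt (Option U) n → _) := by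
  rintro (⟨_ | u, s⟩ | i) (⟨_ | u', s'⟩ | i') h
  · have := att_inj H (kk_inj h); rw [this]
  · simp [jj, kk] at h
  · simp [jj, kk] at h
  · simp [jj, kk] at h
  · simpa [jj] using h
  · simp [jj] at h
  · simp [jj, kk] at h
  · simp [jj] at h
  · simpa [jj] using h

theorem insFun_kk (C : Pairing (Pt (Option U) n)) (H : Graph 3) {x y : H.V × Fin 3}
    (h : H.p (Sum.inl x) = Sum.inl y) : insFun C H (kk x) = kk y := by
  unfold kk insFun
  simp [h, kk]

theorem insFun_jj (C : Pairing (Pt (Option U) n)) (H : Graph 3) (x : Pt (Option U) n) :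
    insFun C H (jj H x) = jj H (C x) := by
  rcases x with ⟨_ | u, s⟩ | i
  · simp [insFun, jj, kk, att_spec']
  · rfl
  · rfl

theorem ins_cases (H : Graph 3) (x : Pt (U ⊕ H.V) n) :
    (∃ y, x = jj H y) ∨ ∃ b b', H.p (Sum.inl b) = Sum.inl b' ∧ x = kk b := by
  rcases x with ⟨u | w, s⟩ | i
  · exact Or.inl ⟨Sum.inl (some u, s), rfl⟩
  · rcases h : H.p (Sum.inl (w, s)) with b' | i
    · exact Or.inr ⟨(w, s), b', h, rfl⟩
    · refine Or.inl ⟨Sum.inl (none, i), ?_⟩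
      simp [jj, att_eq h, kk]
  · exact Or.inl ⟨Sum.inr i, rfl⟩

/-- Insertion of `H` at the trivalent vertex `none` (its `i`-th univalent vertex is glued to the
`i`-th half-edge of `none`). -/
def ins (C : Pairing (Pt (Option U) n)) (H : Graph 3) : Pairing (Pt (U ⊕ H.V) n) where
  toFun := insFun C H
  invol x := by
    rcases ins_cases H x with ⟨y, rfl⟩ | ⟨b, b', h, rfl⟩
    · rw [insFun_jj, insFun_jj, C.invol]
    · rw [insFun_kk C H h, insFun_kk C H (y := b)]
      rw [← h, H.p.invol]
  ne x := by
    rcases ins_cases H x with ⟨y, rfl⟩ | ⟨b, b', h, rfl⟩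
    · rw [insFun_jj]
      exact fun h => C.ne _ (jj_inj H h)
    · rw [insFun_kk C H h]
      intro h'
      rw [kk_inj h'] at h
      exact H.p.ne _ h

theorem ins_jj (C : Pairing (Pt (Option U) n)) (H : Graph 3) (x : Pt (Option U) n) :
    ins C H (jj H x) = jj H (C x) := insFun_jj C H x

theorem ins_kk (C : Pairing (Pt (Option U) n)) (H : Graph 3) {x y : H.V × Fin 3}
    (h : H.p (Sum.inl x) = Sum.inl y) : ins C H (kk x) = kk y := insFun_kk C H h

/-- Naturality of insertion. -/
theorem ins_map {C : Pairing (Pt (Option U) n)} {C' : Pairing (Pt (Option U') n')} {H H' : Graph 3}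
    (θ : Pt (Option U) n → Pt (Option U') n') (hθ : ∀ y, C' (θ y) = θ (C y))
    (E : Pt (U ⊕ H.V) n ≃ Pt (U' ⊕ H'.V) n') (hE : ∀ y, E (jj H y) = jj H' (θ y))
    (hE' : ∀ b b', H.p (Sum.inl b) = Sum.inl b' →
      ∃ c c', H'.p (Sum.inl c) = Sum.inl c' ∧ E (kk b) = kk c ∧ E (kk b') = kk c') :
    ins C' H' = (ins C H).map E := by
  apply Pairing.eq_map
  intro x
  rcases ins_cases H x with ⟨y, rfl⟩ | ⟨b, b', h, rfl⟩
  · rw [hE, ins_jj, hθ, ins_jj, hE]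
  · obtain ⟨c, c', h1, h2, h3⟩ := hE' b b' h
    rw [ins_kk C H h, h2, h3, ins_kk C' H' h1]

/-- The extension of a bijection of half-edges of the inserted graph. -/
def onW {W W' : Type} (θ : W × Fin 3 ≃ W' × Fin 3) : (U ⊕ W) × Fin 3 ≃ (U ⊕ W') × Fin 3 :=
  (Equiv.sumProdDistrib U W (Fin 3)).trans
    ((Equiv.sumCongr (Equiv.refl _) θ).trans (Equiv.sumProdDistrib U W' (Fin 3)).symm)

theorem onW_kk {W W' : Type} (θ : W × Fin 3 ≃ W' × Fin 3) (x : W × Fin 3) :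
    (ext (onW θ) : Pt (U ⊕ W) n ≃ Pt (U ⊕ W') n) (kk x) = kk (θ x) := rfl

theorem ins_right (C : Pairing (Pt (Option U) n)) {H H' : Graph 3}
    (θ : H.V × Fin 3 ≃ H'.V × Fin 3) (h : H'.p = H.p.map (ext θ)) :
    ins C H' = (ins C H).map (ext (onW θ)) := by
  have hp : ∀ x, H'.p (ext θ x) = ext θ (H.p x) := fun x => by rw [h, Pairing.map_apply]
  refine ins_map (fun x => x) (fun _ => rfl) _ ?_ ?_
  · rintro (⟨_ | u, s⟩ | i)
    · have : att H' s = θ (att H s) := by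
        apply att_eq
        have := hp (Sum.inl (att H s))
        rw [att_spec'] at this
        exact this
      simp only [jj, this]; rfl
    · rfl
    · rfl
  · intro b b' hb
    refine ⟨θ b, θ b', ?_, rfl, rfl⟩
    have := hp (Sum.inl b)
    rw [hb] at this
    exact this

theorem onW_sw {W : Type} (a b : W × Fin 3) :
    (onW (sw a b) : Equiv.Perm ((U ⊕ W) × Fin 3)) = sw (Sum.inr a.1, a.2) (Sum.inr b.1, b.2) := by
  ext1 x
  rcases x with ⟨u | w, s⟩
  · rw [sw_ne (by simp) (by simp)]; rfl
  · have := sw_map (fun x : W × Fin 3 => ((Sum.inr x.1, x.2) : (U ⊕ W) × Fin 3))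
      (fun x y h => by rcases x; rcases y; simpa using h) a b (w, s)
    simp only at this
    rw [this]; rfl

theorem onW_mul {W : Type} (a b : Equiv.Perm (W × Fin 3)) :
    (onW (a * b) : Equiv.Perm ((U ⊕ W) × Fin 3)) = onW a * onW b := by
  ext1 x
  rcases x with ⟨u | w, s⟩ <;> rfl

theorem onW_cyc {W : Type} (u v : W) :
    (onW (cyc u v) : Equiv.Perm ((U ⊕ W) × Fin 3)) = cyc (Sum.inr u) (Sum.inr v) := by
  rw [cyc, onW_mul, onW_sw, onW_sw, cyc]

theorem onW_symm {W W' : Type} (θ : W × Fin 3 ≃ W' × Fin 3) :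
    (onW θ.symm : _ ≃ (U ⊕ W) × Fin 3) = (onW θ).symm := rfl

theorem onW_onV {W W' : Type} (e : W ≃ W') :
    (onW (onV e) : _ ≃ (U ⊕ W') × Fin 3) = onV (Equiv.sumCongr (Equiv.refl U) e) := by
  ext1 x
  rcases x with ⟨u | w, s⟩ <;> rfl

/-- Insertion at the vertex `none`, as a linear map. -/
def Ins [Finite U] (C : Pairing (Pt (Option U) n)) : F 3 →ₗ[ℚ] F n :=
  lift (fun H => rcls (ins C H)) <| by
    intro a ha
    cases ha with
    | iso e p h h' =>
      rw [map_sub, Finsupp.linearCombination_single, Finsupp.linearCombination_single, one_smul, one_smul,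
        ins_right C (H := ⟨_, p, h⟩) (H' := ⟨_, _, h'⟩) (onV e) rfl, onW_onV, rcls_iso, sub_self]
    | as p v s s' hs h h' =>
      rw [map_add, Finsupp.linearCombination_single, Finsupp.linearCombination_single, one_smul, one_smul,
        ins_right C (H := ⟨_, p, h⟩) (H' := ⟨_, _, h'⟩) (sw (v, s) (v, s')) rfl, onW_sw,
        rcls_as _ _ hs, neg_add_cancel]
    | ihx p u v huv hp h h' h'' =>
      rw [map_add, map_add, Finsupp.linearCombination_single, Finsupp.linearCombination_single,
        Finsupp.linearCombination_single, one_smul, one_smul, one_smul,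
        ins_right C (H := ⟨_, p, h⟩) (H' := ⟨_, _, h'⟩) (cyc u v) rfl,
        ins_right C (H := ⟨_, p, h⟩) (H' := ⟨_, _, h''⟩) (cyc u v).symm rfl,
        onW_symm, onW_cyc]
      refine rcls_ihx _ (fun h => huv (Sum.inr.inj h)) ?_
      exact ins_kk C ⟨_, p, h⟩ hp

theorem Ins_cls [Finite U] (C : Pairing (Pt (Option U) n)) (H : Graph 3) :
    Ins C H.cls = rcls (ins C H) := lift_cls _ _ _

end insertion

/-! ### Permutation of the labels, and the subspace of antisymmetric elements -/

section legs
variable {V V' : Type} {n : ℕ}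

theorem map_ext_lg (p : Pairing (Pt V n)) (θ : V × Fin 3 ≃ V' × Fin 3) (σ : Equiv.Perm (Fin n)) :
    (p.map (ext θ)).map (lg σ) = (p.map (lg σ)).map (ext θ) := by
  rw [Pairing.map_map, Pairing.map_map]
  congr 1
  ext1 x
  rcases x with x | x <;> rfl

theorem rcls_lg [Finite V] (p : Pairing (Pt V n)) (h : Conn p) (σ : Equiv.Perm (Fin n)) :
    rcls (p.map (lg σ)) = Graph.cls ⟨V, p.map (lg σ), conn_legs σ h⟩ := rcls_of _

/-- The action of permutations of the labels on `F(n)`. -/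
def legs (σ : Equiv.Perm (Fin n)) : F n →ₗ[ℚ] F n :=
  lift (fun G => Graph.cls ⟨G.V, G.p.map (lg σ), conn_legs σ G.conn⟩) <| by
    intro a ha
    cases ha with
    | iso e p h h' =>
      rw [map_sub, Finsupp.linearCombination_single, Finsupp.linearCombination_single, one_smul,
        one_smul, ← rcls_lg p h, ← rcls_lg _ h', map_ext_lg, rcls_iso, sub_self]
    | as p v s s' hs h h' =>
      rw [map_add, Finsupp.linearCombination_single, Finsupp.linearCombination_single, one_smul,
        one_smul, ← rcls_lg p h, ← rcls_lg _ h', map_ext_lg, rcls_as _ _ hs, neg_add_cancel]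
    | ihx p u v huv hp h h' h'' =>
      rw [map_add, map_add, Finsupp.linearCombination_single, Finsupp.linearCombination_single,
        Finsupp.linearCombination_single, one_smul, one_smul, one_smul,
        ← rcls_lg p h, ← rcls_lg _ h', ← rcls_lg _ h'', map_ext_lg, map_ext_lg]
      refine rcls_ihx _ huv ?_
      have := Pairing.map_apply p (lg σ) (Sum.inl (u, 0))
      rw [hp] at this
      exact this

theorem legs_cls (σ : Equiv.Perm (Fin n)) (G : Graph n) :
    legs σ G.cls = Graph.cls ⟨G.V, G.p.map (lg σ), conn_legs σ G.conn⟩ := lift_cls _ _ _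

theorem legs_rcls [Finite V] (σ : Equiv.Perm (Fin n)) (p : Pairing (Pt V n)) :
    legs σ (rcls p) = rcls (p.map (lg σ)) := by
  by_cases h : Conn p
  · rw [rcls_of h, legs_cls, rcls_lg p h]
  · rw [rcls_not h, map_zero, rcls_not]
    intro h'
    have := conn_legs σ⁻¹ h'
    apply h
    convert this using 1
    rw [Pairing.map_map]
    have : (lg σ : Pt V n ≃ Pt V n).trans (lg σ⁻¹) = Equiv.refl _ := by
      ext1 x; rcases x with x | x
      · rfl
      · exact congrArg Sum.inr (σ.symm_apply_apply x)
    rw [this, Pairing.map_refl]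

/-- The subspace `Λ` of antisymmetric elements of `F(3)`: exchanging any two labels changes the
sign. -/
def LambdaSub : Submodule ℚ (F 3) where
  carrier := {a | ∀ i j : Fin 3, i ≠ j → legs (Equiv.swap i j) a = -a}
  add_mem' := by
    intro a b ha hb i j h
    rw [map_add, ha i j h, hb i j h, neg_add]
  zero_mem' := by intro i j _; simp
  smul_mem' := by
    intro c a ha i j h
    rw [map_smul, ha i j h, smul_neg]

end legs

/-! ### Sliding an edge over an inserted graph -/

section slide
variable {P V U : Type} {n : ℕ}

theorem sw_apply_def [DecidableEq P] (a b x : P) :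
    sw a b x = if x = a then b else if x = b then a else x := by
  rw [sw_eq, Equiv.swap_apply_def]

theorem ext_sw (x y : V × Fin 3) :
    (ext (sw x y) : Pt V n ≃ Pt V n) = sw (Sum.inl x) (Sum.inl y) := by
  ext1 z
  rcases z with z | z
  · rw [sw_map _ Sum.inl_injective]; rfl
  · rw [sw_ne (by simp) (by simp)]; rfl

theorem perm_id1 {a b c d : P} (hab : a ≠ b) (hac : a ≠ c) (had : a ≠ d) (_ : b ≠ c)
    (hbd : b ≠ d) (hcd : c ≠ d) :
    sw b d * sw b c * sw d a = sw a b * sw b c * sw d c := by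
  classical
  ext x
  simp only [Equiv.Perm.mul_apply, sw_apply_def]
  grind

theorem perm_id2 {a b c d : P} (hab : a ≠ b) (hac : a ≠ c) (had : a ≠ d) (_hbc : b ≠ c)
    (hbd : b ≠ d) (hcd : c ≠ d) :
    sw b c * sw b d * sw d a = sw a c * sw b c * sw d b := by
  classical
  ext x
  simp only [Equiv.Perm.mul_apply, sw_apply_def]
  grind

theorem Pairing.map_mul (p : Pairing P) (e f : Equiv.Perm P) : p.map (f * e) = (p.map e).map f :=
  rfl

theorem flip_edge (B : Pairing P) {v0 v1 x x' : P} (hv : B v0 = v1) (hx : B x = x')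
    (h0 : x ≠ v0) (h1 : x ≠ v1) :
    B.map (sw v1 x') = (B.map (sw v1 x)).map (sw v0 v1) := by
  classical
  apply Pairing.ext_coe
  intro y
  have hi := B.invol
  have hn := B.ne
  simp only [Pairing.map, sw_symm, sw_apply_def]
  grind

end slide

section slide2
variable {P V U : Type} {n : ℕ}

theorem ext_mul (a b : Equiv.Perm (V × Fin 3)) :
    (ext (a * b) : Equiv.Perm (Pt V n)) = ext a * ext b := by
  ext1 x; rcases x with x | x <;> rfl

theorem cyc_symm (u v : V) : (cyc u v).symm = sw (u, 1) (u, 2) * sw (u, 1) (v, 1) := by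
  ext1 x
  rw [Equiv.symm_apply_eq, cyc, Equiv.Perm.mul_apply, Equiv.Perm.mul_apply]
  rw [sw_sw, sw_sw]

/-- The three ways to attach an edge close to a trivalent vertex `w` sum up to zero; here
`B.map (ext (sw (v, 1) x))` is the graph `B`, which has a loop at `v`, with that loop cut open and
`v` put on the edge at `x`. -/
theorem slide_vertex [Finite V] (B : Pairing (Pt V n)) {v w : V} (hvw : w ≠ v)
    (hB : B (Sum.inl (v, 0)) = Sum.inl (v, 1)) :
    ∑ s : Fin 3, rcls (B.map (ext (sw (v, 1) (w, s)))) = 0 := by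
  have hB' : B (Sum.inl (v, 1)) = Sum.inl (v, 0) := by rw [← hB, B.invol]
  rw [Fin.sum_univ_three]
  have hK : (B.map (ext (sw (v, 1) (w, 0)))) (Sum.inl (w, 0)) = Sum.inl (v, 0) := by
    have := Pairing.map_apply B (ext (sw (v, 1) (w, 0))) (Sum.inl (v, 1))
    rw [hB', ext_inl, ext_inl, sw_left, sw_ne (by simp) (by simp [hvw.symm])] at this
    exact this
  have key := rcls_ihx _ hvw hK
  have e1 : rcls ((B.map (ext (sw (v, 1) (w, 0)))).map (ext (cyc w v)))
      = rcls (B.map (ext (sw (v, 1) (w, 2)))) := by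
    rw [← Pairing.map_mul, ← ext_mul, cyc,
      perm_id1 (by simp) (by simp) (by simp) (by simp) (by simp [hvw]) (by simp),
      mul_assoc, ext_mul, Pairing.map_mul, rcls_as _ _ (by simp), ext_mul, Pairing.map_mul,
      rcls_as _ _ (by simp), neg_neg]
  have e2 : rcls ((B.map (ext (sw (v, 1) (w, 0)))).map (ext (cyc w v).symm))
      = rcls (B.map (ext (sw (v, 1) (w, 1)))) := by
    rw [← Pairing.map_mul, ← ext_mul, cyc_symm,
      perm_id2 (by simp) (by simp) (by simp) (by simp) (by simp [hvw]) (by simp),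
      mul_assoc, ext_mul, Pairing.map_mul, rcls_as _ _ (by simp), ext_mul, Pairing.map_mul,
      rcls_as _ _ (by simp), neg_neg]
  rw [e1, e2] at key
  rw [← key]
  abel

/-- Half-edges of a graph with distinguished trivalent vertex `none`, as half-edges of the result
of an insertion at `none`. -/
def jh (H : Graph 3) : Option U × Fin 3 → (U ⊕ H.V) × Fin 3
  | (some u, s) => (Sum.inl u, s)
  | (none, s) => (Sum.inr (att H s).1, (att H s).2)

theorem jj_inl (H : Graph 3) (x : Option U × Fin 3) :
    (jj H (Sum.inl x) : Pt (U ⊕ H.V) n) = Sum.inl (jh H x) := by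
  rcases x with ⟨_ | u, s⟩ <;> rfl

theorem kk_ne_jj (H : Graph 3) {b b' : H.V × Fin 3} (h : H.p (Sum.inl b) = Sum.inl b')
    (y : Pt (Option U) n) : (kk b : Pt (U ⊕ H.V) n) ≠ jj H y := by
  rcases y with ⟨_ | u, s⟩ | i
  · intro e
    have := kk_inj e
    rw [this, att_spec'] at h
    cases h
  · simp [kk, jj]
  · simp [kk, jj]

theorem ins_sw (C : Pairing (Pt (Option U) n)) (H : Graph 3) (x y : Option U × Fin 3) :
    ins (C.map (ext (sw x y))) H = (ins C H).map (ext (sw (jh H x) (jh H y))) := by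
  refine ins_map (ext (sw x y)) (fun z => Pairing.map_apply _ _ _) _ ?_ ?_
  · intro z
    rw [ext_sw, ext_sw, ← jj_inl, ← jj_inl, sw_map _ (jj_inj H)]
  · intro b b' h
    have h' : H.p (Sum.inl b') = Sum.inl b := by rw [← h, H.p.invol]
    refine ⟨b, b', h, ?_, ?_⟩
    · rw [ext_sw, ← jj_inl, ← jj_inl, sw_ne (kk_ne_jj H h _) (kk_ne_jj H h _)]
    · rw [ext_sw, ← jj_inl, ← jj_inl, sw_ne (kk_ne_jj H h' _) (kk_ne_jj H h' _)]

/-- An edge can be slid over an inserted graph. -/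
theorem slide [Finite U] (C : Pairing (Pt (Option U) n)) (v : U)
    (hC : C (Sum.inl (some v, 0)) = Sum.inl (some v, 1)) (a : F 3) :
    ∑ i : Fin 3, Ins (C.map (ext (sw (some v, 1) (none, i)))) a = 0 := by
  classical
  suffices h : ∑ i : Fin 3, Ins (C.map (ext (sw (some v, 1) (none, i)))) = 0 by
    have := congrArg (fun f => f a) h
    simpa using this
  apply F_induction
  intro H
  rw [LinearMap.sum_apply, LinearMap.zero_apply]
  simp only [Ins_cls, ins_sw]
  have : Fintype H.V := Fintype.ofFinite _
  let B := ins C H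
  have hB : B (Sum.inl (Sum.inl v, 0)) = Sum.inl (Sum.inl v, 1) := by
    have := ins_jj C H (Sum.inl (some v, 0))
    rw [hC] at this
    exact this
  let f : H.V × Fin 3 → F n := fun x => rcls (B.map (ext (sw (Sum.inl v, 1) (Sum.inr x.1, x.2))))
  have h1 : ∑ x, f x = 0 := by
    rw [Fintype.sum_prod_type]
    apply Finset.sum_eq_zero
    intro w _
    exact slide_vertex B (by simp) hB
  have h2 : ∑ x with (H.p (Sum.inl x)).isLeft, f x = 0 := by
    have hg : ∀ x (_ : x ∈ Finset.univ.filter fun x => (H.p (Sum.inl x)).isLeft = true),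
        ∃ y, H.p (Sum.inl x) = Sum.inl y := by
      intro x hx
      exact Sum.isLeft_iff.1 (Finset.mem_filter.1 hx).2
    choose g hg' using hg
    refine Finset.sum_involution g ?_ ?_ ?_ ?_
    · intro x hx
      have hb := ins_kk C H (hg' x hx)
      have : f (g x hx) = - f x := by
        simp only [f]
        rw [ext_sw]
        have := flip_edge B (v0 := Sum.inl (Sum.inl v, 0)) (v1 := Sum.inl (Sum.inl v, 1))
          (x := kk x) (x' := kk (g x hx)) hB hb (by simp [kk]) (by simp [kk])
        unfold kk at this
        rw [this, ← ext_sw, ← ext_sw, rcls_as _ _ (by simp)]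
      rw [this, add_neg_cancel]
    · intro x hx _ h
      have := hg' x hx
      rw [h] at this
      exact H.p.ne _ this
    · intro x hx
      refine Finset.mem_filter.2 ⟨Finset.mem_univ _, ?_⟩
      rw [← hg' x hx, H.p.invol]; rfl
    · intro x hx
      have h1 := hg' x hx
      have h2 := hg' (g x hx) (by
        refine Finset.mem_filter.2 ⟨Finset.mem_univ _, ?_⟩
        rw [← hg' x hx, H.p.invol]; rfl)
      have h3 : H.p (Sum.inl (g x hx)) = Sum.inl x := by rw [← h1, H.p.invol]
      exact Sum.inl.inj (h2.symm.trans h3)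
  rw [← Finset.sum_filter_add_sum_filter_not _ (fun x => (H.p (Sum.inl x)).isLeft = true), h2,
    zero_add] at h1
  rw [← h1]
  refine Finset.sum_bij (fun i _ => att H i) ?_ ?_ ?_ ?_
  · intro i _
    refine Finset.mem_filter.2 ⟨Finset.mem_univ _, ?_⟩
    rw [att_spec']; simp
  · intro i _ j _ h; exact att_inj H h
  · intro x hx
    have := (Finset.mem_filter.1 hx).2
    rcases h : H.p (Sum.inl x) with y | i
    · rw [h] at this; simp at this
    · exact ⟨i, Finset.mem_univ _, att_eq h⟩
  · intro i _; rfl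

end slide2

section moves
variable {P V U U' : Type} {n : ℕ}

theorem att_lg (H : Graph 3) (σ : Equiv.Perm (Fin 3)) (r : Fin 3) :
    att ⟨H.V, H.p.map (lg σ), conn_legs σ H.conn⟩ (σ r) = att H r := by
  apply att_eq
  have := Pairing.map_apply H.p (lg σ) (Sum.inl (att H r))
  rw [att_spec'] at this
  exact this

theorem Ins_hole_legs [Finite U] (C : Pairing (Pt (Option U) n)) (s s' : Fin 3) (b : F 3) :
    Ins (C.map (ext (sw (none, s) (none, s')))) (legs (Equiv.swap s s') b) = Ins C b := by
  suffices h : Ins (C.map (ext (sw (none, s) (none, s')))) ∘ₗ legs (Equiv.swap s s') = Ins C from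
    congrArg (fun f => f b) h
  apply F_induction
  intro H
  rw [LinearMap.comp_apply, legs_cls, Ins_cls, Ins_cls]
  congr 1
  have key := ins_map (C := C) (C' := C.map (ext (sw (none, s) (none, s')))) (H := H)
    (H' := ⟨H.V, H.p.map (lg (Equiv.swap s s')), conn_legs _ H.conn⟩)
    (ext (sw (none, s) (none, s'))) (fun z => Pairing.map_apply _ _ _) (Equiv.refl _) ?_ ?_
  · exact key
  · rintro (⟨_ | u, r⟩ | i)
    · have : sw ((none, s) : Option U × Fin 3) (none, s') (none, r) = (none, Equiv.swap s s' r) := by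
        rw [← sw_eq]
        exact sw_map (fun r : Fin 3 => ((none, r) : Option U × Fin 3))
          (fun x y h => by simpa using h) s s' r
      rw [ext_inl, this]
      simp only [jj]
      rw [att_lg]; rfl
    · rw [ext_inl, sw_ne (by simp) (by simp)]; rfl
    · rfl
  · intro b b' h
    refine ⟨b, b', ?_, rfl, rfl⟩
    have := Pairing.map_apply H.p (lg (Equiv.swap s s')) (Sum.inl b)
    rw [h] at this
    exact this

theorem Ins_hole [Finite U] (C : Pairing (Pt (Option U) n)) {s s' : Fin 3} (hs : s ≠ s')
    {a : F 3} (ha : a ∈ LambdaSub) :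
    Ins (C.map (ext (sw (none, s) (none, s')))) a = - Ins C a := by
  have := Ins_hole_legs C s s' a
  rw [ha s s' hs, map_neg] at this
  rw [← this, neg_neg]

theorem Ins_some [Finite U] (C : Pairing (Pt (Option U) n)) (u : U) {s s' : Fin 3} (hs : s ≠ s')
    (a : F 3) :
    Ins (C.map (ext (sw (some u, s) (some u, s')))) a = - Ins C a := by
  suffices h : Ins (C.map (ext (sw (some u, s) (some u, s')))) = - Ins C from
    congrArg (fun f => f a) h
  apply F_induction
  intro H
  rw [LinearMap.neg_apply, Ins_cls, Ins_cls, ins_sw]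
  exact rcls_as _ _ hs

theorem Ins_iso [Finite U] [Finite U'] (C : Pairing (Pt (Option U) n)) (f : U ≃ U') :
    Ins (C.map (ext (onV (Equiv.optionCongr f)))) = Ins C := by
  apply F_induction
  intro H
  rw [Ins_cls, Ins_cls, ← rcls_iso (Equiv.sumCongr f (Equiv.refl H.V)) (ins C H)]
  congr 1
  refine ins_map (ext (onV (Equiv.optionCongr f))) (fun z => Pairing.map_apply _ _ _) _ ?_ ?_
  · rintro (⟨_ | u, r⟩ | i) <;> rfl
  · intro b b' h
    exact ⟨b, b', h, rfl, rfl⟩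

/-- A function of graphs with a distinguished trivalent vertex `none` (read as a place where
something can be inserted), with the properties that make it independent of that vertex. -/
structure VF (n : ℕ) (M : Type 1) [AddCommGroup M] [Module ℚ M] where
  Φ : ∀ {U : Type} [Finite U], Pairing (Pt (Option U) n) → M
  hole : ∀ {U : Type} [Finite U] (C : Pairing (Pt (Option U) n)) {s s' : Fin 3}, s ≠ s' →
    Φ (C.map (ext (sw (none, s) (none, s')))) = - Φ C
  some' : ∀ {U : Type} [Finite U] (C : Pairing (Pt (Option U) n)) (u : U) {s s' : Fin 3}, s ≠ s' →
    Φ (C.map (ext (sw (some u, s) (some u, s')))) = - Φ C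
  iso : ∀ {U U' : Type} [Finite U] [Finite U'] (C : Pairing (Pt (Option U) n)) (f : U ≃ U'),
    Φ (C.map (ext (onV (Equiv.optionCongr f)))) = Φ C
  slide : ∀ {U : Type} [Finite U] (C : Pairing (Pt (Option U) n)) (v : U),
    C (Sum.inl (some v, 0)) = Sum.inl (some v, 1) →
    ∑ i : Fin 3, Φ (C.map (ext (sw (some v, 1) (none, i)))) = 0

/-- Insertion of an antisymmetric element. -/
def insVF (n : ℕ) (a : F 3) (ha : a ∈ LambdaSub) : VF n (F n) where
  Φ C := Ins C a
  hole C _ _ hs := Ins_hole C hs ha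
  some' C u _ _ hs := Ins_some C u hs a
  iso C f := by rw [Ins_iso]
  slide C v hC := slide C v hC a

variable {M : Type 1} [AddCommGroup M] [Module ℚ M]

theorem VF.ihx [Finite U] (Ψ : VF n M) (X : Pairing (Pt (Option U) n)) {v : U}
    (hX : X (Sum.inl (none, 0)) = Sum.inl (some v, 0)) :
    Ψ.Φ X + Ψ.Φ (X.map (ext (cyc none (some v))))
      + Ψ.Φ (X.map (ext (cyc none (some v)).symm)) = 0 := by
  let C := X.map (ext (sw (some v, 1) (none, 0)))
  have hX0 : X (Sum.inl (some v, 0)) = Sum.inl (none, 0) := by rw [← hX, X.invol]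
  have hC : C (Sum.inl (some v, 0)) = Sum.inl (some v, 1) := by
    have := Pairing.map_apply X (ext (sw (some v, 1) (none, 0))) (Sum.inl (some v, 0))
    rw [hX0, ext_inl, ext_inl, sw_right, sw_ne (by simp) (by simp)] at this
    exact this
  have hXC : X = C.map (ext (sw (some v, 1) (none, 0))) := (map_sw_sw _ _ _).symm
  have key := Ψ.slide C v hC
  rw [Fin.sum_univ_three] at key
  have e1 : Ψ.Φ (X.map (ext (cyc none (some v))))
      = Ψ.Φ (C.map (ext (sw (some v, 1) (none, 2)))) := by
    conv_lhs => rw [hXC]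
    rw [← Pairing.map_mul, ← ext_mul, cyc,
      perm_id1 (by simp) (by simp) (by simp) (by simp) (by simp) (by simp),
      mul_assoc, ext_mul, Pairing.map_mul, Ψ.hole _ (by simp), ext_mul, Pairing.map_mul,
      Ψ.hole _ (by simp), neg_neg]
  have e2 : Ψ.Φ (X.map (ext (cyc none (some v)).symm))
      = Ψ.Φ (C.map (ext (sw (some v, 1) (none, 1)))) := by
    conv_lhs => rw [hXC]
    rw [← Pairing.map_mul, ← ext_mul, cyc_symm,
      perm_id2 (by simp) (by simp) (by simp) (by simp) (by simp) (by simp),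
      mul_assoc, ext_mul, Pairing.map_mul, Ψ.hole _ (by simp), ext_mul, Pairing.map_mul,
      Ψ.hole _ (by simp), neg_neg]
  rw [e1, e2]
  rw [← hXC] at key
  rw [← key]
  abel

/-- Linear algebra on the six edges of a tetrahedron. -/
theorem tetra {M : Type*} [AddCommGroup M] [Module ℚ M] (g : Equiv.Perm (Fin 4) → M)
    (h1 : ∀ σ, g (Equiv.swap 0 1 * σ) = - g σ) (h2 : ∀ σ, g (Equiv.swap 2 3 * σ) = - g σ)
    (h3 : ∀ σ, g σ + g (Equiv.swap 0 2 * Equiv.swap 0 1 * σ)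
      + g (Equiv.swap 0 1 * Equiv.swap 0 2 * σ) = 0) :
    g (Equiv.swap 0 2 * Equiv.swap 1 3) = g 1 := by
  set c : Equiv.Perm (Fin 4) := Equiv.swap 0 2 * Equiv.swap 0 1 with hc
  set d : Equiv.Perm (Fin 4) := Equiv.swap 0 1 * Equiv.swap 0 2 with hd
  set p' : Equiv.Perm (Fin 4) := Equiv.swap 0 2 * Equiv.swap 1 3 with hp'
  have q1 := h3 1
  have q2 := h3 (Equiv.swap 2 3 * d)
  have q3 := h3 (Equiv.swap 0 1 * (Equiv.swap 2 3 * c))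
  have q4 := h3 (Equiv.swap 2 3 * 1)
  have a2 : c * (Equiv.swap 2 3 * d) = Equiv.swap 0 1 * (Equiv.swap 2 3 * (d * Equiv.swap 2 3)) := by
    decide
  have b2 : d * (Equiv.swap 2 3 * d) = Equiv.swap 2 3 * p' := by decide
  have a3 : c * (Equiv.swap 0 1 * (Equiv.swap 2 3 * c))
    = Equiv.swap 2 3 * (c * Equiv.swap 2 3) := by decide
  have b3 : d * (Equiv.swap 0 1 * (Equiv.swap 2 3 * c)) = p' := by decide
  have a4 : c * (Equiv.swap 2 3 * 1) = c * Equiv.swap 2 3 := by rw [mul_one]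
  have b4 : d * (Equiv.swap 2 3 * 1) = d * Equiv.swap 2 3 := by rw [mul_one]
  rw [mul_one, mul_one] at q1
  rw [a2, b2, h1, h2, h2, h2, neg_neg] at q2
  rw [a3, b3, h1, h2, h2, neg_neg] at q3
  rw [a4, b4, h2] at q4
  have h0 : (2 : ℚ) • (g p' - g 1) = 0 := by
    rw [two_smul]
    have : g p' - g 1 + (g p' - g 1) =
      (-(g 1 + g c + g d)) + (g c + - g (c * Equiv.swap 2 3) + g p')
      - (-g d + g (d * Equiv.swap 2 3) + -g p')
      + (-g 1 + g (c * Equiv.swap 2 3) + g (d * Equiv.swap 2 3)) := by abel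
    rw [this, q1, q2, q3, q4]; simp
  exact sub_eq_zero.1 ((smul_eq_zero.1 h0).resolve_left (by norm_num))

end moves

section moves2
variable {P V V' U U' : Type} {n : ℕ} {M : Type 1} [AddCommGroup M] [Module ℚ M]

/-- The four half-edges close to an edge from `none` to `some v`. -/
def quad (v : U) : Fin 4 ↪ Option U × Fin 3 where
  toFun := ![(none, 1), (none, 2), (some v, 1), (some v, 2)]
  inj' := by
    intro i j h
    fin_cases i <;> fin_cases j <;> simp_all

theorem quad_snd (v : U) (i : Fin 4) : (quad v i).2 ≠ 0 := by
  change (![(none, 1), (none, 2), (some v, 1), (some v, 2)] i : Option U × Fin 3).2 ≠ 0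
  fin_cases i <;> simp

theorem via_swap (f : Fin 4 ↪ P) (i j : Fin 4) :
    Equiv.Perm.viaEmbeddingHom f (Equiv.swap i j) = sw (f i) (f j) := by
  ext x
  rw [Equiv.Perm.viaEmbeddingHom_apply]
  by_cases h : x ∈ Set.range f
  · obtain ⟨y, rfl⟩ := h
    rw [Equiv.Perm.viaEmbedding_apply, sw_map _ f.injective, sw_eq]
  · rw [Equiv.Perm.viaEmbedding_apply_of_notMem _ _ _ h, sw_ne] <;>
    · rintro rfl
      exact h ⟨_, rfl⟩

theorem VF.tetra [Finite U] (Ψ : VF n M) (X : Pairing (Pt (Option U) n)) {v : U}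
    (hX : X (Sum.inl (none, 0)) = Sum.inl (some v, 0)) :
    Ψ.Φ (X.map (ext (sw (none, 1) (some v, 1) * sw (none, 2) (some v, 2)))) = Ψ.Φ X := by
  let φ := Equiv.Perm.viaEmbeddingHom (quad v)
  have hφ : ∀ i j, φ (Equiv.swap i j) = sw (quad v i) (quad v j) := via_swap (quad v)
  have hφ0 : ∀ σ x, x ∉ Set.range (quad v) → φ σ x = x := fun σ x hx =>
    Equiv.Perm.viaEmbedding_apply_of_notMem _ _ _ hx
  have n0 : ((none, 0) : Option U × Fin 3) ∉ Set.range (quad v) := by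
    rintro ⟨i, hi⟩
    exact quad_snd v i (congrArg Prod.snd hi)
  have n1 : ((some v, 0) : Option U × Fin 3) ∉ Set.range (quad v) := by
    rintro ⟨i, hi⟩
    exact quad_snd v i (congrArg Prod.snd hi)
  have key := Vogel.tetra (fun σ => Ψ.Φ (X.map (ext (φ σ)))) ?_ ?_ ?_
  · simp only [map_mul, hφ, map_one] at key
    have e1 : X.map (ext 1) = X := by
      have : (1 : Equiv.Perm (Option U × Fin 3)) = Equiv.refl _ := rfl
      rw [this, ext_refl, Pairing.map_refl]
    rw [e1] at key
    exact key
  · intro σ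
    simp only [map_mul, hφ]
    rw [ext_mul, Pairing.map_mul]
    exact Ψ.hole _ (by simp)
  · intro σ
    simp only [map_mul, hφ]
    rw [ext_mul, Pairing.map_mul]
    exact Ψ.some' _ _ (by simp)
  · intro σ
    have hX' : (X.map (ext (φ σ))) (Sum.inl (none, 0)) = Sum.inl (some v, 0) := by
      have := Pairing.map_apply X (ext (φ σ)) (Sum.inl (none, 0))
      rwa [hX, ext_inl, ext_inl, hφ0 σ _ n0, hφ0 σ _ n1] at this
    have := Ψ.ihx _ hX'
    rw [← Pairing.map_mul, ← Pairing.map_mul, ← ext_mul, ← ext_mul, cyc_symm, cyc] at this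
    simp only [map_mul, hφ]
    exact this

/-- Split off the vertex `v`. -/
def opt (v : V) : V ≃ Option {u : V // u ≠ v} :=
  (@Equiv.optionSubtypeNe V (Classical.decEq V) v).symm

theorem opt_self (v : V) : opt v v = none := by
  unfold opt; exact @Equiv.optionSubtypeNe_symm_self V (Classical.decEq V) v

theorem opt_ne {u v : V} (h : u ≠ v) : opt v u = some ⟨u, h⟩ := by
  unfold opt; exact @Equiv.optionSubtypeNe_symm_of_ne V (Classical.decEq V) v u h

/-- The value of `Ψ` for the distinguished vertex `v`. -/
def VF.at (Ψ : VF n M) [Finite V] (p : Pairing (Pt V n)) (v : V) : M :=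
  Ψ.Φ (p.map (ext (onV (opt v))))

theorem optionCongr_of {e : Option U ≃ Option U'} (he : e none = none) :
    ∃ f : U ≃ U', e = Equiv.optionCongr f := by
  refine ⟨Equiv.removeNone e, ?_⟩
  ext1 x
  rcases x with _ | x
  · rw [he]; rfl
  · have : ∃ x', e (some x) = some x' := by
      rcases h : e (some x) with _ | y
      · exact absurd (e.injective (h.trans he.symm)) (by simp)
      · exact ⟨y, rfl⟩
    exact (Equiv.removeNone_some e this).symm

theorem onV_trans {V'' : Type} (e : V ≃ V') (f : V' ≃ V'') :
    (onV e).trans (onV f) = onV (e.trans f) := rfl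

theorem VF.at_of (Ψ : VF n M) [Finite V] [Finite U] (p : Pairing (Pt V n)) {v : V} (e : V ≃ Option U)
    (he : e v = none) : Ψ.at p v = Ψ.Φ (p.map (ext (onV e))) := by
  obtain ⟨f, hf⟩ := optionCongr_of (e := (opt v).symm.trans e) (by
    rw [Equiv.trans_apply, ← opt_self v, Equiv.symm_apply_apply, he])
  have : e = (opt v).trans (Equiv.optionCongr f) := by
    rw [← hf]; ext1 x; simp
  rw [this, ← onV_trans, ← ext_trans, ← Pairing.map_map, Ψ.iso]
  rfl

theorem VF.at_onV (Ψ : VF n M) [Finite V] [Finite V'] (p : Pairing (Pt V n)) (e : V ≃ V') (v : V) :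
    Ψ.at (p.map (ext (onV e))) (e v) = Ψ.at p v := by
  rw [Ψ.at_of p (e.trans (opt (e v))) (by simp [opt_self]), ← onV_trans, ← ext_trans,
    ← Pairing.map_map]
  rfl

theorem map_sw_ext (p : Pairing (Pt V n)) (x y : V × Fin 3) (θ : V × Fin 3 ≃ V' × Fin 3) :
    (p.map (ext (sw x y))).map (ext θ) = (p.map (ext θ)).map (ext (sw (θ x) (θ y))) := by
  rw [Pairing.map_map, Pairing.map_map, ext_trans, ext_trans]
  congr 2
  ext1 z
  simp [sw_map _ θ.injective]

theorem VF.at_as (Ψ : VF n M) [Finite V] (p : Pairing (Pt V n)) (v w : V) {s s' : Fin 3} (hs : s ≠ s') :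
    Ψ.at (p.map (ext (sw (w, s) (w, s')))) v = - Ψ.at p v := by
  unfold VF.at
  rw [map_sw_ext]
  change Ψ.Φ (Pairing.map _ (ext (sw (opt v w, s) (opt v w, s')))) = _
  by_cases h : w = v
  · subst h; rw [opt_self]; exact Ψ.hole _ hs
  · rw [opt_ne h]; exact Ψ.some' _ _ hs

theorem VF.at_adj (Ψ : VF n M) [Finite V] (p : Pairing (Pt V n)) {u v : V} (huv : u ≠ v)
    (hp : p (Sum.inl (u, 0)) = Sum.inl (v, 0)) :
    Ψ.at p u = Ψ.at p v := by
  classical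
  have h1 := Ψ.at_onV p (Equiv.swap u v) v
  rw [Equiv.swap_apply_right] at h1
  have h2 : p.map (ext (onV (Equiv.swap u v)))
      = p.map (ext (sw (u, 1) (v, 1) * sw (u, 2) (v, 2))) := by
    have hp' : p (Sum.inl (v, 0)) = Sum.inl (u, 0) := by rw [← hp, p.invol]
    have h3 : p = p.map (ext (sw (u, 0) (v, 0))) := by
      apply Pairing.eq_map
      intro x
      rw [ext_sw, sw_apply_def, sw_apply_def]
      have hi := p.invol
      grind
    conv_lhs => rw [h3]
    rw [Pairing.map_map, ext_trans]
    congr 2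
    ext1 ⟨x, s⟩
    simp only [Equiv.trans_apply, Equiv.Perm.mul_apply, sw_apply_def]
    fin_cases s <;> simp [onV, Equiv.swap_apply_def] <;> grind
  rw [← h1, h2]
  unfold VF.at
  have hX : (p.map (ext (onV (opt u)))) (Sum.inl (none, 0)) = Sum.inl (some ⟨v, huv.symm⟩, 0) := by
    have := Pairing.map_apply p (ext (onV (opt u))) (Sum.inl (u, 0))
    rw [hp, ext_inl, ext_inl] at this
    simp only [onV, Equiv.prodCongr_apply, Prod.map, opt_self, opt_ne huv.symm] at this
    exact this
  rw [ext_mul, Pairing.map_mul, map_sw_ext, map_sw_ext]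
  have := Ψ.tetra _ hX
  rw [ext_mul, Pairing.map_mul] at this
  rw [← this]
  simp only [onV, Equiv.prodCongr_apply, Prod.map, opt_self, opt_ne huv.symm]
  rfl

theorem VF.at_adj' (Ψ : VF n M) [Finite V] (p : Pairing (Pt V n)) {u v : V} {s s' : Fin 3}
    (hp : p (Sum.inl (u, s)) = Sum.inl (v, s')) :
    Ψ.at p u = Ψ.at p v := by
  by_cases huv : u = v
  · rw [huv]
  have step1 : ∀ (p : Pairing (Pt V n)) (s' : Fin 3), p (Sum.inl (u, 0)) = Sum.inl (v, s') →
      Ψ.at p u = Ψ.at p v := by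
    intro p s' hp
    by_cases h : s' = 0
    · subst h; exact Ψ.at_adj p huv hp
    · have := Ψ.at_adj (p.map (ext (sw (v, s') (v, 0)))) huv (by
        have := Pairing.map_apply p (ext (sw (v, s') (v, 0))) (Sum.inl (u, 0))
        rwa [hp, ext_inl, ext_inl, sw_left, sw_ne (by simp [huv]) (by simp [huv])] at this)
      rw [Ψ.at_as _ _ _ h, Ψ.at_as _ _ _ h] at this
      exact neg_injective this
  by_cases h : s = 0
  · subst h; exact step1 p s' hp
  · have := step1 (p.map (ext (sw (u, s) (u, 0)))) s' (by
        have := Pairing.map_apply p (ext (sw (u, s) (u, 0))) (Sum.inl (u, s))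
        rwa [hp, ext_inl, ext_inl, sw_left,
          sw_ne (by simp [Ne.symm huv]) (by simp [Ne.symm huv])] at this)
    rw [Ψ.at_as _ _ _ h, Ψ.at_as _ _ _ h] at this
    exact neg_injective this

/-- In a connected graph, the value does not depend on the distinguished vertex. -/
theorem VF.at_indep (Ψ : VF n M) [Finite V] {p : Pairing (Pt V n)} (hp : Conn p) (u v : V) : Ψ.at p u = Ψ.at p v := by
  let val : Pt V n → M := fun x => match x with
    | Sum.inl x => Ψ.at p x.1
    | Sum.inr i => match p (Sum.inr i) with
      | Sum.inl y => Ψ.at p y.1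
      | Sum.inr _ => 0
  have key : ∀ x y, EqvGen (Step p) x y → val x = val y := by
    intro x y h
    induction h with
    | rel x y h =>
      cases h with
      | edge =>
        rcases x with x | i
        · rcases h : p (Sum.inl x) with y | j
          · exact Ψ.at_adj' p (s := x.2) (s' := y.2) h
          · have : p (Sum.inr j) = Sum.inl x := by rw [← h, p.invol]
            simp [val, this]
        · rcases h : p (Sum.inr i) with y | j
          · simp [val, h]
          · have : p (Sum.inr j) = Sum.inr i := by rw [← h, p.invol]
            simp [val, h, this]
      | vert v s s' => rfl
    | refl => rfl
    | symm _ _ _ ih => exact ih.symm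
    | trans _ _ _ _ _ h1 h2 => exact h1.trans h2
  exact key (Sum.inl (u, 0)) (Sum.inl (v, 0)) (hp.2 _ _)

end moves2

/-! ### The action of `Λ` on `F(3)` -/

section action
variable {V V' U U' : Type} {n : ℕ}

/-- Insertion at the trivalent vertex `v` of the graph given by a matching: the `i`-th univalent
vertex of the inserted graph is glued to the `i`-th half-edge of `v`. -/
def insAt [Finite V] (p : Pairing (Pt V n)) (v : V) : F 3 →ₗ[ℚ] F n :=
  Ins (p.map (ext (onV (opt v))))

theorem insAt_eq [Finite V] (p : Pairing (Pt V n)) (v : V) {a : F 3} (ha : a ∈ LambdaSub) :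
    insAt p v a = (insVF n a ha).at p v := rfl

theorem odd_card [Finite V] (p : Pairing (Pt V 3)) : Odd (Nat.card V) := by
  classical
  have : Fintype V := Fintype.ofFinite V
  have h : ∑ _x : Pt V 3, (1 : ZMod 2) = 0 :=
    Finset.sum_involution (fun x _ => p x) (fun _ _ => by decide) (fun x _ _ => p.ne x)
      (fun _ _ => Finset.mem_univ _) (fun x _ => p.invol x)
  rw [Finset.sum_const, nsmul_one, Finset.card_univ, ZMod.natCast_eq_zero_iff_even] at h
  simp only [Fintype.card_sum, Fintype.card_prod, Fintype.card_fin] at h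
  rw [Nat.card_eq_fintype_card]
  rcases Nat.even_or_odd (Fintype.card V) with h' | h'
  · exfalso
    rcases h with ⟨a, ha⟩
    rcases h' with ⟨b, hb⟩
    omega
  · exact h'

theorem third [Finite V] (p : Pairing (Pt V 3)) {u v : V} (huv : u ≠ v) :
    ∃ w, w ≠ u ∧ w ≠ v := by
  classical
  have : Fintype V := Fintype.ofFinite V
  by_contra h
  push Not at h
  have h2 : (Finset.univ : Finset V) = {u, v} := by
    ext w
    simp only [Finset.mem_univ, Finset.mem_insert, Finset.mem_singleton, true_iff]
    by_cases hw : w = u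
    · exact Or.inl hw
    · exact Or.inr (h w hw)
  have h3 := odd_card p
  rw [Nat.card_eq_fintype_card, ← Finset.card_univ, h2, Finset.card_pair huv] at h3
  exact absurd h3 (by decide)

theorem map_mul_ext (p : Pairing (Pt V n)) (a b : Equiv.Perm (V × Fin 3)) :
    p.map (ext (a * b)) = (p.map (ext b)).map (ext a) := by
  rw [ext_mul]; rfl

theorem map_cyc_onV (p : Pairing (Pt V n)) (u v : V) (e : V ≃ V') :
    (p.map (ext (cyc u v))).map (ext (onV e)) = (p.map (ext (onV e))).map (ext (cyc (e u) (e v))) := by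
  rw [cyc, map_mul_ext, map_sw_ext, map_sw_ext, cyc, map_mul_ext]
  rfl

theorem map_cyc_symm_onV (p : Pairing (Pt V n)) (u v : V) (e : V ≃ V') :
    (p.map (ext (cyc u v).symm)).map (ext (onV e))
      = (p.map (ext (onV e))).map (ext (cyc (e u) (e v)).symm) := by
  rw [cyc_symm, map_mul_ext, map_sw_ext, map_sw_ext, cyc_symm, map_mul_ext]
  rfl

theorem Ins_ihx_far [Finite U] (C : Pairing (Pt (Option U) n)) {u v : U} (huv : u ≠ v)
    (hC : C (Sum.inl (some u, 0)) = Sum.inl (some v, 0)) (a : F 3) :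
    Ins C a + Ins (C.map (ext (cyc (some u) (some v)))) a
      + Ins (C.map (ext (cyc (some u) (some v)).symm)) a = 0 := by
  suffices h : Ins C + Ins (C.map (ext (cyc (some u) (some v))))
      + Ins (C.map (ext (cyc (some u) (some v)).symm)) = 0 from congrArg (fun f => f a) h
  apply F_induction
  intro H
  rw [LinearMap.add_apply, LinearMap.add_apply, Ins_cls, Ins_cls, Ins_cls, LinearMap.zero_apply,
    cyc_symm, cyc, map_mul_ext, map_mul_ext, ins_sw, ins_sw, ins_sw, ins_sw, ← map_mul_ext,
    ← map_mul_ext]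
  have := rcls_ihx (ins C H) (u := Sum.inl u) (v := Sum.inl v) (by simpa using huv) (by
    have := ins_jj C H (Sum.inl (some u, 0))
    rw [hC] at this
    exact this)
  rw [cyc_symm, cyc] at this
  exact this

/-- The action of an element of `Λ` on `F(3)`, by insertion at any trivalent vertex. -/
def act (a : LambdaSub) : F 3 →ₗ[ℚ] F 3 :=
  lift (fun G => insAt G.p (att G 0).1 a) <| by
    intro x hx
    cases hx with
    | iso e p h h' =>
      rw [map_sub, Finsupp.linearCombination_single, Finsupp.linearCombination_single, one_smul,
        one_smul, sub_eq_zero, insAt_eq _ _ a.2, insAt_eq _ _ a.2,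
        VF.at_indep _ h' _ (e (att ⟨_, p, h⟩ 0).1), VF.at_onV]
    | as p v s s' hs h h' =>
      rw [map_add, Finsupp.linearCombination_single, Finsupp.linearCombination_single, one_smul,
        one_smul, insAt_eq _ _ a.2, insAt_eq _ _ a.2, VF.at_indep _ h' _ (att ⟨_, p, h⟩ 0).1,
        VF.at_as _ _ _ _ hs, neg_add_cancel]
    | ihx p u v huv hp h h' h'' =>
      obtain ⟨w, h1, h2⟩ := third p huv
      rw [map_add, map_add, Finsupp.linearCombination_single, Finsupp.linearCombination_single,
        Finsupp.linearCombination_single, one_smul, one_smul, one_smul, insAt_eq _ _ a.2,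
        insAt_eq _ _ a.2, insAt_eq _ _ a.2, VF.at_indep _ h _ w, VF.at_indep _ h' _ w,
        VF.at_indep _ h'' _ w]
      unfold VF.at
      rw [map_cyc_onV, map_cyc_symm_onV, opt_ne h1.symm, opt_ne h2.symm]
      refine Ins_ihx_far _ (fun h => huv (by simpa using h)) ?_ a.1
      have := Pairing.map_apply p (ext (onV (opt w))) (Sum.inl (u, 0))
      rw [hp, ext_inl, ext_inl] at this
      simp only [onV, Equiv.prodCongr_apply, Prod.map, opt_ne h1.symm, opt_ne h2.symm] at this
      exact this

theorem act_cls (a : LambdaSub) (G : Graph 3) (v : G.V) : act a G.cls = insAt G.p v a := by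
  unfold act
  rw [lift_cls, insAt_eq _ _ a.2, insAt_eq _ _ a.2]
  exact VF.at_indep _ G.conn _ _

theorem act_rcls (a : LambdaSub) [Finite V] {p : Pairing (Pt V 3)} (hp : Conn p) (v : V) :
    act a (rcls p) = insAt p v a := by
  rw [rcls_of hp, act_cls a _ v]

theorem legs_Ins [Finite U] (C : Pairing (Pt (Option U) n)) (σ : Equiv.Perm (Fin n)) (a : F 3) :
    legs σ (Ins C a) = Ins (C.map (lg σ)) a := by
  suffices h : legs σ ∘ₗ Ins C = Ins (C.map (lg σ)) from congrArg (fun f => f a) h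
  apply F_induction
  intro H
  rw [LinearMap.comp_apply, Ins_cls, Ins_cls, legs_rcls]
  congr 1
  symm
  refine ins_map (lg σ) (fun z => Pairing.map_apply _ _ _) _ ?_ ?_
  · rintro (⟨_ | u, r⟩ | i) <;> rfl
  · intro b b' h
    exact ⟨b, b', h, rfl, rfl⟩

theorem legs_act (a : LambdaSub) (σ : Equiv.Perm (Fin 3)) (b : F 3) :
    legs σ (act a b) = act a (legs σ b) := by
  suffices h : legs σ ∘ₗ act a = act a ∘ₗ legs σ from congrArg (fun f => f b) h
  apply F_induction
  intro G
  rw [LinearMap.comp_apply, LinearMap.comp_apply, legs_cls, act_cls a G (att G 0).1,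
    act_cls a ⟨G.V, G.p.map (lg σ), conn_legs σ G.conn⟩ (att G 0).1]
  unfold insAt
  rw [legs_Ins, map_ext_lg]

theorem act_mem (a b : LambdaSub) : act a b ∈ LambdaSub := by
  intro i j h
  rw [legs_act, b.2 i j h, map_neg]

theorem reach_kk (C : Pairing (Pt (Option U) n)) (H : Graph 3) (b b' : H.V × Fin 3) :
    EqvGen (Step (ins C H)) (kk b) (kk b') := by
  refine reach_transfer (p := H.p) (q := ins C H)
    (fun x => match x with | Sum.inl b => kk b | Sum.inr i => kk (att H i)) ?_ ?_
    (H.conn.2 (Sum.inl b) (Sum.inl b'))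
  · rintro (x | i)
    · rcases h : H.p (Sum.inl x) with y | i
      · have := reach_edge (ins C H) (kk x)
        rw [ins_kk C H h] at this
        exact this
      · simp only; rw [att_eq h]; exact EqvGen.refl _
    · rw [att_spec]; exact EqvGen.refl _
  · intro v s s'
    exact reach_vert _ _ _ _

theorem conn_ins {C : Pairing (Pt (Option U) n)} (hC : Conn C) (H : Graph 3) :
    Conn (ins C H) := by
  have h1 : ∀ x y, EqvGen (Step (ins C H)) (jj H x) (jj H y) := by
    intro x y
    refine reach_transfer (p := C) (q := ins C H) (jj H) ?_ ?_ (hC.2 x y)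
    · intro x
      rw [← ins_jj]; exact reach_edge _ _
    · rintro (_ | u) s s'
      · exact reach_kk C H _ _
      · exact reach_vert _ _ _ _
  have h2 : ∀ x, EqvGen (Step (ins C H)) x (jj H (Sum.inl (none, 0))) := by
    intro x
    rcases ins_cases H x with ⟨y, rfl⟩ | ⟨b, b', h, rfl⟩
    · exact h1 _ _
    · exact reach_kk C H _ _
  exact ⟨⟨jj H (Sum.inl (none, 0))⟩, fun x y => EqvGen.trans _ _ _ (h2 x) (EqvGen.symm _ _ (h2 y))⟩

/-- Reassociation of vertex sets. -/
def shift (U W : Type) : U ⊕ Option W ≃ Option (U ⊕ W) where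
  toFun
    | Sum.inl u => some (Sum.inl u)
    | Sum.inr none => none
    | Sum.inr (some w) => some (Sum.inr w)
  invFun
    | none => Sum.inr none
    | some (Sum.inl u) => Sum.inl u
    | some (Sum.inr w) => Sum.inr (some w)
  left_inv := by rintro (u | _ | w) <;> rfl
  right_inv := by rintro (_ | u | w) <;> rfl

theorem ins_assoc {W : Type} [Finite W] (C : Pairing (Pt (Option U) n))
    (D : Pairing (Pt (Option W) 3)) (hD : Conn D) (K : Graph 3) :
    ins ((ins C ⟨Option W, D, hD⟩).map (ext (onV (shift U W)))) K
      = (ins C ⟨W ⊕ K.V, ins D K, conn_ins hD K⟩).map (ext (onV (Equiv.sumAssoc U W K.V).symm)) := by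
  set H : Graph 3 := ⟨Option W, D, hD⟩ with hH
  set H2 : Graph 3 := ⟨W ⊕ K.V, ins D K, conn_ins hD K⟩ with hH2
  have hatt : ∀ s, att H2 s = jh K (att H s) := by
    intro s
    have h1 := att_spec H2 s
    have h2 := ins_jj D K (Sum.inr s)
    have h3 : D (Sum.inr s) = Sum.inl (att H s) := att_spec H s
    rw [h3, jj_inl] at h2
    exact Sum.inl.inj (h1.symm.trans h2)
  have hk : ∀ z : Option W × Fin 3, ext (onV (Equiv.sumAssoc U W K.V).symm)
      (kk (jh K z) : Pt (U ⊕ (W ⊕ K.V)) n) = jj K (ext (onV (shift U W)) (kk z)) := by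
    rintro ⟨_ | w, s⟩ <;> rfl
  have hj : ∀ y, ext (onV (Equiv.sumAssoc U W K.V).symm) (jj H2 y : Pt (U ⊕ (W ⊕ K.V)) n)
      = jj K (ext (onV (shift U W)) (jj H y)) := by
    rintro (⟨_ | u, s⟩ | i)
    · have : (jj H2 (Sum.inl (none, s)) : Pt (U ⊕ (W ⊕ K.V)) n) = kk (jh K (att H s)) := by
        simp only [jj, hatt]
      rw [this]; exact hk _
    · rfl
    · rfl
  apply Pairing.eq_map
  intro x
  rcases ins_cases H2 x with ⟨y, rfl⟩ | ⟨b, b', h, rfl⟩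
  · rw [ins_jj, hj, hj, ins_jj, Pairing.map_apply, ins_jj]
  · rw [ins_kk C H2 h]
    change ins D K (Sum.inl b) = Sum.inl b' at h
    rcases ins_cases K (Sum.inl b : Pt (W ⊕ K.V) 3) with ⟨y, hy⟩ | ⟨c, c', hc, hy⟩
    · rw [hy, ins_jj] at h
      rcases y with z | i
      · rw [jj_inl] at hy
        rcases hz : D (Sum.inl z) with z' | i
        · rw [hz, jj_inl] at h
          rw [Sum.inl.inj hy, ← Sum.inl.inj h, hk, hk, ins_jj, Pairing.map_apply]
          have : ins C H (kk z) = kk z' := ins_kk C H hz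
          rw [this]
        · rw [hz] at h; simp [jj] at h
      · simp [jj] at hy
    · rw [hy, ins_kk D K hc] at h
      have h1 : b = (Sum.inr c.1, c.2) := Sum.inl.inj hy
      have h2 : b' = (Sum.inr c'.1, c'.2) := (Sum.inl.inj h).symm
      rw [h1, h2]
      exact ins_kk _ K hc

theorem Ins_act [Finite U] (a : LambdaSub) (C : Pairing (Pt (Option U) 3)) (hC : Conn C) (b : F 3) :
    Ins C (act a b) = act a (Ins C b) := by
  suffices h : Ins C ∘ₗ act a = act a ∘ₗ Ins C from congrArg (fun f => f b) h
  apply F_induction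
  intro H0
  rw [LinearMap.comp_apply, LinearMap.comp_apply]
  let w := (att H0 0).1
  let D := H0.p.map (ext (onV (opt w)))
  have hD : Conn D := conn_onV _ H0.conn
  have e0 : H0.cls = Graph.cls ⟨_, D, hD⟩ := by
    rw [← rcls_graph, ← rcls_graph]
    exact (rcls_iso (opt w) H0.p).symm
  have e1 : act a H0.cls = Ins D a := act_cls a H0 w
  rw [e1, e0, Ins_cls, act_rcls a (conn_ins hC _) (Sum.inr none), insAt_eq _ _ a.2,
    VF.at_of _ _ (shift U _) rfl]
  change Ins C (Ins D a) = Ins _ (a : F 3)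
  generalize (a : F 3) = a'
  suffices h : Ins C ∘ₗ Ins D = Ins ((ins C ⟨_, D, hD⟩).map (ext (onV (shift U _)))) from
    congrArg (fun f => f a') h
  apply F_induction
  intro K
  rw [LinearMap.comp_apply, Ins_cls, Ins_cls, ins_assoc, rcls_iso, rcls_of (conn_ins hD K), Ins_cls]

theorem act_act (a b : LambdaSub) (c : F 3) : act ⟨act a b, act_mem a b⟩ c = act a (act b c) := by
  suffices h : act ⟨act a b, act_mem a b⟩ = act a ∘ₗ act b from congrArg (fun f => f c) h
  apply F_induction
  intro G
  rw [LinearMap.comp_apply, act_cls _ G (att G 0).1, act_cls b G (att G 0).1]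
  exact Ins_act a _ (conn_onV _ G.conn) b

end action

/-! ### Antisymmetrization -/

section alternation
variable {V U : Type} {n : ℕ}

theorem legs_mul (σ τ : Equiv.Perm (Fin n)) (a : F n) : legs (σ * τ) a = legs σ (legs τ a) := by
  suffices h : legs (σ * τ) = legs σ ∘ₗ legs τ from congrArg (fun f => f a) h
  apply F_induction
  intro G
  rw [LinearMap.comp_apply, ← rcls_graph, legs_rcls, legs_rcls, legs_rcls, Pairing.map_map]
  congr 2
  ext1 x; rcases x with x | x <;> rfl

theorem legs_one (a : F n) : legs 1 a = a := by
  suffices h : legs (1 : Equiv.Perm (Fin n)) = LinearMap.id from congrArg (fun f => f a) h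
  apply F_induction
  intro G
  rw [LinearMap.id_apply, ← rcls_graph, legs_rcls]
  congr 1
  symm
  apply Pairing.eq_map
  have : ∀ x : Pt G.V n, lg 1 x = x := by rintro (x | x) <;> rfl
  intro x
  rw [this, this]

/-- Antisymmetrization `a ↦ (1/6) ∑ sgn(σ) σ(a)` of elements of `F(3)`. -/
def alt : F 3 →ₗ[ℚ] F 3 :=
  (1 / 6 : ℚ) • ∑ σ : Equiv.Perm (Fin 3), ((Equiv.Perm.sign σ : ℤ) : ℚ) • legs σ

theorem alt_apply (a : F 3) :
    alt a = (1 / 6 : ℚ) • ∑ σ : Equiv.Perm (Fin 3), ((Equiv.Perm.sign σ : ℤ) : ℚ) • legs σ a := by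
  simp [alt]

theorem alt_legs (i j : Fin 3) (h : i ≠ j) (a : F 3) : alt (legs (Equiv.swap i j) a) = - alt a := by
  rw [alt_apply, alt_apply, ← smul_neg, ← Finset.sum_neg_distrib]
  congr 1
  refine Fintype.sum_equiv (Equiv.mulRight (Equiv.swap i j)) _ _ ?_
  intro σ
  simp [← legs_mul, Equiv.Perm.sign_mul, Equiv.Perm.sign_swap h]

theorem legs_alt (i j : Fin 3) (h : i ≠ j) (a : F 3) : legs (Equiv.swap i j) (alt a) = - alt a := by
  rw [alt_apply, map_smul, map_sum, ← smul_neg, ← Finset.sum_neg_distrib]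
  congr 1
  refine Fintype.sum_equiv (Equiv.mulLeft (Equiv.swap i j)) _ _ ?_
  intro σ
  simp [← legs_mul, Equiv.Perm.sign_mul, Equiv.Perm.sign_swap h]

theorem alt_mem (a : F 3) : alt a ∈ LambdaSub := fun i j h => legs_alt i j h a

theorem legs_of_mem {a : F 3} (ha : a ∈ LambdaSub) (σ : Equiv.Perm (Fin 3)) :
    legs σ a = ((Equiv.Perm.sign σ : ℤ) : ℚ) • a := by
  induction σ using Equiv.Perm.swap_induction_on with
  | one => simp [legs_one]
  | swap_mul f x y hxy ih =>
    rw [legs_mul, ih, map_smul, ha x y hxy, Equiv.Perm.sign_mul, Equiv.Perm.sign_swap hxy]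
    simp

theorem alt_of_mem {a : F 3} (ha : a ∈ LambdaSub) : alt a = a := by
  rw [alt_apply]
  have : ∀ σ : Equiv.Perm (Fin 3), ((Equiv.Perm.sign σ : ℤ) : ℚ) • legs σ a = a := by
    intro σ
    rw [legs_of_mem ha, smul_smul]
    rcases Int.units_eq_one_or (Equiv.Perm.sign σ) with h | h <;> simp [h]
  rw [Finset.sum_congr rfl (fun σ _ => this σ), Finset.sum_const, Finset.card_univ,
    Fintype.card_perm, Fintype.card_fin, ← Nat.cast_smul_eq_nsmul ℚ, smul_smul]
  norm_num [Nat.factorial]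

end alternation

/-! ### Commutativity of the insertion product -/

section commutativity
variable {P Q V W U U' : Type} {n : ℕ}

theorem map_sw_equiv (p : Pairing P) (x y : P) (e : P ≃ Q) :
    (p.map (sw x y)).map e = (p.map e).map (sw (e x) (e y)) := by
  rw [Pairing.map_map, Pairing.map_map]
  congr 1
  ext1 z
  simp [sw_map _ e.injective]

theorem map_sw_edge (p : Pairing P) {x y : P} (h : p x = y) : p.map (sw x y) = p := by
  classical
  apply Pairing.ext_coe
  intro z
  have hi := p.invol
  have hn := p.ne
  simp only [Pairing.map, sw_symm, sw_apply_def]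
  grind

theorem rcls_loop [Finite V] (B : Pairing (Pt V n)) {v : V} {s s' : Fin 3}
    (hB : B (Sum.inl (v, s)) = Sum.inl (v, s')) : rcls B = 0 := by
  have hs : s ≠ s' := by
    rintro rfl
    exact B.ne _ hB
  have h := rcls_as B v hs
  rw [ext_sw, map_sw_edge B hB] at h
  have h2 : (2 : ℚ) • rcls B = 0 := by
    rw [two_smul]; nth_rewrite 1 [h]; exact neg_add_cancel _
  exact (smul_eq_zero.1 h2).resolve_left (by norm_num)

/-- The sum of all ways to attach an edge to the univalent vertices of a graph vanishes. -/
theorem slide_legs [Finite V] (B : Pairing (Pt V n)) {v : V}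
    (hB : B (Sum.inl (v, 0)) = Sum.inl (v, 1)) :
    ∑ i : Fin n, rcls (B.map (sw (Sum.inl (v, 1)) (Sum.inr i))) = 0 := by
  classical
  have : Fintype V := Fintype.ofFinite V
  have hB' : B (Sum.inl (v, 1)) = Sum.inl (v, 0) := by rw [← hB, B.invol]
  let f : Pt V n → F n := fun x => if x = Sum.inl (v, 0) ∨ x = Sum.inl (v, 1) then 0 else
    rcls (B.map (sw (Sum.inl (v, 1)) x))
  have h1 : ∑ x, f x = 0 := by
    refine Finset.sum_involution (fun x _ => B x) ?_ (fun x _ _ => B.ne x)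
      (fun _ _ => Finset.mem_univ _) (fun x _ => B.invol x)
    intro x _
    by_cases hx : x = Sum.inl (v, 0) ∨ x = Sum.inl (v, 1)
    · have hx' : B x = Sum.inl (v, 0) ∨ B x = Sum.inl (v, 1) := by
        rcases hx with rfl | rfl
        · exact Or.inr hB
        · exact Or.inl hB'
      simp only [f, if_pos hx, if_pos hx', add_zero]
    · have hx' : ¬ (B x = Sum.inl (v, 0) ∨ B x = Sum.inl (v, 1)) := by
        rintro (h | h)
        · exact hx (Or.inr (by rw [← B.invol x, h, hB]))
        · exact hx (Or.inl (by rw [← B.invol x, h, hB']))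
      simp only [f, if_neg hx, if_neg hx']
      push Not at hx
      rw [flip_edge B hB rfl hx.1 hx.2, ← ext_sw, rcls_as _ _ (by simp), add_neg_cancel]
  rw [Fintype.sum_sum_type, Fintype.sum_prod_type] at h1
  have h2 : ∀ w : V, ∑ s : Fin 3, f (Sum.inl (w, s)) = 0 := by
    intro w
    by_cases hw : w = v
    · subst hw
      rw [Fin.sum_univ_three]
      have f0 : f (Sum.inl (w, 0)) = 0 := if_pos (Or.inl rfl)
      have f1 : f (Sum.inl (w, 1)) = 0 := if_pos (Or.inr rfl)
      have f2 : f (Sum.inl (w, 2)) = rcls (B.map (sw (Sum.inl (w, 1)) (Sum.inl (w, 2)))) :=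
        if_neg (by simp)
      rw [f0, f1, f2, ← ext_sw, rcls_as _ _ (by simp), rcls_loop B hB]
      simp
    · rw [← slide_vertex B hw hB]
      refine Finset.sum_congr rfl fun s _ => ?_
      simp only [f]
      rw [if_neg (by simp [hw]), ext_sw]
  rw [Finset.sum_eq_zero (fun w _ => h2 w), zero_add] at h1
  rw [← h1]
  refine Finset.sum_congr rfl fun i _ => ?_
  simp only [f]
  rw [if_neg (by simp)]

/-- Removing the vertex `none` of a closed graph, leaving univalent vertices. -/
def remE : Pt (Option U) 0 ≃ Pt U 3 where
  toFun
    | Sum.inl (none, s) => Sum.inr s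
    | Sum.inl (some u, s) => Sum.inl (u, s)
    | Sum.inr i => i.elim0
  invFun
    | Sum.inl (u, s) => Sum.inl (some u, s)
    | Sum.inr s => Sum.inl (none, s)
  left_inv := by
    rintro (⟨_ | u, s⟩ | i)
    · rfl
    · rfl
    · exact i.elim0
  right_inv := by rintro (⟨u, s⟩ | s) <;> rfl

theorem remE_some (u : U) (s : Fin 3) : remE (Sum.inl (some u, s)) = Sum.inl (u, s) := rfl
theorem remE_none (s : Fin 3) :
    (remE (Sum.inl (none, s)) : Pt U 3) = Sum.inr s := rfl

theorem lg_swap (i j : Fin n) :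
    (lg (Equiv.swap i j) : Pt V n ≃ Pt V n) = sw (Sum.inr i) (Sum.inr j) := by
  ext1 z
  rcases z with z | z
  · rw [sw_ne (by simp) (by simp)]; rfl
  · rw [sw_map _ Sum.inr_injective, sw_eq]; rfl

/-- Removal of a vertex of a closed graph, followed by antisymmetrization. -/
def remVF : VF 0 (F 3) where
  Φ C := alt (rcls (C.map remE))
  hole C s s' hs := by
    rw [ext_sw, map_sw_equiv, remE_none, remE_none, ← lg_swap, ← legs_rcls, alt_legs _ _ hs]
  some' C u s s' hs := by
    rw [ext_sw, map_sw_equiv, remE_some, remE_some, ← ext_sw, rcls_as _ _ hs, map_neg]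
  iso C f := by
    rw [← rcls_iso f (C.map remE), Pairing.map_map, Pairing.map_map]
    congr 3
    ext1 x
    rcases x with ⟨_ | u, s⟩ | i
    · rfl
    · rfl
    · exact i.elim0
  slide C v hC := by
    rw [← map_sum]
    simp only [ext_sw, map_sw_equiv, remE_some, remE_none]
    rw [slide_legs (C.map remE) (v := v), map_zero]
    have := Pairing.map_apply C remE (Sum.inl (some v, 0))
    rw [hC] at this
    exact this

theorem conn_close {p : Pairing (Pt U 3)} (hp : Conn p) :
    Conn (p.map remE.symm) := by
  refine ⟨hp.1.map remE.symm, fun x y => ?_⟩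
  obtain ⟨x, rfl⟩ := remE.symm.surjective x
  obtain ⟨y, rfl⟩ := remE.symm.surjective y
  refine reach_transfer remE.symm ?_ ?_ (hp.2 x y)
  · intro x; rw [← Pairing.map_apply]; exact reach_edge _ _
  · intro v s s'; exact reach_vert _ _ _ _

/-- Exchange of the half-edges of `none` with the univalent vertices. -/
def flip : Pt (Option W) 3 ≃ Pt (Option W) 3 where
  toFun
    | Sum.inl (none, s) => Sum.inr s
    | Sum.inl (some w, s) => Sum.inl (some w, s)
    | Sum.inr s => Sum.inl (none, s)
  invFun
    | Sum.inl (none, s) => Sum.inr s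
    | Sum.inl (some w, s) => Sum.inl (some w, s)
    | Sum.inr s => Sum.inl (none, s)
  left_inv := by rintro (⟨_ | u, s⟩ | i) <;> rfl
  right_inv := by rintro (⟨_ | u, s⟩ | i) <;> rfl

/-- Exchange of the two vertices `none` and `some none`. -/
def vswap : Option (Option U) ≃ Option (Option U) where
  toFun
    | none => some none
    | some none => none
    | some (some u) => some (some u)
  invFun
    | none => some none
    | some none => none
    | some (some u) => some (some u)
  left_inv := by rintro (_ | _ | u) <;> rfl
  right_inv := by rintro (_ | _ | u) <;> rfl

theorem alt_flip [Finite W] (g : Pairing (Pt (Option W) 3)) (hg : Conn (g.map remE.symm)) :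
    alt (rcls (g.map flip)) = alt (rcls g) := by
  have h1 : alt (rcls g) = remVF.at (g.map remE.symm) none := by
    rw [remVF.at_of _ (Equiv.refl _) rfl]
    change _ = alt (rcls _)
    have h : onV (Equiv.refl (Option (Option W))) = Equiv.refl _ := rfl
    rw [h, ext_refl, Pairing.map_refl, Pairing.map_map, Equiv.symm_trans_self, Pairing.map_refl]
  have h2 : alt (rcls (g.map flip)) = remVF.at (g.map remE.symm) (some none) := by
    rw [remVF.at_of _ vswap rfl]
    change _ = alt (rcls _)
    congr 2
    rw [Pairing.map_map, Pairing.map_map]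
    congr 1
    ext1 x
    rcases x with ⟨_ | u, s⟩ | i <;> rfl
  rw [h1, h2]
  exact remVF.at_indep hg _ _

end commutativity

section commutativity2
variable {P Q V W U U' : Type} {n : ℕ}

/-- Reassociation of vertex sets. -/
def shiftL (U W : Type) : Option U ⊕ W ≃ Option (U ⊕ W) where
  toFun
    | Sum.inl none => none
    | Sum.inl (some u) => some (Sum.inl u)
    | Sum.inr w => some (Sum.inr w)
  invFun
    | none => Sum.inl none
    | some (Sum.inl u) => Sum.inl (some u)
    | some (Sum.inr w) => Sum.inr w
  left_inv := by rintro ((_ | u) | w) <;> rfl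
  right_inv := by rintro (_ | u | w) <;> rfl

/-- Exchange of the half-edges of `some none` with the univalent vertices. -/
def flip1 : Pt (Option (Option U)) 3 ≃ Pt (Option (Option U)) 3 :=
  (ext (onV vswap)).trans (flip.trans (ext (onV vswap)))

theorem ins_flip1 (p : Pairing (Pt (Option (Option U)) 3)) (H : Graph 3) :
    ins (p.map flip1) H = (ins p H).map
      ((ext (onV (shiftL U H.V))).trans (flip.trans (ext (onV (shiftL U H.V))).symm)) := by
  refine ins_map flip1 (fun z => Pairing.map_apply _ _ _) _ ?_ ?_
  · rintro (⟨_ | _ | u, s⟩ | i) <;> rfl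
  · intro b b' h
    exact ⟨b, b', h, rfl, rfl⟩

theorem alt_ins_flip1 [Finite U] (p : Pairing (Pt (Option (Option U)) 3)) (H : Graph 3)
    (h : Conn (((ins p H).map (ext (onV (shiftL U H.V)))).map remE.symm)) :
    alt (rcls (ins (p.map flip1) H)) = alt (rcls (ins p H)) := by
  rw [ins_flip1, ← rcls_iso (shiftL U H.V), ← rcls_iso (shiftL U H.V) (ins p H), ← alt_flip _ h]
  congr 2
  rw [Pairing.map_map, Pairing.map_map, Equiv.trans_assoc, Equiv.trans_assoc, Equiv.symm_trans_self,
    Equiv.trans_refl]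

/-- Gluing `H` to the univalent vertices of a graph. -/
theorem ins_flip (p : Pairing (Pt (Option U) 3)) (H : Graph 3) :
    ins (p.map flip) H = (ins (p.map remE.symm) H).map ((ext (onV (shiftL U H.V))).trans remE) := by
  refine ins_map (remE.trans flip) ?_ _ ?_ ?_
  · intro z
    obtain ⟨y, rfl⟩ := remE.symm.surjective z
    rw [Pairing.map_apply, Equiv.trans_apply, Equiv.trans_apply, Equiv.apply_symm_apply,
      Equiv.apply_symm_apply, Pairing.map_apply]
  · rintro (⟨_ | _ | u, s⟩ | i)
    · rfl
    · rfl
    · rfl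
    · exact i.elim0
  · intro b b' h
    exact ⟨b, b', h, rfl, rfl⟩

theorem conn_flip {p : Pairing (Pt (Option U) 3)} (hp : Conn p) (H : Graph 3) :
    Conn ((ins (p.map flip) H).map remE.symm) := by
  have : (ins (p.map flip) H).map remE.symm
      = (ins (p.map remE.symm) H).map (ext (onV (shiftL U H.V))) := by
    rw [ins_flip, Pairing.map_map, Equiv.trans_assoc, Equiv.self_trans_symm, Equiv.trans_refl]
  rw [this]
  exact conn_onV _ (conn_ins (conn_close hp) H)

theorem conn_close_onV {p : Pairing (Pt U 3)} (e : U ≃ U') (h : Conn (p.map remE.symm)) :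
    Conn ((p.map (ext (onV e))).map remE.symm) := by
  have := conn_onV (Equiv.optionCongr e) h
  rw [Pairing.map_map] at this ⊢
  convert this using 2
  ext1 x
  rcases x with x | x <;> rfl

theorem conn_of_ins {C : Pairing (Pt (Option U) n)} {H : Graph 3} (h : Conn (ins C H)) :
    Conn C := by
  let f : Pt (U ⊕ H.V) n → Pt (Option U) n := fun x => match x with
    | Sum.inl (Sum.inl u, s) => Sum.inl (some u, s)
    | Sum.inl (Sum.inr _, _) => Sum.inl (none, 0)
    | Sum.inr i => Sum.inr i
  have hf : ∀ y, EqvGen (Step C) (f (jj H y)) y := by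
    rintro (⟨_ | u, s⟩ | i)
    · exact reach_vert _ _ _ _
    · exact EqvGen.refl _
    · exact EqvGen.refl _
  refine ⟨⟨Sum.inl (none, 0)⟩, fun x y => ?_⟩
  refine EqvGen.trans _ _ _ (EqvGen.symm _ _ (hf x)) (EqvGen.trans _ _ _ ?_ (hf y))
  refine reach_transfer f ?_ ?_ (h.2 (jj H x) (jj H y))
  · intro x
    rcases ins_cases H x with ⟨y, rfl⟩ | ⟨b, b', h, rfl⟩
    · rw [ins_jj]
      exact EqvGen.trans _ _ _ (hf y) (EqvGen.trans _ _ _ (reach_edge C y) (EqvGen.symm _ _ (hf _)))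
    · rw [ins_kk C H h]; exact EqvGen.refl _
  · rintro (u | w) s s'
    · exact reach_vert _ _ _ _
    · exact EqvGen.refl _

theorem Ins_not [Finite U] {C : Pairing (Pt (Option U) n)} (h : ¬ Conn C) : Ins C = 0 := by
  apply F_induction
  intro H
  rw [Ins_cls, rcls_not (fun h' => h (conn_of_ins h'))]
  rfl

theorem Ins_vswap [Finite U] (r : Pairing (Pt (Option (Option U)) n)) {a : F 3}
    (ha : a ∈ LambdaSub) : Ins (r.map (ext (onV vswap))) a = Ins r a := by
  by_cases h : Conn r
  · have h1 : (insVF n a ha).at r none = Ins r a := by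
      rw [VF.at_of _ _ (Equiv.refl _) rfl]
      have h : onV (Equiv.refl (Option (Option U))) = Equiv.refl _ := rfl
      rw [h, ext_refl, Pairing.map_refl]
      rfl
    have h2 : (insVF n a ha).at r (some none) = Ins (r.map (ext (onV vswap))) a := by
      rw [VF.at_of _ _ vswap rfl]
      rfl
    rw [← h1, ← h2]
    exact VF.at_indep _ h _ _
  · rw [Ins_not h, Ins_not]
    intro h'
    have := conn_onV vswap h'
    rw [Pairing.map_map, ext_trans, onV_trans] at this
    have hv : (vswap : Option (Option U) ≃ _).trans vswap = Equiv.refl _ := by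
      ext1 x; rcases x with _ | _ | x <;> rfl
    have hr : onV (Equiv.refl (Option (Option U))) = Equiv.refl _ := rfl
    rw [hv, hr, ext_refl, Pairing.map_refl] at this
    exact h this

theorem alt_Ins_flip1 [Finite U] (p : Pairing (Pt (Option (Option U)) 3)) (a : F 3)
    (h : ∀ H : Graph 3, Conn ((ins p H).map remE.symm)) :
    alt (Ins (p.map flip1) a) = alt (Ins p a) := by
  suffices h : alt ∘ₗ Ins (p.map flip1) = alt ∘ₗ Ins p from congrArg (fun f => f a) h
  apply F_induction
  intro H
  rw [LinearMap.comp_apply, LinearMap.comp_apply, Ins_cls, Ins_cls]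
  exact alt_ins_flip1 p H (conn_close_onV _ (h H))

/-- Exchanging the place of insertion with the univalent vertices. -/
theorem alt_Ins_flip_two [Finite U] (p : Pairing (Pt (Option (Option U)) 3)) (hp : Conn p)
    {a : F 3} (ha : a ∈ LambdaSub) : alt (Ins (p.map flip) a) = alt (Ins p a) := by
  rw [← alt_Ins_flip1 p a (fun H => conn_close (conn_ins hp H)),
    ← alt_Ins_flip1 (p.map flip) a (fun H => conn_flip hp H), ← Ins_vswap (p.map flip1) ha]
  congr 2
  rw [Pairing.map_map, Pairing.map_map]
  congr 2
  ext1 x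
  rcases x with ⟨_ | _ | u, s⟩ | i <;> rfl

theorem alt_Ins_flip_one [IsEmpty U] (p : Pairing (Pt (Option U) 3)) (hp : Conn p)
    {a : F 3} (ha : a ∈ LambdaSub) : alt (Ins (p.map flip) a) = alt (Ins p a) := by
  have hx : ∀ s, ∃ i, p (Sum.inl (none, s)) = Sum.inr i := by
    have hatt : ∀ i, ∃ s, p (Sum.inr i) = Sum.inl (none, s) := by
      intro i
      obtain ⟨⟨x, s⟩, h⟩ := leg_left ⟨_, p, hp⟩ i
      rcases x with _ | u
      · exact ⟨s, h⟩
      · exact isEmptyElim u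
    choose f hf using hatt
    have hinj : Function.Injective f := by
      intro i j h
      have h1 := hf i
      rw [h, ← hf j] at h1
      have := congrArg p h1
      rw [p.invol, p.invol] at this
      exact Sum.inr.inj this
    intro s
    obtain ⟨i, rfl⟩ := (Finite.injective_iff_surjective.1 hinj) s
    exact ⟨i, by rw [← hf, p.invol]⟩
  choose t ht using hx
  have htinj : Function.Injective t := by
    intro i j h
    have h1 := ht i
    rw [h, ← ht j] at h1
    have := congrArg p h1
    rw [p.invol, p.invol] at this
    simpa using this
  obtain ⟨τ, hτ⟩ : ∃ τ : Equiv.Perm (Fin 3), ∀ s, τ s = t s :=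
    ⟨Equiv.ofBijective t ⟨htinj, Finite.injective_iff_surjective.1 htinj⟩, fun _ => rfl⟩
  have hp' : ∀ s, p (Sum.inl (none, s)) = Sum.inr (τ s) := fun s => by rw [ht, hτ]
  clear hτ htinj ht hp
  clear t
  induction τ using Equiv.Perm.swap_induction_on generalizing p with
  | one =>
    have h1 : ∀ s, p (Sum.inr s) = Sum.inl (none, s) := by
      intro s
      have := hp' s
      rw [Equiv.Perm.one_apply] at this
      rw [← this, p.invol]
    have : p.map flip = p := by
      symm
      apply Pairing.eq_map
      rintro (⟨_ | u, s⟩ | i)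
      · rw [hp']; exact h1 s
      · exact isEmptyElim u
      · rw [h1]; exact hp' i
    rw [this]
  | swap_mul f x y hxy ih =>
    have h2 := ih (p.map (lg (Equiv.swap x y))) (by
      intro s
      have := Pairing.map_apply p (lg (Equiv.swap x y)) (Sum.inl (none, s))
      rw [hp'] at this
      refine this.trans ?_
      change Sum.inr (Equiv.swap x y ((Equiv.swap x y * f) s)) = _
      simp)
    have h3 : (p.map (lg (Equiv.swap x y))).map flip
        = (p.map flip).map (ext (sw (none, x) (none, y))) := by
      rw [lg_swap, map_sw_equiv, ext_sw]
      rfl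
    rw [h3, Ins_hole _ hxy ha, ← legs_Ins, alt_legs _ _ hxy, map_neg] at h2
    exact neg_injective h2

theorem alt_Ins_flip [Finite U] (p : Pairing (Pt (Option U) 3)) (hp : Conn p)
    {a : F 3} (ha : a ∈ LambdaSub) : alt (Ins (p.map flip) a) = alt (Ins p a) := by
  rcases isEmpty_or_nonempty U with h | ⟨⟨u⟩⟩
  · exact alt_Ins_flip_one p hp ha
  · have h1 := alt_Ins_flip_two (p.map (ext (onV (Equiv.optionCongr (opt u))))) (conn_onV _ hp) ha
    rw [Ins_iso] at h1
    rw [← h1, ← Ins_iso (p.map flip) (opt u), Pairing.map_map, Pairing.map_map]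
    congr 4
    ext1 x
    rcases x with ⟨_ | u, s⟩ | i <;> rfl

/-- Gluing two graphs along their univalent vertices is symmetric. -/
theorem theta_symm (G H : Graph 3) : ins (H.p.map remE.symm) G
    = (ins (G.p.map remE.symm) H).map (ext (onV (Equiv.sumComm G.V H.V))) := by
  have key : ∀ (G H : Graph 3) (g : G.V × Fin 3),
      (ins (G.p.map remE.symm) H (Sum.inl (Sum.inl g.1, g.2)) =
        match G.p (Sum.inl g) with
        | Sum.inl g' => Sum.inl (Sum.inl g'.1, g'.2)
        | Sum.inr i => kk (att H i)) := by
    intro G H g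
    have h1 := ins_jj (G.p.map remE.symm) H (Sum.inl (some g.1, g.2))
    have h2 := Pairing.map_apply G.p remE.symm (Sum.inl g)
    have h3 : remE.symm (Sum.inl g) = Sum.inl (some g.1, g.2) := rfl
    rw [h3] at h2
    rw [h2] at h1
    refine Eq.trans h1 ?_
    rcases G.p (Sum.inl g) with g' | i <;> rfl
  have key' : ∀ (G H : Graph 3) (h : H.V × Fin 3),
      (ins (G.p.map remE.symm) H (Sum.inl (Sum.inr h.1, h.2)) =
        match H.p (Sum.inl h) with
        | Sum.inl h' => kk h'
        | Sum.inr i => Sum.inl (Sum.inl (att G i).1, (att G i).2)) := by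
    intro G H h
    rcases hh : H.p (Sum.inl h) with h' | i
    · exact ins_kk _ H hh
    · have h1 := ins_jj (G.p.map remE.symm) H (Sum.inl (none, i))
      have h2 := Pairing.map_apply G.p remE.symm (Sum.inr i)
      have h3 : (remE.symm (Sum.inr i) : Pt (Option G.V) 0) = Sum.inl (none, i) := rfl
      rw [h3] at h2
      rw [h2, att_spec] at h1
      have h4 : (jj H (Sum.inl (none, i)) : Pt (G.V ⊕ H.V) 0) = kk h := by
        simp only [jj, att_eq hh]
      rw [h4] at h1
      exact h1
  apply Pairing.eq_map
  rintro (⟨g | h, s⟩ | i)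
  · have e1 := key' H G (g, s)
    have e2 := key G H (g, s)
    rw [e2]
    refine Eq.trans e1 ?_
    rcases G.p (Sum.inl (g, s)) with x | i <;> rfl
  · have e1 := key H G (h, s)
    have e2 := key' G H (h, s)
    rw [e2]
    refine Eq.trans e1 ?_
    rcases H.p (Sum.inl (h, s)) with x | i <;> rfl
  · exact i.elim0

/-- The form `(G, H) ↦ ` (`H` glued to `G`, with a vertex removed), linear in `H`. -/
def form (G : Graph 3) : F 3 →ₗ[ℚ] F 3 :=
  alt ∘ₗ Ins ((G.p.map (ext (onV (opt (att G 0).1)))).map flip)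

theorem form_cls (G H : Graph 3) (v : G.V ⊕ H.V) :
    form G H.cls = remVF.at (ins (G.p.map remE.symm) H) v := by
  have hc : Conn (ins (G.p.map remE.symm) H) := conn_ins (conn_close G.conn) H
  rw [remVF.at_indep hc v (Sum.inl (att G 0).1)]
  set z := (att G 0).1 with hz
  unfold form
  rw [LinearMap.comp_apply, Ins_cls, ins_flip]
  rw [remVF.at_of _ ((Equiv.sumCongr (opt z) (Equiv.refl H.V)).trans (shiftL _ H.V)) (by
    simp only [Equiv.trans_apply, Equiv.sumCongr_apply, Sum.map_inl, opt_self]; rfl)]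
  change _ = alt (rcls _)
  congr 2
  have h1 : ins ((G.p.map (ext (onV (opt z)))).map remE.symm) H
      = (ins (G.p.map remE.symm) H).map
        (ext (onV (Equiv.sumCongr (opt z) (Equiv.refl H.V)))) := by
    refine ins_map (ext (onV (Equiv.optionCongr (opt z)))) ?_ _ ?_ ?_
    · intro y
      obtain ⟨x, rfl⟩ := remE.symm.surjective y
      rw [Pairing.map_apply]
      have e : ∀ x : Pt G.V 3, (ext (onV (Equiv.optionCongr (opt z)))) (remE.symm x)
        = remE.symm (ext (onV (opt z)) x) := by
        rintro (⟨g, s⟩ | i) <;> rfl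
      rw [e, e, Pairing.map_apply, Pairing.map_apply]
    · rintro (⟨_ | u, s⟩ | i)
      · rfl
      · rfl
      · exact i.elim0
    · intro b b' h
      exact ⟨b, b', h, rfl, rfl⟩
  rw [h1, ← onV_trans, ← ext_trans]
  rfl

theorem form_symm (G H : Graph 3) : form G H.cls = form H G.cls := by
  rw [form_cls G H (Sum.inl (att G 0).1), form_cls H G (Sum.inr (att G 0).1), theta_symm G H]
  exact (remVF.at_onV _ (Equiv.sumComm G.V H.V) (Sum.inl (att G 0).1)).symm

theorem alt_act_cls (a : LambdaSub) (G : Graph 3) : alt (act a G.cls) = form G a := by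
  rw [act_cls a G (att G 0).1]
  exact (alt_Ins_flip _ (conn_onV _ G.conn) a.2).symm

theorem exists_rep (b : F n) : ∃ m : Graph n →₀ ℚ, b = m.sum fun G c => c • G.cls := by
  obtain ⟨m, rfl⟩ := Submodule.Quotient.mk_surjective _ b
  refine ⟨m, ?_⟩
  conv_lhs => rw [← Finsupp.sum_single m]
  unfold Finsupp.sum
  rw [← Submodule.mkQ_apply, map_sum]
  refine Finset.sum_congr rfl fun G _ => ?_
  change (Submodule.Quotient.mk (Finsupp.single G (m G)) : F n)
    = m G • Submodule.Quotient.mk (Finsupp.single G 1)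
  rw [← Submodule.Quotient.mk_smul, Finsupp.smul_single, smul_eq_mul, mul_one]

theorem act_comm (a b : LambdaSub) : act a b = act b a := by
  rw [← alt_of_mem (act_mem a b), ← alt_of_mem (act_mem b a)]
  obtain ⟨l, hl⟩ := exists_rep (a : F 3)
  obtain ⟨m, hm⟩ := exists_rep (b : F 3)
  have h1 : alt (act a b) = ∑ G ∈ m.support, ∑ H ∈ l.support, (m G * l H) • form G H.cls := by
    rw [hm, Finsupp.sum, map_sum, map_sum]
    refine Finset.sum_congr rfl fun G _ => ?_
    rw [map_smul, map_smul, alt_act_cls, hl, Finsupp.sum, map_sum, Finset.smul_sum]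
    refine Finset.sum_congr rfl fun H _ => ?_
    rw [map_smul, smul_smul]
  have h2 : alt (act b a) = ∑ H ∈ l.support, ∑ G ∈ m.support, (l H * m G) • form H G.cls := by
    rw [hl, Finsupp.sum, map_sum, map_sum]
    refine Finset.sum_congr rfl fun G _ => ?_
    rw [map_smul, map_smul, alt_act_cls, hm, Finsupp.sum, map_sum, Finset.smul_sum]
    refine Finset.sum_congr rfl fun H _ => ?_
    rw [map_smul, smul_smul]
  rw [h1, h2, Finset.sum_comm]
  refine Finset.sum_congr rfl fun H _ => Finset.sum_congr rfl fun G _ => ?_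
  rw [form_symm, mul_comm]

end commutativity2

/-! ### The algebra `Λ` -/

section algebra

/-- The matching of the graph with a single trivalent vertex. -/
def yPair : Pairing (Pt Unit 3) where
  toFun x := match x with
    | Sum.inl (_, s) => Sum.inr s
    | Sum.inr s => Sum.inl ((), s)
  invol := by rintro (⟨⟨⟩, s⟩ | s) <;> rfl
  ne := by rintro (⟨⟨⟩, s⟩ | s) h <;> cases h

theorem yPair_conn : Conn yPair := by
  have key : ∀ x, EqvGen (Step yPair) x (Sum.inl ((), 0)) := by
    rintro (⟨⟨⟩, s⟩ | s)
    · exact reach_vert _ _ _ _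
    · exact EqvGen.trans _ _ _ (reach_edge yPair (Sum.inr s)) (reach_vert yPair () s 0)
  exact ⟨⟨Sum.inr 0⟩, fun x y => EqvGen.trans _ _ _ (key x) (EqvGen.symm _ _ (key y))⟩

/-- The graph with a single trivalent vertex. -/
abbrev yGraph : Graph 3 := ⟨Unit, yPair, yPair_conn⟩

theorem yPair_inl (s : Fin 3) : yPair (Sum.inl ((), s)) = Sum.inr s := rfl

theorem yPair_inr (s : Fin 3) : yPair (Sum.inr s) = Sum.inl ((), s) := rfl

theorem yGraph_mem : yGraph.cls ∈ LambdaSub := by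
  intro i j h
  rw [← rcls_graph, legs_rcls]
  have : yPair.map (lg (Equiv.swap i j)) = yPair.map (ext (sw ((), i) ((), j))) := by
    symm
    apply Pairing.eq_map
    have h1 : ∀ s, sw ((), i) ((), j) ((), s) = ((), Equiv.swap i j s) := by
      intro s
      rw [← sw_eq]
      exact sw_map (fun r : Fin 3 => ((), r)) (fun x y h => by simpa using h) i j s
    have h2 : ∀ s, sw ((), i) ((), j) ((), Equiv.swap i j s) = ((), s) := by
      intro s; rw [h1]; simp
    rintro (⟨⟨⟩, s⟩ | s)
    · have := Pairing.map_apply yPair (ext (sw ((), i) ((), j)))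
        (Sum.inl ((), Equiv.swap i j s))
      rw [ext_inl, h2, yPair_inl] at this
      exact this
    · have := Pairing.map_apply yPair (ext (sw ((), i) ((), j))) (Sum.inr (Equiv.swap i j s))
      rw [yPair_inr, ext_inl, h2] at this
      exact this
  rw [this]
  exact rcls_as _ _ h

theorem att_yGraph (s : Fin 3) : att yGraph s = ((), s) := att_eq (H := yGraph) (yPair_inl s)

theorem Ins_y {U : Type} [Finite U] {n : ℕ} (C : Pairing (Pt (Option U) n)) :
    Ins C yGraph.cls = rcls C := by
  rw [Ins_cls, ← rcls_iso (Equiv.optionEquivSumPUnit U) C]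
  congr 1
  apply Pairing.eq_map
  have : ∀ y : Pt (Option U) n, ext (onV (Equiv.optionEquivSumPUnit U)) y = jj yGraph y := by
    rintro (⟨_ | u, s⟩ | i)
    · simp only [jj, att_yGraph]; rfl
    · rfl
    · rfl
  intro y
  rw [this, this]
  exact ins_jj C yGraph y

theorem act_one (a : LambdaSub) : act a yGraph.cls = a := by
  rw [act_cls a yGraph (), insAt_eq (n := 3) yPair () a.2,
    VF.at_of _ _ (U := Empty) ((Equiv.equivPUnit (Option Empty)).symm) rfl]
  change Ins (yPair.map (ext (onV (Equiv.equivPUnit (Option Empty)).symm))) (a : F 3) = (a : F 3)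
  generalize (a : F 3) = b
  suffices h : Ins (yPair.map (ext (onV (Equiv.equivPUnit (Option Empty)).symm))) = LinearMap.id
    from congrArg (fun f => f b) h
  apply F_induction
  intro H
  rw [Ins_cls, LinearMap.id_apply, ← rcls_graph, ← rcls_iso (Equiv.emptySum Empty H.V).symm H.p]
  congr 1
  set C := yPair.map (ext (onV (Equiv.equivPUnit (Option Empty)).symm)) with hC
  have hC1 : ∀ s, C (Sum.inl (none, s)) = Sum.inr s := fun s =>
    Pairing.map_apply yPair (ext (onV (Equiv.equivPUnit (Option Empty)).symm)) (Sum.inl ((), s))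
  have hC2 : ∀ s, C (Sum.inr s) = Sum.inl (none, s) := fun s =>
    Pairing.map_apply yPair (ext (onV (Equiv.equivPUnit (Option Empty)).symm)) (Sum.inr s)
  apply Pairing.eq_map
  rintro (x | i)
  · rcases h : H.p (Sum.inl x) with y | i
    · exact ins_kk C H h
    · have := ins_jj C H (Sum.inl (none, i))
      rw [hC1] at this
      simp only [jj, att_eq h] at this
      exact this
  · have := ins_jj C H (Sum.inr i)
    rw [hC2] at this
    rw [att_spec]
    exact this

theorem one_act (b : F 3) : act ⟨yGraph.cls, yGraph_mem⟩ b = b := by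
  suffices h : act ⟨yGraph.cls, yGraph_mem⟩ = LinearMap.id from congrArg (fun f => f b) h
  apply F_induction
  intro G
  rw [act_cls _ G (att G 0).1, LinearMap.id_apply]
  unfold insAt
  rw [Ins_y, rcls_iso, rcls_graph]

theorem add_act (a b : LambdaSub) (c : F 3) : act (a + b) c = act a c + act b c := by
  suffices h : act (a + b) = act a + act b from congrArg (fun f => f c) h
  apply F_induction
  intro G
  rw [LinearMap.add_apply, act_cls _ G (att G 0).1, act_cls _ G (att G 0).1,
    act_cls _ G (att G 0).1, Submodule.coe_add, map_add]

end algebra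

/-- Vogel's algebra `Λ`: the antisymmetric elements of `F(3)`. -/
abbrev Lam : Type 1 := LambdaSub

/-- The product of `Λ`: insertion of `a` at a trivalent vertex of `b`. -/
instance : CommRing Lam :=
  { (inferInstance : AddCommGroup Lam) with
    mul := fun a b => ⟨act a b, act_mem a b⟩
    one := ⟨yGraph.cls, yGraph_mem⟩
    mul_assoc := fun a b c => Subtype.ext (act_act a b c)
    one_mul := fun a => Subtype.ext (one_act a)
    mul_one := fun a => Subtype.ext (act_one a)
    mul_comm := fun a b => Subtype.ext (act_comm a b)
    left_distrib := fun a b c => Subtype.ext (map_add (act a) (b : F 3) c)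
    right_distrib := fun a b c => Subtype.ext (add_act a b c)
    zero_mul := fun a => Subtype.ext (by
      have h := add_act 0 0 (a : F 3)
      rw [add_zero] at h
      exact left_eq_add.1 h)
    mul_zero := fun a => Subtype.ext (map_zero (act a)) }

theorem mul_val (a b : Lam) : ((a * b : Lam) : F 3) = act a b := rfl

instance : Algebra ℚ Lam :=
  Algebra.ofModule
    (fun r a b => by
      rw [mul_comm (r • a) b, mul_comm a b]
      exact Subtype.ext (map_smul (act b) r (a : F 3)))
    (fun r a b => Subtype.ext (map_smul (act a) r (b : F 3)))

/-- The antisymmetrization of an element of `F(3)`, as an element of `Λ`. -/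
def toLam (a : F 3) : Lam := ⟨alt a, alt_mem a⟩

/-- The part of degree `d` of `Λ`: the elements that are combinations of graphs with `2 d + 1`
trivalent vertices. -/
def homog (d : ℕ) : Submodule ℚ Lam :=
  (Submodule.span ℚ {a : F 3 | ∃ G : Graph 3, Nat.card G.V = 2 * d + 1 ∧ a = G.cls}).comap
    LambdaSub.subtype

/-! ### The elements `t` and `x_n` -/

/-- The matching of the triangle: each vertex `i` has, in this cyclic order, the univalent vertex
`i` and the vertices `i + 1` and `i - 1` as neighbours. -/
def tPair : Pairing (Pt (Fin 3) 3) where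
  toFun x := match x with
    | Sum.inl (i, 0) => Sum.inr i
    | Sum.inl (i, 1) => Sum.inl (i + 1, 2)
    | Sum.inl (i, 2) => Sum.inl (i - 1, 1)
    | Sum.inr i => Sum.inl (i, 0)
  invol := by decide
  ne := by decide

theorem tPair_conn : Conn tPair := by
  have h0 : ∀ i s, EqvGen (Step tPair) (Sum.inl (i, s)) (Sum.inl (i + 1, s)) := by
    intro i s
    exact EqvGen.trans _ _ _ (reach_vert tPair i s 1)
      (EqvGen.trans _ _ _ (reach_edge tPair (Sum.inl (i, 1))) (reach_vert tPair (i + 1) 2 s))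
  have h1 : ∀ i s, EqvGen (Step tPair) (Sum.inl (i, s)) (Sum.inl (0, 0)) := by
    intro i s
    refine EqvGen.trans _ _ _ (reach_vert tPair i s 0) ?_
    fin_cases i
    · exact EqvGen.refl _
    · exact EqvGen.symm _ _ (h0 0 0)
    · exact EqvGen.symm _ _ (EqvGen.trans _ _ _ (h0 0 0) (h0 1 0))
  have key : ∀ x, EqvGen (Step tPair) x (Sum.inl (0, 0)) := by
    rintro (⟨i, s⟩ | s)
    · exact h1 _ _
    · exact EqvGen.trans _ _ _ (reach_edge tPair (Sum.inr s)) (h1 s 0)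
  exact ⟨⟨Sum.inr 0⟩, fun x y => EqvGen.trans _ _ _ (key x) (EqvGen.symm _ _ (key y))⟩

/-- The triangle with three univalent vertices. -/
def tGraph : Graph 3 := ⟨Fin 3, tPair, tPair_conn⟩

/-- The matching of the graph of `x_{m+1}`, as a map. The graph has a path of `m + 1` trivalent vertices from the
univalent vertex `0` to the univalent vertex `2`, and a cycle of `m + 2` trivalent vertices; the
`i`-th vertex of the path is joined to the `i`-th vertex of the cycle, and the last vertex of the
cycle is joined to the univalent vertex `1`. The orientations are those of the plane picture with
the path on top and the cycle below:
at a path vertex: left, cycle, right; at a cycle vertex: outward edge, previous, next. -/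
def xFun (m : ℕ) : Pt (Fin (m + 1) ⊕ Fin (m + 2)) 3 → Pt (Fin (m + 1) ⊕ Fin (m + 2)) 3
  | Sum.inl (Sum.inl i, 0) => if i = 0 then Sum.inr 0 else Sum.inl (Sum.inl (i - 1), 2)
  | Sum.inl (Sum.inl i, 1) => Sum.inl (Sum.inr i.castSucc, 0)
  | Sum.inl (Sum.inl i, 2) => if i = Fin.last m then Sum.inr 2 else Sum.inl (Sum.inl (i + 1), 0)
  | Sum.inl (Sum.inr c, 0) =>
    if h : c = Fin.last (m + 1) then Sum.inr 1 else Sum.inl (Sum.inl (c.castPred h), 1)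
  | Sum.inl (Sum.inr c, 1) => Sum.inl (Sum.inr (c - 1), 2)
  | Sum.inl (Sum.inr c, 2) => Sum.inl (Sum.inr (c + 1), 1)
  | Sum.inr 0 => Sum.inl (Sum.inl 0, 0)
  | Sum.inr 1 => Sum.inl (Sum.inr (Fin.last (m + 1)), 0)
  | Sum.inr 2 => Sum.inl (Sum.inl (Fin.last m), 2)

theorem xFun_invol (m : ℕ) (x : Pt (Fin (m + 1) ⊕ Fin (m + 2)) 3) : xFun m (xFun m x) = x := by
  have hz : ∀ i : Fin (m + 1), i ≠ 0 → i - 1 ≠ Fin.last m := by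
    intro i hi h
    apply hi
    have : i = Fin.last m + 1 := by rw [← h, sub_add_cancel]
    rw [this, Fin.last_add_one]
  have hl : ∀ i : Fin (m + 1), i ≠ Fin.last m → i + 1 ≠ 0 := by
    intro i hi h
    apply hi
    have h2 : i + 1 = Fin.last m + 1 := by rw [h, Fin.last_add_one]
    exact add_right_cancel h2
  rcases x with ⟨i | c, s⟩ | s
  · fin_cases s
    · by_cases h : i = 0
      · subst h; simp [xFun]
      · simp [xFun, h, hz i h]
    · simp [xFun, Fin.castSucc_ne_last]
    · by_cases h : i = Fin.last m
      · subst h; simp [xFun]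
      · simp [xFun, h, hl i h]
  · fin_cases s
    · by_cases h : c = Fin.last (m + 1)
      · subst h; simp [xFun]
      · simp [xFun, h]
    · simp [xFun]
    · simp [xFun]
  · fin_cases s <;> simp [xFun]

theorem xFun_ne (m : ℕ) (x : Pt (Fin (m + 1) ⊕ Fin (m + 2)) 3) : xFun m x ≠ x := by
  rcases x with ⟨i | c, s⟩ | s
  · fin_cases s
    · by_cases h : i = 0 <;> simp [xFun, h]
    · simp [xFun]
    · by_cases h : i = Fin.last m <;> simp [xFun, h]
  · fin_cases s
    · by_cases h : c = Fin.last (m + 1) <;> simp [xFun, h]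
    · simp [xFun]
    · simp [xFun]
  · fin_cases s <;> simp [xFun]

/-- The matching of the graph of `x_{m+1}`. -/
def xPair (m : ℕ) : Pairing (Pt (Fin (m + 1) ⊕ Fin (m + 2)) 3) :=
  ⟨xFun m, xFun_invol m, xFun_ne m⟩

theorem xPair_conn (m : ℕ) : Conn (xPair m) := by
  have hpx : ∀ x, xPair m x = xFun m x := fun _ => rfl
  have h0 : ∀ i : Fin (m + 1), ∀ s,
      EqvGen (Step (xPair m)) (Sum.inl (Sum.inl i, s)) (Sum.inl (Sum.inl 0, 0)) := by
    intro i
    induction i using Fin.induction with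
    | zero => intro s; exact reach_vert _ _ _ _
    | succ i ih =>
      intro s
      refine EqvGen.trans _ _ _ (reach_vert (xPair m) _ s 0) ?_
      refine EqvGen.trans _ _ _ (reach_edge (xPair m) _) ?_
      rw [hpx]
      have h1 : i.succ ≠ 0 := Fin.succ_ne_zero i
      have h2 : i.succ - 1 = i.castSucc := by
        rw [← Fin.coeSucc_eq_succ]; exact add_sub_cancel_right _ _
      simp only [xFun, if_neg h1, h2]
      exact ih _
  have h1 : ∀ c : Fin (m + 2), ∀ s,
      EqvGen (Step (xPair m)) (Sum.inl (Sum.inr c, s)) (Sum.inl (Sum.inl 0, 0)) := by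
    have h2 : ∀ c : Fin (m + 2), c ≠ Fin.last (m + 1) → ∀ s,
        EqvGen (Step (xPair m)) (Sum.inl (Sum.inr c, s)) (Sum.inl (Sum.inl 0, 0)) := by
      intro c hc s
      refine EqvGen.trans _ _ _ (reach_vert (xPair m) _ s 0) ?_
      refine EqvGen.trans _ _ _ (reach_edge (xPair m) _) ?_
      rw [hpx]
      simp only [xFun, dif_neg hc]
      exact h0 _ _
    intro c s
    by_cases hc : c = Fin.last (m + 1)
    · refine EqvGen.trans _ _ _ (reach_vert (xPair m) _ s 2) ?_
      refine EqvGen.trans _ _ _ (reach_edge (xPair m) _) ?_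
      rw [hpx]
      simp only [xFun, hc, Fin.last_add_one]
      exact h2 _ (by simp [Fin.ext_iff]) _
    · exact h2 c hc s
  have key : ∀ x, EqvGen (Step (xPair m)) x (Sum.inl (Sum.inl 0, 0)) := by
    rintro (⟨i | c, s⟩ | s)
    · exact h0 _ _
    · exact h1 _ _
    · refine EqvGen.trans _ _ _ (reach_edge (xPair m) _) ?_
      rw [hpx]
      fin_cases s
      · exact h0 _ _
      · exact h1 _ _
      · exact h0 _ _
  exact ⟨⟨Sum.inr 0⟩, fun x y => EqvGen.trans _ _ _ (key x) (EqvGen.symm _ _ (key y))⟩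

/-- The graph of `x_{m+1}`. -/
def xGraph (m : ℕ) : Graph 3 := ⟨Fin (m + 1) ⊕ Fin (m + 2), xPair m, xPair_conn m⟩

/-- The element `t` of `Λ`. -/
def tElt : Lam := toLam tGraph.cls

/-- The elements `x_n` of `Λ`, with `x_1 = 2 t`, `x_2 = t ^ 2`; there is no `x_0`, and the value
given here is never used. -/
def xElt : ℕ → Lam
  | 0 => 0
  | 1 => 2 * tElt
  | 2 => tElt ^ 2
  | n + 3 => toLam (xGraph (n + 2)).cls

/-! ### The polynomials -/

/-- The variables `t` and `x_n`. -/
inductive Gen : Type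
  | t : Gen
  | x (n : ℕ) : Gen

/-- Polynomials in the variables `t` and `x_n`. -/
abbrev Poly : Type := MvPolynomial Gen ℚ

/-- The variable `t`. -/
def T : Poly := MvPolynomial.X Gen.t

/-- The variable `x_n`. -/
def X (n : ℕ) : Poly := MvPolynomial.X (Gen.x n)

/-- The polynomials `P_{i,j}`. -/
def polyP (i j : ℕ) : Poly :=
  3 * X (i + 2) * X (j + 4) - 3 * T * X (i + 1) * X (j + 4) - 9 * T * X (i + 2) * X (j + 3)
    - 6 * T ^ 2 * X i * X (j + 4) + 9 * T ^ 2 * X (i + 1) * X (j + 3)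
    + 18 * T ^ 3 * X i * X (j + 3)
    - 2 * (X 3 + 2 * T ^ 3) * X (i + 1) * X (j + 2)
    + 4 * T * (X 3 - 4 * T ^ 3) * X i * X (j + 2)
    + 8 * T ^ 2 * (T ^ 3 - X 3) * X i * X (j + 1)
    + 3 * T ^ (i + 2) * X (j + 4)
    - 9 * T ^ (i + 3) * X (j + 3) + (7 * T ^ 3 - X 3) * T ^ (i + 1) * X (j + 2)
    + 3 * (X 3 - T ^ 3) * T ^ (i + 2) * X (j + 1) + 2 * (T ^ 3 - X 3) * T ^ (i + 3) * X j

/-- The polynomials `Q^k_{i,j}`, with the first index shifted by one: `polyQ k (i + 1) j` is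
`Q^k_{i,j}`, and `polyQ k 0 2` is `Q^k_{-1,2}` (`polyQ k 0 j` is not used for `j ≠ 2`). -/
def polyQ (k : ℕ) : ℕ → ℕ → Poly
  | 0, _ => T ^ k
  | 1, j => X (j + k)
  | i + 2, j => T * polyQ k (i + 1) (j + 1) - MvPolynomial.C (1 / 2) * polyQ k (i + 1) (j + 2)
      + MvPolynomial.C (1 / 2) * T ^ j * polyQ k (i + 1) 2
      + MvPolynomial.C (1 / 2) * (X (j + 2) - T ^ (j + 2)) * polyQ k i 2

/-- The degrees of the variables. -/
def wt : Gen → ℕ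
  | Gen.t => 1
  | Gen.x n => n

/-- The evaluation of polynomials at the elements `t`, `x_n` of `Λ`. -/
def ev : Poly →ₐ[ℚ] Lam :=
  MvPolynomial.aeval fun g => match g with
    | Gen.t => tElt
    | Gen.x n => xElt n

end Vogel

end

open Relation

noncomputable section

namespace Vogel

/-! ### Graphs with ports and gadgets -/

/-- The ends of a graph with set of trivalent vertices `U` and set of ports `S`. -/
abbrev Pts (U S : Type) : Type := (U × Fin 3) ⊕ S

/-- The disjoint union of two matchings. -/
def Pairing.sum {P Q : Type} (p : Pairing P) (q : Pairing Q) : Pairing (P ⊕ Q) where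
  toFun := Sum.map p q
  invol := by rintro (x | x) <;> simp [p.invol, q.invol]
  ne := by
    rintro (x | x) h
    · exact p.ne x (Sum.inl.inj h)
    · exact q.ne x (Sum.inr.inj h)

/-- Extension of a bijection of half-edges by the identity on the ports. -/
def xt {U U' S : Type} (θ : U × Fin 3 ≃ U' × Fin 3) : Pts U S ≃ Pts U' S :=
  Equiv.sumCongr θ (Equiv.refl _)

/-- A piece of a graph with outer ports `S` and inner ports `S'`: trivalent vertices `N`, and a
matching `D` of those ends `R` that are not connected to an outer port. -/
structure Gad (S S' : Type) where
  N : Type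
  [fin : Finite N]
  R : Type
  D : Pairing R
  E : S ⊕ R ≃ (N × Fin 3) ⊕ S'

attribute [instance] Gad.fin

/-- A graph with ports. -/
structure Cx (S : Type) : Type 1 where
  U : Type
  [fin : Finite U]
  p : Pairing (Pts U S)

attribute [instance] Cx.fin

namespace Gad
variable {S S' S'' U U' : Type}

/-- The ends of a gadget as ends of a graph that contains it. -/
def emb (U : Type) (g : Gad S S') : (g.N × Fin 3) ⊕ S' → Pts (U ⊕ g.N) S'
  | Sum.inl (n, s) => Sum.inl (Sum.inr n, s)
  | Sum.inr a => Sum.inr a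

/-- The bijection of ends used to attach a gadget. -/
def eqv (U : Type) (g : Gad S S') : Pts U S ⊕ g.R ≃ Pts (U ⊕ g.N) S' :=
  (Equiv.sumAssoc _ _ _).trans ((Equiv.sumCongr (Equiv.refl _) g.E).trans
    ((Equiv.sumAssoc _ _ _).symm.trans
      (Equiv.sumCongr (Equiv.sumProdDistrib U g.N (Fin 3)).symm (Equiv.refl _))))

/-- The ends of a graph as ends of the graph with a gadget attached. -/
def inj (U : Type) (g : Gad S S') : Pts U S → Pts (U ⊕ g.N) S'
  | Sum.inl (u, s) => Sum.inl (Sum.inl u, s)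
  | Sum.inr a => g.emb U (g.E (Sum.inl a))

/-- Attaching a gadget to the ports of a graph. -/
def app (g : Gad S S') (p : Pairing (Pts U S)) : Pairing (Pts (U ⊕ g.N) S') :=
  (p.sum g.D).map (g.eqv U)

/-- Attaching a gadget to the ports of a graph. -/
def apC (g : Gad S S') (c : Cx S) : Cx S' := ⟨c.U ⊕ g.N, g.app c.p⟩

theorem eqv_inl (g : Gad S S') (x : Pts U S) : g.eqv U (Sum.inl x) = g.inj U x := by
  rcases x with ⟨u, s⟩ | a
  · rfl
  · simp only [eqv, inj, Equiv.trans_apply, Equiv.sumAssoc_apply_inl_inr, Equiv.sumCongr_apply,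
      Sum.map_inr]
    rcases g.E (Sum.inl a) with ⟨n, s⟩ | b <;> rfl

theorem eqv_inr (g : Gad S S') (r : g.R) :
    g.eqv U (Sum.inr r) = g.emb U (g.E (Sum.inr r)) := by
  simp only [eqv, Equiv.trans_apply, Equiv.sumAssoc_apply_inr, Equiv.sumCongr_apply, Sum.map_inr]
  rcases g.E (Sum.inr r) with ⟨n, s⟩ | b <;> rfl

theorem app_inj (g : Gad S S') (p : Pairing (Pts U S)) (x : Pts U S) :
    g.app p (g.inj U x) = g.inj U (p x) := by
  rw [← eqv_inl, ← eqv_inl]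
  exact Pairing.map_apply _ _ _

theorem app_emb (g : Gad S S') (p : Pairing (Pts U S)) (r : g.R) :
    g.app p (g.emb U (g.E (Sum.inr r))) = g.emb U (g.E (Sum.inr (g.D r))) := by
  rw [← eqv_inr, ← eqv_inr]
  exact Pairing.map_apply _ _ _

theorem cases_app (g : Gad S S') (y : Pts (U ⊕ g.N) S') :
    (∃ x, y = g.inj U x) ∨ ∃ r, y = g.emb U (g.E (Sum.inr r)) := by
  obtain ⟨x | r, rfl⟩ := (g.eqv U).surjective y
  · exact Or.inl ⟨x, eqv_inl g x⟩
  · exact Or.inr ⟨r, eqv_inr g r⟩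

/-- The other end of the edge at an end of a gadget, or the outer port where it leads. -/
def nbr (g : Gad S S') (y : (g.N × Fin 3) ⊕ S') : S ⊕ ((g.N × Fin 3) ⊕ S') :=
  match g.E.symm y with
  | Sum.inl a => Sum.inl a
  | Sum.inr r => Sum.inr (g.E (Sum.inr (g.D r)))

theorem nbr_inl (g : Gad S S') (a : S) : g.nbr (g.E (Sum.inl a)) = Sum.inl a := by
  simp [nbr]

theorem nbr_inr (g : Gad S S') (r : g.R) :
    g.nbr (g.E (Sum.inr r)) = Sum.inr (g.E (Sum.inr (g.D r))) := by
  simp [nbr]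

theorem nbr_eq_inl {g : Gad S S'} {y} {a : S} (h : g.nbr y = Sum.inl a) :
    y = g.E (Sum.inl a) := by
  obtain ⟨x | r, rfl⟩ := g.E.surjective y
  · rw [nbr_inl] at h; rw [Sum.inl.inj h]
  · rw [nbr_inr] at h; cases h

theorem nbr_eq_inr {g : Gad S S'} {y z} (h : g.nbr y = Sum.inr z) :
    ∃ r, y = g.E (Sum.inr r) ∧ z = g.E (Sum.inr (g.D r)) := by
  obtain ⟨x | r, rfl⟩ := g.E.surjective y
  · rw [nbr_inl] at h; cases h
  · rw [nbr_inr] at h; exact ⟨r, rfl, (Sum.inr.inj h).symm⟩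

theorem app_of_nbr {g : Gad S S'} (p : Pairing (Pts U S)) {y z} (h : g.nbr y = Sum.inr z) :
    g.app p (g.emb U y) = g.emb U z := by
  obtain ⟨r, rfl, rfl⟩ := nbr_eq_inr h
  exact app_emb g p r

/-- A criterion for a matching to be the image of a graph with a gadget attached. -/
theorem eq_map_app {g : Gad S S'} {p : Pairing (Pts U S)} {Q : Type} {q : Pairing Q}
    (e : Pts (U ⊕ g.N) S' ≃ Q) (h1 : ∀ x, q (e (g.inj U x)) = e (g.inj U (p x)))
    (h2 : ∀ r, q (e (g.emb U (g.E (Sum.inr r)))) = e (g.emb U (g.E (Sum.inr (g.D r))))) :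
    q = (g.app p).map e := by
  apply Pairing.eq_map
  intro y
  rcases g.cases_app y with ⟨x, rfl⟩ | ⟨r, rfl⟩
  · rw [app_inj, h1]
  · rw [app_emb, h2]

/-- The twist by a bijection of vertices and permutations at the vertices. -/
abbrev tw {V V' : Type} (e : V ≃ V') (τ : V → Equiv.Perm (Fin 3)) : V × Fin 3 ≃ V' × Fin 3 :=
  Equiv.prodShear e τ

/-- Two gadgets that differ by a twist give graphs that differ by a twist. -/
theorem app_twist {g g' : Gad S S'} (e : g.N ≃ g'.N) (τ : g.N → Equiv.Perm (Fin 3))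
    (h : ∀ y, g'.nbr (Sum.map (tw e τ) id y) = Sum.map id (Sum.map (tw e τ) id) (g.nbr y))
    (p : Pairing (Pts U S)) :
    g'.app p = (g.app p).map
      (xt (tw (Equiv.sumCongr (Equiv.refl U) e) (Sum.elim (fun _ => 1) τ))) := by
  have hem : ∀ y, xt (tw (Equiv.sumCongr (Equiv.refl U) e) (Sum.elim (fun _ => 1) τ))
      (g.emb U y) = g'.emb U (Sum.map (tw e τ) id y) := by rintro (⟨n, s⟩ | a) <;> rfl
  have hin : ∀ x, xt (tw (Equiv.sumCongr (Equiv.refl U) e) (Sum.elim (fun _ => 1) τ))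
      (g.inj U x) = g'.inj U x := by
    rintro (⟨u, s⟩ | a)
    · rfl
    · have := h (g.E (Sum.inl a))
      rw [nbr_inl] at this
      rw [inj, hem, inj, nbr_eq_inl this]; rfl
  apply eq_map_app
  · intro x; rw [hin, hin, app_inj]
  · intro r
    have := h (g.E (Sum.inr r))
    rw [nbr_inr] at this
    rw [hem, hem]
    exact app_of_nbr p this

/-- Composition of gadgets. -/
abbrev comp (g : Gad S S') (h : Gad S' S'') : Gad S S'' where
  N := g.N ⊕ h.N
  R := g.R ⊕ h.R
  D := g.D.sum h.D
  E := (Equiv.sumAssoc _ _ _).symm.trans ((Equiv.sumCongr g.E (Equiv.refl _)).trans (h.eqv g.N))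

/-- Gadgets that act on one summand of the set of ports. -/
abbrev left (g : Gad S S') (K : Type) : Gad (S ⊕ K) (S' ⊕ K) where
  N := g.N
  R := g.R
  D := g.D
  E := (Equiv.sumAssoc _ _ _).trans ((Equiv.sumCongr (Equiv.refl _) (Equiv.sumComm _ _)).trans
    ((Equiv.sumAssoc _ _ _).symm.trans ((Equiv.sumCongr g.E (Equiv.refl _)).trans
      (Equiv.sumAssoc _ _ _))))

/-- Renaming of ports. -/
abbrev ren (σ : S ≃ S') : Gad S S' where
  N := Empty
  R := Empty
  D := ⟨id, fun _ => rfl, fun x => x.elim⟩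
  E := (Equiv.sumEmpty _ _).trans (σ.trans
    (@Equiv.emptySum (Empty × Fin 3) S' ⟨fun x => x.1.elim⟩).symm)

/-- Filling of some of the ports. -/
abbrev fill (g : Gad S Empty) (K : Type) : Gad (S ⊕ K) K where
  N := g.N
  R := g.R
  D := g.D
  E := (Equiv.sumAssoc _ _ _).trans ((Equiv.sumCongr (Equiv.refl _) (Equiv.sumComm _ _)).trans
    ((Equiv.sumAssoc _ _ _).symm.trans ((Equiv.sumCongr (g.E.trans (Equiv.sumEmpty _ _))
      (Equiv.refl _)))))

/-- Gadgets that act on one summand of the set of ports. -/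
abbrev right (g : Gad S S') (A : Type) : Gad (A ⊕ S) (A ⊕ S') where
  N := g.N
  R := g.R
  D := g.D
  E := (Equiv.sumAssoc _ _ _).trans ((Equiv.sumCongr (Equiv.refl _) g.E).trans
    ((Equiv.sumAssoc _ _ _).symm.trans ((Equiv.sumCongr (Equiv.sumComm _ _) (Equiv.refl _)).trans
      (Equiv.sumAssoc _ _ _))))

/-- Isomorphic gadgets, by comparison of the bijections of ends. -/
theorem nbr_of_E {g g' : Gad S S'} (e : g.N ≃ g'.N) (ρ : g.R ≃ g'.R)
    (hD : ∀ r, g'.D (ρ r) = ρ (g.D r))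
    (h1 : ∀ a, g'.E (Sum.inl a) = Sum.map (tw e fun _ => 1) id (g.E (Sum.inl a)))
    (h2 : ∀ r, g'.E (Sum.inr (ρ r)) = Sum.map (tw e fun _ => 1) id (g.E (Sum.inr r))) (y) :
    g'.nbr (Sum.map (tw e fun _ => 1) id y)
      = Sum.map id (Sum.map (tw e fun _ => 1) id) (g.nbr y) := by
  obtain ⟨a | r, rfl⟩ := g.E.surjective y
  · rw [← h1, nbr_inl, nbr_inl]; rfl
  · rw [← h2, nbr_inr, nbr_inr, hD, h2]; rfl

theorem comp_inl (g : Gad S S') (h : Gad S' S'') (a : S) :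
    (g.comp h).E (Sum.inl a) = h.inj g.N (g.E (Sum.inl a)) := eqv_inl h _

theorem comp_inr_inl (g : Gad S S') (h : Gad S' S'') (r : g.R) :
    (g.comp h).E (Sum.inr (Sum.inl r)) = h.inj g.N (g.E (Sum.inr r)) := eqv_inl h _

theorem comp_inr_inr (g : Gad S S') (h : Gad S' S'') (r : h.R) :
    (g.comp h).E (Sum.inr (Sum.inr r)) = h.emb g.N (h.E (Sum.inr r)) := eqv_inr h _

/-- Attaching two gadgets is attaching their composition. -/
theorem app_comp (g : Gad S S') (h : Gad S' S'') (p : Pairing (Pts U S)) :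
    (g.comp h).app p = (h.app (g.app p)).map (xt (onV (Equiv.sumAssoc U g.N h.N))) := by
  have hin : ∀ y, xt (onV (Equiv.sumAssoc U g.N h.N)) (h.inj _ (g.emb U y))
      = (g.comp h).emb U (h.inj g.N y) := by
    rintro (⟨n, s⟩ | a)
    · rfl
    · show xt _ (h.emb _ (h.E (Sum.inl a))) = (g.comp h).emb U (h.emb _ (h.E (Sum.inl a)))
      rcases h.E (Sum.inl a) with ⟨n, s⟩ | b <;> rfl
  have hii : ∀ y, xt (onV (Equiv.sumAssoc U g.N h.N)) (h.inj _ (g.inj U y))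
      = (g.comp h).inj U y := by
    rintro (⟨u, s⟩ | a)
    · rfl
    · show _ = (g.comp h).emb U ((g.comp h).E (Sum.inl a))
      rw [comp_inl, ← hin]; rfl
  have hem : ∀ y, xt (onV (Equiv.sumAssoc U g.N h.N)) (h.emb _ y)
      = (g.comp h).emb U (h.emb g.N y) := by rintro (⟨n, s⟩ | a) <;> rfl
  apply eq_map_app
  · intro x
    rcases g.cases_app x with ⟨x, rfl⟩ | ⟨r, rfl⟩
    · rw [app_inj, hii, hii, app_inj]
    · rw [app_emb, hin, hin, ← comp_inr_inl, ← comp_inr_inl, app_emb]; rfl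
  · intro r
    rw [hem, hem, ← comp_inr_inr, ← comp_inr_inr, app_emb]; rfl

theorem fill_inl (f : Gad S Empty) (K : Type) (a : S) :
    (f.fill K).E (Sum.inl (Sum.inl a)) = Sum.map id Empty.elim (f.E (Sum.inl a)) := by
  show Sum.inl (Equiv.sumEmpty _ _ (f.E (Sum.inl a))) = _
  rcases f.E (Sum.inl a) with x | x
  · rfl
  · exact x.elim

theorem fill_inr (f : Gad S Empty) (K : Type) (r : f.R) :
    (f.fill K).E (Sum.inr r) = Sum.map id Empty.elim (f.E (Sum.inr r)) := by
  show Sum.inl (Equiv.sumEmpty _ _ (f.E (Sum.inr r))) = _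
  rcases f.E (Sum.inr r) with x | x
  · rfl
  · exact x.elim

theorem left_inl (f : Gad S S') (K : Type) (a : S) :
    (f.left K).E (Sum.inl (Sum.inl a)) = Sum.map id Sum.inl (f.E (Sum.inl a)) := by
  show Equiv.sumAssoc _ _ _ (Sum.inl (f.E (Sum.inl a))) = _
  rcases f.E (Sum.inl a) with x | x <;> rfl

theorem left_inr (f : Gad S S') (K : Type) (r : f.R) :
    (f.left K).E (Sum.inr r) = Sum.map id Sum.inl (f.E (Sum.inr r)) := by
  show Equiv.sumAssoc _ _ _ (Sum.inl (f.E (Sum.inr r))) = _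
  rcases f.E (Sum.inr r) with x | x <;> rfl

theorem right_inl (g : Gad S S') (A : Type) (a : S) :
    (g.right A).E (Sum.inl (Sum.inr a)) = Sum.map id Sum.inr (g.E (Sum.inl a)) := by
  show (Equiv.sumAssoc _ _ _) (Equiv.sumCongr (Equiv.sumComm _ _) (Equiv.refl _)
    ((Equiv.sumAssoc _ _ _).symm (Sum.inr (g.E (Sum.inl a))))) = _
  rcases g.E (Sum.inl a) with x | x <;> rfl

theorem right_inr (g : Gad S S') (A : Type) (r : g.R) :
    (g.right A).E (Sum.inr r) = Sum.map id Sum.inr (g.E (Sum.inr r)) := by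
  show (Equiv.sumAssoc _ _ _) (Equiv.sumCongr (Equiv.sumComm _ _) (Equiv.refl _)
    ((Equiv.sumAssoc _ _ _).symm (Sum.inr (g.E (Sum.inr r))))) = _
  rcases g.E (Sum.inr r) with x | x <;> rfl

/-- Filling some ports and attaching a gadget to others are independent. -/
theorem nbr_fill_right {A : Type} (f : Gad A Empty) (g : Gad S S') (y) :
    ((g.right A).comp (f.fill S')).nbr
      (Sum.map (tw (Equiv.sumComm f.N g.N) fun _ => 1) id y)
      = Sum.map id (Sum.map (tw (Equiv.sumComm f.N g.N) fun _ => 1) id)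
        (((f.fill S).comp g).nbr y) := by
  refine nbr_of_E (g := (f.fill S).comp g) (g' := (g.right A).comp (f.fill S'))
    (Equiv.sumComm f.N g.N) (Equiv.sumComm f.R g.R) ?_ ?_ ?_ y
  · rintro (r | r) <;> rfl
  · rintro (a | a)
    · rw [comp_inl, comp_inl, fill_inl]
      show (f.fill S').emb _ ((f.fill S').E (Sum.inl (Sum.inl a))) = _
      rw [fill_inl]
      rcases f.E (Sum.inl a) with x | x
      · rfl
      · exact x.elim
    · rw [comp_inl, comp_inl, right_inl]
      show _ = Sum.map _ _ (g.emb _ (g.E (Sum.inl a)))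
      rcases g.E (Sum.inl a) with x | x <;> rfl
  · rintro (r | r)
    · refine (comp_inr_inr (g.right A) (f.fill S') r).trans ?_
      rw [comp_inr_inl, fill_inr, fill_inr]
      rcases f.E (Sum.inr r) with x | x
      · rfl
      · exact x.elim
    · refine (comp_inr_inl (g.right A) (f.fill S') r).trans ?_
      rw [comp_inr_inr, right_inr]
      rcases g.E (Sum.inr r) with x | x <;> rfl

end Gad

/-! ### Weights -/

instance : Module Lam (F 3) where
  smul a x := act a x
  one_smul x := one_act x
  mul_smul a b x := act_act a b x
  smul_zero a := map_zero (act a)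
  smul_add a x y := map_add (act a) x y
  add_smul a b x := add_act a b x
  zero_smul x := by
    have h := add_act 0 0 x
    rw [add_zero] at h
    exact left_eq_add.1 h

namespace Gad
variable {S S' U U' : Type}

/-- Bijections of half-edges of a graph, extended to the graph with a gadget attached. -/
def onL (N : Type) (θ : U × Fin 3 ≃ U' × Fin 3) : (U ⊕ N) × Fin 3 ≃ (U' ⊕ N) × Fin 3 :=
  (Equiv.sumProdDistrib U N (Fin 3)).trans
    ((Equiv.sumCongr θ (Equiv.refl _)).trans (Equiv.sumProdDistrib U' N (Fin 3)).symm)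

theorem onL_inl (N : Type) (θ : U × Fin 3 ≃ U' × Fin 3) (u : U) (s : Fin 3) :
    onL N θ (Sum.inl u, s) = (Sum.inl (θ (u, s)).1, (θ (u, s)).2) := rfl

theorem app_map (g : Gad S S') (p : Pairing (Pts U S)) (θ : U × Fin 3 ≃ U' × Fin 3) :
    g.app (p.map (xt θ)) = (g.app p).map (xt (onL g.N θ)) := by
  have hin : ∀ x, xt (onL g.N θ) (g.inj U x) = g.inj U' (xt θ x) := by
    rintro (⟨u, s⟩ | a)
    · rfl
    · show xt _ (g.emb U (g.E (Sum.inl a))) = g.emb U' (g.E (Sum.inl a))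
      rcases g.E (Sum.inl a) with ⟨n, s⟩ | b <;> rfl
  have hem : ∀ y, xt (onL g.N θ) (g.emb U y) = g.emb U' y := by rintro (⟨n, s⟩ | a) <;> rfl
  apply eq_map_app
  · intro x; rw [hin, hin, app_inj, Pairing.map_apply]
  · intro r; rw [hem, hem, app_emb]

theorem onL_onV (N : Type) (e : U ≃ U') :
    onL N (onV e) = onV (Equiv.sumCongr e (Equiv.refl N)) := by
  ext1 x; rcases x with ⟨u | n, s⟩ <;> rfl

theorem onL_sw (N : Type) (x y : U × Fin 3) :
    onL N (sw x y) = sw (Sum.inl x.1, x.2) (Sum.inl y.1, y.2) := by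
  ext1 z
  rcases z with ⟨u | n, s⟩
  · rw [onL_inl]
    exact (sw_map (fun a : U × Fin 3 => ((Sum.inl a.1, a.2) : (U ⊕ N) × Fin 3))
      (fun a b h => by simpa [Prod.ext_iff] using h) x y (u, s)).symm
  · rw [sw_ne (by simp) (by simp)]; rfl

theorem onL_mul (N : Type) (a b : Equiv.Perm (U × Fin 3)) :
    onL N (a * b) = onL N a * onL N b := by
  ext1 x; rcases x with ⟨u | n, s⟩ <;> rfl

theorem onL_cyc (N : Type) (u v : U) : onL N (cyc u v) = cyc (Sum.inl u) (Sum.inl v) := by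
  rw [cyc, onL_mul, onL_sw, onL_sw]; rfl

theorem onL_symm (N : Type) (θ : U × Fin 3 ≃ U' × Fin 3) :
    onL N θ.symm = (onL N θ).symm := rfl

/-- The graph with univalent vertices `S` given by a gadget. -/
def graph (f : Gad S Empty) : Pairing (Pts f.N S) :=
  ((show Pairing (S ⊕ S) from
    ⟨Sum.swap, Sum.swap_swap, by rintro (x | x) h <;> cases h⟩).sum f.D).map
  ((Equiv.sumAssoc _ _ _).trans ((Equiv.sumCongr (Equiv.refl _) f.E).trans
    ((Equiv.sumComm _ _).trans (Equiv.sumCongr (Equiv.sumEmpty _ _) (Equiv.refl _)))))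

theorem graph_port (f : Gad S Empty) (a : S) :
    f.graph (Sum.inr a) = Sum.map id Empty.elim (f.E (Sum.inl a)) := by
  refine (Pairing.map_apply _ _ (Sum.inl (Sum.inl a))).trans ?_
  show Sum.inl (Equiv.sumEmpty _ _ (f.E (Sum.inl a))) = _
  rcases f.E (Sum.inl a) with x | x
  · rfl
  · exact x.elim

theorem graph_inr (f : Gad S Empty) (r : f.R) :
    f.graph (Sum.map id Empty.elim (f.E (Sum.inr r)))
      = Sum.map id Empty.elim (f.E (Sum.inr (f.D r))) := by
  have h : ∀ y : (f.N × Fin 3) ⊕ Empty, (Sum.map id Empty.elim y : Pts f.N S)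
      = Sum.inl (Equiv.sumEmpty _ _ y) := by
    rintro (x | x)
    · rfl
    · exact x.elim
  rw [h, h]
  exact Pairing.map_apply _ _ (Sum.inr r)

/-- The element of `F(3)` given by a gadget. -/
def cls (f : Gad (Fin 3) Empty) : F 3 := rcls (n := 3) f.graph

/-- The gadget with a single trivalent vertex. -/
abbrev vert : Gad (Fin 3) Empty where
  N := Unit
  R := Empty
  D := ⟨id, fun _ => rfl, fun x => x.elim⟩
  E := (Equiv.sumEmpty _ _).trans ((Equiv.punitProd (Fin 3)).symm.trans (Equiv.sumEmpty _ _).symm)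

end Gad

section weights
variable {S S' S'' : Type} {M : Type 1} [AddCommGroup M] [Module Lam M]

/-- Functions of graphs with ports that satisfy (AS) and (IHX) and turn insertion of elements of
`Λ` into scalar multiplication. -/
structure IsWt (φ : Cx S → M) : Prop where
  iso : ∀ {U U' : Type} [Finite U] [Finite U'] (e : U ≃ U') (p : Pairing (Pts U S)),
    φ ⟨U', p.map (xt (onV e))⟩ = φ ⟨U, p⟩
  as : ∀ {U : Type} [Finite U] (p : Pairing (Pts U S)) (v : U) {s s' : Fin 3}, s ≠ s' →
    φ ⟨U, p.map (xt (sw (v, s) (v, s')))⟩ = - φ ⟨U, p⟩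
  ihx : ∀ {U : Type} [Finite U] (p : Pairing (Pts U S)) {u v : U}, u ≠ v →
    p (Sum.inl (u, 0)) = Sum.inl (v, 0) →
    φ ⟨U, p⟩ + φ ⟨U, p.map (xt (cyc u v))⟩ + φ ⟨U, p.map (xt (cyc u v).symm)⟩ = 0
  ins : ∀ (f : Gad (Fin 3) Empty), Conn (n := 3) f.graph → ∀ (h : f.cls ∈ LambdaSub)
    (c : Cx (Fin 3 ⊕ S)), φ ((f.fill S).apC c) = (⟨f.cls, h⟩ : Lam) • φ ((Gad.vert.fill S).apC c)

variable (S M) in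
/-- The weights on graphs with ports `S`. -/
def Wt : Submodule Lam (Cx S → M) where
  carrier := {φ | IsWt φ}
  add_mem' {a b} ha hb :=
    { iso := fun e p => by simp only [Pi.add_apply]; rw [ha.iso e p, hb.iso e p]
      as := fun p v s s' hs => by simp only [Pi.add_apply]; rw [ha.as p v hs, hb.as p v hs]; abel
      ihx := fun p u v huv hp => by
        have h1 := ha.ihx p huv hp
        have h2 := hb.ihx p huv hp
        simp only [Pi.add_apply]
        rw [← add_zero (0 : M)]
        nth_rewrite 1 [← h1]
        rw [← h2]
        abel
      ins := fun f hf h c => by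
        simp only [Pi.add_apply]; rw [ha.ins f hf h c, hb.ins f hf h c, smul_add] }
  zero_mem' :=
    { iso := fun e p => rfl
      as := fun p v s s' hs => neg_zero.symm
      ihx := fun p u v huv hp => by simp
      ins := fun f hf h c => (smul_zero _).symm }
  smul_mem' r a ha :=
    { iso := fun e p => by simp only [Pi.smul_apply]; rw [ha.iso e p]
      as := fun p v s s' hs => by simp only [Pi.smul_apply]; rw [ha.as p v hs, smul_neg]
      ihx := fun p u v huv hp => by
        simp only [Pi.smul_apply]; rw [← smul_add, ← smul_add, ha.ihx p huv hp, smul_zero]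
      ins := fun f hf h c => by
        simp only [Pi.smul_apply]; rw [ha.ins f hf h c, smul_comm] }

/-- The sign of a family of permutations. -/
def sgn {V : Type} [Fintype V] (τ : V → Equiv.Perm (Fin 3)) : ℤ :=
  ∏ v, (Equiv.Perm.sign (τ v) : ℤ)

theorem xt_mul {U : Type} (a b : Equiv.Perm (U × Fin 3)) :
    (xt (a * b) : Equiv.Perm (Pts U S)) = xt a * xt b := by
  ext1 x; rcases x with x | x <;> rfl

theorem IsWt.single {φ : Cx S → M} (hφ : IsWt φ) {U : Type} [Finite U] [DecidableEq U]
    (p : Pairing (Pts U S)) (v : U) (τ : Equiv.Perm (Fin 3)) :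
    φ ⟨U, p.map (xt (Gad.tw (Equiv.refl U) (Pi.mulSingle v τ)))⟩
      = (Equiv.Perm.sign τ : ℤ) • φ ⟨U, p⟩ := by
  induction τ using Equiv.Perm.swap_induction_on generalizing p with
  | one =>
    have : (xt (Gad.tw (Equiv.refl U) (Pi.mulSingle v (1 : Equiv.Perm (Fin 3)))) :
        Pts U S ≃ Pts U S) = Equiv.refl _ := by
      ext1 x; rcases x with ⟨u, s⟩ | a <;> simp [xt]
    rw [this, Pairing.map_refl]; simp
  | swap_mul f x y hxy ih =>
    have : (xt (Gad.tw (Equiv.refl U) (Pi.mulSingle v (Equiv.swap x y * f))) :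
        Equiv.Perm (Pts U S)) =
          xt (sw (v, x) (v, y)) * xt (Gad.tw (Equiv.refl U) (Pi.mulSingle v f)) := by
      rw [← xt_mul]
      congr 1
      ext1 z
      rcases z with ⟨u, s⟩
      rw [Equiv.Perm.mul_apply]
      by_cases h : u = v
      · subst h
        simp only [Equiv.prodShear_apply, Equiv.refl_apply, Pi.mulSingle_eq_same,
          Equiv.Perm.mul_apply]
        rw [← sw_eq]
        exact (sw_map (fun r : Fin 3 => (u, r)) (fun x y h => by simpa using h) x y (f s)).symm
      · simp only [Equiv.prodShear_apply, Equiv.refl_apply, Pi.mulSingle_eq_of_ne h]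
        rw [sw_ne (by simp [h]) (by simp [h])]
    rw [this, Pairing.map_mul, hφ.as _ _ hxy, ih, Equiv.Perm.sign_mul, Equiv.Perm.sign_swap hxy]
    simp

theorem IsWt.twist {φ : Cx S → M} (hφ : IsWt φ) {U : Type} [Fintype U]
    (p : Pairing (Pts U S)) (τ : U → Equiv.Perm (Fin 3)) :
    φ ⟨U, p.map (xt (Gad.tw (Equiv.refl U) τ))⟩ = sgn τ • φ ⟨U, p⟩ := by
  classical
  suffices h : ∀ s : Finset U, ∀ p : Pairing (Pts U S),
      φ ⟨U, p.map (xt (Gad.tw (Equiv.refl U) fun v => if v ∈ s then τ v else 1))⟩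
        = (∏ v ∈ s, (Equiv.Perm.sign (τ v) : ℤ)) • φ ⟨U, p⟩ by
    simpa [sgn] using h Finset.univ p
  intro s
  induction s using Finset.induction_on with
  | empty =>
    intro p
    have : (xt (Gad.tw (Equiv.refl U) fun v => if v ∈ (∅ : Finset U) then τ v else 1) :
        Pts U S ≃ Pts U S) = Equiv.refl _ := by
      ext1 x; rcases x with ⟨u, s⟩ | a <;> simp [xt]
    rw [this, Pairing.map_refl]; simp
  | insert a s ha ih =>
    intro p
    have : (xt (Gad.tw (Equiv.refl U) fun v => if v ∈ insert a s then τ v else 1) :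
        Equiv.Perm (Pts U S)) = xt (Gad.tw (Equiv.refl U) (Pi.mulSingle a (τ a))) *
          xt (Gad.tw (Equiv.refl U) fun v => if v ∈ s then τ v else 1) := by
      rw [← xt_mul]
      congr 1
      ext1 z
      rcases z with ⟨u, r⟩
      rw [Equiv.Perm.mul_apply]
      by_cases h : u = a
      · subst h; simp [ha]
      · simp [h]
    rw [this, Pairing.map_mul, hφ.single, ih, Finset.prod_insert ha, mul_smul]

theorem Cx.ext_map {c : Cx S} {U : Type} [Finite U] (φ : Cx S → M) (hφ : IsWt φ) (e : c.U ≃ U)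
    {q : Pairing (Pts U S)} (h : q = c.p.map (xt (onV e))) : φ ⟨U, q⟩ = φ c := by
  rw [h, hφ.iso e]

/-- Composition of a weight with the attachment of a gadget. -/
def pull (g : Gad S S') : Wt S' M →ₗ[Lam] Wt S M where
  toFun φ := ⟨fun c => φ.1 (g.apC c),
    { iso := fun e p => by
        show φ.1 ⟨_, g.app (p.map (xt (onV e)))⟩ = φ.1 ⟨_, g.app p⟩
        rw [Gad.app_map, Gad.onL_onV, φ.2.iso]
      as := fun p v s s' hs => by
        show φ.1 ⟨_, g.app (p.map _)⟩ = - φ.1 ⟨_, g.app p⟩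
        rw [Gad.app_map, Gad.onL_sw, φ.2.as _ _ hs]
      ihx := fun p u v huv hp => by
        show φ.1 ⟨_, g.app p⟩ + φ.1 ⟨_, g.app (p.map _)⟩ + φ.1 ⟨_, g.app (p.map _)⟩ = 0
        rw [Gad.app_map, Gad.app_map, Gad.onL_symm, Gad.onL_cyc]
        refine φ.2.ihx _ (fun h => huv (Sum.inl.inj h)) ?_
        exact (g.app_inj p (Sum.inl (u, 0))).trans (congrArg _ hp)
      ins := fun f hf h c => by
        have key : ∀ f : Gad (Fin 3) Empty, φ.1 (g.apC ((f.fill S).apC c))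
            = φ.1 ((f.fill S').apC ((g.right (Fin 3)).apC c)) := by
          intro f
          have h1 := (((f.fill S).app_comp g) c.p)
          have h2 := ((g.right (Fin 3)).app_comp (f.fill S')) c.p
          have h3 := Gad.app_twist (g := (f.fill S).comp g)
            (g' := (g.right (Fin 3)).comp (f.fill S')) _ _ (Gad.nbr_fill_right (A := Fin 3) f g) c.p
          have e1 : φ.1 (((f.fill S).comp g).apC c) = φ.1 (g.apC ((f.fill S).apC c)) :=
            Cx.ext_map _ φ.2 _ h1
          have e2 : φ.1 (((g.right (Fin 3)).comp (f.fill S')).apC c)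
            = φ.1 ((f.fill S').apC ((g.right (Fin 3)).apC c)) := Cx.ext_map _ φ.2 _ h2
          rw [← e1, ← e2]
          symm
          refine Cx.ext_map (c := ((f.fill S).comp g).apC c) _ φ.2
            (Equiv.sumCongr (Equiv.refl c.U) (Equiv.sumComm f.N g.N)) (h3.trans ?_)
          congr 2
          ext1 x
          rcases x with ⟨u | n, s⟩ <;> rfl
        show φ.1 (g.apC ((f.fill S).apC c)) = _ • φ.1 (g.apC ((Gad.vert.fill S).apC c))
        rw [key, key, φ.2.ins f hf h] }⟩
  map_add' _ _ := rfl
  map_smul' _ _ := rfl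

theorem pull_comp (g : Gad S S') (h : Gad S' S'') (φ : Wt S'' M) :
    pull (g.comp h) φ = pull g (pull h φ) := by
  apply Subtype.ext
  funext c
  exact Cx.ext_map (c := h.apC (g.apC c)) _ φ.2 _ (g.app_comp h c.p)

/-- Gadgets that agree up to a bijection of vertices and cyclic orders at the vertices. -/
def Gad.Tw (g g' : Gad S S') (e : g.N ≃ g'.N) (τ : g.N → Equiv.Perm (Fin 3)) : Prop :=
  ∀ y, g'.nbr (Sum.map (Gad.tw e τ) id y) = Sum.map id (Sum.map (Gad.tw e τ) id) (g.nbr y)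

theorem pull_tw {g g' : Gad S S'} [Fintype g.N] (e : g.N ≃ g'.N) (τ : g.N → Equiv.Perm (Fin 3))
    (h : g.Tw g' e τ) (φ : Wt S' M) : pull g' φ = sgn τ • pull g φ := by
  apply Subtype.ext
  funext c
  show φ.1 ⟨_, g'.app c.p⟩ = sgn τ • φ.1 (g.apC c)
  have : Fintype c.U := Fintype.ofFinite _
  have h1 : (xt (Gad.tw (Equiv.sumCongr (Equiv.refl c.U) e) (Sum.elim (fun _ => 1) τ)) :
      Pts (c.U ⊕ g.N) S' ≃ Pts (c.U ⊕ g'.N) S') =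
      (xt (Gad.tw (Equiv.refl _) (Sum.elim (fun _ => 1) τ))).trans
        (xt (onV (Equiv.sumCongr (Equiv.refl c.U) e))) := by
    ext1 x
    rcases x with ⟨u | n, s⟩ | a <;> rfl
  rw [Gad.app_twist e τ h, h1, ← Pairing.map_map, φ.2.iso, φ.2.twist]
  congr 1
  simp [sgn]

end weights

/-! ### Calculus of gadgets -/

section calculus
variable {S S' S'' T : Type} {M : Type 1} [AddCommGroup M] [Module Lam M]

namespace Gad

/-- A criterion for `Gad.Tw` in terms of the bijections of ends. -/
def TwE (g g' : Gad S S') (e : g.N ≃ g'.N) (τ : g.N → Equiv.Perm (Fin 3)) : Prop :=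
  (∀ a, g'.E (Sum.inl a) = Sum.map (tw e τ) id (g.E (Sum.inl a))) ∧
  ∀ r, ∃ r', g'.E (Sum.inr r') = Sum.map (tw e τ) id (g.E (Sum.inr r)) ∧
    g'.E (Sum.inr (g'.D r')) = Sum.map (tw e τ) id (g.E (Sum.inr (g.D r)))

theorem TwE.tw {g g' : Gad S S'} {e : g.N ≃ g'.N} {τ : g.N → Equiv.Perm (Fin 3)}
    (h : g.TwE g' e τ) : g.Tw g' e τ := by
  intro y
  obtain ⟨a | r, rfl⟩ := g.E.surjective y
  · rw [← h.1, nbr_inl, nbr_inl]; rfl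
  · obtain ⟨r', h1, h2⟩ := h.2 r
    rw [← h1, nbr_inr, nbr_inr, h2]; rfl

theorem TwE.left {g g' : Gad S S'} {e : g.N ≃ g'.N} {τ : g.N → Equiv.Perm (Fin 3)}
    (h : g.TwE g' e τ) (K : Type) : (g.left K).TwE (g'.left K) e τ := by
  have key : ∀ y : (g.N × Fin 3) ⊕ S', Sum.map id Sum.inl (Sum.map (Gad.tw e τ) id y) =
      (Sum.map (Gad.tw e τ) id (Sum.map id Sum.inl y) : (g'.N × Fin 3) ⊕ (S' ⊕ K)) := by
    rintro (y | y) <;> rfl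
  refine ⟨?_, fun r => ?_⟩
  · rintro (a | a)
    · rw [left_inl, left_inl, h.1, key]
    · rfl
  · obtain ⟨r', h1, h2⟩ := h.2 r
    exact ⟨r', by rw [left_inr, left_inr, h1, key], by rw [left_inr, left_inr, h2, key]⟩

theorem TwE.fill {g g' : Gad S Empty} {e : g.N ≃ g'.N} {τ : g.N → Equiv.Perm (Fin 3)}
    (h : g.TwE g' e τ) (K : Type) : (g.fill K).TwE (g'.fill K) e τ := by
  have key : ∀ y : (g.N × Fin 3) ⊕ Empty, Sum.map id Empty.elim (Sum.map (Gad.tw e τ) id y) =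
      (Sum.map (Gad.tw e τ) id (Sum.map id Empty.elim y) : (g'.N × Fin 3) ⊕ K) := by
    rintro (y | y)
    · rfl
    · exact y.elim
  refine ⟨?_, fun r => ?_⟩
  · rintro (a | a)
    · rw [fill_inl, fill_inl, h.1, key]
    · rfl
  · obtain ⟨r', h1, h2⟩ := h.2 r
    exact ⟨r', by rw [fill_inr, fill_inr, h1, key], by rw [fill_inr, fill_inr, h2, key]⟩

/-- The gadget with vertices `Fin n`, outer ports attached by `o`, and edges `d`. -/
abbrev of (n : ℕ) {k : ℕ} (o : S → (Fin n × Fin 3) ⊕ S')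
    (d : Fin k → ((Fin n × Fin 3) ⊕ S') × ((Fin n × Fin 3) ⊕ S'))
    (h : Function.Bijective (Sum.elim o fun r : Fin k × Bool => cond r.2 (d r.1).1 (d r.1).2)) :
    Gad S S' where
  N := Fin n
  R := Fin k × Bool
  D := ⟨fun r => (r.1, !r.2), by simp, by rintro ⟨r, b⟩ h; cases b <;> simp at h⟩
  E := Equiv.ofBijective _ h

theorem twE_comp_left (g : Gad S S') (h : Gad S' S'') (K : Type) :
    ((g.comp h).left K).TwE ((g.left K).comp (h.left K)) (Equiv.refl _) fun _ => 1 := by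
  have key : ∀ y : (g.N × Fin 3) ⊕ S', (h.left K).inj g.N (Sum.map id Sum.inl y) =
      Sum.map (Gad.tw (Equiv.refl _) fun _ => 1) id (Sum.map id Sum.inl (h.inj g.N y)) := by
    rintro (⟨n, s⟩ | a)
    · rfl
    · show (h.left K).emb g.N ((h.left K).E _) = Sum.map _ _ (Sum.map _ _ (h.emb g.N (h.E _)))
      rw [left_inl]
      rcases h.E (Sum.inl a) with x | x <;> rfl
  refine ⟨?_, ?_⟩
  · rintro (a | a)
    · rw [comp_inl, left_inl, key, left_inl, comp_inl]
    · rfl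
  · rintro (r | r)
    · refine ⟨Sum.inl r, ?_, ?_⟩
      · rw [comp_inr_inl, left_inr, key, left_inr, comp_inr_inl]
      · refine (comp_inr_inl (g.left K) (h.left K) (g.D r)).trans ?_
        rw [left_inr, key, left_inr]
        exact congrArg _ (congrArg _ (comp_inr_inl g h _).symm)
    · have key2 : ∀ y : (h.N × Fin 3) ⊕ S'', (h.left K).emb g.N (Sum.map id Sum.inl y) =
          Sum.map (Gad.tw (Equiv.refl _) fun _ => 1) id (Sum.map id Sum.inl (h.emb g.N y)) := by
        rintro (⟨n, s⟩ | a) <;> rfl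
      refine ⟨Sum.inr r, ?_, ?_⟩
      · rw [comp_inr_inr, left_inr, key2, left_inr, comp_inr_inr]
      · refine (comp_inr_inr (g.left K) (h.left K) (h.D r)).trans ?_
        rw [left_inr, key2, left_inr]
        exact congrArg _ (congrArg _ (comp_inr_inr g h _).symm)

theorem twE_comp_fill (g : Gad S S') (h : Gad S' Empty) (K : Type) :
    ((g.comp h).fill K).TwE ((g.left K).comp (h.fill K)) (Equiv.refl _) fun _ => 1 := by
  have key : ∀ y : (g.N × Fin 3) ⊕ S', (h.fill K).inj g.N (Sum.map id Sum.inl y) =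
      Sum.map (Gad.tw (Equiv.refl _) fun _ => 1) id (Sum.map id Empty.elim (h.inj g.N y)) := by
    rintro (⟨n, s⟩ | a)
    · rfl
    · show (h.fill K).emb g.N ((h.fill K).E (Sum.inl (Sum.inl a)))
        = Sum.map _ _ (Sum.map id Empty.elim (h.emb g.N (h.E (Sum.inl a))))
      rw [fill_inl]
      rcases h.E (Sum.inl a) with x | x
      · rfl
      · exact x.elim
  have key2 : ∀ y : (h.N × Fin 3) ⊕ Empty, (h.fill K).emb g.N (Sum.map id Empty.elim y) =
      Sum.map (Gad.tw (Equiv.refl _) fun _ => 1) id (Sum.map id Empty.elim (h.emb g.N y)) := by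
    rintro (⟨n, s⟩ | a)
    · rfl
    · exact a.elim
  refine ⟨?_, ?_⟩
  · rintro (a | a)
    · rw [comp_inl, left_inl, key, fill_inl, comp_inl]
    · rfl
  · rintro (r | r)
    · refine ⟨Sum.inl r, ?_, ?_⟩
      · rw [comp_inr_inl, left_inr, key, fill_inr, comp_inr_inl]
      · refine (comp_inr_inl (g.left K) (h.fill K) (g.D r)).trans ?_
        rw [left_inr, key, fill_inr]
        exact congrArg _ (congrArg _ (comp_inr_inl g h _).symm)
    · refine ⟨Sum.inr r, ?_, ?_⟩
      · rw [comp_inr_inr, fill_inr, key2, fill_inr, comp_inr_inr]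
      · refine (comp_inr_inr (g.left K) (h.fill K) (h.D r)).trans ?_
        rw [fill_inr, key2, fill_inr]
        exact congrArg _ (congrArg _ (comp_inr_inr g h _).symm)

end Gad

theorem sgn_one {V : Type} [Fintype V] : sgn (fun _ : V => 1) = 1 := by simp [sgn]

theorem pull_twE {g g' : Gad S S'} [Fintype g.N] (e : g.N ≃ g'.N) (τ : g.N → Equiv.Perm (Fin 3))
    (h : g.TwE g' e τ) (φ : Wt S' M) : pull g' φ = sgn τ • pull g φ := pull_tw e τ h.tw φ

theorem pull_iso {g g' : Gad S S'} (e : g.N ≃ g'.N)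
    (h : g.TwE g' e fun _ => 1) (φ : Wt S' M) : pull g' φ = pull g φ := by
  have : Fintype g.N := Fintype.ofFinite _
  rw [pull_tw e _ h.tw φ, sgn_one, one_smul]

theorem pull_comp_left (g : Gad S S') (h : Gad S' S'') (φ : Wt (S'' ⊕ T) M) :
    pull ((g.comp h).left T) φ = pull (g.left T) (pull (h.left T) φ) := by
  rw [← pull_comp]; exact (pull_iso _ (Gad.twE_comp_left g h T) φ).symm

theorem pull_comp_fill (g : Gad S S') (h : Gad S' Empty) (φ : Wt T M) :
    pull ((g.comp h).fill T) φ = pull (g.left T) (pull (h.fill T) φ) := by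
  rw [← pull_comp]; exact (pull_iso _ (Gad.twE_comp_fill g h T) φ).symm

theorem pull_fill_right {A : Type} (f : Gad A Empty) (g : Gad S S') (φ : Wt S' M) :
    pull (g.right A) (pull (f.fill S') φ) = pull (f.fill S) (pull g φ) := by
  have : Fintype ((f.fill S).comp g).N := Fintype.ofFinite _
  rw [← pull_comp, ← pull_comp, pull_tw (g := (f.fill S).comp g) _ _
    (Gad.nbr_fill_right f g) φ, sgn_one, one_smul]

theorem pull_left_tw {g g' : Gad S S'} [Fintype g.N] (e : g.N ≃ g'.N)
    (τ : g.N → Equiv.Perm (Fin 3)) (h : g.TwE g' e τ) (φ : Wt (S' ⊕ T) M) :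
    pull (g'.left T) φ = sgn τ • pull (g.left T) φ :=
  pull_twE (g := g.left T) (g' := g'.left T) e τ (h.left T) φ

theorem pull_fill_tw {g g' : Gad S Empty} [Fintype g.N] (e : g.N ≃ g'.N)
    (τ : g.N → Equiv.Perm (Fin 3)) (h : g.TwE g' e τ) (φ : Wt T M) :
    pull (g'.fill T) φ = sgn τ • pull (g.fill T) φ :=
  pull_twE (g := g.fill T) (g' := g'.fill T) e τ (h.fill T) φ

theorem pull_ren_refl (φ : Wt S M) : pull (Gad.ren (Equiv.refl S)) φ = φ := by
  apply Subtype.ext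
  funext c
  refine Cx.ext_map (c := c) _ φ.2 (Equiv.sumEmpty c.U Empty).symm ?_
  have h : ∀ x, xt (onV (Equiv.sumEmpty c.U Empty).symm) x
      = (Gad.ren (Equiv.refl S)).inj c.U x := by rintro (x | x) <;> rfl
  apply Pairing.eq_map
  intro x
  rw [h, h, Gad.app_inj]

theorem pull_ren_left (σ : S ≃ S') (φ : Wt (S' ⊕ T) M) :
    pull ((Gad.ren σ).left T) φ = pull (Gad.ren (Equiv.sumCongr σ (Equiv.refl T))) φ := by
  refine pull_iso (g := Gad.ren (Equiv.sumCongr σ (Equiv.refl T))) (g' := (Gad.ren σ).left T)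
    (Equiv.refl _) ⟨?_, fun r => r.elim⟩ φ
  rintro (a | a) <;> rfl

/-- The tree with pairs of ports `0, 1` and `2, 3`. -/
abbrev treeA : Gad (Fin 4) Empty := .of 2 ![.inl (0, 1), .inl (0, 2), .inl (1, 1), .inl (1, 2)]
  ![(.inl (0, 0), .inl (1, 0))] (by decide)
/-- The tree with pairs of ports `2, 0` and `1, 3`. -/
abbrev treeB : Gad (Fin 4) Empty := .of 2 ![.inl (0, 2), .inl (1, 1), .inl (0, 1), .inl (1, 2)]
  ![(.inl (0, 0), .inl (1, 0))] (by decide)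
/-- The tree with pairs of ports `1, 2` and `0, 3`. -/
abbrev treeC : Gad (Fin 4) Empty := .of 2 ![.inl (1, 1), .inl (0, 1), .inl (0, 2), .inl (1, 2)]
  ![(.inl (0, 0), .inl (1, 0))] (by decide)

theorem pull_tree (φ : Wt T M) : pull (treeA.fill T) φ + pull (treeB.fill T) φ
    + pull (treeC.fill T) φ = 0 := by
  apply Subtype.ext
  funext c
  have hc : ∀ i, cyc (Sum.inr 0 : c.U ⊕ Fin 2) (Sum.inr 1) (Sum.inr i, 0) = (Sum.inr i, 0) :=
    fun i => cyc_ne (by simp) (by simp) (by simp)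
  have hcl : ∀ u s, cyc (Sum.inr 0 : c.U ⊕ Fin 2) (Sum.inr 1) (Sum.inl u, s) = (Sum.inl u, s) :=
    fun i s => cyc_ne (by simp) (by simp) (by simp)
  have hc2 : cyc (Sum.inr 0 : c.U ⊕ Fin 2) (Sum.inr 1) (Sum.inr 1, 2) = (Sum.inr 1, 2) :=
    cyc_ne (by simp) (by simp) (by simp)
  have hc3 := cyc_3 (show (Sum.inr 0 : c.U ⊕ Fin 2) ≠ Sum.inr 1 by simp)
  have h1 : (treeB.fill T).app c.p = ((treeA.fill T).app c.p).map
      (xt (cyc (Sum.inr (0 : Fin 2)) (Sum.inr 1))) := by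
    have hi : ∀ x, xt (cyc (Sum.inr (0 : Fin 2)) (Sum.inr 1)) ((treeA.fill T).inj c.U x)
        = (treeB.fill T).inj c.U x := by
      rintro (⟨u, s⟩ | a | a)
      · exact congrArg Sum.inl (hcl u s)
      · fin_cases a
        · exact congrArg Sum.inl cyc_1
        · exact congrArg Sum.inl cyc_2
        · exact congrArg Sum.inl hc3
        · exact congrArg Sum.inl hc2
      · rfl
    have hr : ∀ r, xt (cyc (Sum.inr (0 : Fin 2)) (Sum.inr 1))
        ((treeA.fill T).emb c.U ((treeA.fill T).E (Sum.inr r)))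
        = (treeB.fill T).emb c.U ((treeB.fill T).E (Sum.inr r)) := by
      rintro ⟨i, b⟩
      fin_cases i
      cases b <;> exact congrArg Sum.inl (hc _)
    exact Gad.eq_map_app _ (fun x => by rw [hi, hi, Gad.app_inj])
      (fun r => by rw [hr, hr, Gad.app_emb])
  have h2 : (treeA.fill T).app c.p = ((treeC.fill T).app c.p).map
      (xt (cyc (Sum.inr (0 : Fin 2)) (Sum.inr 1))) := by
    have hi : ∀ x, xt (cyc (Sum.inr (0 : Fin 2)) (Sum.inr 1)) ((treeC.fill T).inj c.U x)
        = (treeA.fill T).inj c.U x := by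
      rintro (⟨u, s⟩ | a | a)
      · exact congrArg Sum.inl (hcl u s)
      · fin_cases a
        · exact congrArg Sum.inl hc3
        · exact congrArg Sum.inl cyc_1
        · exact congrArg Sum.inl cyc_2
        · exact congrArg Sum.inl hc2
      · rfl
    have hr : ∀ r, xt (cyc (Sum.inr (0 : Fin 2)) (Sum.inr 1))
        ((treeC.fill T).emb c.U ((treeC.fill T).E (Sum.inr r)))
        = (treeA.fill T).emb c.U ((treeA.fill T).E (Sum.inr r)) := by
      rintro ⟨i, b⟩
      fin_cases i
      cases b <;> exact congrArg Sum.inl (hc _)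
    exact Gad.eq_map_app _ (fun x => by rw [hi, hi, Gad.app_inj])
      (fun r => by rw [hr, hr, Gad.app_emb])
  have h3 : (treeC.fill T).app c.p = ((treeA.fill T).app c.p).map
      (xt (cyc (Sum.inr (0 : Fin 2)) (Sum.inr 1)).symm) := by
    rw [h2, Pairing.map_map]
    have : ∀ θ : Equiv.Perm ((c.U ⊕ Fin 2) × Fin 3),
        (xt θ : Equiv.Perm (Pts _ T)).trans (xt θ.symm) = Equiv.refl _ := by
      intro θ; ext1 x; rcases x with x | x <;> simp [xt]
    rw [this, Pairing.map_refl]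
  show φ.1 ⟨_, (treeA.fill T).app c.p⟩ + φ.1 ⟨_, (treeB.fill T).app c.p⟩
    + φ.1 ⟨_, (treeC.fill T).app c.p⟩ = 0
  rw [h1, h3]
  exact φ.2.ihx _ (by simp) ((treeA.fill T).app_emb c.p (0, true))

end calculus

/-! ### The basic weights -/

section base
variable {S U U' : Type} {n : ℕ}

namespace Gad

/-- Ports `0, 1, 2` as the half-edges of an additional vertex. -/
def joinE : Pts U (Fin 3 ⊕ S) ≃ Pts (Option U) S where
  toFun
    | Sum.inl (u, s) => Sum.inl (some u, s)
    | Sum.inr (Sum.inl i) => Sum.inl (none, i)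
    | Sum.inr (Sum.inr a) => Sum.inr a
  invFun
    | Sum.inl (some u, s) => Sum.inl (u, s)
    | Sum.inl (none, i) => Sum.inr (Sum.inl i)
    | Sum.inr a => Sum.inr (Sum.inr a)
  left_inv := by rintro (⟨u, s⟩ | i | a) <;> rfl
  right_inv := by rintro (⟨_ | u, s⟩ | a) <;> rfl

theorem att_graph (f : Gad (Fin 3) Empty) (hf : Conn (n := 3) f.graph) (i : Fin 3) :
    Sum.inl (Vogel.att ⟨f.N, f.graph, hf⟩ i)
      = (Sum.map id Empty.elim (f.E (Sum.inl i)) : Pts f.N (Fin 3)) := by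
  rw [← graph_port]; exact (att_spec ⟨f.N, f.graph, hf⟩ i).symm

/-- Filling three ports with a gadget is insertion of its graph. -/
theorem app_fill (f : Gad (Fin 3) Empty) (hf : Conn (n := 3) f.graph)
    (p : Pairing (Pts U (Fin 3 ⊕ Fin n))) :
    (f.fill (Fin n)).app p = ins (p.map joinE) ⟨f.N, f.graph, hf⟩ := by
  have hin : ∀ x, (f.fill (Fin n)).inj U x
      = jj (⟨f.N, f.graph, hf⟩ : Graph 3) (joinE x : Pt (Option U) n) := by
    rintro (⟨u, s⟩ | i | a)
    · rfl
    · have := att_graph f hf i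
      show (f.fill (Fin n)).emb U ((f.fill (Fin n)).E (Sum.inl (Sum.inl i)))
        = kk (U := U) (n := n) (W := f.N) (Vogel.att (⟨f.N, f.graph, hf⟩ : Graph 3) i)
      rw [fill_inl]
      generalize f.E (Sum.inl i) = z at this
      rcases z with ⟨m, s⟩ | z
      · rw [Sum.inl.inj this]; rfl
      · exact z.elim
    · rfl
  have hem : ∀ r, ins (p.map joinE) ⟨f.N, f.graph, hf⟩
      ((f.fill (Fin n)).emb U ((f.fill (Fin n)).E (Sum.inr r)))
        = (f.fill (Fin n)).emb U ((f.fill (Fin n)).E (Sum.inr (f.D r))) := by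
    intro r
    have h1 := graph_inr f r
    rw [fill_inr, fill_inr]
    rcases hz : f.E (Sum.inr r) with ⟨m, s⟩ | z
    · rcases hz' : f.E (Sum.inr (f.D r)) with ⟨m', s'⟩ | z'
      · rw [hz, hz'] at h1
        have h2 : f.graph (Sum.inl (m, s)) = Sum.inl (m', s') := h1
        have h3 := ins_kk (U := U) (n := n) (p.map joinE) ⟨f.N, f.graph, hf⟩ h2
        exact h3
      · exact z'.elim
    · exact z.elim
  apply Pairing.ext_coe
  intro y
  rcases (f.fill (Fin n)).cases_app y with ⟨x, rfl⟩ | ⟨r, rfl⟩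
  · rw [app_inj, hin, hin, ins_jj, Pairing.map_apply]
  · rw [app_emb]; exact (hem r).symm

theorem graph_eq {f : Gad S Empty} {q : Pairing (Pts f.N S)}
    (h1 : ∀ a, q (Sum.inr a) = Sum.map id Empty.elim (f.E (Sum.inl a)))
    (h2 : ∀ r, q (Sum.map id Empty.elim (f.E (Sum.inr r)))
      = Sum.map id Empty.elim (f.E (Sum.inr (f.D r)))) : f.graph = q := by
  have key : ∀ x, f.graph (Sum.inr x) = q (Sum.inr x) := fun x => by rw [graph_port, h1]
  apply Pairing.ext_coe
  rintro (x | x)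
  · have hx : (Sum.inl x : Pts f.N S) = Sum.map id Empty.elim (Sum.inl x : (f.N × Fin 3) ⊕ Empty) :=
      rfl
    rw [hx]
    obtain ⟨a | r, hy⟩ := f.E.surjective (Sum.inl x)
    · rw [← hy, ← graph_port, f.graph.invol, key, q.invol]
    · rw [← hy, graph_inr, h2]
  · exact key x

theorem graph_vert : vert.graph = yPair := graph_eq (fun _ => rfl) fun r => r.elim

theorem cls_vert : vert.cls = yGraph.cls := by
  rw [cls, graph_vert, ← rcls_graph]

theorem conn_vert : Conn (n := 3) vert.graph := by rw [graph_vert]; exact yPair_conn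

theorem rcls_fill [Finite U] (f : Gad (Fin 3) Empty) (hf : Conn (n := 3) f.graph)
    (p : Pairing (Pts U (Fin 3 ⊕ Fin n))) :
    rcls (n := n) ((f.fill (Fin n)).app p) = Ins (p.map joinE) f.cls := by
  rw [app_fill f hf, cls, rcls_of hf, Ins_cls]

end Gad

/-- Insertion of an element of `Λ` in `F(3)` is multiplication. -/
theorem Ins_eq_act [Finite U] (C : Pairing (Pt (Option U) 3)) (a : Lam) :
    Ins C a.1 = act a (rcls C) := by
  by_cases h : Conn C
  · rw [act_rcls a h none, insAt_eq _ _ a.2, VF.at_of _ _ (Equiv.refl _) rfl]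
    change _ = Ins (C.map (ext (onV (Equiv.refl _)))) a.1
    have : (ext (onV (Equiv.refl (Option U))) : Pt (Option U) 3 ≃ _) = Equiv.refl _ := by
      ext1 x; rcases x with x | x <;> rfl
    rw [this, Pairing.map_refl]
  · rw [Ins_not h, rcls_not h, map_zero]; rfl

/-- The weight on graphs with three univalent vertices with values in `F(3)`. -/
def openWt : Wt (Fin 3) (F 3) := ⟨fun c => rcls (n := 3) c.p,
  { iso := fun e p => rcls_iso e p
    as := fun p v _ _ hs => rcls_as p v hs
    ihx := fun p _ _ huv hp => rcls_ihx p huv hp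
    ins := fun f hf h c => by
      show rcls (n := 3) ((f.fill (Fin 3)).app c.p) = act ⟨f.cls, h⟩
        (rcls (n := 3) ((Gad.vert.fill (Fin 3)).app c.p))
      rw [Gad.rcls_fill f hf, Gad.rcls_fill _ Gad.conn_vert, Gad.cls_vert, Ins_y]
      exact Ins_eq_act _ ⟨f.cls, h⟩ }⟩

theorem alt_act (a : Lam) (b : F 3) : alt (act a b) = act a (alt b) := by
  rw [alt_apply, alt_apply, map_smul, map_sum]
  simp only [map_smul, legs_act]

/-- The half-edges of the vertex `some none` as univalent vertices. -/
def cutE : Pt (Option (Option U)) 0 ≃ Pt (Option U) 3 where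
  toFun
    | Sum.inl (some none, s) => Sum.inr s
    | Sum.inl (some (some u), s) => Sum.inl (some u, s)
    | Sum.inl (none, s) => Sum.inl (none, s)
    | Sum.inr i => i.elim0
  invFun
    | Sum.inl (some u, s) => Sum.inl (some (some u), s)
    | Sum.inl (none, s) => Sum.inl (none, s)
    | Sum.inr s => Sum.inl (some none, s)
  left_inv := by
    rintro (⟨_ | _ | u, s⟩ | i)
    · rfl
    · rfl
    · rfl
    · exact i.elim0
  right_inv := by rintro (⟨_ | u, s⟩ | s) <;> rfl

theorem remVF_ins [Finite U] (C : Pairing (Pt (Option U) 0)) (u : U) (H : Graph 3)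
    (h : H.cls ∈ LambdaSub) :
    remVF.at (ins C H) (Sum.inl u) = act ⟨H.cls, h⟩ (remVF.at C (some u)) := by
  classical
  let ε : U ≃ Option {v // v ≠ u} := opt u
  have hε : ε u = none := opt_self u
  let C' : Pairing (Pt (Option (Option {v // v ≠ u})) 0) :=
    C.map (ext (onV (Equiv.optionCongr ε)))
  let D : Pairing (Pt (Option {v // v ≠ u}) 3) := C'.map cutE
  have e1 : remVF.at C (some u) = alt (rcls D) := by
    rw [VF.at_of _ _ ((Equiv.optionCongr ε).trans vswap) (by
      rw [Equiv.trans_apply, Equiv.optionCongr_apply, Option.map_some, hε]; rfl)]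
    rw [← onV_trans, ← ext_trans]
    show alt (rcls _) = _
    congr 2
    apply Pairing.eq_map
    intro x
    obtain ⟨x, rfl⟩ := (ext (onV (Equiv.optionCongr ε))).surjective x
    have key : ∀ y : Pt (Option (Option {v // v ≠ u})) 0, cutE y
        = remE (ext (onV vswap) y) := by
      rintro (⟨_ | _ | u, s⟩ | i)
      · rfl
      · rfl
      · rfl
      · exact i.elim0
    rw [key, Pairing.map_apply, key, Pairing.map_apply]
    exact congrArg remE (Pairing.map_apply C
      ((ext (onV (Equiv.optionCongr ε))).trans (ext (onV vswap))) x)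
  have e2 : remVF.at (ins C H) (Sum.inl u) = alt (rcls (ins D H)) := by
    rw [VF.at_of _ _ ((Equiv.sumCongr ε (Equiv.refl H.V)).trans (shiftL _ _)) (by
      rw [Equiv.trans_apply, Equiv.sumCongr_apply, Sum.map_inl, hε]; rfl)]
    show alt (rcls _) = _
    congr 2
    symm
    refine ins_map (n' := 3) (fun y => cutE (ext (onV (Equiv.optionCongr ε)) y)) (fun y => ?_)
      ((ext (onV ((Equiv.sumCongr ε (Equiv.refl H.V)).trans (shiftL _ _)))).trans remE) ?_ ?_
    · exact Pairing.map_apply C ((ext (onV (Equiv.optionCongr ε))).trans cutE) y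
    · rintro (⟨_ | v, s⟩ | i)
      · rfl
      · show remE (Sum.inl (shiftL _ _ (Sum.inl (ε v)), s))
          = jj H (cutE (Sum.inl (some (ε v), s)))
        rcases ε v with _ | w <;> rfl
      · exact i.elim0
    · intro b b' hb
      exact ⟨b, b', hb, rfl, rfl⟩
  rw [e1, e2, ← alt_act, ← Ins_eq_act, Ins_cls]

open Classical in
/-- The value of a closed graph. -/
def closedVal (c : Cx (Fin 0)) : F 3 :=
  if h : Conn (n := 0) c.p then remVF.at (n := 0) c.p (h.1.some.elim Prod.fst Fin.elim0) else 0

theorem closedVal_of {V : Type} [Finite V] {p : Pairing (Pt V 0)} (h : Conn p) (v : V) :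
    closedVal ⟨V, p⟩ = remVF.at p v :=
  (dif_pos h).trans (VF.at_indep _ h _ _)

theorem closedVal_not {V : Type} [Finite V] {p : Pairing (Pt V 0)} (h : ¬ Conn p) :
    closedVal ⟨V, p⟩ = 0 := dif_neg h

theorem conn_vertex {V : Type} {p : Pairing (Pt V 0)} (h : Conn p) : Nonempty V :=
  ⟨h.1.some.elim Prod.fst Fin.elim0⟩

theorem remVF_at_mem {V : Type} [Finite V] (p : Pairing (Pt V 0)) (v : V) :
    remVF.at p v ∈ LambdaSub := alt_mem _

theorem closedVal_mem (c : Cx (Fin 0)) : closedVal c ∈ LambdaSub := by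
  unfold closedVal
  split_ifs
  · exact remVF_at_mem _ _
  · exact zero_mem _

theorem closedVal_iso {V V' : Type} [Finite V] [Finite V'] (e : V ≃ V') (p : Pairing (Pt V 0)) :
    closedVal ⟨V', p.map (ext (onV e))⟩ = closedVal ⟨V, p⟩ := by
  by_cases h : Conn p
  · obtain ⟨v⟩ := conn_vertex h
    rw [closedVal_of h v, closedVal_of (conn_onV e h) (e v), VF.at_onV]
  · rw [closedVal_not h, closedVal_not]
    intro h'
    have := conn_onV e.symm h'
    rw [Pairing.map_map, ext_trans, onV_symm, Equiv.self_trans_symm, ext_refl] at this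
    exact h this

theorem closedVal_as {V : Type} [Finite V] (p : Pairing (Pt V 0)) (v : V) {s s' : Fin 3}
    (hs : s ≠ s') : closedVal ⟨V, p.map (ext (sw (v, s) (v, s')))⟩ = - closedVal ⟨V, p⟩ := by
  by_cases h : Conn p
  · rw [closedVal_of h v, closedVal_of (conn_as v s s' h) v, VF.at_as _ _ _ _ hs]
  · rw [closedVal_not h, closedVal_not, neg_zero]
    intro h'
    have := conn_as v s s' h'
    rw [map_sw_sw] at this
    exact h this

theorem closedVal_ihx {V : Type} [Finite V] (p : Pairing (Pt V 0)) {u v : V} (huv : u ≠ v)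
    (hp : p (Sum.inl (u, 0)) = Sum.inl (v, 0)) :
    closedVal ⟨V, p⟩ + closedVal ⟨V, p.map (ext (cyc u v))⟩
      + closedVal ⟨V, p.map (ext (cyc u v).symm)⟩ = 0 := by
  have hback : ∀ θ : Equiv.Perm (V × Fin 3), (p.map (ext θ)).map (ext θ.symm) = p := by
    intro θ
    rw [Pairing.map_map, ext_trans, Equiv.self_trans_symm, ext_refl, Pairing.map_refl]
  have hu : cyc u v (u, 0) = (u, 0) := cyc_ne (by simp) (by simp) (by simp)
  have hv : cyc u v (v, 0) = (v, 0) := cyc_ne (by simp) (by simp) (by simp)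
  by_cases h : Conn p
  · rw [closedVal_of h u, closedVal_of (conn_cyc huv hp h) u, closedVal_of (conn_cyc' huv hp h) u]
    unfold VF.at
    rw [map_cyc_onV, map_cyc_symm_onV, opt_self, opt_ne huv.symm]
    apply VF.ihx
    have := Pairing.map_apply p (ext (onV (opt u))) (Sum.inl (u, 0))
    rw [hp, ext_inl, ext_inl] at this
    simp only [onV, Equiv.prodCongr_apply, Prod.map, opt_self, opt_ne huv.symm] at this
    exact this
  · rw [closedVal_not h, closedVal_not, closedVal_not, add_zero, add_zero]
    · intro h'
      apply h
      have e := Pairing.map_apply p (ext (cyc u v).symm) (Sum.inl (u, 0))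
      rw [hp, ext_inl, ext_inl, (Equiv.symm_apply_eq _).2 hu.symm,
        (Equiv.symm_apply_eq _).2 hv.symm] at e
      have := conn_cyc huv e h'
      have h2 := hback (cyc u v).symm
      rw [Equiv.symm_symm] at h2
      rwa [h2] at this
    · intro h'
      apply h
      have e := Pairing.map_apply p (ext (cyc u v)) (Sum.inl (u, 0))
      rw [hp, ext_inl, ext_inl, hu, hv] at e
      have := conn_cyc' huv e h'
      rwa [hback] at this

theorem no_pairing (C : Pairing (Pt (Option Empty) 0)) : False := by
  have h : ∀ x : Pt (Option Empty) 0, ∃ i, x = Sum.inl (none, i) := by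
    rintro (⟨_ | u, s⟩ | i)
    · exact ⟨s, rfl⟩
    · exact u.elim
    · exact i.elim0
  choose f hf using h
  have h1 : ∀ i, f (C (Sum.inl (none, f (C (Sum.inl (none, i)))))) = i := by
    intro i
    rw [← hf, C.invol]
    have := hf (Sum.inl (none, i))
    simpa using this.symm
  have h2 : ∀ i, f (C (Sum.inl (none, i))) ≠ i := by
    intro i h
    have h3 := hf (C (Sum.inl (none, i)))
    rw [h] at h3
    exact C.ne _ h3
  generalize hg : (fun i => f (C (Sum.inl (none, i)))) = g at *
  have hg' : ∀ i, f (C (Sum.inl (none, i))) = g i := fun i => congrFun hg i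
  simp only [hg'] at h1 h2
  clear hg hg'
  revert g
  decide

/-- The weight on closed graphs with values in `Λ`. -/
def closedWt : Wt (Fin 0) Lam := ⟨fun c => ⟨closedVal c, closedVal_mem c⟩,
  { iso := fun e p => Subtype.ext (closedVal_iso e p)
    as := fun p v _ _ hs => Subtype.ext (closedVal_as p v hs)
    ihx := fun p _ _ huv hp => Subtype.ext (closedVal_ihx p huv hp)
    ins := fun f hf h c => by
      apply Subtype.ext
      show closedVal ⟨_, (f.fill (Fin 0)).app c.p⟩ = act ⟨f.cls, h⟩
        (closedVal ⟨_, (Gad.vert.fill (Fin 0)).app c.p⟩)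
      rw [Gad.app_fill f hf, Gad.app_fill _ Gad.conn_vert]
      generalize c.p.map Gad.joinE = C
      have hH : Graph.cls ⟨f.N, f.graph, hf⟩ = f.cls := (rcls_of hf).symm
      have hY : Graph.cls ⟨Gad.vert.N, Gad.vert.graph, Gad.conn_vert⟩ = yGraph.cls := by
        rw [← Gad.cls_vert]; exact (rcls_of Gad.conn_vert).symm
      by_cases hC : Conn (n := 0) C
      · rcases isEmpty_or_nonempty c.U with hU | ⟨⟨u⟩⟩
        · exact (no_pairing (C.map (ext (onV (Equiv.optionCongr (Equiv.equivEmpty c.U)))))).elim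
        · have a1 := closedVal_of (conn_ins hC ⟨f.N, f.graph, hf⟩) (Sum.inl u)
          have a2 := closedVal_of
            (conn_ins hC ⟨Gad.vert.N, Gad.vert.graph, Gad.conn_vert⟩) (Sum.inl u)
          rw [remVF_ins C u _ (hH ▸ h)] at a1
          rw [remVF_ins C u _ (hY ▸ yGraph_mem)] at a2
          have e1 : (⟨Graph.cls ⟨Gad.vert.N, Gad.vert.graph, Gad.conn_vert⟩, hY ▸ yGraph_mem⟩ :
              LambdaSub) = ⟨yGraph.cls, yGraph_mem⟩ := Subtype.ext hY
          have e2 : (⟨Graph.cls ⟨f.N, f.graph, hf⟩, hH ▸ h⟩ : LambdaSub) = ⟨f.cls, h⟩ :=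
            Subtype.ext hH
          rw [e1, one_act] at a2
          rw [e2] at a1
          exact a1.trans (congrArg (act ⟨f.cls, h⟩) a2.symm)
      · have a1 := closedVal_not fun h => hC (conn_of_ins (H := ⟨f.N, f.graph, hf⟩) h)
        have a2 := closedVal_not fun h => hC
          (conn_of_ins (H := ⟨Gad.vert.N, Gad.vert.graph, Gad.conn_vert⟩) h)
        exact a1.trans ((map_zero _).symm.trans (congrArg (act ⟨f.cls, h⟩) a2.symm)) }⟩

end base

/-! ### Holes with four ports -/

section holes
variable {S S' S'' T K : Type} {M : Type 1} [AddCommGroup M] [Module Lam M]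

instance (g g' : Gad S S') (e : g.N ≃ g'.N) (τ : g.N → Equiv.Perm (Fin 3)) [Fintype S]
    [Fintype g.R] [Fintype g'.R] [DecidableEq g'.N] [DecidableEq S'] :
    Decidable (g.TwE g' e τ) := by
  unfold Gad.TwE; infer_instance

/-- Attaching a gadget to the first summand of the ports. -/
def ap (g : Gad S S') : Wt (S' ⊕ T) M →ₗ[Lam] Wt (S ⊕ T) M := pull (g.left T)

/-- Filling the first summand of the ports. -/
def fl (f : Gad S Empty) : Wt T M →ₗ[Lam] Wt (S ⊕ T) M := pull (f.fill T)

theorem ap_comp (g : Gad S S') (h : Gad S' S'') (φ : Wt (S'' ⊕ T) M) :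
    ap (g.comp h) φ = ap g (ap h φ) := pull_comp_left g h φ

theorem fl_comp (g : Gad S S') (h : Gad S' Empty) (φ : Wt T M) :
    fl (g.comp h) φ = ap g (fl h φ) := pull_comp_fill g h φ

theorem ap_pos {g g' : Gad S S'} [Fintype g.N] (f : g.N → g'.N) (hf : Function.Bijective f)
    (τ : g.N → Equiv.Perm (Fin 3)) (h : g.TwE g' (Equiv.ofBijective f hf) τ) (hs : sgn τ = 1)
    (φ : Wt (S' ⊕ T) M) : ap g' φ = ap g φ :=
  (pull_left_tw _ τ h φ).trans (by rw [hs, one_smul]; rfl)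

theorem ap_neg {g g' : Gad S S'} [Fintype g.N] (f : g.N → g'.N) (hf : Function.Bijective f)
    (τ : g.N → Equiv.Perm (Fin 3)) (h : g.TwE g' (Equiv.ofBijective f hf) τ) (hs : sgn τ = -1)
    (φ : Wt (S' ⊕ T) M) : ap g' φ = - ap g φ :=
  (pull_left_tw _ τ h φ).trans (by rw [hs, neg_one_smul]; rfl)

theorem fl_pos {g g' : Gad S Empty} [Fintype g.N] (f : g.N → g'.N) (hf : Function.Bijective f)
    (τ : g.N → Equiv.Perm (Fin 3)) (h : g.TwE g' (Equiv.ofBijective f hf) τ) (hs : sgn τ = 1)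
    (φ : Wt T M) : fl g' φ = fl g φ :=
  (pull_fill_tw _ τ h φ).trans (by rw [hs, one_smul]; rfl)

theorem fl_neg {g g' : Gad S Empty} [Fintype g.N] (f : g.N → g'.N) (hf : Function.Bijective f)
    (τ : g.N → Equiv.Perm (Fin 3)) (h : g.TwE g' (Equiv.ofBijective f hf) τ) (hs : sgn τ = -1)
    (φ : Wt T M) : fl g' φ = - fl g φ :=
  (pull_fill_tw _ τ h φ).trans (by rw [hs, neg_one_smul]; rfl)

theorem ap_fill (f : Gad S Empty) (φ : Wt (K ⊕ T) M) :
    ap (f.fill K) φ = pull (Gad.ren (Equiv.sumAssoc S K T)) (fl f φ) := by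
  rw [fl, ← pull_comp]
  refine pull_iso (g := (Gad.ren (Equiv.sumAssoc S K T)).comp (f.fill (K ⊕ T)))
    (g' := (f.fill K).left T) (Equiv.emptySum _ _) ⟨?_, ?_⟩ φ
  · rintro ((a | a) | a)
    · rw [Gad.left_inl, Gad.fill_inl, Gad.comp_inl]
      show _ = Sum.map _ _ ((f.fill (K ⊕ T)).emb _ ((f.fill (K ⊕ T)).E (Sum.inl (Sum.inl a))))
      rw [Gad.fill_inl]
      rcases f.E (Sum.inl a) with x | x
      · rfl
      · exact x.elim
    · rfl
    · rfl
  · have key : ∀ r, ((f.fill K).left T).E (Sum.inr r) = Sum.map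
        (Gad.tw (Equiv.emptySum Empty f.N) fun _ => 1) id
          (((Gad.ren (Equiv.sumAssoc S K T)).comp (f.fill (K ⊕ T))).E (Sum.inr (Sum.inr r))) := by
      intro r
      rw [Gad.left_inr, Gad.fill_inr, Gad.comp_inr_inr, Gad.fill_inr]
      rcases f.E (Sum.inr r) with x | x
      · rfl
      · exact x.elim
    rintro (r | r)
    · exact r.elim
    · exact ⟨r, key r, key (f.D r)⟩

theorem fl_tree (φ : Wt T M) : fl treeA φ + fl treeB φ + fl treeC φ = 0 := pull_tree φ

theorem ap_tree (φ : Wt (K ⊕ T) M) :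
    ap (treeA.fill K) φ + ap (treeB.fill K) φ + ap (treeC.fill K) φ = 0 := by
  rw [ap_fill, ap_fill, ap_fill, ← map_add, ← map_add, fl_tree, map_zero]

/-- The identification of the univalent vertices of a filling. -/
def endsP : Pairing (Pts Empty (Fin 3 ⊕ Fin 3)) :=
  Pairing.map ⟨Sum.swap, Sum.swap_swap, by rintro (x | x) h <;> cases h⟩
    (Equiv.emptySum (Empty × Fin 3) (Fin 3 ⊕ Fin 3)).symm

theorem fill_endsP (f : Gad (Fin 3) Empty) : (f.fill (Fin 3)).app endsP
    = f.graph.map (xt (onV (Equiv.emptySum Empty f.N).symm)) := by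
  have hp : ∀ x, endsP (Sum.inr x) = Sum.inr x.swap := fun x => rfl
  have key : ∀ y : (f.N × Fin 3) ⊕ Empty, (xt (onV (Equiv.emptySum Empty f.N).symm)
      (Sum.map id Empty.elim y) : Pts (Empty ⊕ f.N) (Fin 3))
        = (f.fill (Fin 3)).emb Empty (Sum.map id Empty.elim y) := by
    rintro (x | x)
    · rfl
    · exact x.elim
  have kp : ∀ a, (f.fill (Fin 3)).app endsP (Sum.inr a) =
      (f.fill (Fin 3)).emb Empty (Sum.map id Empty.elim (f.E (Sum.inl a))) := by
    intro a
    have := (f.fill (Fin 3)).app_inj endsP (Sum.inr (Sum.inr a))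
    rw [hp] at this
    refine this.trans ?_
    show (f.fill (Fin 3)).emb Empty ((f.fill (Fin 3)).E (Sum.inl (Sum.inl a))) = _
    rw [Gad.fill_inl]
  apply Pairing.eq_map
  rintro (x | a)
  · have hx : (Sum.inl x : Pts f.N (Fin 3)) =
      Sum.map id Empty.elim (Sum.inl x : (f.N × Fin 3) ⊕ Empty) := rfl
    rw [hx]
    obtain ⟨a | r, hy⟩ := f.E.surjective (Sum.inl x)
    · rw [← hy, key, ← kp, Pairing.invol, ← Gad.graph_port, Pairing.invol]; rfl
    · rw [← hy, key, Gad.graph_inr, key, ← Gad.fill_inr, Gad.app_emb, ← Gad.fill_inr]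
  · refine (kp a).trans ?_
    rw [Gad.graph_port, key]

theorem cls_eq (f : Gad (Fin 3) Empty) : f.cls = (fl f openWt).1 ⟨Empty, endsP⟩ := by
  refine (rcls_iso (n := 3) (Equiv.emptySum Empty f.N).symm f.graph).symm.trans
    (congrArg (rcls (n := 3)) ?_)
  exact (fill_endsP f).symm

theorem legs_cls_swap (f : Gad (Fin 3) Empty) (i j : Fin 3) :
    legs (Equiv.swap i j) f.cls = ((Gad.ren (Equiv.swap i j)).comp f).cls := by
  rw [Gad.cls, legs_rcls, Gad.cls, ← rcls_iso (Equiv.emptySum Empty f.N).symm]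
  congr 1
  symm
  have h1 : ∀ a, ((Gad.ren (Equiv.swap i j)).comp f).graph (Sum.inr a) =
      (xt (onV (Equiv.emptySum Empty f.N).symm))
        (Sum.map id Empty.elim (f.E (Sum.inl (Equiv.swap i j a)))) := by
    intro a
    rw [Gad.graph_port, Gad.comp_inl]
    show Sum.map id Empty.elim (f.emb Empty (f.E (Sum.inl (Equiv.swap i j a)))) = _
    rcases f.E (Sum.inl (Equiv.swap i j a)) with x | x
    · rfl
    · exact x.elim
  refine Pairing.eq_map (Q := Pts (Empty ⊕ f.N) (Fin 3))
    (q := ((Gad.ren (Equiv.swap i j)).comp f).graph) _ ?_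
  intro y
  obtain ⟨y, rfl⟩ := (lg (Equiv.swap i j)).surjective y
  rw [Pairing.map_apply]
  rcases y with x | a
  · have hx : (Sum.inl x : Pts f.N (Fin 3)) =
      Sum.map id Empty.elim (Sum.inl x : (f.N × Fin 3) ⊕ Empty) := rfl
    rw [hx]
    obtain ⟨a | r, hy⟩ := f.E.surjective (Sum.inl x)
    · have h2 := h1 (Equiv.swap i j a)
      rw [Equiv.swap_apply_self] at h2
      rw [← hy, ← Gad.graph_port, Pairing.invol, Gad.graph_port]
      have h3 : (lg (Equiv.swap i j) : Pt f.N 3 ≃ Pt f.N 3)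
        (Sum.map id Empty.elim (f.E (Sum.inl a))) = Sum.map id Empty.elim (f.E (Sum.inl a)) := by
        rw [hy]; rfl
      rw [h3]
      refine (congrArg _ h2.symm).trans ?_
      rw [Pairing.invol]; rfl
    · have h2 := Gad.graph_inr ((Gad.ren (Equiv.swap i j)).comp f) (Sum.inr r)
      have k1 : ∀ r, (xt (onV (Equiv.emptySum Empty f.N).symm) : Pts f.N (Fin 3) ≃ _)
          (lg (n := 3) (Equiv.swap i j) (Sum.map id Empty.elim (f.E (Sum.inr r)))) =
          Sum.map id Empty.elim (((Gad.ren (Equiv.swap i j)).comp f).E (Sum.inr (Sum.inr r))) := by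
        intro r
        rw [Gad.comp_inr_inr]
        rcases f.E (Sum.inr r) with x | x
        · rfl
        · exact x.elim
      rw [← hy, Gad.graph_inr]
      refine (congrArg _ (k1 r)).trans (h2.trans (k1 (f.D r)).symm)
  · refine (h1 _).trans ?_
    show xt _ (Sum.map id Empty.elim (f.E (Sum.inl (Equiv.swap i j (Equiv.swap i j a))))) = _
    rw [Equiv.swap_apply_self, Gad.graph_port]
    rcases f.E (Sum.inl a) with x | x
    · rfl
    · exact x.elim

theorem cls_mem {f : Gad (Fin 3) Empty} (h : ∀ i j : Fin 3, i ≠ j →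
    fl ((Gad.ren (Equiv.swap i j)).comp f) openWt = - fl f openWt) : f.cls ∈ LambdaSub := by
  intro i j hij
  rw [legs_cls_swap, cls_eq, cls_eq, h i j hij]; rfl

/-- The triangle. -/
abbrev tri : Gad (Fin 3) Empty := .of 3 ![.inl (0, 0), .inl (1, 0), .inl (2, 0)]
  ![(.inl (0, 1), .inl (1, 2)), (.inl (1, 1), .inl (2, 2)), (.inl (2, 1), .inl (0, 2))] (by decide)

theorem graph_tri : tri.graph = tPair := Gad.graph_eq (by decide) (by decide)

theorem cls_tri : tri.cls = tGraph.cls := by rw [Gad.cls, graph_tri]; exact rcls_graph tGraph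

theorem tri_swap (φ : Wt T M) (i j : Fin 3) (h : i ≠ j) :
    fl ((Gad.ren (Equiv.swap i j)).comp tri) φ = - fl tri φ :=
  fl_neg (g := tri) (g' := (Gad.ren (Equiv.swap i j)).comp tri) 
    (fun k => Sum.inr (Equiv.swap i j k)) (by decide +revert) (fun _ => Equiv.swap 1 2)
    (by decide +revert) (by decide +revert) φ

theorem tGraph_mem : tGraph.cls ∈ LambdaSub := by
  rw [← cls_tri]; exact cls_mem fun i j h => tri_swap _ i j h

theorem tElt_val : (tElt : F 3) = tGraph.cls := alt_of_mem tGraph_mem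

theorem fl_ins {f : Gad (Fin 3) Empty} (hf : Conn (n := 3) f.graph) (h : f.cls ∈ LambdaSub)
    (φ : Wt T M) : fl f φ = (⟨f.cls, h⟩ : Lam) • fl Gad.vert φ := by
  apply Subtype.ext
  funext c
  exact φ.2.ins f hf h c

theorem fl_tri (φ : Wt T M) : fl tri φ = tElt • fl Gad.vert φ := by
  have h : tElt = ⟨tri.cls, by rw [cls_tri]; exact tGraph_mem⟩ :=
    Subtype.ext (tElt_val.trans cls_tri.symm)
  rw [h]
  exact fl_ins (by rw [graph_tri]; exact tPair_conn) _ φ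

/-- A bubble on the first of three ports. -/
abbrev bubV : Gad (Fin 3) (Fin 3) := .of 2 ![.inl (0, 0), .inr 1, .inr 2]
  ![(.inl (0, 1), .inl (1, 2)), (.inl (0, 2), .inl (1, 1)), (.inl (1, 0), .inr 0)] (by decide)

theorem fl_bubV (φ : Wt T M) : fl (bubV.comp Gad.vert) φ = (2 * tElt) • fl Gad.vert φ := by
  let m : Gad (Fin 3) (Fin 4) := .of 1 ![.inl (0, 0), .inr 2, .inr 3]
    ![(.inl (0, 1), .inr 1), (.inl (0, 2), .inr 0)] (by decide)
  have hA : fl (m.comp treeA) φ = fl (bubV.comp Gad.vert) φ :=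
    fl_pos (Sum.elim ![Sum.inl 0, Sum.inr 0] (fun _ => Sum.inr 1)) (by decide)
          (Sum.elim ![1, 1] (fun _ => 1)) (by decide) (by decide) φ
  have hB : fl (m.comp treeB) φ = - fl tri φ :=
    fl_neg ![Sum.inl 0, Sum.inr 0, Sum.inr 1] (by decide)
          ![Equiv.swap 1 2, Equiv.swap 0 1, Equiv.swap 0 2] (by decide) (by decide) φ
  have hC : fl (m.comp treeC) φ = - fl tri φ :=
    fl_neg ![Sum.inl 0, Sum.inr 0, Sum.inr 1] (by decide)
          ![1, (finRotate 3)⁻¹, Equiv.swap 0 2] (by decide) (by decide) φ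
  have h := congrArg (ap m) (fl_tree φ)
  rw [map_add, map_add, map_zero, ← fl_comp, ← fl_comp, ← fl_comp, hA, hB, hC, fl_tri] at h
  linear_combination (norm := module) h

theorem ap_bubV (φ : Wt (K ⊕ T) M) : ap ((bubV.comp Gad.vert).fill K) φ
    = (2 * tElt) • ap (Gad.vert.fill K) φ := by
  rw [ap_fill, ap_fill, fl_bubV, map_smul]

/-- A rung between two ports. -/
abbrev rung (i j : Fin 4) (h : i ≠ j := by decide) : Gad (Fin 4) (Fin 4) :=
  .of 2 (fun k => if k = i then .inl (0, 1) else if k = j then .inl (1, 2) else .inr k)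
    ![(.inl (0, 0), .inl (1, 0)), (.inl (0, 2), .inr i), (.inl (1, 1), .inr j)]
    (by revert i j; decide)

/-- A vertex on a port, with an additional port. -/
abbrev tine (i : Fin 4) : Gad (Fin 4 ⊕ Fin 1) (Fin 4) :=
  .of 1 (Sum.elim (fun k => if k = i then .inl (0, 1) else .inr k) fun _ => .inl (0, 0))
    ![(.inl (0, 2), .inr i)] (by revert i; decide)

/-- A bubble on a port. -/
abbrev bub (i : Fin 4) : Gad (Fin 4) (Fin 4) :=
  .of 2 (fun k => if k = i then .inl (0, 0) else .inr k)
    ![(.inl (0, 1), .inl (1, 2)), (.inl (0, 2), .inl (1, 1)), (.inl (1, 0), .inr i)]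
    (by revert i; decide)

/-- Permutation of the ports. -/
abbrev pm (σ : Equiv.Perm (Fin 4)) : Wt (Fin 4 ⊕ T) M →ₗ[Lam] Wt (Fin 4 ⊕ T) M := ap (Gad.ren σ)

/-- The weights for which edges slide over the first four ports, and bubbles there are scalars. -/
structure IsHole (φ : Wt (Fin 4 ⊕ T) M) : Prop where
  slide : ∑ i, ap (tine i) φ = 0
  bubble : ∀ i, ap (bub i) φ = (2 * tElt) • φ

theorem IsHole.add {φ ψ : Wt (Fin 4 ⊕ T) M} (h : IsHole φ) (h' : IsHole ψ) : IsHole (φ + ψ) where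
  slide := by simp only [map_add, Finset.sum_add_distrib, h.slide, h'.slide, add_zero]
  bubble i := by rw [map_add, h.bubble, h'.bubble, smul_add]

theorem IsHole.smul {φ : Wt (Fin 4 ⊕ T) M} (h : IsHole φ) (r : Lam) : IsHole (r • φ) where
  slide := by simp only [map_smul, ← Finset.smul_sum, h.slide, smul_zero]
  bubble i := by rw [map_smul, h.bubble, smul_comm]

theorem pm_pm (σ τ : Equiv.Perm (Fin 4)) (φ : Wt (Fin 4 ⊕ T) M) :
    pm σ (pm τ φ) = pm (τ * σ) φ := by
  rw [← ap_comp]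
  exact pull_iso (g := (Gad.ren (τ * σ)).left T) (g' := ((Gad.ren σ).comp (Gad.ren τ)).left T)
    (Equiv.sumEmpty _ _).symm ⟨by rintro (a | a) <;> rfl, fun r => r.elim⟩ φ

theorem pm_one (φ : Wt (Fin 4 ⊕ T) M) : pm 1 φ = φ := by
  show pull ((Gad.ren (Equiv.refl _)).left T) φ = φ
  rw [pull_ren_left, Equiv.sumCongr_refl, pull_ren_refl]

theorem rung_symm (i j : Fin 4) (h : i ≠ j) (φ : Wt (Fin 4 ⊕ T) M) :
    ap (rung j i h.symm) φ = ap (rung i j h) φ :=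
  ap_pos (g := rung i j h) (g' := rung j i h.symm) ![1, 0] (by decide +revert)
    ![Equiv.swap 1 2, Equiv.swap 1 2] (by decide +revert) (by decide +revert) φ

theorem rung_pm (a b i j : Fin 4) (h : i ≠ j) (φ : Wt (Fin 4 ⊕ T) M) :
    ap (rung i j h) (pm (Equiv.swap a b) φ) = pm (Equiv.swap a b)
      (ap (rung (Equiv.swap a b i) (Equiv.swap a b j) ((Equiv.swap a b).injective.ne h)) φ) := by
  rw [← ap_comp, ← ap_comp]
  exact ap_pos (g := (Gad.ren (Equiv.swap a b)).comp (rung (Equiv.swap a b i) (Equiv.swap a b j) _))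
    (g' := (rung i j h).comp (Gad.ren (Equiv.swap a b))) (Sum.elim Empty.elim Sum.inl)
    (by decide +revert) (fun _ => 1) (by revert a b i j; decide +kernel) (by decide +revert) φ

theorem IsHole.perm {φ : Wt (Fin 4 ⊕ T) M} (h : IsHole φ) (a b : Fin 4) :
    IsHole (pm (Equiv.swap a b) φ) where
  slide := by
    have key : ∀ i, ap (tine i) (ap (Gad.ren (Equiv.swap a b)) φ)
        = ap (Gad.ren (Equiv.sumCongr (Equiv.swap a b) (Equiv.refl _)))
          (ap (tine (Equiv.swap a b i)) φ) := by
      intro i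
      rw [← ap_comp, ← ap_comp]
      exact ap_pos (g := (Gad.ren (Equiv.sumCongr (Equiv.swap a b) (Equiv.refl _))).comp
        (tine (Equiv.swap a b i))) (g' := (tine i).comp (Gad.ren (Equiv.swap a b)))
        (Sum.elim Empty.elim Sum.inl) (by decide +revert) (fun _ => 1)
        (by revert a b i; decide +kernel) (by decide +revert) φ
    simp only [key]
    rw [← map_sum, Equiv.sum_comp (Equiv.swap a b) fun i => ap (tine i) φ, h.slide, map_zero]
  bubble i := by
    rw [← map_smul, ← h.bubble (Equiv.swap a b i), ← ap_comp, ← ap_comp]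
    exact ap_pos (g := (Gad.ren (Equiv.swap a b)).comp (bub (Equiv.swap a b i)))
      (g' := (bub i).comp (Gad.ren (Equiv.swap a b))) (Sum.elim Empty.elim Sum.inl)
      (by decide +revert) (fun _ => 1) (by revert a b i; decide +kernel) (by decide +revert) φ

theorem IsHole.sum_rung {φ : Wt (Fin 4 ⊕ T) M} (h : IsHole φ) :
    ap (rung 0 1) φ + ap (rung 0 2) φ + ap (rung 0 3) φ = (2 * tElt) • φ := by
  let z : Gad (Fin 4) (Fin 4 ⊕ Fin 1) := .of 1
    ![.inl (0, 1), .inr (.inl 1), .inr (.inl 2), .inr (.inl 3)]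
    ![(.inl (0, 0), .inr (.inr 0)), (.inl (0, 2), .inr (.inl 0))] (by decide)
  have h0 : ap (z.comp (tine 0)) φ = ap (bub 0) φ :=
    ap_pos ![Sum.inl 0, Sum.inr 0] (by decide)
          ![Equiv.swap 0 1, Equiv.swap 0 2] (by decide) (by decide) φ
  have h1 : ap (z.comp (tine 1)) φ = - ap (rung 0 1) φ :=
    ap_neg ![Sum.inl 0, Sum.inr 0] (by decide)
          ![1, Equiv.swap 1 2] (by decide) (by decide) φ
  have h2 : ap (z.comp (tine 2)) φ = - ap (rung 0 2) φ :=
    ap_neg ![Sum.inl 0, Sum.inr 0] (by decide)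
          ![1, Equiv.swap 1 2] (by decide) (by decide) φ
  have h3 : ap (z.comp (tine 3)) φ = - ap (rung 0 3) φ :=
    ap_neg ![Sum.inl 0, Sum.inr 0] (by decide)
          ![1, Equiv.swap 1 2] (by decide) (by decide) φ
  have hs := congrArg (ap z) h.slide
  rw [map_sum, map_zero, Fin.sum_univ_four, ← ap_comp, ← ap_comp, ← ap_comp, ← ap_comp, h0, h1,
    h2, h3, h.bubble] at hs
  linear_combination (norm := module) - hs

theorem isHole_treeA (φ : Wt T M) : IsHole (fl treeA φ) where
  slide := by
    let a : Gad (Fin 4 ⊕ Fin 1) (Fin 4) := .of 1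
      (Sum.elim ![.inr 0, .inr 1, .inl (0, 1), .inl (0, 2)] ![.inr 2])
      ![(.inl (0, 0), .inr 3)] (by decide)
    let b : Gad (Fin 4 ⊕ Fin 1) (Fin 4) := .of 1
      (Sum.elim ![.inl (0, 1), .inl (0, 2), .inr 0, .inr 1] ![.inr 2])
      ![(.inl (0, 0), .inr 3)] (by decide)
    have aB : fl (a.comp treeB) φ = fl ((tine 0).comp treeA) φ :=
      fl_pos (Sum.elim ![Sum.inr 0] ![Sum.inr 1, Sum.inl 0]) (by decide)
          (Sum.elim ![finRotate 3] ![(finRotate 3)⁻¹, 1]) (by decide) (by decide) φ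
    have aC : fl (a.comp treeC) φ = fl ((tine 1).comp treeA) φ :=
      fl_pos (Sum.elim ![Sum.inr 0] ![Sum.inr 1, Sum.inl 0]) (by decide)
          (Sum.elim ![Equiv.swap 0 2] ![Equiv.swap 0 2, 1]) (by decide) (by decide) φ
    have bB : fl (b.comp treeB) φ = fl ((tine 2).comp treeA) φ :=
      fl_pos (Sum.elim ![Sum.inr 0] ![Sum.inl 0, Sum.inr 1]) (by decide)
          (Sum.elim ![finRotate 3] ![1, (finRotate 3)⁻¹]) (by decide) (by decide) φ
    have bC : fl (b.comp treeC) φ = fl ((tine 3).comp treeA) φ :=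
      fl_pos (Sum.elim ![Sum.inr 0] ![Sum.inl 0, Sum.inr 1]) (by decide)
          (Sum.elim ![Equiv.swap 0 2] ![1, Equiv.swap 0 2]) (by decide) (by decide) φ
    have ab : fl (b.comp treeA) φ = - fl (a.comp treeA) φ :=
      fl_neg (Sum.elim ![Sum.inr 0] ![Sum.inl 0, Sum.inr 1]) (by decide)
          (Sum.elim ![1] ![1, Equiv.swap 0 2]) (by decide) (by decide) φ
    have h1 := congrArg (ap a) (fl_tree φ)
    have h2 := congrArg (ap b) (fl_tree φ)
    rw [map_add, map_add, map_zero, ← fl_comp, ← fl_comp, ← fl_comp, aB, aC] at h1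
    rw [map_add, map_add, map_zero, ← fl_comp, ← fl_comp, ← fl_comp, ab, bB, bC] at h2
    rw [Fin.sum_univ_four, ← fl_comp, ← fl_comp, ← fl_comp, ← fl_comp]
    linear_combination (norm := module) h1 + h2
  bubble i := by
    fin_cases i
    · let q : Gad (Fin 4) (Fin 3) := .of 1 ![.inr 0, .inr 1, .inl (0, 1), .inl (0, 2)]
        ![(.inl (0, 0), .inr 2)] (by decide)
      have e1 : fl (q.comp Gad.vert) φ = fl treeA φ :=
        fl_pos ![Sum.inr 0, Sum.inl 0] (by decide)
          ![(finRotate 3)⁻¹, 1] (by decide) (by decide) φ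
      have e2 : fl (q.comp (bubV.comp Gad.vert)) φ = fl ((bub 0).comp treeA) φ :=
        fl_pos (Sum.elim ![Sum.inr (Sum.inl 0), Sum.inr (Sum.inl 1)] ![Sum.inr (Sum.inr 0), Sum.inl 0]) (by decide)
          (Sum.elim ![1, 1] ![(finRotate 3)⁻¹, 1]) (by decide) (by decide) φ
      rw [fl_comp, fl_bubV, map_smul, ← fl_comp, e1] at e2
      exact (fl_comp _ _ _).symm.trans (by exact e2.symm)
    · let q : Gad (Fin 4) (Fin 3) := .of 1 ![.inr 1, .inr 0, .inl (0, 1), .inl (0, 2)]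
        ![(.inl (0, 0), .inr 2)] (by decide)
      have e1 : fl (q.comp Gad.vert) φ = - fl treeA φ :=
        fl_neg ![Sum.inr 0, Sum.inl 0] (by decide)
          ![Equiv.swap 0 2, 1] (by decide) (by decide) φ
      have e2 : fl (q.comp (bubV.comp Gad.vert)) φ = - fl ((bub 1).comp treeA) φ :=
        fl_neg (Sum.elim ![Sum.inr (Sum.inl 0), Sum.inr (Sum.inl 1)] ![Sum.inr (Sum.inr 0), Sum.inl 0]) (by decide)
          (Sum.elim ![1, 1] ![Equiv.swap 0 2, 1]) (by decide) (by decide) φ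
      rw [fl_comp, fl_bubV, map_smul, ← fl_comp, e1] at e2
      exact (fl_comp _ _ _).symm.trans (by rw [smul_neg] at e2; exact (neg_injective e2).symm)
    · let q : Gad (Fin 4) (Fin 3) := .of 1 ![.inl (0, 1), .inl (0, 2), .inr 0, .inr 1]
        ![(.inl (0, 0), .inr 2)] (by decide)
      have e1 : fl (q.comp Gad.vert) φ = fl treeA φ :=
        fl_pos ![Sum.inl 0, Sum.inr 0] (by decide)
          ![1, (finRotate 3)⁻¹] (by decide) (by decide) φ
      have e2 : fl (q.comp (bubV.comp Gad.vert)) φ = fl ((bub 2).comp treeA) φ :=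
        fl_pos (Sum.elim ![Sum.inr (Sum.inl 0), Sum.inr (Sum.inl 1)] ![Sum.inl 0, Sum.inr (Sum.inr 0)]) (by decide)
          (Sum.elim ![1, 1] ![1, (finRotate 3)⁻¹]) (by decide) (by decide) φ
      rw [fl_comp, fl_bubV, map_smul, ← fl_comp, e1] at e2
      exact (fl_comp _ _ _).symm.trans (by exact e2.symm)
    · let q : Gad (Fin 4) (Fin 3) := .of 1 ![.inl (0, 1), .inl (0, 2), .inr 1, .inr 0]
        ![(.inl (0, 0), .inr 2)] (by decide)
      have e1 : fl (q.comp Gad.vert) φ = - fl treeA φ :=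
        fl_neg ![Sum.inl 0, Sum.inr 0] (by decide)
          ![1, Equiv.swap 0 2] (by decide) (by decide) φ
      have e2 : fl (q.comp (bubV.comp Gad.vert)) φ = - fl ((bub 3).comp treeA) φ :=
        fl_neg (Sum.elim ![Sum.inr (Sum.inl 0), Sum.inr (Sum.inl 1)] ![Sum.inl 0, Sum.inr (Sum.inr 0)]) (by decide)
          (Sum.elim ![1, 1] ![1, Equiv.swap 0 2]) (by decide) (by decide) φ
      rw [fl_comp, fl_bubV, map_smul, ← fl_comp, e1] at e2
      exact (fl_comp _ _ _).symm.trans (by rw [smul_neg] at e2; exact (neg_injective e2).symm)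

theorem IsHole.rg {φ : Wt (Fin 4 ⊕ T) M} (h : IsHole φ) : IsHole (ap (rung 0 1) φ) where
  slide := by
    let c : Gad (Fin 4 ⊕ Fin 1) (Fin 4 ⊕ Fin 4) := .of 1
      (Sum.elim ![.inr (.inl 0), .inl (0, 2), .inr (.inr 2), .inr (.inr 3)] ![.inr (.inl 1)])
      ![(.inl (0, 0), .inr (.inl 3)), (.inl (0, 1), .inr (.inr 1)), (.inr (.inl 2), .inr (.inr 0))]
      (by decide)
    let d : Gad (Fin 4 ⊕ Fin 1) (Fin 4 ⊕ Fin 4) := .of 1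
      (Sum.elim ![.inl (0, 1), .inr (.inl 0), .inr (.inr 2), .inr (.inr 3)] ![.inr (.inl 1)])
      ![(.inl (0, 0), .inr (.inl 3)), (.inl (0, 2), .inr (.inr 0)), (.inr (.inl 2), .inr (.inr 1))]
      (by decide)
    have cA : ap (c.comp (treeA.fill (Fin 4))) φ = - ap ((tine 0).comp (rung 0 1)) φ :=
      ap_neg (Sum.elim ![Sum.inr 0] ![Sum.inr 1, Sum.inl 0]) (by decide)
          (Sum.elim ![Equiv.swap 0 2] ![(finRotate 3)⁻¹, 1]) (by decide) (by decide) φ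
    have cC : ap (c.comp (treeC.fill (Fin 4))) φ
        = ap (((rung 0 1).left (Fin 1)).comp (tine 0)) φ :=
      ap_pos (Sum.elim ![Sum.inr 1, Sum.inl 0] ![Sum.inr 0]) (by decide)
          (Sum.elim ![Equiv.swap 0 2, 1] ![Equiv.swap 0 1]) (by decide) (by decide) φ
    have dA : ap (d.comp (treeA.fill (Fin 4))) φ = ap ((tine 1).comp (rung 0 1)) φ :=
      ap_pos (Sum.elim ![Sum.inr 0] ![Sum.inl 0, Sum.inr 1]) (by decide)
          (Sum.elim ![Equiv.swap 0 2] ![1, Equiv.swap 0 2]) (by decide) (by decide) φ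
    have dC : ap (d.comp (treeC.fill (Fin 4))) φ
        = - ap (((rung 0 1).left (Fin 1)).comp (tine 1)) φ :=
      ap_neg (Sum.elim ![Sum.inl 0, Sum.inr 1] ![Sum.inr 0]) (by decide)
          (Sum.elim ![1, (finRotate 3)⁻¹] ![Equiv.swap 0 1]) (by decide) (by decide) φ
    have cd : ap (d.comp (treeB.fill (Fin 4))) φ = ap (c.comp (treeB.fill (Fin 4))) φ :=
      ap_pos (Sum.elim ![Sum.inr 0] ![Sum.inl 0, Sum.inr 1]) (by decide)
          (Sum.elim ![1] ![Equiv.swap 1 2, Equiv.swap 0 2]) (by decide) (by decide) φ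
    have e2 : ap ((tine 2).comp (rung 0 1)) φ
        = ap (((rung 0 1).left (Fin 1)).comp (tine 2)) φ :=
      ap_pos (Sum.elim ![Sum.inr 0, Sum.inr 1] ![Sum.inl 0]) (by decide)
          (Sum.elim ![1, 1] ![1]) (by decide) (by decide) φ
    have e3 : ap ((tine 3).comp (rung 0 1)) φ
        = ap (((rung 0 1).left (Fin 1)).comp (tine 3)) φ :=
      ap_pos (Sum.elim ![Sum.inr 0, Sum.inr 1] ![Sum.inl 0]) (by decide)
          (Sum.elim ![1, 1] ![1]) (by decide) (by decide) φ
    have h1 := congrArg (ap c) (ap_tree φ)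
    have h2 := congrArg (ap d) (ap_tree φ)
    have h3 := congrArg (ap ((rung 0 1).left (Fin 1))) h.slide
    rw [map_add, map_add, map_zero, ← ap_comp, ← ap_comp, ← ap_comp, cA, cC] at h1
    rw [map_add, map_add, map_zero, ← ap_comp, ← ap_comp, ← ap_comp, dA, dC, cd] at h2
    rw [map_sum, map_zero, Fin.sum_univ_four, ← ap_comp, ← ap_comp, ← ap_comp, ← ap_comp] at h3
    rw [Fin.sum_univ_four, ← ap_comp, ← ap_comp, ← ap_comp, ← ap_comp, e2, e3]
    linear_combination (norm := module) h3 - h1 + h2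
  bubble i := by
    fin_cases i
    · let n : Gad (Fin 4) (Fin 3 ⊕ Fin 4) := .of 1 ![.inr (.inl 0), .inl (0, 2), .inr (.inr 2), .inr (.inr 3)]
        ![(.inr (.inl 1), .inr (.inr 0)), (.inl (0, 0), .inr (.inl 2)), (.inl (0, 1), .inr (.inr 1))] (by decide)
      have e1 : ap (n.comp (Gad.vert.fill (Fin 4))) φ = ap (rung 0 1) φ :=
        ap_pos ![Sum.inr 0, Sum.inl 0] (by decide)
          ![(finRotate 3)⁻¹, 1] (by decide) (by decide) φ
      have e2 : ap (n.comp ((bubV.comp Gad.vert).fill (Fin 4))) φ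
          = ap ((bub 0).comp (rung 0 1)) φ :=
        ap_pos (Sum.elim ![Sum.inr (Sum.inl 0), Sum.inr (Sum.inl 1)] ![Sum.inr (Sum.inr 0), Sum.inl 0]) (by decide)
          (Sum.elim ![1, 1] ![(finRotate 3)⁻¹, 1]) (by decide) (by decide) φ
      rw [ap_comp, ap_bubV, map_smul, ← ap_comp, e1] at e2
      exact (ap_comp _ _ _).symm.trans (by exact e2.symm)
    · let n : Gad (Fin 4) (Fin 3 ⊕ Fin 4) := .of 1 ![.inl (0, 1), .inr (.inl 0), .inr (.inr 2), .inr (.inr 3)]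
        ![(.inr (.inl 1), .inr (.inr 1)), (.inl (0, 0), .inr (.inl 2)), (.inl (0, 2), .inr (.inr 0))] (by decide)
      have e1 : ap (n.comp (Gad.vert.fill (Fin 4))) φ = - ap (rung 0 1) φ :=
        ap_neg ![Sum.inl 0, Sum.inr 0] (by decide)
          ![1, Equiv.swap 0 2] (by decide) (by decide) φ
      have e2 : ap (n.comp ((bubV.comp Gad.vert).fill (Fin 4))) φ
          = - ap ((bub 1).comp (rung 0 1)) φ :=
        ap_neg (Sum.elim ![Sum.inr (Sum.inl 0), Sum.inr (Sum.inl 1)] ![Sum.inl 0, Sum.inr (Sum.inr 0)]) (by decide)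
          (Sum.elim ![1, 1] ![1, Equiv.swap 0 2]) (by decide) (by decide) φ
      rw [ap_comp, ap_bubV, map_smul, ← ap_comp, e1] at e2
      exact (ap_comp _ _ _).symm.trans (by rw [smul_neg] at e2; exact (neg_injective e2).symm)
    · have e : ap ((bub 2).comp (rung 0 1)) φ
          = ap ((rung 0 1).comp (bub 2)) φ :=
        ap_pos (Sum.elim ![Sum.inr 0, Sum.inr 1] ![Sum.inl 0, Sum.inl 1]) (by decide)
          (Sum.elim ![1, 1] ![1, 1]) (by decide) (by decide) φ
      rw [ap_comp, ap_comp, h.bubble, map_smul] at e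
      exact e
    · have e : ap ((bub 3).comp (rung 0 1)) φ
          = ap ((rung 0 1).comp (bub 3)) φ :=
        ap_pos (Sum.elim ![Sum.inr 0, Sum.inr 1] ![Sum.inl 0, Sum.inl 1]) (by decide)
          (Sum.elim ![1, 1] ![1, 1]) (by decide) (by decide) φ
      rw [ap_comp, ap_comp, h.bubble, map_smul] at e
      exact e

/-- Joining the ports `0` and `1` at a vertex. -/
abbrev join : Gad (Fin 3) (Fin 4) := .of 1 ![.inl (0, 0), .inr 2, .inr 3]
  ![(.inl (0, 1), .inr 0), (.inl (0, 2), .inr 1)] (by decide)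

/-- A vertex that joins the ports `0` and `1` from outside. -/
abbrev split : Gad (Fin 4) (Fin 3) := .of 1 ![.inl (0, 1), .inl (0, 2), .inr 1, .inr 2]
  ![(.inl (0, 0), .inr 0)] (by decide)

theorem rung_sub_swap (φ : Wt (Fin 4 ⊕ T) M) :
    ap (rung 0 1) φ - ap (rung 0 1) (pm (Equiv.swap 0 1) φ) = - ap split (ap join φ) := by
  let k : Gad (Fin 4) (Fin 4 ⊕ Fin 4) := .of 0
    ![.inr (.inl 0), .inr (.inl 1), .inr (.inr 2), .inr (.inr 3)]
    ![(.inr (.inl 2), .inr (.inr 0)), (.inr (.inl 3), .inr (.inr 1))] (by decide)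
  have kA : ap (k.comp (treeA.fill (Fin 4))) φ = ap (split.comp join) φ :=
    ap_pos (Sum.elim ![Sum.inr 0] ![Sum.inr 1]) (by decide)
          (Sum.elim ![1] ![1]) (by decide) (by decide) φ
  have kB : ap (k.comp (treeB.fill (Fin 4))) φ = ap (rung 0 1) φ :=
    ap_pos ![Sum.inr 0, Sum.inr 1] (by decide)
          ![Equiv.swap 1 2, Equiv.swap 1 2] (by decide) (by decide) φ
  have kC : ap (k.comp (treeC.fill (Fin 4))) φ
      = - ap ((rung 0 1).comp (Gad.ren (Equiv.swap 0 1))) φ :=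
    ap_neg (Sum.elim ![Sum.inr 1, Sum.inr 0] Empty.elim) (by decide)
          (Sum.elim ![1, Equiv.swap 1 2] Empty.elim) (by decide) (by decide) φ
  have h1 := congrArg (ap k) (ap_tree φ)
  rw [map_add, map_add, map_zero, ← ap_comp, ← ap_comp, ← ap_comp, kA, kB, kC, ap_comp,
    ap_comp] at h1
  linear_combination (norm := module) h1

theorem split_vert (φ : Wt T M) : ap split (fl Gad.vert φ) = fl treeA φ := by
  rw [← fl_comp]
  exact fl_pos ![Sum.inl 0, Sum.inr 0] (by decide)
          ![1, 1] (by decide) (by decide) φ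

end holes

/-! ### Rungs on holes -/

section rungs
variable {T : Type} {M : Type 1} [AddCommGroup M] [Module Lam M]

theorem smul_cancel {X : Type*} [AddCommGroup X] [Module Lam X] (n : ℕ) (hn : n ≠ 0) {x y : X}
    (h : (n : Lam) • x = (n : Lam) • y) : x = y := by
  have h1 : algebraMap ℚ Lam (1 / n) * (n : Lam) = 1 := by
    rw [← map_natCast (algebraMap ℚ Lam), ← map_mul, one_div_mul_cancel (by exact_mod_cast hn),
      map_one]
  have h2 := congrArg (fun z => algebraMap ℚ Lam (1 / n) • z) h
  simpa only [smul_smul, h1, one_smul] using h2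

theorem pm_swap_swap (a b : Fin 4) (φ : Wt (Fin 4 ⊕ T) M) :
    pm (Equiv.swap a b) (pm (Equiv.swap a b) φ) = φ := by
  rw [pm_pm, Equiv.swap_mul_self, pm_one]

theorem IsHole.rung_two_three {φ : Wt (Fin 4 ⊕ T) M} (h : IsHole φ) :
    ap (rung 2 3) φ = ap (rung 0 1) φ := by
  have h0 := h.sum_rung
  have h1 := congrArg (pm (Equiv.swap 0 1)) (h.perm 0 1).sum_rung
  have h2 := congrArg (pm (Equiv.swap 0 2)) (h.perm 0 2).sum_rung
  have h3 := congrArg (pm (Equiv.swap 0 3)) (h.perm 0 3).sum_rung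
  have e1 : ∀ j (hj : 0 ≠ j), ap (rung 0 j hj) (pm (Equiv.swap 0 1) φ) = _ :=
    fun j hj => rung_pm 0 1 0 j hj φ
  have e2 : ∀ j (hj : 0 ≠ j), ap (rung 0 j hj) (pm (Equiv.swap 0 2) φ) = _ :=
    fun j hj => rung_pm 0 2 0 j hj φ
  have e3 : ∀ j (hj : 0 ≠ j), ap (rung 0 j hj) (pm (Equiv.swap 0 3) φ) = _ :=
    fun j hj => rung_pm 0 3 0 j hj φ
  rw [map_add, map_add, e1, e1, e1, pm_swap_swap, pm_swap_swap, pm_swap_swap, map_smul,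
    pm_swap_swap] at h1
  rw [map_add, map_add, e2, e2, e2, pm_swap_swap, pm_swap_swap, pm_swap_swap, map_smul,
    pm_swap_swap] at h2
  rw [map_add, map_add, e3, e3, e3, pm_swap_swap, pm_swap_swap, pm_swap_swap, map_smul,
    pm_swap_swap] at h3
  replace h1 : ap (rung 1 0) φ + ap (rung 1 2) φ + ap (rung 1 3) φ = (2 * tElt) • φ := h1
  replace h2 : ap (rung 2 1) φ + ap (rung 2 0) φ + ap (rung 2 3) φ = (2 * tElt) • φ := h2
  replace h3 : ap (rung 3 1) φ + ap (rung 3 2) φ + ap (rung 3 0) φ = (2 * tElt) • φ := h3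
  rw [rung_symm 0 1 (by decide)] at h1
  rw [rung_symm 1 2 (by decide), rung_symm 0 2 (by decide)] at h2
  rw [rung_symm 1 3 (by decide), rung_symm 2 3 (by decide), rung_symm 0 3 (by decide)] at h3
  refine smul_cancel 2 (by norm_num) ?_
  push_cast
  linear_combination (norm := module) h2 + h3 - h0 - h1

/-- The class of a port with respect to the pairing `01|23`. -/
def side : Fin 4 → Fin 2 := ![0, 0, 1, 1]

/-- Invariance under the permutations that preserve the pairing `01|23`. -/
def Even (φ : Wt (Fin 4 ⊕ T) M) : Prop :=
  ∀ σ : Equiv.Perm (Fin 4), side (σ 0) = side (σ 1) → pm σ φ = φ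

theorem even_of {φ : Wt (Fin 4 ⊕ T) M} (h1 : pm (Equiv.swap 0 1) φ = φ)
    (h2 : pm (Equiv.swap 2 3) φ = φ) (h3 : pm (Equiv.swap 0 2) (pm (Equiv.swap 1 3) φ) = φ) :
    Even φ := by
  have key : ∀ σ : Equiv.Perm (Fin 4), side (σ 0) = side (σ 1) → ∃ a b c : Fin 2,
      σ = (Equiv.swap 1 3 * Equiv.swap 0 2) ^ (c : ℕ) * Equiv.swap 2 3 ^ (b : ℕ)
        * Equiv.swap 0 1 ^ (a : ℕ) := by decide +kernel
  have hp : ∀ (σ : Equiv.Perm (Fin 4)), pm σ φ = φ → ∀ n : ℕ, pm (σ ^ n) φ = φ := by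
    intro σ hσ n
    induction n with
    | zero => exact pm_one φ
    | succ n ih => rw [pow_succ, ← pm_pm, ih, hσ]
  rw [pm_pm] at h3
  intro σ hσ
  obtain ⟨a, b, c, rfl⟩ := key σ hσ
  rw [← pm_pm, ← pm_pm, hp _ h3, hp _ h2, hp _ h1]

theorem Even.pm_eq {φ : Wt (Fin 4 ⊕ T) M} (h : Even φ) {σ τ : Equiv.Perm (Fin 4)}
    (hs : side ((σ * τ⁻¹) 0) = side ((σ * τ⁻¹) 1)) : pm σ φ = pm τ φ := by
  conv_rhs => rw [← h _ hs, pm_pm, inv_mul_cancel_right]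

theorem Even.add {φ ψ : Wt (Fin 4 ⊕ T) M} (h : Even φ) (h' : Even ψ) : Even (φ + ψ) :=
  fun σ hσ => by rw [map_add, h σ hσ, h' σ hσ]

theorem Even.smul {φ : Wt (Fin 4 ⊕ T) M} (h : Even φ) (r : Lam) : Even (r • φ) :=
  fun σ hσ => by rw [map_smul, h σ hσ]

theorem Even.rg {φ : Wt (Fin 4 ⊕ T) M} (h : Even φ) (hh : IsHole φ) : Even (ap (rung 0 1) φ) := by
  refine even_of ?_ ?_ ?_
  · have e : ap (rung 0 1) (pm (Equiv.swap 0 1) φ) = pm (Equiv.swap 0 1) (ap (rung 1 0) φ) :=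
      rung_pm 0 1 0 1 _ φ
    rw [rung_symm 0 1 (by decide), h _ (by decide)] at e
    exact e.symm
  · have e : ap (rung 0 1) (pm (Equiv.swap 2 3) φ) = pm (Equiv.swap 2 3) (ap (rung 0 1) φ) :=
      rung_pm 2 3 0 1 _ φ
    rw [h _ (by decide)] at e
    exact e.symm
  · have e : ap (rung 0 1) (pm (Equiv.swap 0 2) (pm (Equiv.swap 1 3) φ))
        = pm (Equiv.swap 0 2) (ap (rung 2 1) (pm (Equiv.swap 1 3) φ)) := rung_pm 0 2 0 1 _ _
    have e' : ap (rung 2 1) (pm (Equiv.swap 1 3) φ) = pm (Equiv.swap 1 3) (ap (rung 2 3) φ) :=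
      rung_pm 1 3 2 1 _ φ
    rw [e', pm_pm, h _ (by decide), hh.rung_two_three] at e
    exact e.symm

theorem pm_treeB_01 (φ : Wt T M) : pm (Equiv.swap 0 1) (fl treeB φ) = - fl treeC φ := by
  rw [← fl_comp]
  exact fl_neg ![Sum.inr 0, Sum.inr 1] (by decide)
          ![Equiv.swap 1 2, 1] (by decide) (by decide) φ

theorem pm_treeB_23 (φ : Wt T M) : pm (Equiv.swap 2 3) (fl treeB φ) = - fl treeC φ := by
  rw [← fl_comp]
  exact fl_neg ![Sum.inr 1, Sum.inr 0] (by decide)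
          ![1, Equiv.swap 1 2] (by decide) (by decide) φ

theorem pm_treeA_12 (φ : Wt T M) : pm (Equiv.swap 1 2) (fl treeA φ) = - fl treeB φ := by
  rw [← fl_comp]
  exact fl_neg ![Sum.inr 0, Sum.inr 1] (by decide)
          ![Equiv.swap 1 2, 1] (by decide) (by decide) φ

theorem pm_treeC_12 (φ : Wt T M) : pm (Equiv.swap 1 2) (fl treeC φ) = - fl treeC φ := by
  rw [← fl_comp]
  exact fl_neg ![Sum.inr 0, Sum.inr 1] (by decide)
          ![Equiv.swap 1 2, 1] (by decide) (by decide) φ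

theorem pm_treeA_13 (φ : Wt T M) : pm (Equiv.swap 1 3) (fl treeA φ) = - fl treeC φ := by
  rw [← fl_comp]
  exact fl_neg ![Sum.inr 1, Sum.inr 0] (by decide)
          ![Equiv.swap 1 2, 1] (by decide) (by decide) φ

theorem pm_treeB_13 (φ : Wt T M) : pm (Equiv.swap 1 3) (fl treeB φ) = - fl treeB φ := by
  rw [← fl_comp]
  exact fl_neg ![Sum.inr 0, Sum.inr 1] (by decide)
          ![1, Equiv.swap 1 2] (by decide) (by decide) φ

theorem pm_treeC_01 (φ : Wt T M) : pm (Equiv.swap 0 1) (fl treeC φ) = - fl treeB φ := by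
  rw [← pm_swap_swap 0 1 (fl treeB φ), pm_treeB_01, map_neg, neg_neg]

theorem pm_treeC_23 (φ : Wt T M) : pm (Equiv.swap 2 3) (fl treeC φ) = - fl treeB φ := by
  rw [← pm_swap_swap 2 3 (fl treeB φ), pm_treeB_23, map_neg, neg_neg]

theorem pm_treeB_12 (φ : Wt T M) : pm (Equiv.swap 1 2) (fl treeB φ) = - fl treeA φ := by
  rw [← pm_swap_swap 1 2 (fl treeA φ), pm_treeA_12, map_neg, neg_neg]

theorem pm_treeC_13 (φ : Wt T M) : pm (Equiv.swap 1 3) (fl treeC φ) = - fl treeA φ := by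
  rw [← pm_swap_swap 1 3 (fl treeA φ), pm_treeA_13, map_neg, neg_neg]

theorem isHole_treeB (φ : Wt T M) : IsHole (fl treeB φ) := by
  have h := ((isHole_treeA φ).perm 1 2).smul (-1)
  rwa [pm_treeA_12, smul_neg, neg_one_smul, neg_neg] at h

theorem isHole_treeC (φ : Wt T M) : IsHole (fl treeC φ) := by
  have h := ((isHole_treeA φ).perm 1 3).smul (-1)
  rwa [pm_treeA_13, smul_neg, neg_one_smul, neg_neg] at h

theorem rung_treeA (φ : Wt T M) : ap (rung 0 1) (fl treeA φ) = tElt • fl treeA φ := by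
  let q : Gad (Fin 4) (Fin 3) := .of 1 ![.inr 1, .inr 2, .inl (0, 1), .inl (0, 2)]
    ![(.inl (0, 0), .inr 0)] (by decide)
  have h1 : fl (q.comp tri) φ = fl ((rung 0 1).comp treeA) φ :=
    fl_pos (Sum.elim ![Sum.inr 1, Sum.inr 2] ![Sum.inr 0, Sum.inl 0]) (by decide)
          (Sum.elim ![Equiv.swap 0 1, Equiv.swap 0 2] ![1, 1]) (by decide) (by decide) φ
  have h2 : fl (q.comp Gad.vert) φ = fl treeA φ :=
    fl_pos ![Sum.inr 0, Sum.inl 0] (by decide)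
          ![1, 1] (by decide) (by decide) φ
  rw [fl_comp, fl_tri, map_smul, ← fl_comp, h2, fl_comp] at h1
  exact h1.symm

/-- Weights on the first four ports that behave like ladders, with `y` the scalar given by joining
two ports. -/
structure IsLad (y : Lam) (φ : Wt T M) (ψ : Wt (Fin 4 ⊕ T) M) : Prop where
  hole : IsHole ψ
  even : Even ψ
  join : ap join (pm (Equiv.swap 1 2) ψ) = y • fl Gad.vert φ

theorem IsLad.add {y z : Lam} {φ : Wt T M} {ψ χ : Wt (Fin 4 ⊕ T) M} (h : IsLad y φ ψ)
    (h' : IsLad z φ χ) : IsLad (y + z) φ (ψ + χ) :=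
  ⟨h.hole.add h'.hole, h.even.add h'.even, by rw [map_add, map_add, h.join, h'.join, add_smul]⟩

theorem IsLad.smul {y : Lam} {φ : Wt T M} {ψ : Wt (Fin 4 ⊕ T) M} (h : IsLad y φ ψ) (r : Lam) :
    IsLad (r * y) φ (r • ψ) :=
  ⟨h.hole.smul r, h.even.smul r, by rw [map_smul, map_smul, h.join, smul_smul]⟩

/-- The effect of a rung on a ladder of another type. -/
theorem IsLad.rung_cross {y : Lam} {φ : Wt T M} {ψ : Wt (Fin 4 ⊕ T) M} (h : IsLad y φ ψ) :
    (2 : Lam) • ap (rung 0 1) (pm (Equiv.swap 1 2) ψ) =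
      (2 * tElt) • (pm (Equiv.swap 1 2) ψ + pm (Equiv.swap 1 3) ψ - ψ)
      - (pm (Equiv.swap 1 2) (ap (rung 0 1) ψ) + pm (Equiv.swap 1 3) (ap (rung 0 1) ψ)
        - ap (rung 0 1) ψ) + (2 * y) • fl treeB φ := by
  have sA := h.hole.sum_rung
  have sB := (h.hole.perm 1 2).sum_rung
  have sC := (h.hole.perm 1 3).sum_rung
  have rB : ap (rung 0 2) (pm (Equiv.swap 1 2) ψ) = pm (Equiv.swap 1 2) (ap (rung 0 1) ψ) :=
    rung_pm 1 2 0 2 _ ψ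
  have rC : ap (rung 0 3) (pm (Equiv.swap 1 3) ψ) = pm (Equiv.swap 1 3) (ap (rung 0 1) ψ) :=
    rung_pm 1 3 0 3 _ ψ
  have cA := rung_sub_swap (pm (Equiv.swap 1 2) ψ)
  rw [h.join, map_smul, split_vert, pm_pm, h.even.pm_eq (σ := Equiv.swap 1 2 * Equiv.swap 0 1)
    (τ := Equiv.swap 1 3) (by decide)] at cA
  have cB := congrArg (pm (Equiv.swap 1 2)) cA
  have cC := congrArg (pm (Equiv.swap 1 3)) cA
  have b1 : ap (rung 0 2) (pm (Equiv.swap 1 2) (pm (Equiv.swap 1 2) ψ))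
      = pm (Equiv.swap 1 2) (ap (rung 0 1) (pm (Equiv.swap 1 2) ψ)) := rung_pm 1 2 0 2 _ _
  have b2 : ap (rung 0 2) (pm (Equiv.swap 1 2) (pm (Equiv.swap 1 3) ψ))
      = pm (Equiv.swap 1 2) (ap (rung 0 1) (pm (Equiv.swap 1 3) ψ)) := rung_pm 1 2 0 2 _ _
  have c1 : ap (rung 0 3) (pm (Equiv.swap 1 3) (pm (Equiv.swap 1 2) ψ))
      = pm (Equiv.swap 1 3) (ap (rung 0 1) (pm (Equiv.swap 1 2) ψ)) := rung_pm 1 3 0 3 _ _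
  have c2 : ap (rung 0 3) (pm (Equiv.swap 1 3) (pm (Equiv.swap 1 3) ψ))
      = pm (Equiv.swap 1 3) (ap (rung 0 1) (pm (Equiv.swap 1 3) ψ)) := rung_pm 1 3 0 3 _ _
  rw [map_sub, ← b1, ← b2, pm_swap_swap, pm_pm, h.even.pm_eq
    (σ := Equiv.swap 1 3 * Equiv.swap 1 2) (τ := Equiv.swap 1 3) (by decide), map_neg, map_smul, pm_treeA_12] at cB
  rw [map_sub, ← c1, ← c2, pm_swap_swap, pm_pm, h.even.pm_eq
    (σ := Equiv.swap 1 2 * Equiv.swap 1 3) (τ := Equiv.swap 1 2) (by decide), map_neg, map_smul, pm_treeA_13] at cC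
  have ht := fl_tree φ
  rw [rB] at sB
  rw [rC] at sC
  linear_combination (norm := module) sB + sC - sA + cB + cA - cC - y • ht

/-- Joining the ports `1` and `3` at a vertex. -/
abbrev brk : Gad (Fin 3) (Fin 4) := .of 1 ![.inr 0, .inl (0, 0), .inr 2]
  ![(.inl (0, 1), .inr 3), (.inl (0, 2), .inr 1)] (by decide)

theorem ap_join_eq (φ : Wt (Fin 4 ⊕ T) M) :
    ap join (pm (Equiv.swap 1 2) φ) = - ap (Gad.ren (Equiv.swap 0 1))
      (ap brk (pm (Equiv.swap 0 1) (pm (Equiv.swap 2 3) φ))) := by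
  rw [← ap_comp, ← ap_comp, ← ap_comp, ← ap_comp]
  exact ap_neg (Sum.elim (Sum.elim (Sum.elim Empty.elim ![Sum.inl 0]) Empty.elim) Empty.elim) (by decide)
          (Sum.elim (Sum.elim (Sum.elim Empty.elim ![Equiv.swap 1 2]) Empty.elim) Empty.elim) (by decide) (by decide) φ

/-- A rung between two of three ports. -/
abbrev rungV : Gad (Fin 3) (Fin 3) := .of 2 ![.inl (0, 1), .inl (1, 2), .inr 2]
  ![(.inl (0, 0), .inl (1, 0)), (.inl (0, 2), .inr 0), (.inl (1, 1), .inr 1)] (by decide)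

theorem rungV_vert (φ : Wt T M) : ap rungV (fl Gad.vert φ) = tElt • fl Gad.vert φ := by
  rw [← fl_comp, ← fl_tri]
  exact fl_pos ![Sum.inl 0, Sum.inl 1, Sum.inr 0] (by decide)
          ![Equiv.swap 0 1, Equiv.swap 0 2, (finRotate 3)⁻¹] (by decide) (by decide) φ

theorem brk_rung (φ : Wt (Fin 4 ⊕ T) M) :
    ap brk (ap (rung 0 1) φ) + ap brk (ap (rung 0 3) φ) = ap rungV (ap brk φ) := by
  let k : Gad (Fin 3) (Fin 4 ⊕ Fin 4) := .of 1 ![.inl (0, 1), .inr (.inl 0), .inr (.inr 2)]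
    ![(.inl (0, 0), .inr (.inl 2)), (.inl (0, 2), .inr (.inr 0)), (.inr (.inl 1), .inr (.inr 3)),
      (.inr (.inl 3), .inr (.inr 1))] (by decide)
  have kA : ap (k.comp (treeA.fill (Fin 4))) φ = ap (brk.comp (rung 0 1)) φ :=
    ap_pos (Sum.elim ![Sum.inr 0] ![Sum.inl 0, Sum.inr 1]) (by decide)
          (Sum.elim ![finRotate 3] ![1, finRotate 3]) (by decide) (by decide) φ
  have kB : ap (k.comp (treeB.fill (Fin 4))) φ = - ap (rungV.comp brk) φ :=
    ap_neg (Sum.elim ![Sum.inl 0, Sum.inr 0] ![Sum.inr 1]) (by decide)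
          (Sum.elim ![1, Equiv.swap 0 1] ![1]) (by decide) (by decide) φ
  have kC : ap (k.comp (treeC.fill (Fin 4))) φ = ap (brk.comp (rung 0 3)) φ :=
    ap_pos (Sum.elim ![Sum.inr 1] ![Sum.inl 0, Sum.inr 0]) (by decide)
          (Sum.elim ![Equiv.swap 0 1] ![1, Equiv.swap 0 2]) (by decide) (by decide) φ
  have h1 := congrArg (ap k) (ap_tree φ)
  rw [map_add, map_add, map_zero, ← ap_comp, ← ap_comp, ← ap_comp, kA, kB, kC, ap_comp,
    ap_comp, ap_comp] at h1
  linear_combination (norm := module) h1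

theorem brk_swap_01 (φ : Wt (Fin 4 ⊕ T) M) : ap (Gad.ren (Equiv.swap 0 1))
    (ap brk (ap (rung 0 3) φ)) = - ap brk (ap (rung 0 3) (pm (Equiv.swap 0 1) φ)) := by
  rw [← ap_comp, ← ap_comp, ← ap_comp, ← ap_comp]
  exact ap_neg (Sum.elim (Sum.elim ![Sum.inr 0] ![Sum.inl (Sum.inr 0), Sum.inr 1]) Empty.elim) (by decide)
          (Sum.elim (Sum.elim ![Equiv.swap 0 1] ![Equiv.swap 0 1, Equiv.swap 0 2]) Empty.elim) (by decide) (by decide) φ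

theorem brk_swap_02 (φ : Wt (Fin 4 ⊕ T) M) : ap (Gad.ren (Equiv.swap 0 2)) (ap brk φ)
    = - ap brk (pm (Equiv.swap 0 2) (pm (Equiv.swap 1 3) φ)) := by
  rw [← ap_comp, ← ap_comp, ← ap_comp]
  exact ap_neg (Sum.elim (Sum.elim ![Sum.inr 0] Empty.elim) Empty.elim) (by decide)
          (Sum.elim (Sum.elim ![Equiv.swap 1 2] Empty.elim) Empty.elim) (by decide) (by decide) φ

theorem brk_treeA (φ : Wt T M) : ap brk (fl treeA φ) = -(tElt • fl Gad.vert φ) := by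
  rw [← fl_comp, ← fl_tri]
  exact fl_neg ![Sum.inr 0, Sum.inl 0, Sum.inr 1] (by decide)
          ![finRotate 3, 1, Equiv.swap 0 1] (by decide) (by decide) φ

theorem brk_treeB (φ : Wt T M) : ap brk (fl treeB φ) = (2 * tElt) • fl Gad.vert φ := by
  have h1 : fl (brk.comp treeB) φ = fl ((Gad.ren (finRotate 3).symm).comp (bubV.comp Gad.vert)) φ :=
    fl_pos (Sum.elim Empty.elim (Sum.elim ![Sum.inl 0, Sum.inr 1] (fun _ => Sum.inr 0))) (by decide)
          (Sum.elim Empty.elim (Sum.elim ![1, 1] (fun _ => 1))) (by decide) (by decide) φ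
  have h2 : fl ((Gad.ren (finRotate 3).symm).comp Gad.vert) φ = fl Gad.vert φ :=
    fl_pos (fun _ => Sum.inr 0) (by decide)
          (fun _ => (finRotate 3)⁻¹) (by decide) (by decide) φ
  rw [fl_comp, fl_comp _ (bubV.comp Gad.vert), fl_bubV, map_smul, ← fl_comp _ Gad.vert, h2] at h1
  exact h1

end rungs

/-! ### Ladders -/

section ladders
variable {T : Type} {M : Type 1} [AddCommGroup M] [Module Lam M]

/-- A rung between the first two ports, oriented as in the graphs `xGraph`. -/
abbrev rungX : Gad (Fin 4) (Fin 4) := .of 2 ![.inl (0, 0), .inl (1, 1), .inr 2, .inr 3]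
  ![(.inl (0, 1), .inl (1, 0)), (.inl (0, 2), .inr 0), (.inl (1, 2), .inr 1)] (by decide)

/-- A tree, oriented as in the graphs `xGraph`. -/
abbrev treeX : Gad (Fin 4) Empty := .of 2 ![.inl (0, 0), .inl (1, 1), .inl (0, 2), .inl (1, 2)]
  ![(.inl (0, 1), .inl (1, 0))] (by decide)

/-- The ladder with `m + 1` rungs. -/
def lad : ℕ → Gad (Fin 4) Empty
  | 0 => treeX
  | m + 1 => rungX.comp (lad m)

theorem ap_rungX (φ : Wt (Fin 4 ⊕ T) M) : ap rungX φ = ap (rung 0 1) φ :=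
  ap_pos ![0, 1] (by decide) ![Equiv.swap 0 1, Equiv.swap 1 2] (by decide) (by decide) φ

theorem fl_treeX (φ : Wt T M) : fl treeX φ = fl treeB φ :=
  fl_pos ![0, 1] (by decide) ![finRotate 3, 1] (by decide) (by decide) φ

theorem fl_lad (m : ℕ) (φ : Wt T M) : fl (lad m) φ = (ap (rung 0 1))^[m] (fl treeB φ) := by
  induction m with
  | zero => exact fl_treeX φ
  | succ m ih =>
    rw [Function.iterate_succ_apply', ← ih, ← ap_rungX]
    exact fl_comp _ _ φ

/-- The edges of the graphs `xGraph` that follow the ladder. -/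
inductive Link : (Bool × ℕ) × Fin 3 → (Bool × ℕ) × Fin 3 → Prop
  | rung (i : ℕ) : Link ((false, i), 1) ((true, i), 0)
  | path (i : ℕ) : Link ((false, i), 2) ((false, i + 1), 0)
  | cycle (i : ℕ) : Link ((true, i), 2) ((true, i + 1), 1)

/-- The position of a vertex of a ladder. -/
def ladV : (m k : ℕ) → (lad m).N → Bool × ℕ
  | 0, k => ![(false, k), (true, k)]
  | m + 1, k => Sum.elim ![(false, k), (true, k)] (ladV m (k + 1))

/-- The position of an end of a ladder. -/
def ladH (m k : ℕ) : ((lad m).N × Fin 3) ⊕ Empty → (Bool × ℕ) × Fin 3 :=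
  Sum.elim (Prod.map (ladV m k) id) Empty.elim

theorem ladH_emb (m k : ℕ) (y : ((lad m).N × Fin 3) ⊕ Empty) :
    ladH (m + 1) k ((lad m).emb (Fin 2) y) = ladH m (k + 1) y := by
  rcases y with ⟨v, s⟩ | y
  · rfl
  · exact y.elim

theorem lad_port (m k : ℕ) (a : Fin 4) : ladH m k ((lad m).E (Sum.inl a)) =
    ![((false, k), 0), ((true, k), 1), ((false, k + m), 2), ((true, k + m), 2)] a := by
  induction m generalizing k a with
  | zero => fin_cases a <;> rfl
  | succ m ih =>
    have h : (lad (m + 1)).E (Sum.inl a) = (lad m).inj _ (rungX.E (Sum.inl a)) :=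
      Gad.comp_inl rungX (lad m) a
    rw [h]
    have key : ∀ a, ladH (m + 1) k ((lad m).inj (Fin 2) (Sum.inr a))
        = ladH m (k + 1) ((lad m).E (Sum.inl a)) := fun a => ladH_emb m k _
    fin_cases a
    · rfl
    · rfl
    · exact (key 2).trans ((ih (k + 1) 2).trans (by simp; omega))
    · exact (key 3).trans ((ih (k + 1) 3).trans (by simp; omega))

theorem lad_edge (m k : ℕ) (r : (lad m).R) :
    Link (ladH m k ((lad m).E (Sum.inr r))) (ladH m k ((lad m).E (Sum.inr ((lad m).D r)))) ∨
    Link (ladH m k ((lad m).E (Sum.inr ((lad m).D r)))) (ladH m k ((lad m).E (Sum.inr r))) := by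
  induction m generalizing k with
  | zero =>
    obtain ⟨i, b⟩ := r
    fin_cases i; cases b
    · exact Or.inr (Link.rung k)
    · exact Or.inl (Link.rung k)
  | succ m ih =>
    have key : ∀ a, ladH (m + 1) k ((lad m).inj (Fin 2) (Sum.inr a))
        = ladH m (k + 1) ((lad m).E (Sum.inl a)) := fun a => ladH_emb m k _
    rcases r with ⟨i, b⟩ | r
    · have h : ∀ r, (lad (m + 1)).E (Sum.inr (Sum.inl r)) = (lad m).inj _ (rungX.E (Sum.inr r)) :=
        Gad.comp_inr_inl rungX (lad m)
      have h' : (lad (m + 1)).D (Sum.inl (i, b)) = Sum.inl (i, !b) := rfl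
      rw [h', h, h]
      have k0 : ladH (m + 1) k ((lad m).inj (Fin 2) (Sum.inr 0)) = ((false, k + 1), 0) :=
        (key 0).trans (lad_port m (k + 1) 0)
      have k1 : ladH (m + 1) k ((lad m).inj (Fin 2) (Sum.inr 1)) = ((true, k + 1), 1) :=
        (key 1).trans (lad_port m (k + 1) 1)
      fin_cases i <;> cases b
      · exact Or.inr (Link.rung k)
      · exact Or.inl (Link.rung k)
      · right; have := Link.path k; rw [← k0] at this; exact this
      · left; have := Link.path k; rw [← k0] at this; exact this
      · right; have := Link.cycle k; rw [← k1] at this; exact this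
      · left; have := Link.cycle k; rw [← k1] at this; exact this
    · have h : ∀ r, (lad (m + 1)).E (Sum.inr (Sum.inr r)) = (lad m).emb _ ((lad m).E (Sum.inr r)) :=
        Gad.comp_inr_inr rungX (lad m)
      have h' : (lad (m + 1)).D (Sum.inr r) = Sum.inr ((lad m).D r) := rfl
      rw [h', h, h]
      have := ih (k + 1) r
      rw [← ladH_emb, ← ladH_emb] at this
      exact this

theorem ladV_bound (m k : ℕ) (v : (lad m).N) : k ≤ (ladV m k v).2 ∧ (ladV m k v).2 ≤ k + m := by
  induction m generalizing k with
  | zero => revert v; show ∀ v : Fin 2, _; intro v; fin_cases v <;> exact ⟨le_rfl, le_rfl⟩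
  | succ m ih =>
    rcases v with v | v
    · revert v; show ∀ v : Fin 2, _
      intro v; fin_cases v <;> exact ⟨le_rfl, Nat.le_add_right _ _⟩
    · have := ih (k + 1) v
      show k ≤ (ladV m (k + 1) v).2 ∧ (ladV m (k + 1) v).2 ≤ _
      omega

theorem ladV_inj (m k : ℕ) : Function.Injective (ladV m k) := by
  have base : ∀ k : ℕ, Function.Injective (![(false, k), (true, k)] : Fin 2 → Bool × ℕ) := by
    intro k v w h; fin_cases v <;> fin_cases w <;> simp at h ⊢
  have val : ∀ (k : ℕ) (v : Fin 2), ((![(false, k), (true, k)] : Fin 2 → Bool × ℕ) v).2 = k := by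
    intro k v; fin_cases v <;> rfl
  induction m generalizing k with
  | zero => exact base k
  | succ m ih =>
    rintro (v | v) (w | w) h
    · exact congrArg _ (base k h)
    · have h1 := (ladV_bound m (k + 1) w).1
      have h2 : (ladV m (k + 1) w).2 = k := (congrArg Prod.snd h.symm).trans (val k v)
      omega
    · have h1 := (ladV_bound m (k + 1) v).1
      have h2 : (ladV m (k + 1) v).2 = k := (congrArg Prod.snd h).trans (val k w)
      omega
    · exact congrArg _ (ih (k + 1) h)

theorem ladV_surj (m k : ℕ) (b : Bool) (i : ℕ) (h1 : k ≤ i) (h2 : i ≤ k + m) :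
    ∃ v, ladV m k v = (b, i) := by
  have base : ∀ k : ℕ, ∃ v, (![(false, k), (true, k)] : Fin 2 → Bool × ℕ) v = (b, k) := by
    intro k; cases b
    · exact ⟨0, rfl⟩
    · exact ⟨1, rfl⟩
  induction m generalizing k with
  | zero => obtain rfl : k = i := by omega
            exact base k
  | succ m ih =>
    rcases h1.eq_or_lt with rfl | h
    · obtain ⟨v, hv⟩ := base k
      exact ⟨Sum.inl v, hv⟩
    · obtain ⟨v, hv⟩ := ih (k + 1) h (by omega)
      exact ⟨Sum.inr v, hv⟩

/-- The ladder closed as in the graphs `xGraph`. -/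
abbrev xg (m : ℕ) : Gad (Fin 3) Empty := brk.comp (lad m)

/-- The vertex of `xGraph` at a given position. -/
def xV (m : ℕ) (x : Bool × ℕ) : Fin (m + 1) ⊕ Fin (m + 2) :=
  cond x.1 (Sum.inr (Fin.ofNat (m + 2) x.2)) (Sum.inl (Fin.ofNat (m + 1) x.2))

theorem xFun_link (m : ℕ) {x y : (Bool × ℕ) × Fin 3} (h : Link x y) (hx : x.1.2 ≤ m)
    (hy : y.1.2 ≤ cond y.1.1 (m + 1) m) :
    xFun m (Sum.inl (xV m x.1, x.2)) = Sum.inl (xV m y.1, y.2) := by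
  cases h with
  | rung i =>
    simp only [xV, cond_true, cond_false, xFun] at hx ⊢
    congr 3; apply Fin.ext
    simp only [Fin.val_castSucc, Fin.val_ofNat]
    rw [Nat.mod_eq_of_lt (by omega), Nat.mod_eq_of_lt (by omega)]
  | path i =>
    simp only [cond_false] at hx hy
    have : Fin.ofNat (m + 1) i ≠ Fin.last m := by
      intro h; have := congrArg Fin.val h
      simp only [Fin.val_ofNat, Fin.val_last] at this
      rw [Nat.mod_eq_of_lt (by omega)] at this; omega
    simp only [xV, cond_false, xFun, if_neg this]
    congr 3; apply Fin.ext
    simp [Fin.val_add]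
  | cycle i =>
    simp only [xV, cond_true, xFun]
    congr 3; apply Fin.ext
    simp [Fin.val_add]

/-- The position of a vertex of the closed ladder. -/
def xgV (m : ℕ) : (xg m).N → Bool × ℕ := Sum.elim (fun _ => (true, m + 1)) (ladV m 0)

theorem xgV_bound (m : ℕ) (v : (xg m).N) : (xgV m v).2 ≤ cond (xgV m v).1 (m + 1) m := by
  rcases v with v | v
  · exact le_rfl
  · have := (ladV_bound m 0 v).2
    show (ladV m 0 v).2 ≤ cond (ladV m 0 v).1 (m + 1) m
    cases (ladV m 0 v).1 <;> simp <;> omega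

theorem xgV_inj (m : ℕ) : Function.Injective (xgV m) := by
  rintro (v | v) (w | w) h
  · exact congrArg _ (Subsingleton.elim _ _)
  · have h1 := (ladV_bound m 0 w).2
    have h2 : m + 1 = (ladV m 0 w).2 := congrArg Prod.snd h
    omega
  · have h1 := (ladV_bound m 0 v).2
    have h2 : (ladV m 0 v).2 = m + 1 := congrArg Prod.snd h
    omega
  · exact congrArg _ (ladV_inj m 0 h)

theorem xV_inj (m : ℕ) (x y : Bool × ℕ) (hv : x.2 ≤ cond x.1 (m + 1) m)
    (hw : y.2 ≤ cond y.1 (m + 1) m) (h : xV m x = xV m y) : x = y := by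
  obtain ⟨b, i⟩ := x
  obtain ⟨c, j⟩ := y
  cases b <;> cases c
  · have h := congrArg Fin.val (Sum.inl.inj h)
    simp only [Fin.val_ofNat, cond_false] at h hv hw
    rw [Nat.mod_eq_of_lt (by omega), Nat.mod_eq_of_lt (by omega)] at h
    rw [h]
  · cases h
  · cases h
  · have h := congrArg Fin.val (Sum.inr.inj h)
    simp only [Fin.val_ofNat, cond_true] at h hv hw
    rw [Nat.mod_eq_of_lt (by omega), Nat.mod_eq_of_lt (by omega)] at h
    rw [h]

theorem xV_bij (m : ℕ) : Function.Bijective (fun v => xV m (xgV m v)) := by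
  constructor
  · intro v w h
    apply xgV_inj m
    exact xV_inj m _ _ (xgV_bound m v) (xgV_bound m w) h
  · have key : ∀ {n : ℕ} (i : Fin (n + 1)), Fin.ofNat (n + 1) i = i := by
      intro n i; apply Fin.ext; simp only [Fin.val_ofNat]; exact Nat.mod_eq_of_lt i.2
    rintro (i | i)
    · obtain ⟨v, hv⟩ := ladV_surj m 0 false i (Nat.zero_le _) (by omega)
      refine ⟨Sum.inr v, ?_⟩
      show xV m (ladV m 0 v) = _
      rw [hv]; exact congrArg Sum.inl (key i)
    · rcases Nat.lt_or_ge i (m + 1) with h | h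
      · obtain ⟨v, hv⟩ := ladV_surj m 0 true i (Nat.zero_le _) (by omega)
        refine ⟨Sum.inr v, ?_⟩
        show xV m (ladV m 0 v) = _
        rw [hv]; exact congrArg Sum.inr (key i)
      · refine ⟨Sum.inl 0, ?_⟩
        have : i = Fin.last (m + 1) := Fin.ext (by have := i.2; simp; omega)
        rw [this]
        exact congrArg Sum.inr (key (Fin.last (m + 1)))

/-- The identification of the vertices of the closed ladder with those of `xGraph`. -/
def xgE (m : ℕ) : (xg m).N ≃ Fin (m + 1) ⊕ Fin (m + 2) := Equiv.ofBijective _ (xV_bij m)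

theorem graph_xg (m : ℕ) : (xg m).graph = (xPair m).map (xt (onV (xgE m).symm)) := by
  have hap : ∀ y : Pts (xg m).N (Fin 3), (xPair m).map (xt (onV (xgE m).symm)) y =
      xt (onV (xgE m).symm) (xFun m (xt (onV (xgE m)) y)) := by
    intro y
    have h := Pairing.map_apply (xPair m) (xt (onV (xgE m).symm)) (xt (onV (xgE m)) y)
    have h' : xt (onV (xgE m).symm) (xt (onV (xgE m)) y) = y := by
      rcases y with ⟨v, s⟩ | y
      · exact congrArg Sum.inl (Prod.ext ((xgE m).symm_apply_apply v) rfl)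
      · rfl
    rw [h'] at h
    exact h
  have hin : ∀ x y, xFun m x = xt (onV (xgE m)) y →
      xt (onV (xgE m).symm) (xFun m x) = y := by
    intro x y h
    rw [h]
    rcases y with ⟨v, s⟩ | y
    · exact congrArg Sum.inl (Prod.ext ((xgE m).symm_apply_apply v) rfl)
    · rfl
  let Z : ((xg m).N × Fin 3) ⊕ Empty → (Bool × ℕ) × Fin 3 :=
    Sum.elim (Prod.map (xgV m) id) Empty.elim
  have hZ : ∀ y, xt (onV (xgE m)) (Sum.map id Empty.elim y : Pts (xg m).N (Fin 3))
      = Sum.inl (xV m (Z y).1, (Z y).2) := by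
    rintro (⟨v, s⟩ | y)
    · rfl
    · exact y.elim
  have hemb : ∀ y, Z ((lad m).emb (Fin 1) y) = ladH m 0 y := by
    rintro (⟨v, s⟩ | y)
    · rfl
    · exact y.elim
  have hbd : ∀ y, (Z y).1.2 ≤ cond (Z y).1.1 (m + 1) m := by
    rintro (⟨v, s⟩ | y)
    · exact xgV_bound m v
    · exact y.elim
  have port : ∀ a, Z ((lad m).inj (Fin 1) (Sum.inr a)) = _ := fun a =>
    (hemb _).trans (lad_port m 0 a)
  have key : ∀ {y z : ((xg m).N × Fin 3) ⊕ Empty}, xFun m (Sum.inl (xV m (Z y).1, (Z y).2))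
      = Sum.inl (xV m (Z z).1, (Z z).2) →
      (xPair m).map (xt (onV (xgE m).symm)) (Sum.map id Empty.elim y) = Sum.map id Empty.elim z := by
    intro y z h
    rw [hap, hZ]
    apply hin
    rw [h, hZ]
  have flp : ∀ {y z : ((xg m).N × Fin 3) ⊕ Empty}, xFun m (Sum.inl (xV m (Z y).1, (Z y).2))
      = Sum.inl (xV m (Z z).1, (Z z).2) → xFun m (Sum.inl (xV m (Z z).1, (Z z).2))
      = Sum.inl (xV m (Z y).1, (Z y).2) := by
    intro y z h; rw [← h, xFun_invol]
  have lnk : ∀ {y z : ((xg m).N × Fin 3) ⊕ Empty}, Link (Z y) (Z z) → (Z y).1.2 ≤ m →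
      xFun m (Sum.inl (xV m (Z y).1, (Z y).2)) = Sum.inl (xV m (Z z).1, (Z z).2) :=
    fun {y z} h hy => xFun_link m h hy (hbd z)
  have hlast : ∀ n : ℕ, Fin.ofNat (n + 1) n = Fin.last n := by
    intro n; apply Fin.ext; simp
  apply Gad.graph_eq
  · intro a
    rw [Gad.comp_inl, hap]
    apply hin
    rw [hZ]
    fin_cases a
    · show Sum.inl (Sum.inl 0, 0) = Sum.inl (xV m (Z ((lad m).inj (Fin 1) (Sum.inr 0))).1,
        (Z ((lad m).inj (Fin 1) (Sum.inr 0))).2)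
      rw [port 0]; rfl
    · show Sum.inl (Sum.inr (Fin.last (m + 1)), 0) = Sum.inl (Sum.inr (Fin.ofNat (m + 2) (m + 1)), 0)
      rw [hlast]
    · show Sum.inl (Sum.inl (Fin.last m), 2) = Sum.inl (xV m (Z ((lad m).inj (Fin 1) (Sum.inr 2))).1,
        (Z ((lad m).inj (Fin 1) (Sum.inr 2))).2)
      rw [port 2]
      show _ = Sum.inl (Sum.inl (Fin.ofNat (m + 1) (0 + m)), 2)
      rw [Nat.zero_add, hlast]
  · rintro (⟨i, b⟩ | r)
    · have h' : (xg m).D (Sum.inl (i, b)) = Sum.inl (i, !b) := rfl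
      rw [h', Gad.comp_inr_inl, Gad.comp_inr_inl]
      apply key
      have e0 : xFun m (Sum.inl (xV m (Z ((lad m).inj (Fin 1) (Sum.inr 3))).1,
          (Z ((lad m).inj (Fin 1) (Sum.inr 3))).2)) = Sum.inl (xV m (true, m + 1), 1) := by
        rw [port 3]
        have := xFun_link m (Link.cycle (0 + m)) (by simp) (by simp)
        simpa using this
      have e1 : xFun m (Sum.inl (xV m (true, m + 1), 2)) =
          Sum.inl (xV m (Z ((lad m).inj (Fin 1) (Sum.inr 1))).1,
          (Z ((lad m).inj (Fin 1) (Sum.inr 1))).2) := by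
        rw [port 1]
        show Sum.inl (Sum.inr (Fin.ofNat (m + 2) (m + 1) + 1), 1) = Sum.inl (Sum.inr _, _)
        rw [hlast, Fin.last_add_one]; rfl
      fin_cases i <;> cases b
      · exact e0
      · exact flp (y := (lad m).inj (Fin 1) (Sum.inr 3)) (z := Sum.inl (Sum.inl 0, 1)) e0
      · exact flp (y := Sum.inl (Sum.inl 0, 2)) (z := (lad m).inj (Fin 1) (Sum.inr 1)) e1
      · exact e1
    · have h' : (xg m).D (Sum.inr r) = Sum.inr ((lad m).D r) := rfl
      rw [h', Gad.comp_inr_inr, Gad.comp_inr_inr]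
      apply key
      have hb : ∀ y, (Z ((lad m).emb (Fin 1) y)).1.2 ≤ m := by
        rintro (⟨v, s⟩ | y)
        · have := (ladV_bound m 0 v).2
          rw [Nat.zero_add] at this; exact this
        · exact y.elim
      have := lad_edge m 0 r
      rw [← hemb, ← hemb] at this
      rcases this with h | h
      · exact lnk h (hb _)
      · exact flp (lnk h (hb _))

theorem conn_xg (m : ℕ) : Conn (n := 3) (xg m).graph := by
  rw [graph_xg]
  exact conn_onV (n := 3) (xgE m).symm (xPair_conn m)

theorem cls_xg (m : ℕ) : (xg m).cls = (xGraph m).cls := by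
  rw [Gad.cls, graph_xg]
  exact (rcls_iso (n := 3) (xgE m).symm (xPair m)).trans (rcls_graph (xGraph m))

end ladders

/-! ### Ladders as elements of `Lam` -/

section values
variable {T : Type} {M : Type 1} [AddCommGroup M] [Module Lam M]

theorem cls_of_fl {f : Gad (Fin 3) Empty} {a : Lam}
    (h : fl f openWt = a • fl Gad.vert openWt) : f.cls = a := by
  rw [cls_eq, h]
  show a • (fl Gad.vert openWt).1 ⟨Empty, endsP⟩ = _
  rw [← cls_eq, Gad.cls_vert]
  exact congrArg Subtype.val (mul_one a)

theorem ap_ren_ren (σ τ : Equiv.Perm (Fin 3)) (φ : Wt (Fin 3 ⊕ T) M) :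
    ap (Gad.ren σ) (ap (Gad.ren τ) φ) = ap (Gad.ren (τ * σ)) φ := by
  rw [← ap_comp]
  exact pull_iso (g := (Gad.ren (τ * σ)).left T) (g' := ((Gad.ren σ).comp (Gad.ren τ)).left T)
    (Equiv.sumEmpty _ _).symm ⟨by rintro (a | a) <;> rfl, fun r => r.elim⟩ φ

theorem ren_swap_of {φ : Wt (Fin 3 ⊕ T) M} (h1 : ap (Gad.ren (Equiv.swap 0 1)) φ = - φ)
    (h2 : ap (Gad.ren (Equiv.swap 0 2)) φ = - φ) (i j : Fin 3) (hij : i ≠ j) :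
    ap (Gad.ren (Equiv.swap i j)) φ = - φ := by
  have h3 : ap (Gad.ren (Equiv.swap 1 2)) φ = - φ := by
    have e : Equiv.swap (1 : Fin 3) 2 = Equiv.swap 0 1 * Equiv.swap 0 2 * Equiv.swap 0 1 := by
      decide
    rw [e, ← ap_ren_ren, ← ap_ren_ren, h1, map_neg, h2, neg_neg, h1]
  fin_cases i <;> fin_cases j <;> first | exact absurd rfl hij | skip
  · exact h1
  · exact h2
  · rw [Equiv.swap_comm]; exact h1
  · exact h3
  · rw [Equiv.swap_comm]; exact h2
  · rw [Equiv.swap_comm]; exact h3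

theorem ren_swap_vert (φ : Wt T M) (i j : Fin 3) (h : i ≠ j) :
    ap (Gad.ren (Equiv.swap i j)) (fl Gad.vert φ) = - fl Gad.vert φ := by
  rw [← fl_comp]
  exact fl_neg (g := Gad.vert) (g' := (Gad.ren (Equiv.swap i j)).comp Gad.vert)
    (fun _ => Sum.inr ()) (by decide +revert) (fun _ => Equiv.swap i j) (by decide +revert)
    (by decide +revert) φ

/-- The rung operator. -/
abbrev rg : Module.End Lam (Wt (Fin 4 ⊕ T) M) := ap (rung 0 1)

theorem rg_pm_01 (φ : Wt (Fin 4 ⊕ T) M) :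
    rg (pm (Equiv.swap 0 1) φ) = pm (Equiv.swap 0 1) (rg φ) := by
  have e : ap (rung 0 1) (pm (Equiv.swap 0 1) φ) = pm (Equiv.swap 0 1) (ap (rung 1 0) φ) :=
    rung_pm 0 1 0 1 _ φ
  rwa [rung_symm 0 1 (by decide)] at e

theorem rg_pm_02_13 {φ : Wt (Fin 4 ⊕ T) M} (h : IsHole φ) :
    rg (pm (Equiv.swap 0 2) (pm (Equiv.swap 1 3) φ))
      = pm (Equiv.swap 0 2) (pm (Equiv.swap 1 3) (rg φ)) := by
  have e : ap (rung 0 1) (pm (Equiv.swap 0 2) (pm (Equiv.swap 1 3) φ))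
      = pm (Equiv.swap 0 2) (ap (rung 2 1) (pm (Equiv.swap 1 3) φ)) := rung_pm 0 2 0 1 _ _
  have e' : ap (rung 2 1) (pm (Equiv.swap 1 3) φ) = pm (Equiv.swap 1 3) (ap (rung 2 3) φ) :=
    rung_pm 1 3 2 1 _ φ
  rwa [e', h.rung_two_three] at e

theorem pm_treeB_02 (φ : Wt T M) : pm (Equiv.swap 0 2) (fl treeB φ) = - fl treeB φ := by
  rw [← fl_comp]
  exact fl_neg ![Sum.inr 0, Sum.inr 1] (by decide)
          ![Equiv.swap 1 2, 1] (by decide) (by decide) φ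

theorem pm_treeA_02 (φ : Wt T M) : pm (Equiv.swap 0 2) (fl treeA φ) = - fl treeC φ := by
  rw [← fl_comp]
  exact fl_neg ![Sum.inr 0, Sum.inr 1] (by decide)
          ![Equiv.swap 1 2, 1] (by decide) (by decide) φ

theorem brk_pm_13 (φ : Wt (Fin 4 ⊕ T) M) : ap brk (pm (Equiv.swap 1 3) φ) = - ap brk φ := by
  rw [← ap_comp]
  exact ap_neg ![Sum.inl 0] (by decide)
          ![Equiv.swap 1 2] (by decide) (by decide) φ

theorem isHole_pow {φ : Wt (Fin 4 ⊕ T) M} (h : IsHole φ) (n : ℕ) : IsHole ((rg ^ n) φ) := by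
  induction n with
  | zero => exact h
  | succ n ih => rw [pow_succ', Module.End.mul_apply]; exact ih.rg

theorem even_pow {φ : Wt (Fin 4 ⊕ T) M} (h : Even φ) (hh : IsHole φ) (n : ℕ) :
    Even ((rg ^ n) φ) := by
  induction n with
  | zero => exact h
  | succ n ih => rw [pow_succ', Module.End.mul_apply]; exact ih.rg (isHole_pow hh n)

theorem pow_rung_treeA (n : ℕ) (φ : Wt T M) :
    (rg ^ n) (fl treeA φ) = tElt ^ n • fl treeA φ := by
  induction n with
  | zero => rw [pow_zero, pow_zero, one_smul]; rfl
  | succ n ih =>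
    rw [pow_succ', Module.End.mul_apply, ih, map_smul, rung_treeA, smul_smul, pow_succ]

theorem pow_rung_swap (n : ℕ) (φ : Wt T M) : (rg ^ n) (fl treeB φ)
    - pm (Equiv.swap 0 1) ((rg ^ n) (fl treeB φ)) = -(tElt ^ n • fl treeA φ) := by
  rw [← pow_rung_treeA]
  have h : pm (Equiv.swap 0 1) ((rg ^ n) (fl treeB φ)) = (rg ^ n) (pm (Equiv.swap 0 1) (fl treeB φ)) := by
    induction n with
    | zero => rfl
    | succ n ih => rw [pow_succ', Module.End.mul_apply, ← rg_pm_01, ih]; rfl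
  have e : fl treeB φ - - fl treeC φ = - fl treeA φ := by
    linear_combination (norm := module) fl_tree φ
  rw [h, pm_treeB_01, ← map_sub, e, map_neg]

theorem pow_rung_inv (n : ℕ) (φ : Wt T M) :
    pm (Equiv.swap 0 2) (pm (Equiv.swap 1 3) ((rg ^ n) (fl treeB φ)))
      = (rg ^ n) (fl treeB φ) := by
  induction n with
  | zero =>
    show pm (Equiv.swap 0 2) (pm (Equiv.swap 1 3) (fl treeB φ)) = fl treeB φ
    rw [pm_treeB_13, map_neg, pm_treeB_02, neg_neg]
  | succ n ih =>
    rw [pow_succ', Module.End.mul_apply, ← rg_pm_02_13 (isHole_pow (isHole_treeB φ) n), ih]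

theorem brk_rung_treeA (φ : Wt T M) : ap brk (ap (rung 0 3) (fl treeA φ)) = 0 := by
  have h := brk_rung (fl treeA φ)
  rw [rung_treeA, map_smul, brk_treeA, map_neg, map_smul, rungV_vert] at h
  linear_combination (norm := module) h

theorem fl_xg (n : ℕ) (φ : Wt T M) : fl (xg n) φ = ap brk ((rg ^ n) (fl treeB φ)) := by
  rw [fl_comp, fl_lad, Module.End.coe_pow]

theorem xg_mem (n : ℕ) : (xg n).cls ∈ LambdaSub := by
  have h2 : ∀ n, ap (Gad.ren (Equiv.swap 0 2)) (ap brk ((rg ^ n) (fl treeB openWt)))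
      = - ap brk ((rg ^ n) (fl treeB openWt)) := by
    intro n; rw [brk_swap_02, pow_rung_inv]
  suffices h1 : ap (Gad.ren (Equiv.swap 0 1)) (ap brk ((rg ^ n) (fl treeB openWt)))
      = - ap brk ((rg ^ n) (fl treeB openWt)) by
    apply cls_mem
    intro i j hij
    rw [fl_comp, fl_xg]
    exact ren_swap_of h1 (h2 n) i j hij
  induction n with
  | zero =>
    show ap (Gad.ren (Equiv.swap 0 1)) (ap brk (fl treeB openWt)) = - ap brk (fl treeB openWt)
    rw [brk_treeB, map_smul, ren_swap_vert _ _ _ (by decide), smul_neg]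
  | succ n ih =>
    have hm : (xg n).cls ∈ LambdaSub := by
      apply cls_mem
      intro i j hij
      rw [fl_comp, fl_xg]
      exact ren_swap_of ih (h2 n) i j hij
    have hx := fl_ins (conn_xg n) hm openWt
    rw [fl_xg] at hx
    have h3 := brk_rung ((rg ^ n) (fl treeB openWt))
    rw [hx, map_smul, rungV_vert] at h3
    have h4 := congrArg (ap (Gad.ren (Equiv.swap 0 1))) h3
    rw [map_add, brk_swap_01, map_smul, map_smul, ren_swap_vert _ _ _ (by decide)] at h4
    have h5 := congrArg (fun z => ap brk (ap (rung 0 3) z)) (pow_rung_swap n openWt)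
    simp only [map_sub, map_neg, map_smul, brk_rung_treeA, smul_zero, neg_zero] at h5
    rw [pow_succ', Module.End.mul_apply]
    linear_combination (norm := module) h3 + h4 - h5

theorem xGraph_mem (n : ℕ) : (xGraph n).cls ∈ LambdaSub := cls_xg n ▸ xg_mem n

theorem brk_ladder (n : ℕ) (φ : Wt T M) :
    ap brk ((rg ^ n) (fl treeB φ)) = xElt (n + 1) • fl Gad.vert φ := by
  match n with
  | 0 => exact brk_treeB φ
  | 1 =>
    have h1 := brk_rung (fl treeB φ)
    have e : ap (rung 0 3) (pm (Equiv.swap 1 3) (fl treeB φ))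
      = pm (Equiv.swap 1 3) (ap (rung 0 1) (fl treeB φ)) := rung_pm 1 3 0 3 _ _
    have e2 := congrArg (ap brk) e
    rw [pm_treeB_13, map_neg, map_neg, brk_pm_13] at e2
    rw [neg_injective e2, brk_treeB, map_smul, rungV_vert] at h1
    refine smul_cancel 2 (by norm_num) ?_
    push_cast
    have h3 : xElt (1 + 1) = tElt ^ 2 := rfl
    rw [pow_one, h3]
    linear_combination (norm := module) h1
  | n + 2 =>
    rw [← fl_xg, fl_ins (conn_xg _) (xg_mem _)]
    congr 1
    apply Subtype.ext
    show (xg (n + 2)).cls = alt (xGraph (n + 2)).cls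
    rw [alt_of_mem (xGraph_mem _), cls_xg]

theorem xElt_val (n : ℕ) : (xElt (n + 1) : F 3) = (xGraph n).cls := by
  rw [← cls_xg]
  refine (cls_of_fl ?_).symm
  rw [fl_xg, brk_ladder]

/-- The difference of the trees `treeB` and `treeC`. -/
def tr (φ : Wt T M) : Wt (Fin 4 ⊕ T) M := fl treeB φ - fl treeC φ

theorem isHole_tr (φ : Wt T M) : IsHole (tr φ) := by
  have := (isHole_treeB φ).add ((isHole_treeC φ).smul (-1))
  have e : tr φ = fl treeB φ + (-1 : Lam) • fl treeC φ := by rw [tr]; module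
  rwa [e]

theorem even_tr (φ : Wt T M) : Even (tr φ) := by
  have h02 : pm (Equiv.swap 0 2) (pm (Equiv.swap 1 3) (fl treeC φ)) = fl treeC φ := by
    rw [pm_treeC_13, map_neg, pm_treeA_02, neg_neg]
  apply even_of
  · rw [tr, map_sub, pm_treeB_01, pm_treeC_01]; module
  · rw [tr, map_sub, pm_treeB_23, pm_treeC_23]; module
  · have h := pow_rung_inv 0 (φ := φ)
    rw [tr, map_sub, map_sub, h02]
    congr 1

/-- The scalars given by joining two ports of a ladder. -/
def yElt (n : ℕ) : Lam := 2 * xElt (n + 1) - tElt ^ (n + 1)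

theorem isLad_pow (n : ℕ) (φ : Wt T M) : IsLad (yElt n) φ ((rg ^ n) (tr φ)) := by
  have hh := isHole_pow (isHole_tr φ) n
  have he := even_pow (even_tr φ) (isHole_tr φ) n
  refine ⟨hh, he, ?_⟩
  rw [ap_join_eq, he _ (by decide), he _ (by decide)]
  have e : tr φ = (2 : Lam) • fl treeB φ + fl treeA φ := by
    rw [tr]; linear_combination (norm := module) - fl_tree φ
  rw [e, map_add, map_smul, pow_rung_treeA, map_add, map_smul, map_smul, brk_ladder, brk_treeA,
    map_add, map_smul, map_smul, map_smul, map_neg, map_smul, ren_swap_vert _ _ _ (by decide), yElt]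
  module

open Polynomial

/-- The ladder with the rungs given by a polynomial. -/
def hl (f : Lam[X]) (φ : Wt T M) : Wt (Fin 4 ⊕ T) M := aeval (rg (T := T) (M := M)) f (tr φ)

/-- The scalars given by joining two ports of a ladder. -/
def yv : Lam[X] →ₗ[Lam] Lam := Polynomial.lsum fun n => yElt n • LinearMap.id

theorem yv_monomial (n : ℕ) (a : Lam) : yv (monomial n a) = a * yElt n := by
  simp [yv, Polynomial.lsum, mul_comm]

theorem isLad_hl (f : Lam[X]) (φ : Wt T M) : IsLad (yv f) φ (hl f φ) := by
  induction f using Polynomial.induction_on' with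
  | add p q hp hq =>
    have := hp.add hq
    rwa [hl, map_add, map_add]
  | monomial n a =>
    rw [yv_monomial, hl, aeval_monomial, Module.End.mul_apply, Module.algebraMap_end_apply]
    exact (isLad_pow n φ).smul a

end values

/-! ### Natural insertions into holes and forms on them -/

section ops
open Polynomial

/-- Families of maps that insert something with four ports. -/
abbrev Ops : Type 1 := ∀ T : Type, Wt T Lam →ₗ[Lam] Wt (Fin 4 ⊕ T) Lam

instance : AddCommGroup Ops := Pi.addCommGroup
instance : Module Lam Ops := Pi.module _ _ _

/-- The span of the insertions of gadgets. -/
def opSub : Submodule Lam Ops :=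
  Submodule.span Lam (Set.range fun (f : Gad (Fin 4) Empty) _ => fl f)

/-- The linear combinations of insertions of gadgets. -/
def Op : Type 1 := opSub

instance : AddCommGroup Op := inferInstanceAs (AddCommGroup opSub)
instance : Module Lam Op := inferInstanceAs (Module Lam opSub)

variable {S S' T : Type}

theorem Op.nat (A : Op) (g : Gad S S') (φ : Wt S' Lam) :
    A.1 S (pull g φ) = pull (g.right (Fin 4)) (A.1 S' φ) := by
  obtain ⟨A, hA⟩ := A
  induction hA using Submodule.span_induction with
  | mem x h => obtain ⟨f, rfl⟩ := h; exact (pull_fill_right f g φ).symm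
  | zero => exact (map_zero _).symm
  | add x y _ _ hx hy =>
    show x S _ + y S _ = pull _ (x S' φ + y S' φ)
    rw [map_add]; exact congrArg₂ _ hx hy
  | smul a x _ hx =>
    show a • x S _ = pull _ (a • x S' φ)
    rw [map_smul]; exact congrArg _ hx

/-- The exchange of the first two summands. -/
def exch (S S' T : Type) : S ⊕ (S' ⊕ T) ≃ S' ⊕ (S ⊕ T) where
  toFun := Sum.elim (fun a => .inr (.inl a)) (Sum.elim .inl fun b => .inr (.inr b))
  invFun := Sum.elim (fun a => .inr (.inl a)) (Sum.elim .inl fun b => .inr (.inr b))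
  left_inv := by rintro (a | a | a) <;> rfl
  right_inv := by rintro (a | a | a) <;> rfl

theorem pull_right_fill (f : Gad S Empty) (φ : Wt (S' ⊕ T) Lam) :
    pull ((f.fill T).right S') φ = pull (Gad.ren (exch S' S T)) (fl f φ) := by
  rw [fl, ← pull_comp]
  refine pull_iso (g := (Gad.ren (exch S' S T)).comp (f.fill (S' ⊕ T)))
    (g' := (f.fill T).right S') (Equiv.emptySum _ _) ⟨?_, ?_⟩ φ
  · rintro (a | a | a)
    · rfl
    · rw [Gad.right_inl, Gad.fill_inl, Gad.comp_inl]
      show _ = Sum.map _ _ ((f.fill (S' ⊕ T)).emb _ ((f.fill (S' ⊕ T)).E (Sum.inl (Sum.inl a))))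
      rw [Gad.fill_inl]
      rcases f.E (Sum.inl a) with x | x
      · rfl
      · exact x.elim
    · rfl
  · have key : ∀ r, ((f.fill T).right S').E (Sum.inr r) = Sum.map
        (Gad.tw (Equiv.emptySum Empty f.N) fun _ => 1) id
          (((Gad.ren (exch S' S T)).comp (f.fill (S' ⊕ T))).E (Sum.inr (Sum.inr r))) := by
      intro r
      rw [Gad.right_inr, Gad.fill_inr, Gad.comp_inr_inr, Gad.fill_inr]
      rcases f.E (Sum.inr r) with x | x
      · rfl
      · exact x.elim
    rintro (r | r)
    · exact r.elim
    · exact ⟨r, key r, key (f.D r)⟩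

theorem Op.comm (A B : Op) (φ : Wt T Lam) :
    A.1 _ (B.1 _ φ) = pull (Gad.ren (exch _ _ _)) (B.1 _ (A.1 _ φ)) := by
  obtain ⟨B, hB⟩ := B
  induction hB using Submodule.span_induction with
  | mem x h =>
    obtain ⟨f, rfl⟩ := h
    exact (A.nat (f.fill T) φ).trans (pull_right_fill f _)
  | zero =>
    show A.1 _ 0 = pull _ 0
    rw [map_zero, map_zero]
  | add x y _ _ hx hy =>
    show A.1 _ (x _ φ + y _ φ) = pull _ (x _ _ + y _ _)
    rw [map_add, map_add]; exact congrArg₂ _ hx hy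
  | smul a x _ hx =>
    show A.1 _ (a • x _ φ) = pull _ (a • x _ _)
    rw [map_smul, map_smul]; exact congrArg _ hx

/-- The action of gadgets on insertions. -/
def on (g : Gad (Fin 4) (Fin 4)) : Op →ₗ[Lam] Op where
  toFun A := ⟨fun T => ap g ∘ₗ A.1 T, by
    obtain ⟨A, hA⟩ := A
    induction hA using Submodule.span_induction with
    | mem x h =>
      obtain ⟨f, rfl⟩ := h
      refine Submodule.subset_span ⟨g.comp f, ?_⟩
      funext T; ext1 φ; exact fl_comp g f φ
    | zero => 
      have e : (fun T => ap g ∘ₗ (0 : Ops) T : Ops) = 0 := by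
        funext T; ext1 φ; exact map_zero (ap g)
      show (fun T => ap g ∘ₗ (0 : Ops) T : Ops) ∈ opSub
      rw [e]; exact zero_mem _
    | add x y _ _ hx hy => 
      have e : (fun T => ap g ∘ₗ (x + y) T : Ops)
          = (fun T => ap g ∘ₗ x T : Ops) + (fun T => ap g ∘ₗ y T : Ops) := by
        funext T; ext1 φ; exact map_add (ap g) _ _
      show (fun T => ap g ∘ₗ (x + y) T : Ops) ∈ opSub
      rw [e]; exact add_mem hx hy
    | smul a x _ hx =>
      have e : (fun T => ap g ∘ₗ (a • x) T : Ops) = a • (fun T => ap g ∘ₗ x T : Ops) := by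
        funext T; ext1 φ; exact map_smul (ap g) _ _
      show (fun T => ap g ∘ₗ (a • x) T : Ops) ∈ opSub
      rw [e]; exact Submodule.smul_mem _ a hx⟩
  map_add' A B := Subtype.ext (by funext T; ext1 φ; exact map_add (ap g) _ _)
  map_smul' a A := Subtype.ext (by funext T; ext1 φ; exact map_smul (ap g) _ _)

theorem on_apply (g : Gad (Fin 4) (Fin 4)) (A : Op) (φ : Wt T Lam) :
    (on g A).1 T φ = ap g (A.1 T φ) := rfl

theorem Op.ext {A B : Op} (h : ∀ (T : Type) (φ : Wt T Lam), A.1 T φ = B.1 T φ) : A = B :=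
  Subtype.ext (funext fun T => LinearMap.ext (h T))

theorem Op.add_apply (A B : Op) (φ : Wt T Lam) : (A + B).1 T φ = A.1 T φ + B.1 T φ := rfl
theorem Op.sub_apply (A B : Op) (φ : Wt T Lam) : (A - B).1 T φ = A.1 T φ - B.1 T φ := rfl
theorem Op.neg_apply (A : Op) (φ : Wt T Lam) : (-A).1 T φ = -A.1 T φ := rfl
theorem Op.smul_apply (a : Lam) (A : Op) (φ : Wt T Lam) : (a • A).1 T φ = a • A.1 T φ := rfl

/-- The insertion of a gadget. -/
def ofl (f : Gad (Fin 4) Empty) : Op := ⟨fun _ => fl f, Submodule.subset_span ⟨f, rfl⟩⟩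

/-- Ladders as insertions. -/
def lo : Lam[X] →ₗ[Lam] Op where
  toFun f := aeval (on (rung 0 1)) f (ofl treeB - ofl treeC)
  map_add' f g := by rw [map_add]; rfl
  map_smul' a f := by rw [map_smul]; rfl

theorem lo_apply (f : Lam[X]) (φ : Wt T Lam) : (lo f).1 T φ = hl f φ := by
  induction f using Polynomial.induction_on' with
  | add p q hp hq =>
    rw [map_add, Op.add_apply, hp, hq]
    exact (congrArg (fun z : Module.End Lam _ => z (tr φ)) (map_add (aeval rg) p q)).symm
  | monomial n a =>
    show ((aeval (on (rung 0 1)) (monomial n a)) (ofl treeB - ofl treeC)).1 T φ = _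
    rw [hl, aeval_monomial, aeval_monomial, Module.End.mul_apply, Module.End.mul_apply,
      Module.algebraMap_end_apply, Module.algebraMap_end_apply, Op.smul_apply]
    congr 1
    induction n with
    | zero => rfl
    | succ n ih => rw [pow_succ', pow_succ', Module.End.mul_apply, Module.End.mul_apply,
        on_apply, ih]

/-- The variable of the polynomials. -/
abbrev ξ : Lam[X] := Polynomial.X

theorem lo_X_mul (f : Lam[X]) : lo (ξ * f) = on (rung 0 1) (lo f) := by
  show (aeval (on (rung 0 1)) (ξ * f)) _ = _
  rw [map_mul, aeval_X]; rfl

/-- Permutations of the ports of insertions. -/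
abbrev om (σ : Equiv.Perm (Fin 4)) : Op →ₗ[Lam] Op := on (Gad.ren σ)

theorem om_om (σ τ : Equiv.Perm (Fin 4)) (A : Op) : om σ (om τ A) = om (τ * σ) A :=
  Op.ext fun _ _ => pm_pm σ τ _

theorem om_lo {σ τ : Equiv.Perm (Fin 4)} (f : Lam[X])
    (hs : side ((σ * τ⁻¹) 0) = side ((σ * τ⁻¹) 1)) : om σ (lo f) = om τ (lo f) :=
  Op.ext fun T φ => by
    rw [on_apply, on_apply, lo_apply]; exact (isLad_hl f φ).even.pm_eq hs

/-- The value of a weight on a closed context. -/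
def vl (C : Gad Empty S) : Wt S Lam →ₗ[Lam] Lam where
  toFun φ := (pull C φ).1 ⟨Empty, ⟨id, fun _ => rfl, by rintro (x | x); exacts [x.1.elim, x.elim]⟩⟩
  map_add' φ ψ := by rw [map_add]; rfl
  map_smul' a φ := by rw [map_smul]; rfl

theorem vl_comp (C : Gad Empty S) (g : Gad S S') (φ : Wt S' Lam) :
    vl (C.comp g) φ = vl C (pull g φ) := by
  show (pull (C.comp g) φ).1 _ = _; rw [pull_comp]; rfl

theorem vl_pos {C C' : Gad Empty S} [Fintype C.N] (f : C.N → C'.N) (hf : Function.Bijective f)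
    (τ : C.N → Equiv.Perm (Fin 3)) (h : C.TwE C' (Equiv.ofBijective f hf) τ) (hs : sgn τ = 1)
    (φ : Wt S Lam) : vl C' φ = vl C φ := by
  show (pull C' φ).1 _ = _; rw [pull_twE _ τ h, hs, one_smul]; rfl

theorem vl_neg {C C' : Gad Empty S} [Fintype C.N] (f : C.N → C'.N) (hf : Function.Bijective f)
    (τ : C.N → Equiv.Perm (Fin 3)) (h : C.TwE C' (Equiv.ofBijective f hf) τ) (hs : sgn τ = -1)
    (φ : Wt S Lam) : vl C' φ = - vl C φ := by
  show (pull C' φ).1 _ = _; rw [pull_twE _ τ h, hs, neg_one_smul]; rfl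

/-- The ports of two holes. -/
abbrev H2 : Type := Fin 4 ⊕ (Fin 4 ⊕ Fin 0)
/-- The ports of three holes. -/
abbrev H3 : Type := Fin 4 ⊕ (Fin 4 ⊕ (Fin 4 ⊕ Fin 0))

/-- The weight on two holes given by two insertions. -/
def w2 (A B : Op) : Wt H2 Lam := A.1 _ (B.1 _ closedWt)
/-- The weight on three holes given by three insertions. -/
def w3 (A B C : Op) : Wt H3 Lam := A.1 _ (w2 B C)

/-- The bilinear form given by a context. -/
def f2 (G : Gad Empty H2) : Op →ₗ[Lam] Op →ₗ[Lam] Lam :=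
  LinearMap.mk₂ Lam (fun A B => vl G (w2 A B))
    (fun A A' B => map_add (vl G) _ _) (fun a A B => map_smul (vl G) _ _)
    (fun A B B' => by rw [w2, Op.add_apply, map_add, map_add]; rfl)
    (fun a A B => by rw [w2, Op.smul_apply, map_smul, map_smul]; rfl)

theorem w3_add_fst (A A' B C : Op) : w3 (A + A') B C = w3 A B C + w3 A' B C := rfl
theorem w3_smul_fst (a : Lam) (A B C : Op) : w3 (a • A) B C = a • w3 A B C := rfl
theorem w3_add_snd (A B B' C : Op) : w3 A (B + B') C = w3 A B C + w3 A B' C :=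
  map_add (A.1 _) _ _
theorem w3_smul_snd (a : Lam) (A B C : Op) : w3 A (a • B) C = a • w3 A B C :=
  map_smul (A.1 _) _ _
theorem w3_add_trd (A B C C' : Op) : w3 A B (C + C') = w3 A B C + w3 A B C' := by
  rw [w3, w2, Op.add_apply, map_add, map_add]; rfl
theorem w3_smul_trd (a : Lam) (A B C : Op) : w3 A B (a • C) = a • w3 A B C := by
  rw [w3, w2, Op.smul_apply, map_smul, map_smul]; rfl

/-- The trilinear form given by a context. -/
def f3 (G : Gad Empty H3) : Op →ₗ[Lam] Op →ₗ[Lam] Op →ₗ[Lam] Lam :=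
  LinearMap.mk₂ Lam (fun A B =>
    { toFun := fun C => vl G (w3 A B C)
      map_add' := fun C C' => by rw [w3_add_trd, map_add]
      map_smul' := fun a C => by rw [w3_smul_trd, map_smul, RingHom.id_apply] })
    (fun A A' B => LinearMap.ext fun C => by
      show vl G (w3 (A + A') B C) = vl G (w3 A B C) + vl G (w3 A' B C); rw [w3_add_fst, map_add])
    (fun a A B => LinearMap.ext fun C => by
      show vl G (w3 (a • A) B C) = a • vl G (w3 A B C); rw [w3_smul_fst, map_smul])
    (fun A B B' => LinearMap.ext fun C => by
      show vl G (w3 A (B + B') C) = vl G (w3 A B C) + vl G (w3 A B' C); rw [w3_add_snd, map_add])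
    (fun a A B => LinearMap.ext fun C => by
      show vl G (w3 A (a • B) C) = a • vl G (w3 A B C); rw [w3_smul_snd, map_smul])

theorem f2_apply (G : Gad Empty H2) (A B : Op) : f2 G A B = vl G (w2 A B) := rfl
theorem f3_apply (G : Gad Empty H3) (A B C : Op) : f3 G A B C = vl G (w3 A B C) := rfl

variable (g : Gad (Fin 4) (Fin 4)) (A B C : Op)

theorem f2_fst (G : Gad Empty H2) : f2 G (on g A) B = f2 (G.comp (g.left _)) A B :=
  (vl_comp _ _ _).symm

theorem f2_snd (G : Gad Empty H2) :
    f2 G A (on g B) = f2 (G.comp ((g.left _).right (Fin 4))) A B := by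
  rw [f2_apply, f2_apply, vl_comp]; exact congrArg _ (A.nat _ _)

theorem f3_fst (G : Gad Empty H3) : f3 G (on g A) B C = f3 (G.comp (g.left _)) A B C :=
  (vl_comp _ _ _).symm

theorem f3_snd (G : Gad Empty H3) :
    f3 G A (on g B) C = f3 (G.comp ((g.left _).right (Fin 4))) A B C := by
  rw [f3_apply, f3_apply, vl_comp]; exact congrArg _ (A.nat _ _)

theorem f3_trd (G : Gad Empty H3) :
    f3 G A B (on g C) = f3 (G.comp (((g.left _).right (Fin 4)).right (Fin 4))) A B C := by
  rw [f3_apply, f3_apply, vl_comp]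
  exact congrArg (vl G) (Eq.trans (congrArg (A.1 _) (B.nat (g.left _) _)) (A.nat _ _))

theorem f3_swap12 (G : Gad Empty H3) :
    f3 G A B C = f3 (G.comp (Gad.ren (exch _ _ _))) B A C := by
  rw [f3_apply, f3_apply, vl_comp]; exact congrArg _ (A.comm B _)

theorem f3_swap23 (G : Gad Empty H3) :
    f3 G A B C = f3 (G.comp ((Gad.ren (exch _ _ _)).right (Fin 4))) A C B := by
  rw [f3_apply, f3_apply, vl_comp]
  exact congrArg (vl G) (Eq.trans (congrArg (A.1 _) (B.comm C _)) (A.nat _ _))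

/-- Edges slide over the insertion. -/
def Op.IsSl (A : Op) : Prop := ∀ (T : Type) (φ : Wt T Lam), IsHole (A.1 T φ)

theorem f3_slide {A : Op} (hA : A.IsSl) (B C : Op)
    (G : Gad Empty ((Fin 4 ⊕ Fin 1) ⊕ (Fin 4 ⊕ (Fin 4 ⊕ Fin 0)))) :
    ∑ j, f3 (G.comp ((tine j).left _)) A B C = 0 := by
  simp only [f3_apply, vl_comp]
  rw [← map_sum]
  exact (congrArg _ (hA _ (w2 B C)).slide).trans (map_zero _)

theorem f3_tree (A B C : Op) (G : Gad Empty (Fin 4 ⊕ H3)) :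
    f3 (G.comp (treeA.fill _)) A B C + f3 (G.comp (treeB.fill _)) A B C
      + f3 (G.comp (treeC.fill _)) A B C = 0 := by
  simp only [f3_apply, vl_comp]
  rw [← map_add, ← map_add]
  exact (congrArg _ (fl_tree _)).trans (map_zero _)

end ops

/-! ### Contexts with two and three holes -/

section contexts
open Polynomial

theorem f3_pos {G G' : Gad Empty H3} [Fintype G.N] (f : G.N → G'.N) (hf : Function.Bijective f)
    (τ : G.N → Equiv.Perm (Fin 3)) (h : G.TwE G' (Equiv.ofBijective f hf) τ) (hs : sgn τ = 1)
    (A B C : Op) : f3 G' A B C = f3 G A B C := vl_pos f hf τ h hs _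

theorem f3_neg {G G' : Gad Empty H3} [Fintype G.N] (f : G.N → G'.N) (hf : Function.Bijective f)
    (τ : G.N → Equiv.Perm (Fin 3)) (h : G.TwE G' (Equiv.ofBijective f hf) τ) (hs : sgn τ = -1)
    (A B C : Op) : f3 G' A B C = - f3 G A B C := vl_neg f hf τ h hs _

theorem f2_pos {G G' : Gad Empty H2} [Fintype G.N] (f : G.N → G'.N) (hf : Function.Bijective f)
    (τ : G.N → Equiv.Perm (Fin 3)) (h : G.TwE G' (Equiv.ofBijective f hf) τ) (hs : sgn τ = 1)
    (A B : Op) : f2 G' A B = f2 G A B := vl_pos f hf τ h hs _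

theorem f2_neg {G G' : Gad Empty H2} [Fintype G.N] (f : G.N → G'.N) (hf : Function.Bijective f)
    (τ : G.N → Equiv.Perm (Fin 3)) (h : G.TwE G' (Equiv.ofBijective f hf) τ) (hs : sgn τ = -1)
    (A B : Op) : f2 G' A B = - f2 G A B := vl_neg f hf τ h hs _

/-- Three holes in a circle, neighbours joined by two edges. -/
abbrev ctD : Gad Empty H3 := .of 0 Empty.elim
  ![(.inr (.inl 0), .inr (.inr (.inl 2))), (.inr (.inl 1), .inr (.inr (.inl 3))), (.inr (.inr (.inl 0)), .inr (.inr (.inr (.inl 2)))), (.inr (.inr (.inl 1)), .inr (.inr (.inr (.inl 3)))), (.inr (.inr (.inr (.inl 0))), .inr (.inl 2)), (.inr (.inr (.inr (.inl 1))), .inr (.inl 3))]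
  (by decide +kernel)

/-- Two holes joined by two pairs of edges. -/
abbrev ctE : Gad Empty H2 := .of 0 Empty.elim
  ![(.inr (.inl 0), .inr (.inr (.inl 2))), (.inr (.inl 1), .inr (.inr (.inl 3))), (.inr (.inr (.inl 0)), .inr (.inl 2)), (.inr (.inr (.inl 1)), .inr (.inl 3))]
  (by decide +kernel)

/-- Three holes joined pairwise by an edge, and two vertices joined to all of them. -/
abbrev ctK : Gad Empty H3 := .of 2 Empty.elim
  ![(.inr (.inl 0), .inr (.inr (.inl 1))), (.inr (.inr (.inl 0)), .inr (.inr (.inr (.inl 1)))), (.inr (.inr (.inr (.inl 0))), .inr (.inl 1)), (.inl (0, 0), .inr (.inl 2)), (.inl (0, 1), .inr (.inr (.inl 2))), (.inl (0, 2), .inr (.inr (.inr (.inl 2)))), (.inl (1, 0), .inr (.inl 3)), (.inl (1, 1), .inr (.inr (.inl 3))), (.inl (1, 2), .inr (.inr (.inr (.inl 3))))]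
  (by decide +kernel)

/-- Three holes joined pairwise by an edge, and a path of four vertices. -/
abbrev ctP : Gad Empty H3 := .of 4 Empty.elim
  ![(.inr (.inr (.inl 0)), .inr (.inr (.inr (.inl 1)))), (.inr (.inr (.inr (.inl 0))), .inr (.inl 1)), (.inr (.inl 0), .inr (.inr (.inl 1))), (.inl (0, 0), .inr (.inr (.inl 2))), (.inl (0, 1), .inr (.inr (.inr (.inl 2)))), (.inl (0, 2), .inl (3, 2)), (.inl (3, 0), .inr (.inl 2)), (.inl (3, 1), .inl (2, 1)), (.inl (2, 0), .inr (.inr (.inl 3))), (.inl (2, 2), .inl (1, 0)), (.inl (1, 1), .inr (.inr (.inr (.inl 3)))), (.inl (1, 2), .inr (.inl 3))]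
  (by decide +kernel)

/-- The context that arises when the end of an edge of `ctP` is moved. -/
abbrev ctG : Gad Empty H3 := .of 4 Empty.elim
  ![(.inr (.inr (.inl 0)), .inr (.inr (.inr (.inl 1)))), (.inr (.inl 0), .inr (.inr (.inl 1))), (.inl (0, 0), .inr (.inr (.inl 2))), (.inl (0, 1), .inr (.inr (.inr (.inl 2)))), (.inl (0, 2), .inr (.inl 2)), (.inl (2, 0), .inr (.inr (.inl 3))), (.inl (2, 2), .inl (1, 0)), (.inl (1, 1), .inr (.inr (.inr (.inl 3)))), (.inl (1, 2), .inr (.inl 3)), (.inl (2, 1), .inl (3, 0)), (.inl (3, 1), .inr (.inr (.inr (.inl 0)))), (.inl (3, 2), .inr (.inl 1))]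
  (by decide +kernel)

/-- Three holes joined pairwise by an edge, and a tripod of vertices. -/
abbrev ctS : Gad Empty H3 := .of 4 Empty.elim
  ![(.inr (.inr (.inl 0)), .inr (.inr (.inr (.inl 1)))), (.inr (.inr (.inr (.inl 0))), .inr (.inl 1)), (.inr (.inl 0), .inr (.inr (.inl 1))), (.inl (0, 0), .inr (.inr (.inl 2))), (.inl (0, 1), .inr (.inr (.inr (.inl 2)))), (.inl (0, 2), .inl (3, 0)), (.inl (1, 0), .inr (.inr (.inr (.inl 3)))), (.inl (1, 1), .inr (.inl 3)), (.inl (1, 2), .inl (3, 1)), (.inl (2, 0), .inr (.inl 2)), (.inl (2, 1), .inr (.inr (.inl 3))), (.inl (2, 2), .inl (3, 2))]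
  (by decide +kernel)

/-- A vertex joined to three ports. -/
abbrev ctV : Gad Empty (Fin 3 ⊕ Fin 0) := .of 1 Empty.elim
  ![(.inr (.inl 0), .inl (0, 0)), (.inr (.inl 1), .inl (0, 1)), (.inr (.inl 2), .inl (0, 2))]
  (by decide +kernel)

variable (A B C : Op)

theorem ctD_rung_fst : f3 ctD (on (rung 0 1) A) B C = f3 ctD A (on (rung 2 3) B) C := by
  rw [f3_fst, f3_snd]
  exact f3_pos
    (Sum.elim ![] ![Sum.inr 0, Sum.inr 1]) (by decide +kernel)
    (Sum.elim ![] ![Equiv.swap 1 2, Equiv.swap 1 2]) (by decide +kernel) (by decide +kernel) _ _ _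

theorem ctD_bar_fst : f3 ctD (om (Equiv.swap 0 1) A) (om (Equiv.swap 2 3) B) C = f3 ctD A B C := by
  rw [f3_snd, f3_fst]
  exact f3_pos
    ![] (by decide +kernel)
    ![] (by decide +kernel) (by decide +kernel) _ _ _

theorem ctD_bar_snd : f3 ctD A (om (Equiv.swap 0 1) B) (om (Equiv.swap 2 3) C) = f3 ctD A B C := by
  rw [f3_trd, f3_snd]
  exact f3_pos
    ![] (by decide +kernel)
    ![] (by decide +kernel) (by decide +kernel) _ _ _

theorem ctD_rot : f3 ctD A B C = f3 ctD B C A := by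
  rw [f3_swap12, f3_swap23]
  exact f3_pos
    ![] (by decide +kernel)
    ![] (by decide +kernel) (by decide +kernel) _ _ _

theorem ctE_rung : f2 ctE (on (rung 0 1) A) B = f2 ctE A (on (rung 2 3) B) := by
  rw [f2_fst, f2_snd]
  exact f2_pos
    (Sum.elim ![] ![Sum.inr 0, Sum.inr 1]) (by decide +kernel)
    (Sum.elim ![] ![Equiv.swap 1 2, Equiv.swap 1 2]) (by decide +kernel) (by decide +kernel) _ _

theorem ctE_bar : f2 ctE (om (Equiv.swap 0 1) A) (om (Equiv.swap 2 3) B) = f2 ctE A B := by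
  rw [f2_snd, f2_fst]
  exact f2_pos
    ![] (by decide +kernel)
    ![] (by decide +kernel) (by decide +kernel) _ _

theorem ctK_bar : f3 ctK (om (Equiv.swap 2 3) A) (om (Equiv.swap 2 3) B) (om (Equiv.swap 2 3) C) = f3 ctK A B C := by
  rw [f3_trd, f3_snd, f3_fst]
  exact f3_pos
    ![Sum.inl (Sum.inl (Sum.inl 1)), Sum.inl (Sum.inl (Sum.inl 0))] (by decide +kernel)
    ![1, 1] (by decide +kernel) (by decide +kernel) _ _ _

theorem ctK_rot : f3 ctK A B C = f3 ctK B C A := by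
  rw [f3_swap12, f3_swap23]
  exact f3_pos
    ![Sum.inl (Sum.inl 0), Sum.inl (Sum.inl 1)] (by decide +kernel)
    ![finRotate 3, finRotate 3] (by decide +kernel) (by decide +kernel) _ _ _

/-- The ports exchanged in pairs. -/
abbrev vv : Equiv.Perm (Fin 4) := Equiv.swap 0 1 * Equiv.swap 2 3

theorem ctS_swap_fst : f3 ctS (om vv B) (om vv A) (om (Equiv.swap 0 1) C) = f3 ctS A B (om (Equiv.swap 2 3) C) := by
  rw [f3_trd, f3_snd, f3_fst, f3_swap12, f3_trd]
  exact f3_pos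
    (Sum.elim ![Sum.inl (Sum.inl (Sum.inl (Sum.inl 1))), Sum.inl (Sum.inl (Sum.inl (Sum.inl 0))), Sum.inl (Sum.inl (Sum.inl (Sum.inl 2))), Sum.inl (Sum.inl (Sum.inl (Sum.inl 3)))] Empty.elim) (by decide +kernel)
    (Sum.elim ![Equiv.swap 0 1, Equiv.swap 0 1, Equiv.swap 0 1, Equiv.swap 0 1] Empty.elim) (by decide +kernel) (by decide +kernel) _ _ _

theorem ctS_swap_snd : f3 ctS (om vv A) (om vv C) (om (Equiv.swap 0 1) B) = f3 ctS A B (om (Equiv.swap 2 3) C) := by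
  rw [f3_trd, f3_snd, f3_fst, f3_swap23, f3_trd]
  exact f3_pos
    (Sum.elim ![Sum.inl (Sum.inl (Sum.inl (Sum.inl 0))), Sum.inl (Sum.inl (Sum.inl (Sum.inl 2))), Sum.inl (Sum.inl (Sum.inl (Sum.inl 1))), Sum.inl (Sum.inl (Sum.inl (Sum.inl 3)))] Empty.elim) (by decide +kernel)
    (Sum.elim ![Equiv.swap 0 1, Equiv.swap 0 1, Equiv.swap 0 1, Equiv.swap 1 2] Empty.elim) (by decide +kernel) (by decide +kernel) _ _ _

theorem ctG_fold : f3 ctG (om (Equiv.swap 1 3) A) B (om (Equiv.swap 0 3) C) = - f3 ctG A B C := by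
  rw [f3_trd, f3_fst]
  exact f3_neg
    ![Sum.inl (Sum.inl 0), Sum.inl (Sum.inl 3), Sum.inl (Sum.inl 2), Sum.inl (Sum.inl 1)] (by decide +kernel)
    ![1, 1, Equiv.swap 1 2, 1] (by decide +kernel) (by decide +kernel) _ _ _

theorem ctG_refl : f3 ctG (om (Equiv.swap 0 1) C) (om (Equiv.swap 0 1) B) (om (Equiv.swap 0 1) A) = - f3 ctG A B C := by
  rw [f3_trd, f3_snd, f3_fst, f3_swap12, f3_swap23, f3_swap12]
  exact f3_neg
    ![Sum.inl (Sum.inl (Sum.inl (Sum.inl (Sum.inl (Sum.inl 0))))), Sum.inl (Sum.inl (Sum.inl (Sum.inl (Sum.inl (Sum.inl 1))))), Sum.inl (Sum.inl (Sum.inl (Sum.inl (Sum.inl (Sum.inl 2))))), Sum.inl (Sum.inl (Sum.inl (Sum.inl (Sum.inl (Sum.inl 3)))))] (by decide +kernel)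
    ![Equiv.swap 1 2, Equiv.swap 1 2, 1, Equiv.swap 1 2] (by decide +kernel) (by decide +kernel) _ _ _

theorem ctP_ihx : f3 ctP A B C - f3 ctS A B C + f3 ctD (om (Equiv.swap 1 2) (on (rung 2 3) A))
    (om (Equiv.swap 1 2) (on (rung 2 3) B)) (om (Equiv.swap 1 2 * Equiv.swap 1 3) C) = 0 := by
  let q : Gad Empty (Fin 4 ⊕ H3) := .of 2 Empty.elim
    ![(.inr (.inr (.inr (.inl 0))), .inr (.inr (.inr (.inr (.inl 1))))), (.inr (.inr (.inr (.inr (.inl 0)))), .inr (.inr (.inl 1))), (.inr (.inr (.inl 0)), .inr (.inr (.inr (.inl 1)))), (.inl (0, 0), .inr (.inr (.inr (.inl 2)))), (.inl (0, 1), .inr (.inr (.inr (.inr (.inl 2))))), (.inl (1, 1), .inr (.inr (.inr (.inr (.inl 3))))), (.inl (1, 2), .inr (.inr (.inl 3))), (.inr (.inl 0), .inr (.inr (.inr (.inl 3)))), (.inr (.inl 1), .inl (1, 0)), (.inr (.inl 2), .inr (.inr (.inl 2))), (.inr (.inl 3), .inl (0, 2))]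
    (by decide +kernel)
  have hA : f3 (q.comp (treeA.fill _)) A B C = f3 ctP A B C := by
    exact f3_pos
      ![Sum.inl 0, Sum.inl 1, Sum.inr 0, Sum.inr 1] (by decide +kernel)
      ![1, 1, Equiv.swap 0 1, Equiv.swap 0 1] (by decide +kernel) (by decide +kernel) _ _ _
  have hB : f3 (q.comp (treeB.fill _)) A B C = - f3 ctS A B C := by
    exact f3_neg
      ![Sum.inl 0, Sum.inl 1, Sum.inr 0, Sum.inr 1] (by decide +kernel)
      ![1, finRotate 3, finRotate 3, Equiv.swap 0 2] (by decide +kernel) (by decide +kernel) _ _ _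
  have hC : f3 (q.comp (treeC.fill _)) A B C = f3 ctD (om (Equiv.swap 1 2) (on (rung 2 3) A)) (om (Equiv.swap 1 2) (on (rung 2 3) B)) (om (Equiv.swap 1 2 * Equiv.swap 1 3) C) := by
    rw [f3_trd, f3_snd, f3_snd, f3_fst, f3_fst]
    exact f3_pos
      (Sum.elim (Sum.elim (Sum.elim (Sum.elim (Sum.elim ![] Empty.elim) Empty.elim) ![Sum.inl 0, Sum.inr 1]) Empty.elim) ![Sum.inr 0, Sum.inl 1]) (by decide +kernel)
      (Sum.elim (Sum.elim (Sum.elim (Sum.elim (Sum.elim ![] Empty.elim) Empty.elim) ![Equiv.swap 0 2, Equiv.swap 0 2]) Empty.elim) ![Equiv.swap 0 1, Equiv.swap 1 2]) (by decide +kernel) (by decide +kernel) _ _ _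
  have h := f3_tree A B C q
  rw [hA, hB, hC] at h
  linear_combination h

theorem ctP_slide {A : Op} (hA : A.IsSl) (B C : Op) :
    f3 ctP A B C + f3 ctG A B C + f3 ctK A (on (rung 1 3) B) C - tElt * f3 ctK A B C = 0 := by
  let z : Gad Empty ((Fin 4 ⊕ Fin 1) ⊕ (Fin 4 ⊕ (Fin 4 ⊕ Fin 0))) := .of 3 Empty.elim
    ![(.inr (.inr (.inl 0)), .inr (.inr (.inr (.inl 1)))), (.inr (.inr (.inr (.inl 0))), .inr (.inl (.inl 1))), (.inr (.inl (.inl 0)), .inr (.inr (.inl 1))), (.inl (0, 0), .inr (.inr (.inl 2))), (.inl (0, 1), .inr (.inr (.inr (.inl 2)))), (.inl (0, 2), .inr (.inl (.inl 2))), (.inl (2, 0), .inr (.inr (.inl 3))), (.inl (2, 2), .inl (1, 0)), (.inl (1, 1), .inr (.inr (.inr (.inl 3)))), (.inl (1, 2), .inr (.inl (.inl 3))), (.inl (2, 1), .inr (.inl (.inr 0)))]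
    (by decide +kernel)
  let k : Gad Empty (Fin 3 ⊕ H3) := .of 1 Empty.elim
    ![(.inr (.inr (.inl 0)), .inr (.inr (.inr (.inl 1)))), (.inr (.inr (.inr (.inl 0))), .inr (.inr (.inr (.inr (.inl 1))))), (.inr (.inr (.inr (.inr (.inl 0)))), .inr (.inr (.inl 1))), (.inl (0, 0), .inr (.inr (.inl 2))), (.inl (0, 1), .inr (.inr (.inr (.inl 2)))), (.inl (0, 2), .inr (.inr (.inr (.inr (.inl 2))))), (.inr (.inl 0), .inr (.inr (.inl 3))), (.inr (.inl 1), .inr (.inr (.inr (.inl 3)))), (.inr (.inl 2), .inr (.inr (.inr (.inr (.inl 3)))))]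
    (by decide +kernel)
  have h0 : f3 (z.comp ((tine 0).left _)) A B C = f3 ctK A (on (rung 1 3) B) C := by
    rw [f3_snd]
    exact f3_pos
      (Sum.elim ![Sum.inl 0, Sum.inl 1] ![Sum.inr 0, Sum.inl 2]) (by decide +kernel)
      (Sum.elim ![(finRotate 3)⁻¹, (finRotate 3)⁻¹] ![Equiv.swap 1 2, Equiv.swap 0 1]) (by decide +kernel) (by decide +kernel) _ _ _
  have h1 : f3 (z.comp ((tine 1).left _)) A B C = f3 ctG A B C := by
    exact f3_pos
      ![Sum.inl 0, Sum.inl 1, Sum.inl 2, Sum.inr 0] (by decide +kernel)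
      ![1, 1, 1, 1] (by decide +kernel) (by decide +kernel) _ _ _
  have h2 : f3 (z.comp ((tine 2).left _)) A B C = f3 ctP A B C := by
    exact f3_pos
      ![Sum.inl 0, Sum.inl 1, Sum.inl 2, Sum.inr 0] (by decide +kernel)
      ![1, 1, 1, (finRotate 3)⁻¹] (by decide +kernel) (by decide +kernel) _ _ _
  have h3 : f3 (z.comp ((tine 3).left _)) A B C = - f3 (k.comp (tri.fill _)) A B C := by
    exact f3_neg
      (Sum.elim ![Sum.inl 0] ![Sum.inr 0, Sum.inl 2, Sum.inl 1]) (by decide +kernel)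
      (Sum.elim ![(finRotate 3)⁻¹] ![(finRotate 3)⁻¹, Equiv.swap 1 2, finRotate 3]) (by decide +kernel) (by decide +kernel) _ _ _
  have h4 : f3 (k.comp (Gad.vert.fill _)) A B C = f3 ctK A B C := by
    exact f3_pos
      ![Sum.inl 0, Sum.inr 0] (by decide +kernel)
      ![1, 1] (by decide +kernel) (by decide +kernel) _ _ _
  have h5 : f3 (k.comp (tri.fill _)) A B C = tElt * f3 (k.comp (Gad.vert.fill _)) A B C := by
    rw [f3_apply, f3_apply, vl_comp, vl_comp, ← smul_eq_mul, ← map_smul]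
    exact congrArg _ (fl_tri _)
  have h := f3_slide hA B C z
  rw [Fin.sum_univ_four, h0, h1, h2, h3, h5, h4] at h
  linear_combination h

theorem ctK_slide {A : Op} (hA : A.IsSl) {B : Op} {b : Lam} (hB : ∀ (T : Type) (φ : Wt T Lam),
    ap join (pm (finRotate 4) (B.1 T φ)) = b • fl Gad.vert φ) (C : Op) :
    f3 ctK A B C + f3 ctK (om (Equiv.swap 1 2) A) B (om (Equiv.swap 0 2) C)
      + f3 ctD (om (Equiv.swap 1 2 * Equiv.swap 1 3) A)
        (om (Equiv.swap 1 2 * Equiv.swap 1 3) (on (rung 2 3) B)) (om (Equiv.swap 1 2) C)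
      + b * f2 ctE A (om (Equiv.swap 0 1 * Equiv.swap 0 2 * Equiv.swap 1 3) (on (rung 1 3) C)) = 0 := by
  let z : Gad Empty ((Fin 4 ⊕ Fin 1) ⊕ (Fin 4 ⊕ (Fin 4 ⊕ Fin 0))) := .of 1 Empty.elim
    ![(.inr (.inl (.inl 0)), .inr (.inr (.inl 1))), (.inr (.inl (.inl 1)), .inr (.inr (.inr (.inl 0)))), (.inr (.inl (.inl 2)), .inr (.inr (.inr (.inl 2)))), (.inl (0, 0), .inr (.inl (.inl 3))), (.inl (0, 1), .inr (.inr (.inl 3))), (.inl (0, 2), .inr (.inr (.inr (.inl 3)))), (.inr (.inr (.inl 0)), .inr (.inr (.inr (.inl 1)))), (.inr (.inl (.inr 0)), .inr (.inr (.inl 2)))]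
    (by decide +kernel)
  let y : Gad Empty (Fin 4 ⊕ (Fin 3 ⊕ (Fin 4 ⊕ Fin 0))) := .of 1 Empty.elim
    ![(.inr (.inl 0), .inr (.inr (.inl 0))), (.inr (.inl 1), .inr (.inr (.inr (.inl 0)))), (.inr (.inl 2), .inr (.inr (.inr (.inl 2)))), (.inl (0, 0), .inr (.inl 3)), (.inl (0, 1), .inr (.inr (.inl 1))), (.inl (0, 2), .inr (.inr (.inr (.inl 3)))), (.inr (.inr (.inl 2)), .inr (.inr (.inr (.inl 1))))]
    (by decide +kernel)
  have h0 : f3 (z.comp ((tine 0).left _)) A B C = - f3 ((y.comp ((join.left _).right _)).comp (((Gad.ren (finRotate 4)).left _).right _)) A B C := by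
    exact f3_neg
      (Sum.elim (Sum.elim ![Sum.inl 0] ![Sum.inr 0]) Empty.elim) (by decide +kernel)
      (Sum.elim (Sum.elim ![1] ![Equiv.swap 0 2]) Empty.elim) (by decide +kernel) (by decide +kernel) _ _ _
  have h1 : f3 (z.comp ((tine 1).left _)) A B C = f3 ctK (om (Equiv.swap 1 2) A) B (om (Equiv.swap 0 2) C) := by
    rw [f3_trd, f3_fst]
    exact f3_pos
      (Sum.elim (Sum.elim ![Sum.inr 0, Sum.inl 0] Empty.elim) Empty.elim) (by decide +kernel)
      (Sum.elim (Sum.elim ![(finRotate 3)⁻¹, 1] Empty.elim) Empty.elim) (by decide +kernel) (by decide +kernel) _ _ _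
  have h2 : f3 (z.comp ((tine 2).left _)) A B C = f3 ctK A B C := by
    exact f3_pos
      ![Sum.inr 0, Sum.inl 0] (by decide +kernel)
      ![(finRotate 3)⁻¹, 1] (by decide +kernel) (by decide +kernel) _ _ _
  have h3 : f3 (z.comp ((tine 3).left _)) A B C = f3 ctD (om (Equiv.swap 1 2 * Equiv.swap 1 3) A) (om (Equiv.swap 1 2 * Equiv.swap 1 3) (on (rung 2 3) B)) (om (Equiv.swap 1 2) C) := by
    rw [f3_trd, f3_snd, f3_snd, f3_fst]
    exact f3_pos
      (Sum.elim (Sum.elim (Sum.elim (Sum.elim ![] Empty.elim) Empty.elim) ![Sum.inr 0, Sum.inl 0]) Empty.elim) (by decide +kernel)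
      (Sum.elim (Sum.elim (Sum.elim (Sum.elim ![] Empty.elim) Empty.elim) ![finRotate 3, 1]) Empty.elim) (by decide +kernel) (by decide +kernel) _ _ _
  have h4 : f2 (y.comp ((Gad.vert.fill _).right _)) A C
      = - f2 ctE A (om (Equiv.swap 0 1 * Equiv.swap 0 2 * Equiv.swap 1 3) (on (rung 1 3) C)) := by
    rw [f2_snd, f2_snd]
    exact f2_neg
      (Sum.elim (Sum.elim ![] Empty.elim) ![Sum.inr 0, Sum.inl 0]) (by decide +kernel)
      (Sum.elim (Sum.elim ![] Empty.elim) ![Equiv.swap 0 1, finRotate 3]) (by decide +kernel) (by decide +kernel) _ _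
  have h5 : f3 ((y.comp ((join.left _).right _)).comp (((Gad.ren (finRotate 4)).left _).right _))
      A B C = b * f2 (y.comp ((Gad.vert.fill _).right _)) A C := by
    rw [f3_apply, f2_apply, vl_comp, vl_comp, vl_comp, ← smul_eq_mul, ← map_smul]
    refine congrArg (vl y) ?_
    have e : A.1 _ (ap join (pm (finRotate 4) (B.1 _ (C.1 _ closedWt))))
        = A.1 _ (b • fl Gad.vert (C.1 _ closedWt)) := congrArg _ (hB _ _)
    rw [map_smul] at e
    refine Eq.trans ?_ (e.trans (congrArg (b • ·) (Op.nat A _ _)))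
    refine Eq.trans ?_ (Op.nat A _ _).symm
    exact congrArg (pull _) (Op.nat A _ _).symm
  have h := f3_slide hA B C z
  rw [Fin.sum_univ_four, h0, h1, h2, h3, h5, h4] at h
  linear_combination h

theorem ctD_treeB : f3 ctD (ofl treeB) A B = f2 ctE (on (rung 2 3) A) B := by
  rw [f2_fst]
  refine Eq.trans (vl_comp ctD (treeB.fill _) (w2 A B)).symm ?_
  exact f2_pos
    (Sum.elim ![] ![Sum.inr 0, Sum.inr 1]) (by decide +kernel)
    (Sum.elim ![] ![1, 1]) (by decide +kernel) (by decide +kernel) _ _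

theorem ctE_treeB : f2 ctE (ofl treeB) A = - vl ctV (ap join (pm (Equiv.swap 1 2) (A.1 _ closedWt))) := by
  refine Eq.trans (vl_comp ctE (treeB.fill _) _).symm ?_
  refine Eq.trans (vl_neg (C := (ctV.comp (join.left _)).comp ((Gad.ren (Equiv.swap 1 2)).left _))
    (Sum.elim (Sum.elim ![Sum.inr 1] ![Sum.inr 0]) Empty.elim) (by decide +kernel)
    (Sum.elim (Sum.elim ![Equiv.swap 1 2] ![1]) Empty.elim) (by decide +kernel) (by decide +kernel) _) (congrArg Neg.neg ((vl_comp _ _ _).trans (vl_comp _ _ _)))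

/-- The two pairs of ports exchanged. -/
abbrev uu : Equiv.Perm (Fin 4) := Equiv.swap 0 2 * Equiv.swap 1 3

theorem ctD_refl : f3 ctD (om uu C) (om uu B) (om uu A) = f3 ctD A B C := by
  rw [f3_trd, f3_snd, f3_fst, f3_swap12, f3_swap23, f3_swap12]
  exact f3_pos
    ![] (by decide +kernel)
    ![] (by decide +kernel) (by decide +kernel) _ _ _

theorem ctK_swap : f3 ctK (om vv B) (om vv A) (om vv C) = f3 ctK A B C := by
  rw [f3_trd, f3_snd, f3_fst, f3_swap12]
  exact f3_pos
    ![Sum.inl (Sum.inl (Sum.inl (Sum.inl 1))), Sum.inl (Sum.inl (Sum.inl (Sum.inl 0)))] (by decide +kernel)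
    ![Equiv.swap 0 1, Equiv.swap 0 1] (by decide +kernel) (by decide +kernel) _ _ _

theorem ctD_treeA {A B : Op} {a b : Lam}
    (hA : ∀ (T : Type) (φ : Wt T Lam), ap join (A.1 T φ) = a • fl Gad.vert φ)
    (hB : ∀ (T : Type) (φ : Wt T Lam), ap join (B.1 T φ) = b • fl Gad.vert φ) :
    f3 ctD (ofl treeA) (om uu A) B = a * b * vl ctV (fl Gad.vert closedWt) := by
  let y : Gad Empty (Fin 3 ⊕ (Fin 3 ⊕ Fin 0)) := .of 0 Empty.elim
    ![(.inr (.inl 0), .inr (.inr (.inl 0))), (.inr (.inl 1), .inr (.inr (.inl 1))), (.inr (.inl 2), .inr (.inr (.inl 2)))]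
    (by decide +kernel)
  have h1 : f3 ctD (ofl treeA) (om uu A) B
      = vl y (ap join (A.1 _ (ap join (B.1 _ closedWt)))) := by
    have hn : A.1 _ (ap join (B.1 _ closedWt)) = pull ((join.left _).right _) (w2 A B) :=
      Op.nat A (join.left _) _
    refine Eq.trans ?_ (congrArg (fun z => vl y (ap join z)) hn.symm)
    refine Eq.trans (vl_comp ctD (treeA.fill _) (w2 (om uu A) B)).symm ?_
    refine Eq.trans (vl_comp _ ((Gad.ren uu).left _) (w2 A B)).symm ?_
    refine Eq.trans (vl_pos (C := (y.comp (join.left _)).comp ((join.left _).right _))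
      (Sum.elim (Sum.elim ![] ![Sum.inl (Sum.inr 0)]) ![Sum.inl (Sum.inr 1)]) (by decide +kernel)
      (Sum.elim (Sum.elim ![] ![1]) ![1]) (by decide +kernel) (by decide +kernel) _)
      (congrArg id ((vl_comp _ _ _).trans (vl_comp _ _ _)))
  have h2 : vl y (fl Gad.vert (fl Gad.vert closedWt)) = vl ctV (fl Gad.vert closedWt) := by
    refine Eq.trans ((vl_comp _ _ _).trans (vl_comp y (Gad.vert.fill _) _)).symm ?_
    refine Eq.trans (vl_pos (C := ctV.comp (Gad.vert.fill _))
      (Sum.elim ![Sum.inl (Sum.inr 0)] (fun _ => Sum.inr 0)) (by decide +kernel)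
      (Sum.elim ![1] (fun _ => 1)) (by decide +kernel) (by decide +kernel) _)
      (congrArg id (vl_comp _ _ _))
  rw [h1, hB, map_smul, map_smul, hA, map_smul, map_smul, h2, smul_eq_mul, smul_eq_mul]
  ring

end contexts

/-! ### Ladders of the three types -/

section types
open Polynomial

theorem closedVal_theta : closedVal ⟨Option Unit, yPair.map remE.symm⟩ = yGraph.cls := by
  have hc : Conn (yPair.map remE.symm) := by
    have key : ∀ x, EqvGen (Step (yPair.map remE.symm)) x (Sum.inl (none, 0)) := by
      have hn : ∀ s, EqvGen (Step (yPair.map remE.symm)) (Sum.inl (none, s)) (Sum.inl (none, 0)) :=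
        fun s => reach_vert _ _ _ _
      rintro (⟨_ | ⟨⟨⟩⟩, s⟩ | i)
      · exact hn s
      · exact EqvGen.trans _ _ _ (reach_edge (yPair.map remE.symm) (Sum.inl (some (), s))) (hn s)
      · exact i.elim0
    exact ⟨⟨Sum.inl (none, 0)⟩, fun x y => EqvGen.trans _ _ _ (key x) (EqvGen.symm _ _ (key y))⟩
  rw [closedVal_of hc none, remVF.at_of _ (Equiv.refl _) rfl]
  change alt (rcls _) = _
  have h : onV (Equiv.refl (Option Unit)) = Equiv.refl _ := rfl
  rw [h, ext_refl, Pairing.map_refl, Pairing.map_map, Equiv.symm_trans_self, Pairing.map_refl]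
  have e : yGraph.cls = rcls yPair := (rcls_graph yGraph).symm
  rw [← e]; exact alt_of_mem (1 : Lam).2

theorem vl_theta : vl ctV (fl Gad.vert closedWt) = 1 := by
  refine Eq.trans (vl_comp ctV (Gad.vert.fill _) closedWt).symm ?_
  let e : (Empty ⊕ (Fin 1 ⊕ Unit)) ≃ Option Unit := ⟨Sum.elim Empty.elim (Sum.elim (fun _ => none) fun _ => some ()),
    fun o => Option.elim o (.inr (.inl 0)) fun _ => .inr (.inr ()), by decide, by decide⟩
  apply Subtype.ext
  refine Eq.trans ?_ closedVal_theta
  refine Eq.trans (closedVal_iso e _).symm (congrArg closedVal ?_)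
  refine congrArg (Cx.mk (Option Unit)) ?_
  symm
  apply Pairing.eq_map
  have key : ∀ x, ∃ r, (ctV.comp (Gad.vert.fill (Fin 0))).emb Empty
      ((ctV.comp (Gad.vert.fill (Fin 0))).E (Sum.inr r)) = x := by decide +kernel
  intro x
  obtain ⟨r, rfl⟩ := key x
  rw [Gad.app_emb]
  revert r
  decide +kernel

/-- Representatives of the three pairings of the ports. -/
def sp : Fin 3 → Equiv.Perm (Fin 4) := ![1, Equiv.swap 1 2, Equiv.swap 1 3]

/-- Ladders of the three types. -/
def ty (p : Fin 3) : Lam[X] →ₗ[Lam] Op := om (sp p) ∘ₗ lo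

/-- The action of permutations on types. -/
def tp (σ : Equiv.Perm (Fin 4)) (p : Fin 3) : Fin 3 :=
  if side ((sp p * σ * (sp 0)⁻¹) 0) = side ((sp p * σ * (sp 0)⁻¹) 1) then 0
  else if side ((sp p * σ * (sp 1)⁻¹) 0) = side ((sp p * σ * (sp 1)⁻¹) 1) then 1 else 2

theorem om_ty (σ : Equiv.Perm (Fin 4)) (p : Fin 3) (f : Lam[X]) :
    om σ (ty p f) = ty (tp σ p) f := by
  have key : ∀ σ p, side ((sp p * σ * (sp (tp σ p))⁻¹) 0)
      = side ((sp p * σ * (sp (tp σ p))⁻¹) 1) := by decide +kernel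
  show om σ (om (sp p) (lo f)) = om (sp (tp σ p)) (lo f)
  rw [om_om]
  exact om_lo f (key σ p)

theorem ty_zero (f : Lam[X]) : ty 0 f = lo f := Op.ext fun _ _ => pm_one _

theorem om_ty_eq {σ : Equiv.Perm (Fin 4)} {p q : Fin 3} (h : tp σ p = q) (f : Lam[X]) :
    om σ (ty p f) = ty q f := h ▸ om_ty σ p f

theorem ty_apply (p : Fin 3) (f : Lam[X]) {T : Type} (φ : Wt T Lam) :
    (ty p f).1 T φ = pm (sp p) (hl f φ) := by rw [← lo_apply]; rfl

theorem isSl_ty (p : Fin 3) (f : Lam[X]) : (ty p f).IsSl := by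
  intro T φ
  rw [ty_apply]
  fin_cases p
  · show IsHole (pm 1 _); rw [pm_one]; exact (isLad_hl f φ).hole
  · exact (isLad_hl f φ).hole.perm 1 2
  · exact (isLad_hl f φ).hole.perm 1 3

theorem on_two_three (p : Fin 3) (f : Lam[X]) :
    on (rung 2 3) (ty p f) = on (rung 0 1) (ty p f) :=
  Op.ext fun T φ => (isSl_ty p f T φ).rung_two_three

theorem on_one_three (p : Fin 3) (f : Lam[X]) : on (rung 1 3) (ty p f)
    = om (Equiv.swap 1 2) (on (rung 0 1) (om (Equiv.swap 1 2) (ty p f))) := by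
  rw [om_ty, ← on_two_three, ← om_ty]
  refine Op.ext fun T φ => ?_
  show ap (rung 1 3) _ = pm _ (ap (rung 2 3) (pm (Equiv.swap 1 2) _))
  have h : ap (rung 2 3) (pm (Equiv.swap 1 2) ((ty p f).1 T φ))
    = pm (Equiv.swap 1 2) (ap (rung 1 3) ((ty p f).1 T φ)) := rung_pm 1 2 2 3 _ _
  rw [h, pm_swap_swap]

theorem rung_ty_zero (f : Lam[X]) : on (rung 0 1) (ty 0 f) = ty 0 (ξ * f) := by
  rw [ty_zero, ty_zero, lo_X_mul]

theorem ty_one (p : Fin 3) : ty p 1 = om (sp p) (ofl treeB - ofl treeC) := by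
  show om (sp p) (aeval (on (rung 0 1)) (1 : Lam[X]) _) = _
  rw [map_one]; rfl

theorem ofl_treeB : (3 : Lam) • ofl treeB = ty 0 1 - ty 2 1 := by
  rw [ty_one, ty_one]
  refine Op.ext fun T φ => ?_
  show (3 : Lam) • fl treeB φ = pm 1 (fl treeB φ - fl treeC φ)
    - pm (Equiv.swap 1 3) (fl treeB φ - fl treeC φ)
  rw [pm_one, map_sub, pm_treeB_13, pm_treeC_13]
  linear_combination (norm := module) fl_tree φ

theorem om_treeB : om (Equiv.swap 0 1) (ofl treeB) = - ofl treeC :=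
  Op.ext fun _ φ => pm_treeB_01 φ

theorem om_on_zero_one (A : Op) :
    om (Equiv.swap 0 1) (on (rung 0 1) A) = on (rung 0 1) (om (Equiv.swap 0 1) A) :=
  Op.ext fun _ _ => (rg_pm_01 _).symm

theorem rung_ty_one (f : Lam[X]) : (6 : Lam) • on (rung 0 1) (ty 1 f)
    = (6 * tElt) • (ty 1 f + ty 2 f - ty 0 f) - (3 : Lam) • (ty 1 (ξ * f) + ty 2 (ξ * f)
      - ty 0 (ξ * f)) + (2 * yv f) • (ty 0 1 - ty 2 1) := by
  have h : (2 : Lam) • on (rung 0 1) (ty 1 f) = (2 * tElt) • (ty 1 f + ty 2 f - ty 0 f)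
      - (ty 1 (ξ * f) + ty 2 (ξ * f) - ty 0 (ξ * f)) + (2 * yv f) • ofl treeB := by
    rw [ty_zero, ty_zero]
    show (2 : Lam) • on (rung 0 1) (om (Equiv.swap 1 2) (lo f)) = (2 * tElt) •
      (om (Equiv.swap 1 2) (lo f) + om (Equiv.swap 1 3) (lo f) - lo f)
      - (om (Equiv.swap 1 2) (lo (ξ * f)) + om (Equiv.swap 1 3) (lo (ξ * f)) - lo (ξ * f))
        + (2 * yv f) • ofl treeB
    rw [lo_X_mul]
    refine Op.ext fun T φ => ?_
    have := (isLad_hl f φ).rung_cross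
    rw [← lo_apply] at this
    exact this
  have h2 := ofl_treeB
  linear_combination (norm := module) (3 : Lam) • h + (2 * yv f) • h2

theorem rung_ty_two (f : Lam[X]) : (6 : Lam) • on (rung 0 1) (ty 2 f)
    = (6 * tElt) • (ty 1 f + ty 2 f - ty 0 f) - (3 : Lam) • (ty 1 (ξ * f) + ty 2 (ξ * f)
      - ty 0 (ξ * f)) + (2 * yv f) • (ty 0 1 - ty 1 1) := by
  have h := congrArg (om (Equiv.swap 0 1)) (rung_ty_one f)
  have e0 : ∀ f, om (Equiv.swap 0 1) (ty 0 f) = ty 0 f := om_ty_eq (by decide +kernel)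
  have e1 : ∀ f, om (Equiv.swap 0 1) (ty 1 f) = ty 2 f := om_ty_eq (by decide +kernel)
  have e2 : ∀ f, om (Equiv.swap 0 1) (ty 2 f) = ty 1 f := om_ty_eq (by decide +kernel)
  simp only [map_smul, map_add, map_sub, e0, e1, e2, om_on_zero_one] at h
  rw [h]; module

/-- Ladders whose types sum up to zero. -/
def Std (f : Lam[X]) : Prop := ty 0 f + ty 1 f + ty 2 f = 0

/-- Ladders that are invariant under all permutations. -/
def Sym (f : Lam[X]) : Prop := ∀ p, ty p f = ty 0 f

theorem std_one : Std 1 := by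
  rw [Std, ty_one, ty_one, ty_one]
  refine Op.ext fun T φ => ?_
  show pm 1 (fl treeB φ - fl treeC φ) + pm (Equiv.swap 1 2) (fl treeB φ - fl treeC φ)
    + pm (Equiv.swap 1 3) (fl treeB φ - fl treeC φ) = 0
  rw [pm_one, map_sub, map_sub, pm_treeB_13, pm_treeC_13, pm_treeB_12, pm_treeC_12]
  module

theorem yv_one : yv 1 = 3 * tElt := by
  have h := yv_monomial 0 1
  rw [one_mul, monomial_zero_one] at h
  rw [h]
  show 2 * (2 * tElt) - tElt ^ 1 = _
  ring

/-- The symmetric ladder obtained from a ladder whose types sum up to zero. -/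
def al (f : Lam[X]) : Lam[X] := (3 : Lam) • (ξ * f) - (4 * tElt) • f + yv f • 1

section std
variable {e f g : Lam[X]}

theorem Std.sum_eq (h : Std f) : ty 0 (al f) = ty 0 (ξ * f) + ty 1 (ξ * f) + ty 2 (ξ * f) := by
  have h1 := rung_ty_one f
  have h2 := rung_ty_two f
  have h0 := rung_ty_zero f
  have h3 := congrArg (on (rung 0 1)) h
  rw [map_add, map_add, map_zero, h0] at h3
  have h5 : ty 0 1 + ty 1 1 + ty 2 1 = 0 := std_one
  have h6 : ty 0 f + ty 1 f + ty 2 f = 0 := h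
  rw [al, map_add, map_sub, map_smul, map_smul, map_smul]
  refine smul_cancel 6 (by norm_num) ?_
  push_cast
  linear_combination (norm := module) (6 : Lam) • h3 - h1 - h2 - (12 * tElt) • h6
    + (2 * yv f) • h5

theorem Std.sym (h : Std f) : Sym (al f) := by
  intro p
  have h1 := congrArg (om (sp p)) h.sum_eq
  have e : ∀ σ q f, om σ (ty q f) = ty (tp σ q) f := om_ty
  simp only [map_add, e] at h1
  rw [h.sum_eq]
  fin_cases p
  · exact h1
  · refine Eq.trans ?_ (h1.trans ?_)
    · rfl
    · show ty 1 _ + ty 0 _ + ty 2 _ = _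
      abel
  · refine Eq.trans ?_ (h1.trans ?_)
    · rfl
    · show ty 2 _ + ty 1 _ + ty 0 _ = _
      abel

theorem rung_zero (f : Lam[X]) : (6 : Lam) • on (rung 0 1) (ty 0 f)
    = (2 : Lam) • ty 0 (al f) + (8 * tElt) • ty 0 f - (2 * yv f) • ty 0 1 := by
  rw [rung_ty_zero, al, map_add, map_sub, map_smul, map_smul, map_smul]; module

theorem Std.rung_one (h : Std f) : (6 : Lam) • on (rung 0 1) (ty 1 f)
    = - ty 0 (al f) - (4 * tElt) • ty 0 f - (2 * yv f) • ty 2 1 := by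
  have h6 : ty 0 f + ty 1 f + ty 2 f = 0 := h
  have h7 := h.sum_eq
  have h8 := rung_zero f
  rw [rung_ty_zero] at h8
  rw [rung_ty_one]
  linear_combination (norm := module) (6 * tElt) • h6 + (3 : Lam) • h7 + h8

theorem Std.rung_two (h : Std f) : (6 : Lam) • on (rung 0 1) (ty 2 f)
    = - ty 0 (al f) - (4 * tElt) • ty 0 f - (2 * yv f) • ty 1 1 := by
  have h6 : ty 0 f + ty 1 f + ty 2 f = 0 := h
  have h7 := h.sum_eq
  have h8 := rung_zero f
  rw [rung_ty_zero] at h8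
  rw [rung_ty_two]
  linear_combination (norm := module) (6 * tElt) • h6 + (3 : Lam) • h7 + h8

end std

end types

/-! ### Values of the forms on ladders -/

section forms
open Polynomial

theorem tp_val : tp (Equiv.swap 1 2) 0 = 1 ∧ tp (Equiv.swap 1 2) 1 = 0 ∧ tp (Equiv.swap 1 2) 2 = 2 ∧
    tp (Equiv.swap 0 2) 0 = 2 ∧ tp (Equiv.swap 0 2) 1 = 1 ∧ tp (Equiv.swap 0 2) 2 = 0 ∧
    tp (Equiv.swap 1 2 * Equiv.swap 1 3) 0 = 1 ∧ tp (Equiv.swap 1 2 * Equiv.swap 1 3) 1 = 2 ∧ tp (Equiv.swap 1 2 * Equiv.swap 1 3) 2 = 0 ∧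
    tp (Equiv.swap 0 1) 0 = 0 ∧ tp (Equiv.swap 0 1) 1 = 2 ∧ tp (Equiv.swap 0 1) 2 = 1 ∧
    tp (Equiv.swap 2 3) 0 = 0 ∧ tp (Equiv.swap 2 3) 1 = 2 ∧ tp (Equiv.swap 2 3) 2 = 1 ∧
    tp (uu) 0 = 0 ∧ tp (uu) 1 = 1 ∧ tp (uu) 2 = 2 ∧
    tp (vv) 0 = 0 ∧ tp (vv) 1 = 1 ∧ tp (vv) 2 = 2 ∧
    tp (Equiv.swap 0 3) 0 = 1 ∧ tp (Equiv.swap 0 3) 1 = 0 ∧ tp (Equiv.swap 0 3) 2 = 2 ∧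
    tp (Equiv.swap 1 3) 0 = 2 ∧ tp (Equiv.swap 1 3) 1 = 1 ∧ tp (Equiv.swap 1 3) 2 = 0 ∧
    tp (Equiv.swap 0 1 * Equiv.swap 0 2 * Equiv.swap 1 3) 0 = 0 ∧ tp (Equiv.swap 0 1 * Equiv.swap 0 2 * Equiv.swap 1 3) 1 = 2 ∧ tp (Equiv.swap 0 1 * Equiv.swap 0 2 * Equiv.swap 1 3) 2 = 1 ∧
    tp (finRotate 4) 0 = 2 ∧ tp (finRotate 4) 1 = 1 ∧ tp (finRotate 4) 2 = 0 := by
  decide +kernel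

theorem join_pm {T : Type} (φ : Wt (Fin 4 ⊕ T) Lam) :
    ap join (pm (Equiv.swap 0 1) φ) = - ap join φ := by
  rw [← ap_comp]
  exact ap_neg ![Sum.inl 0] (by decide)
          ![Equiv.swap 1 2] (by decide) (by decide) φ

/-- The signs of the values of joined ports. -/
def bt : Fin 3 → Lam := ![0, 1, -1]

theorem join_ty (p : Fin 3) (f : Lam[X]) (T : Type) (φ : Wt T Lam) :
    ap join ((ty p f).1 T φ) = (bt p * yv f) • fl Gad.vert φ := by
  have h1 : ap join ((ty 1 f).1 T φ) = yv f • fl Gad.vert φ := by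
    rw [ty_apply]; exact (isLad_hl f φ).join
  have h2 : ∀ p, ap join ((ty (tp (Equiv.swap 0 1) p) f).1 T φ) = - ap join ((ty p f).1 T φ) := by
    intro p; rw [← om_ty]; exact join_pm _
  have h3 := h2 0
  have h4 := h2 1
  simp only [tp_val] at h3 h4
  fin_cases p
  · show _ = (0 * yv f) • _
    rw [zero_mul, zero_smul]
    refine smul_cancel 2 (by norm_num) ?_
    push_cast
    linear_combination (norm := module) h3
  · exact h1.trans (by show _ = (1 * yv f) • _; rw [one_mul])
  · exact h4.trans (by rw [h1]; show _ = (-1 * yv f) • _; module)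

theorem join_rot (p : Fin 3) (f : Lam[X]) (T : Type) (φ : Wt T Lam) :
    ap join (pm (finRotate 4) ((ty p f).1 T φ))
      = (bt (tp (finRotate 4) p) * yv f) • fl Gad.vert φ := by
  rw [← join_ty, ← om_ty]; rfl

theorem nat_cancel (n : ℕ) (hn : n ≠ 0) {x y : Lam} (h : (n : Lam) * x = n * y) : x = y :=
  smul_cancel n hn h

/-! Two holes. -/

theorem ctE_bar_ty (p q : Fin 3) (f g : Lam[X]) : f2 ctE (ty (tp (Equiv.swap 0 1) p) f)
    (ty (tp (Equiv.swap 2 3) q) g) = f2 ctE (ty p f) (ty q g) := by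
  rw [← om_ty, ← om_ty, ctE_bar]

theorem ctE_swap (A B : Op) :
    f2 ctE (om (Equiv.swap 1 2) A) (om (Equiv.swap 0 3) B) = f2 ctE A B := by
  rw [f2_snd, f2_fst]
  exact f2_pos
    ![] (by decide +kernel)
    ![] (by decide +kernel) (by decide +kernel) _ _

theorem ctE_move (f g : Lam[X]) : f2 ctE (ty 0 f) (ty 0 g) = f2 ctE (ty 0 1) (ty 0 (f * g)) := by
  induction f using Polynomial.induction_on' with
  | add p q hp hq => rw [add_mul, map_add, map_add, map_add, map_add, LinearMap.add_apply, hp, hq]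
  | monomial n a =>
    induction n generalizing g with
    | zero =>
      rw [monomial_zero_left, ← smul_eq_C_mul, ← mul_one (C a), ← smul_eq_C_mul, map_smul, map_smul,
        map_smul, map_smul, LinearMap.smul_apply]
    | succ n ih =>
      have e : monomial (n + 1) a = ξ * monomial n a := by rw [X_mul_monomial]
      have h : ξ * monomial n a * g = monomial n a * (ξ * g) := by ring
      rw [e, h, ← ih, ← rung_ty_zero, ctE_rung, on_two_three, rung_ty_zero]

theorem ctE_val (f g : Lam[X]) : f2 ctE (ty 0 f) (ty 0 g) = -(2 * yv (f * g)) := by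
  rw [ctE_move, ty_one]
  have e : om (sp 0) (ofl treeB - ofl treeC) = ofl treeB + om (Equiv.swap 0 1) (ofl treeB) := by
    rw [om_treeB, ← sub_eq_add_neg]; exact Op.ext fun _ _ => pm_one _
  have h0 : f2 ctE (om (Equiv.swap 0 1) (ofl treeB)) (ty 0 (f * g))
      = f2 ctE (ofl treeB) (ty 0 (f * g)) := by
    conv_lhs => rw [← om_ty_eq (σ := Equiv.swap 2 3) (p := 0) (q := 0) (by decide +kernel) (f * g)]
    exact ctE_bar _ _
  have h1 : f2 ctE (ofl treeB) (ty 0 (f * g)) = - yv (f * g) := by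
    rw [ctE_treeB]
    have h2 : pm (Equiv.swap 1 2) ((ty 0 (f * g)).1 _ closedWt)
        = (ty 1 (f * g)).1 _ closedWt := by
      rw [← om_ty_eq (σ := Equiv.swap 1 2) (p := 0) (q := 1) (by decide +kernel)]; rfl
    rw [h2, join_ty, map_smul, vl_theta]
    show - ((1 * yv (f * g)) * 1) = _
    ring
  rw [e, map_add, LinearMap.add_apply, h0, h1]; ring

theorem Sym.yv_mul {f s : Lam[X]} (hf : Std f) (hs : Sym s) : yv (f * s) = 0 := by
  have h0 : ∀ p, f2 ctE (ty p f) (ty 0 s) = f2 ctE (ty 0 f) (ty 0 s) := by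
    have h1 : f2 ctE (ty 1 f) (ty 0 s) = f2 ctE (ty 0 f) (ty 0 s) := by
      conv_rhs => rw [← ctE_swap, om_ty, om_ty, hs]
      simp only [tp_val]
    have h2 : f2 ctE (ty 2 f) (ty 0 s) = f2 ctE (ty 1 f) (ty 0 s) := by
      have := ctE_bar_ty 1 0 f s
      simp only [tp_val] at this
      exact this
    intro p
    fin_cases p
    · rfl
    · exact h1
    · exact h2.trans h1
  have h1 : ty 0 f + ty 1 f + ty 2 f = 0 := hf
  have h2 : f2 ctE (ty 0 f + ty 1 f + ty 2 f) (ty 0 s) = 0 := by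
    rw [h1, map_zero, LinearMap.zero_apply]
  rw [map_add, map_add, LinearMap.add_apply, LinearMap.add_apply, h0 1, h0 2, ctE_val] at h2
  refine nat_cancel 6 (by norm_num) ?_
  push_cast
  linear_combination - h2

theorem Sym.yv_eq {s : Lam[X]} (hs : Sym s) : yv s = 0 := by
  rw [← one_mul s]; exact hs.yv_mul std_one

theorem ctE_off {f g : Lam[X]} (hg : Std g) : f2 ctE (ty 0 f) (ty 2 g) = yv (f * g) := by
  have h := ctE_bar_ty 0 1 f g
  simp only [tp_val] at h
  have h1 : ty 0 g + ty 1 g + ty 2 g = 0 := hg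
  have h2 : f2 ctE (ty 0 f) (ty 0 g + ty 1 g + ty 2 g) = 0 := by rw [h1, map_zero]
  rw [map_add, map_add, ctE_val, ← h] at h2
  refine nat_cancel 2 (by norm_num) ?_
  push_cast
  linear_combination h2

/-! Three holes in a circle. -/

theorem ctD_bar_fst_ty (p q r : Fin 3) (e f g : Lam[X]) :
    f3 ctD (ty (tp (Equiv.swap 0 1) p) e) (ty (tp (Equiv.swap 2 3) q) f) (ty r g)
      = f3 ctD (ty p e) (ty q f) (ty r g) := by
  rw [← om_ty, ← om_ty, ctD_bar_fst]

theorem ctD_bar_snd_ty (p q r : Fin 3) (e f g : Lam[X]) :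
    f3 ctD (ty p e) (ty (tp (Equiv.swap 0 1) q) f) (ty (tp (Equiv.swap 2 3) r) g)
      = f3 ctD (ty p e) (ty q f) (ty r g) := by
  rw [← om_ty, ← om_ty, ctD_bar_snd]

theorem ctD_move (e f g : Lam[X]) : f3 ctD (ty 0 e) (ty 0 f) (ty 0 g)
    = f3 ctD (ty 0 1) (ty 0 (e * f)) (ty 0 g) := by
  induction e using Polynomial.induction_on' with
  | add p q hp hq =>
    rw [add_mul, map_add, map_add, map_add, map_add, LinearMap.add_apply, LinearMap.add_apply,
      LinearMap.add_apply, hp, hq]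
  | monomial n a =>
    induction n generalizing f with
    | zero =>
      rw [monomial_zero_left, ← smul_eq_C_mul, ← mul_one (C a), ← smul_eq_C_mul, map_smul, map_smul,
        map_smul, map_smul]; rfl
    | succ n ih =>
      have e : monomial (n + 1) a = ξ * monomial n a := by rw [X_mul_monomial]
      have h : ξ * monomial n a * f = monomial n a * (ξ * f) := by ring
      rw [e, h, ← ih, ← rung_ty_zero, ctD_rung_fst, on_two_three, rung_ty_zero]

theorem ctD_val (e f g : Lam[X]) : f3 ctD (ty 0 e) (ty 0 f) (ty 0 g)
    = -(4 * yv (ξ * (e * f * g))) := by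
  rw [ctD_move, ty_one]
  have e1 : om (sp 0) (ofl treeB - ofl treeC) = ofl treeB + om (Equiv.swap 0 1) (ofl treeB) := by
    rw [om_treeB, ← sub_eq_add_neg]; exact Op.ext fun _ _ => pm_one _
  have h0 : f3 ctD (om (Equiv.swap 0 1) (ofl treeB)) (ty 0 (e * f)) (ty 0 g)
      = f3 ctD (ofl treeB) (ty 0 (e * f)) (ty 0 g) := by
    conv_lhs => rw [← om_ty_eq (σ := Equiv.swap 2 3) (p := 0) (q := 0) (by decide +kernel) (e * f)]
    exact ctD_bar_fst _ _ _
  have h1 : f3 ctD (ofl treeB) (ty 0 (e * f)) (ty 0 g) = -(2 * yv (ξ * (e * f * g))) := by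
    rw [ctD_treeB, on_two_three, rung_ty_zero, ctE_val, mul_assoc ξ]
  rw [e1, map_add, LinearMap.add_apply, LinearMap.add_apply, h0, h1]; ring

/-- Ladders for which the types are related by a scalar. -/
def Tw (k : Lam) (f : Lam[X]) : Prop := ty 1 f + ty 2 f = k • ty 0 f

theorem Std.tw {f : Lam[X]} (h : Std f) : Tw (-1) f := by
  have h' : ty 0 f + ty 1 f + ty 2 f = 0 := h
  show ty 1 f + ty 2 f = _
  linear_combination (norm := module) h'

theorem Sym.tw {f : Lam[X]} (h : Sym f) : Tw 2 f := by
  show ty 1 f + ty 2 f = _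
  rw [h 1, h 2]; module

/-- The factors by which the types of a hole contribute. -/
def nu (k : Lam) : Fin 3 → Lam := ![2, k, k]

theorem ctD_fst {k l : Lam} {f g : Lam[X]} (e : Lam[X]) (hf : Tw k f) (hg : Tw l g) (q r : Fin 3) :
    f3 ctD (ty 0 e) (ty q f) (ty r g) = -(nu k q * nu l r * yv (ξ * (e * f * g))) := by
  have hf' : ty 1 f + ty 2 f = k • ty 0 f := hf
  have hg' : ty 1 g + ty 2 g = l • ty 0 g := hg
  have a1 := ctD_bar_fst_ty 0 1 0 e f g
  have a2 := ctD_bar_fst_ty 0 1 1 e f g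
  have a3 := ctD_bar_fst_ty 0 1 2 e f g
  have b1 := ctD_bar_snd_ty 0 0 1 e f g
  have b2 := ctD_bar_snd_ty 0 1 1 e f g
  simp only [tp_val] at a1 a2 a3 b1 b2
  have c0 := congrArg (fun z => f3 ctD (ty 0 e) z (ty 0 g)) hf'
  have c1 := congrArg (fun z => f3 ctD (ty 0 e) z (ty 1 g)) hf'
  have c3 := congrArg (f3 ctD (ty 0 e) (ty 0 f)) hg'
  simp only [map_add, map_smul, LinearMap.add_apply, LinearMap.smul_apply, smul_eq_mul,
    ctD_val] at c0 c1 c3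
  have r1 : f3 ctD (ty 0 e) (ty 0 f) (ty 1 g) = -(2 * l * yv (ξ * (e * f * g))) := by
    refine nat_cancel 2 (by norm_num) ?_
    push_cast; linear_combination c3 - b1
  have r2 : f3 ctD (ty 0 e) (ty 1 f) (ty 1 g) = -(k * l * yv (ξ * (e * f * g))) := by
    refine nat_cancel 2 (by norm_num) ?_
    push_cast; linear_combination c1 - a2 + k * r1
  have r3 : f3 ctD (ty 0 e) (ty 1 f) (ty 0 g) = -(k * 2 * yv (ξ * (e * f * g))) := by
    refine nat_cancel 2 (by norm_num) ?_
    push_cast; linear_combination c0 - a1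
  fin_cases q <;> fin_cases r
  · show f3 ctD (ty 0 e) (ty 0 f) (ty 0 g) = -(2 * 2 * yv _); rw [ctD_val]; ring
  · exact r1
  · exact b1.trans r1
  · exact r3
  · exact r2
  · exact (a3.symm.trans b2).trans r2
  · exact a1.trans r3
  · exact a2.trans r2
  · exact b2.trans r2

theorem ctD_trd {k l : Lam} {e f : Lam[X]} (he : Tw k e) (hf : Tw l f) (g : Lam[X]) (p q : Fin 3) :
    f3 ctD (ty p e) (ty q f) (ty 0 g) = -(nu k p * nu l q * yv (ξ * (e * f * g))) := by
  rw [ctD_rot, ctD_rot, ctD_fst g he hf]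
  have h : g * e * f = e * f * g := by ring
  rw [h]

theorem ctD_snd {k l : Lam} {e g : Lam[X]} (he : Tw k e) (f : Lam[X]) (hg : Tw l g) (p r : Fin 3) :
    f3 ctD (ty p e) (ty 0 f) (ty r g) = -(nu k p * nu l r * yv (ξ * (e * f * g))) := by
  rw [ctD_rot, ctD_fst f hg he]
  have h : f * g * e = e * f * g := by ring
  rw [h]; ring

/-- The value of the circle of three ladders in general position. -/
def kk1 (e f g : Lam[X]) : Lam := f3 ctD (ty 1 e) (ty 1 f) (ty 1 g)

theorem kk1_rot (e f g : Lam[X]) : kk1 e f g = kk1 f g e := ctD_rot _ _ _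

theorem kk1_swap (e f g : Lam[X]) : kk1 e f g = kk1 f e g := by
  have h := ctD_refl (ty 1 e) (ty 1 f) (ty 1 g)
  simp only [om_ty, tp_val] at h
  rw [kk1, ← h]
  exact kk1_rot g f e

/-- The parity of the types in general position. -/
def pr : Fin 3 → Fin 3 → Fin 3 → Bool := fun p q r => (p = 2) ^^ (q = 2) ^^ (r = 2)

theorem ctD_gen {e f g : Lam[X]} (he : Std e) (hf : Std f) (hg : Std g) (p q r : Fin 3) (hp : p ≠ 0)
    (hq : q ≠ 0) (hr : r ≠ 0) : f3 ctD (ty p e) (ty q f) (ty r g)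
      = if pr p q r then yv (ξ * (e * f * g)) - kk1 e f g else kk1 e f g := by
  have hg' : ty 0 g + ty 1 g + ty 2 g = 0 := hg
  have c := congrArg (f3 ctD (ty 1 e) (ty 1 f)) hg'
  have a1 := ctD_bar_fst_ty 1 1 1 e f g
  have a2 := ctD_bar_fst_ty 1 1 2 e f g
  have a3 := ctD_bar_fst_ty 1 2 1 e f g
  have a4 := ctD_bar_fst_ty 1 2 2 e f g
  have b1 := ctD_bar_snd_ty 1 1 1 e f g
  have b2 := ctD_bar_snd_ty 1 1 2 e f g
  simp only [tp_val] at a1 a2 a3 a4 b1 b2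
  simp only [map_add, map_zero, ctD_trd he.tw hf.tw] at c
  have o : f3 ctD (ty 1 e) (ty 1 f) (ty 2 g) = yv (ξ * (e * f * g)) - kk1 e f g := by
    have hk : kk1 e f g = f3 ctD (ty 1 e) (ty 1 f) (ty 1 g) := rfl
    have hn : nu (-1) 1 = -1 := rfl
    rw [hn] at c
    linear_combination c + hk
  fin_cases p <;> first | exact absurd rfl hp | skip
  all_goals fin_cases q <;> first | exact absurd rfl hq | skip
  all_goals fin_cases r <;> first | exact absurd rfl hr | skip
  · rfl
  · exact o
  · exact b2.trans o
  · exact b1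
  · exact a3.trans (b2.trans o)
  · exact a4.trans b1
  · exact a1
  · exact a2.trans o

theorem kk1_one {f g : Lam[X]} (hf : Std f) (hg : Std g) :
    2 * kk1 1 f g = yv (ξ * (f * g)) - 3 * yv f * yv g := by
  have h1 : (3 : Lam) • ofl treeA = ty 2 1 - ty 1 1 := by
    rw [ty_one, ty_one]
    refine Op.ext fun T φ => ?_
    show (3 : Lam) • fl treeA φ = pm (Equiv.swap 1 3) (fl treeB φ - fl treeC φ)
      - pm (Equiv.swap 1 2) (fl treeB φ - fl treeC φ)
    rw [map_sub, map_sub, pm_treeB_13, pm_treeC_13, pm_treeB_12, pm_treeC_12]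
    linear_combination (norm := module) fl_tree φ
  have h2 := ctD_treeA (join_ty 1 f) (join_ty 1 g)
  have h3 := congrArg (fun z => f3 ctD z (ty 1 f) (ty 1 g)) h1
  simp only [om_ty, tp_val] at h2
  simp only [map_smul, map_sub, LinearMap.sub_apply, LinearMap.smul_apply, smul_eq_mul, h2,
    vl_theta] at h3
  rw [ctD_gen std_one hf hg _ _ _ (by decide) (by decide) (by decide),
    ctD_gen std_one hf hg _ _ _ (by decide) (by decide) (by decide), if_pos (by decide),
    if_neg (by decide), one_mul] at h3
  have hb : bt 1 = 1 := rfl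
  rw [hb] at h3
  linear_combination h3

end forms

/-! ### The values of `ctK` -/

section kvalues
open Polynomial

/-- The value of three ladders of different types joined to two vertices. -/
def kap (p : Lam[X]) : Lam := 2 * tElt * yv (ξ * p) - yv (ξ * (ξ * p))

theorem ctK_two_two_one (e f g : Lam[X]) :
    f3 ctK (ty 2 e) (ty 2 f) (ty 1 g) = kap (e * f * g) := by
  have h := ctK_slide (isSl_ty 2 e) (join_rot 2 f) (ty 1 g)
  have h6 := congrArg (fun z => f3 ctD (ty 0 e) (om (Equiv.swap 1 2 * Equiv.swap 1 3) z) (ty 0 g))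
    (rung_ty_two f)
  have hb : bt 0 = 0 := rfl
  simp only [om_ty, tp_val, on_two_three, hb, zero_mul, add_zero] at h
  simp only [map_smul, map_add, map_sub, LinearMap.smul_apply, LinearMap.add_apply,
    LinearMap.sub_apply, om_ty, tp_val, ctD_val, smul_eq_mul] at h6
  have a : ∀ f, f3 ctD (ty 0 e) (ty 2 f) (ty 0 g) = f3 ctD (ty 0 e) (ty 1 f) (ty 0 g) := by
    intro f
    have := ctD_bar_fst_ty 0 1 0 e f g
    simp only [tp_val] at this
    exact this
  have hx : e * (ξ * f) * g = ξ * (e * f * g) := by ring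
  rw [a, a, a, hx] at h6
  refine nat_cancel 12 (by norm_num) ?_
  push_cast
  rw [kap]
  linear_combination 6 * h - h6

theorem ctK_bar_ty (p q r : Fin 3) (e f g : Lam[X]) :
    f3 ctK (ty (tp (Equiv.swap 2 3) p) e) (ty (tp (Equiv.swap 2 3) q) f)
      (ty (tp (Equiv.swap 2 3) r) g) = f3 ctK (ty p e) (ty q f) (ty r g) := by
  rw [← om_ty, ← om_ty, ← om_ty, ctK_bar]

theorem ctK_mix (p q r : Fin 3) (hp : p ≠ 0) (hq : q ≠ 0) (hr : r ≠ 0) (hne : ¬ (p = q ∧ q = r))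
    (e f g : Lam[X]) : f3 ctK (ty p e) (ty q f) (ty r g) = kap (e * f * g) := by
  have k1 := ctK_two_two_one
  have k2 : ∀ e f g, f3 ctK (ty 2 e) (ty 1 f) (ty 2 g) = kap (e * f * g) := by
    intro e f g
    have h : g * e * f = e * f * g := by ring
    rw [ctK_rot, ctK_rot, k1, h]
  have k3 : ∀ e f g, f3 ctK (ty 1 e) (ty 2 f) (ty 2 g) = kap (e * f * g) := by
    intro e f g
    have h : f * g * e = e * f * g := by ring
    rw [ctK_rot, k1, h]
  have b1 := ctK_bar_ty 2 2 1 e f g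
  have b2 := ctK_bar_ty 2 1 2 e f g
  have b3 := ctK_bar_ty 1 2 2 e f g
  simp only [tp_val] at b1 b2 b3
  fin_cases p <;> first | exact absurd rfl hp | skip
  all_goals fin_cases q <;> first | exact absurd rfl hq | skip
  all_goals fin_cases r <;> first | exact absurd rfl hr | exact absurd ⟨rfl, rfl⟩ hne | skip
  · exact b1.trans (k1 _ _ _)
  · exact b2.trans (k2 _ _ _)
  · exact k3 _ _ _
  · exact b3.trans (k3 _ _ _)
  · exact k2 _ _ _
  · exact k1 _ _ _

/-- The value of three ladders of the same type joined to two vertices. -/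
def ks (e f g : Lam[X]) : Lam := f3 ctK (ty 1 e) (ty 1 f) (ty 1 g)

theorem ctK_two (e f g : Lam[X]) : f3 ctK (ty 2 e) (ty 2 f) (ty 2 g) = ks e f g := by
  have b := ctK_bar_ty 1 1 1 e f g
  simp only [tp_val] at b
  exact b

theorem ks_rot (e f g : Lam[X]) : ks e f g = ks f g e := ctK_rot _ _ _

theorem ks_swap (e f g : Lam[X]) : ks e f g = ks f e g := by
  have h := ctK_swap (ty 1 e) (ty 1 f) (ty 1 g)
  simp only [om_ty, tp_val] at h
  exact h.symm

theorem Sym.ks {s : Lam[X]} (hs : Sym s) (f g : Lam[X]) : ks s f g = kap (s * f * g) := by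
  rw [Vogel.ks, hs 1, ← hs 2]
  exact ctK_mix 2 1 1 (by decide) (by decide) (by decide) (by decide) s f g

theorem Std.zero_eq {f : Lam[X]} (h : Std f) : ty 0 f = - ty 1 f - ty 2 f := by
  have h' : ty 0 f + ty 1 f + ty 2 f = 0 := h
  linear_combination (norm := module) h'

theorem nu_zero (k : Lam) : nu k 0 = 2 := rfl
theorem nu_one (k : Lam) : nu k 1 = k := rfl
theorem nu_two (k : Lam) : nu k 2 = k := rfl

theorem ctK_zero_one_two {e g : Lam[X]} (he : Std e) (hg : Std g) (f : Lam[X]) : f3 ctK (ty 0 e) (ty 1 f) (ty 2 g)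
    + f3 ctK (ty 1 e) (ty 1 f) (ty 0 g) = -(3 * kap (e * f * g) + ks e f g) := by
  rw [he.zero_eq, hg.zero_eq]
  simp only [map_sub, map_neg, LinearMap.sub_apply, LinearMap.neg_apply]
  rw [ctK_mix 1 1 2 (by decide) (by decide) (by decide) (by decide),
    ctK_mix 2 1 2 (by decide) (by decide) (by decide) (by decide), ← ks]
  ring

theorem ks_mid {e g : Lam[X]} (he : Std e) (hg : Std g) (f : Lam[X]) : 6 * (3 * kap (e * f * g) + ks e f g)
    = f3 ctD (ty 1 e) (om (Equiv.swap 1 2 * Equiv.swap 1 3) ((6 : Lam) • on (rung 0 1) (ty 1 f)))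
        (ty 2 g) + yv f * (4 * yv e * yv g - 4 * tElt * yv (e * g)) := by
  have h := ctK_slide (isSl_ty 0 e) (join_rot 1 f) (ty 2 g)
  have hb : bt 1 = 1 := rfl
  simp only [om_ty, tp_val, on_two_three, on_one_three, hb, one_mul] at h
  rw [ctK_zero_one_two he hg] at h
  have h6 := congrArg (fun z => f2 ctE (ty 0 e) (om (Equiv.swap 0 1 * Equiv.swap 0 2 * Equiv.swap 1 3)
    (om (Equiv.swap 1 2) z))) hg.rung_two
  simp only [map_smul, map_sub, map_neg, om_ty, tp_val, ctE_val, ctE_off hg,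
    smul_eq_mul, mul_one, hg.sym.yv_mul he, hg.sym 1] at h6
  rw [map_smul, map_smul, LinearMap.smul_apply, smul_eq_mul]
  linear_combination -6 * h + yv f * h6

theorem ks_val {e f g : Lam[X]} (he : Std e) (hf : Std f) (hg : Std g) : 6 * (3 * kap (e * f * g) + ks e f g)
    = yv (ξ * (e * al f * g)) - 4 * tElt * yv (ξ * (e * f * g)) + 4 * tElt * kk1 e f g
      + 2 * yv f * yv (ξ * (e * 1 * g)) + yv f * (4 * yv e * yv g - 4 * tElt * yv (e * g)) := by
  rw [ks_mid he hg, hf.rung_one]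
  simp only [map_smul, map_sub, map_neg, LinearMap.smul_apply, LinearMap.sub_apply,
    LinearMap.neg_apply, om_ty, tp_val, hf.sym 1, smul_eq_mul]
  rw [ctD_snd he.tw _ hg.tw, ctD_snd he.tw _ hg.tw,
    ctD_gen he hf hg _ _ _ (by decide) (by decide) (by decide), if_pos (by decide), nu_one, nu_two]
  ring

theorem Sym.std {s : Lam[X]} (hs : Sym s) : Std ((3 : Lam) • (ξ * s) - (2 * tElt) • s) := by
  have h := rung_ty_one s
  rw [hs 1, hs 2, rung_ty_zero, hs.yv_eq] at h
  have e : ∀ p, ty p ((3 : Lam) • (ξ * s) - (2 * tElt) • s)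
      = (3 : Lam) • ty p (ξ * s) - (2 * tElt) • ty 0 s := by
    intro p; rw [map_sub, map_smul, map_smul, hs p]
  rw [Std, e, e, e]
  linear_combination (norm := module) h

theorem Sym.kk1 {s e g : Lam[X]} (hs : Sym s) (he : Std e) (hg : Std g) :
    kk1 e ((3 : Lam) • (ξ * s) - (2 * tElt) • s) g
      = yv (ξ * (e * ((3 : Lam) • (ξ * s) - (2 * tElt) • s) * g))
        - 2 * tElt * yv (ξ * (e * s * g)) - 12 * kap (e * s * g) := by
  have h := ks_mid he hg s
  rw [hs.yv_eq, zero_mul, add_zero, ks_swap e s g,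
    hs.ks, hs 1, rung_ty_zero] at h
  have h1 := ctD_gen he hs.std hg 1 1 2 (by decide) (by decide) (by decide)
  rw [if_pos (by decide)] at h1
  rw [map_sub, map_smul, map_smul, hs 1] at h1
  simp only [map_sub, map_smul, LinearMap.sub_apply, LinearMap.smul_apply, smul_eq_mul,
    ctD_snd he.tw s hg.tw, nu_one, nu_two] at h1
  simp only [map_smul, LinearMap.smul_apply, om_ty, tp_val, smul_eq_mul] at h
  have e2 : s * e * g = e * s * g := by ring
  rw [e2] at h
  refine nat_cancel 2 (by norm_num) ?_
  push_cast
  linear_combination h + 2 * h1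

end kvalues

/-! ### The relation between three ladders -/

section relation
set_option linter.unusedSimpArgs false
open Polynomial

theorem ctK_mix_val (e f g : Lam[X]) :
    f3 ctK (ty 1 e) (ty 1 f) (ty 2 g) = kap (e * f * g) ∧
    f3 ctK (ty 1 e) (ty 2 f) (ty 1 g) = kap (e * f * g) ∧
    f3 ctK (ty 2 e) (ty 1 f) (ty 1 g) = kap (e * f * g) ∧
    f3 ctK (ty 2 e) (ty 2 f) (ty 1 g) = kap (e * f * g) ∧
    f3 ctK (ty 2 e) (ty 1 f) (ty 2 g) = kap (e * f * g) ∧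
    f3 ctK (ty 1 e) (ty 2 f) (ty 2 g) = kap (e * f * g) := by
  refine ⟨?_, ?_, ?_, ?_, ?_, ?_⟩ <;> apply ctK_mix <;> decide

theorem Sym.ctK {s : Lam[X]} (hs : Sym s) (e g : Lam[X]) :
    f3 Vogel.ctK (ty 1 e) (ty 0 s) (ty 1 g) = kap (e * s * g) ∧
    f3 Vogel.ctK (ty 2 e) (ty 0 s) (ty 2 g) = kap (e * s * g) := by
  refine ⟨?_, ?_⟩
  · rw [← hs 2]; apply ctK_mix <;> decide
  · rw [← hs 1]; apply ctK_mix <;> decide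

theorem ctK_one (e f g : Lam[X]) : f3 ctK (ty 1 e) (ty 1 f) (ty 1 g) = ks e f g := rfl

theorem ctD_even {e f g : Lam[X]} (he : Std e) (hf : Std f) (hg : Std g) (p q r : Fin 3) (hp : p ≠ 0)
    (hq : q ≠ 0) (hr : r ≠ 0) (h : ¬ pr p q r = true) :
    f3 ctD (ty p e) (ty q f) (ty r g) = kk1 e f g := by
  rw [ctD_gen he hf hg p q r hp hq hr, if_neg h]

theorem ctD_odd {e f g : Lam[X]} (he : Std e) (hf : Std f) (hg : Std g) (p q r : Fin 3) (hp : p ≠ 0)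
    (hq : q ≠ 0) (hr : r ≠ 0) (h : pr p q r = true) :
    f3 ctD (ty p e) (ty q f) (ty r g) = yv (ξ * (e * f * g)) - kk1 e f g := by
  rw [ctD_gen he hf hg p q r hp hq hr, if_pos h]

theorem ctM {A : Op} (hA : A.IsSl) (B C : Op) : f3 ctS A B C + f3 ctG A B C
    = f3 ctD (om (Equiv.swap 1 2) (on (rung 2 3) A)) (om (Equiv.swap 1 2) (on (rung 2 3) B))
        (om (Equiv.swap 1 2 * Equiv.swap 1 3) C)
      - f3 ctK A (on (rung 1 3) B) C + tElt * f3 ctK A B C := by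
  linear_combination ctP_slide hA B C - ctP_ihx A B C

/-- The sum of the values of the two contexts with four vertices. -/
def mm (p q r : Fin 3) (e f g : Lam[X]) : Lam :=
  f3 ctS (ty p e) (ty q f) (ty r g) + f3 ctG (ty p e) (ty q f) (ty r g)

theorem mm_eq (p q r : Fin 3) (e f g : Lam[X]) : 36 * mm p q r e f g
    = f3 ctD (om (Equiv.swap 1 2) ((6 : Lam) • on (rung 0 1) (ty p e)))
        (om (Equiv.swap 1 2) ((6 : Lam) • on (rung 0 1) (ty q f)))
        (ty (tp (Equiv.swap 1 2 * Equiv.swap 1 3) r) g)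
      - 6 * f3 ctK (ty p e) (om (Equiv.swap 1 2)
        ((6 : Lam) • on (rung 0 1) (ty (tp (Equiv.swap 1 2) q) f))) (ty r g)
      + 36 * tElt * f3 ctK (ty p e) (ty q f) (ty r g) := by
  rw [mm, ctM (isSl_ty p e), on_two_three, on_two_three, on_one_three, om_ty, om_ty]
  simp only [map_smul, LinearMap.smul_apply, smul_eq_mul]
  ring

theorem mm_rel (e f g : Lam[X]) : 2 * mm 2 1 0 g e f + 2 * mm 0 1 1 g e f = mm 1 0 1 e f g
    + mm 2 0 2 g f e + mm 2 0 2 f g e + mm 1 0 1 e g f := by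
  have g1 := ctG_fold (ty 2 g) (ty 1 e) (ty 0 f)
  have g2 := ctG_refl (ty 1 e) (ty 0 f) (ty 1 g)
  have g3 := ctG_refl (ty 1 e) (ty 0 g) (ty 1 f)
  have a1 := ctS_swap_fst (ty 2 g) (ty 1 e) (ty 0 f)
  have a2 := ctS_swap_snd (ty 1 e) (ty 2 g) (ty 0 f)
  have a3 := ctS_swap_snd (ty 2 g) (ty 1 e) (ty 0 f)
  have a4 := ctS_swap_fst (ty 0 g) (ty 1 e) (ty 2 f)
  have a5 := ctS_swap_snd (ty 0 g) (ty 1 e) (ty 2 f)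
  have a6 := ctS_swap_fst (ty 0 g) (ty 2 f) (ty 1 e)
  simp only [om_ty, tp_val] at g1 g2 g3 a1 a2 a3 a4 a5 a6
  simp only [mm]
  linear_combination 2 * g1 - g2 - g3 - a1 - a2 - a3 - a4 - a5 - a6

theorem mm_two_one_zero {e f g : Lam[X]} (he : Std e) (hf : Std f) (hg : Std g) : 36 * mm 2 1 0 g e f
    = ((-1) * (-1) * -(2 * (-1) * yv (ξ * ((al g) * (al e) * f)))
      + (-1) * (-4 * tElt) * -((-1) * (-1) * yv (ξ * ((al g) * e * f)))
      + (-1) * (-2 * yv e) * -((-1) * (-1) * yv (ξ * ((al g) * 1 * f)))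
      + (-4 * tElt) * (-1) * -((-1) * (-1) * yv (ξ * (g * (al e) * f)))
      + (-4 * tElt) * (-4 * tElt) * (kk1 g e f)
      + (-4 * tElt) * (-2 * yv e) * (yv (ξ * (g * 1 * f)) - kk1 g 1 f)
      + (-2 * yv g) * (-1) * -(2 * (-1) * yv (ξ * (1 * (al e) * f)))
      + (-2 * yv g) * (-4 * tElt) * -((-1) * (-1) * yv (ξ * (1 * e * f)))
      + (-2 * yv g) * (-2 * yv e) * -((-1) * (-1) * yv (ξ * (1 * 1 * f))))
      - 6 * (6 * 1 * (-1) * kap (g * (ξ * e) * f)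
      + 6 * 1 * (-1) * kap (g * (ξ * e) * f))
      + 36 * tElt * (1 * 1 * (-1) * kap (g * e * f)
      + 1 * 1 * (-1) * kap (g * e * f)) := by
  have hD : f3 ctD (om (Equiv.swap 1 2) ((6 : Lam) • on (rung 0 1) (ty 2 g)))
      (om (Equiv.swap 1 2) ((6 : Lam) • on (rung 0 1) (ty 1 e))) (ty 1 f) = (-1) * (-1) * -(2 * (-1) * yv (ξ * ((al g) * (al e) * f)))
      + (-1) * (-4 * tElt) * -((-1) * (-1) * yv (ξ * ((al g) * e * f)))
      + (-1) * (-2 * yv e) * -((-1) * (-1) * yv (ξ * ((al g) * 1 * f)))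
      + (-4 * tElt) * (-1) * -((-1) * (-1) * yv (ξ * (g * (al e) * f)))
      + (-4 * tElt) * (-4 * tElt) * (kk1 g e f)
      + (-4 * tElt) * (-2 * yv e) * (yv (ξ * (g * 1 * f)) - kk1 g 1 f)
      + (-2 * yv g) * (-1) * -(2 * (-1) * yv (ξ * (1 * (al e) * f)))
      + (-2 * yv g) * (-4 * tElt) * -((-1) * (-1) * yv (ξ * (1 * e * f)))
      + (-2 * yv g) * (-2 * yv e) * -((-1) * (-1) * yv (ξ * (1 * 1 * f))) := by
    rw [hg.rung_two, he.rung_one]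
    simp only [map_smul, map_add, map_sub, map_neg, LinearMap.add_apply, LinearMap.smul_apply,
      LinearMap.sub_apply, LinearMap.neg_apply, om_ty, tp_val, smul_eq_mul, hg.sym 1, he.sym 1,
      ctD_fst (al g) he.sym.tw hf.tw 0 1,
      ctD_fst (al g) he.tw hf.tw 1 1,
      ctD_fst (al g) std_one.tw hf.tw 2 1,
      ctD_snd hg.tw (al e) hf.tw 1 1,
      ctD_even hg he hf 1 1 1 (by decide) (by decide) (by decide) (by decide),
      ctD_odd hg std_one hf 1 2 1 (by decide) (by decide) (by decide) (by decide),
      ctD_fst 1 he.sym.tw hf.tw 0 1,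
      ctD_fst 1 he.tw hf.tw 1 1,
      ctD_fst 1 std_one.tw hf.tw 2 1, nu_zero, nu_one, nu_two]
    ring
  have hK : f3 ctK (ty 2 g) (om (Equiv.swap 1 2) ((6 : Lam) • on (rung 0 1) (ty 0 e))) (ty 0 f)
      = 6 * 1 * (-1) * kap (g * (ξ * e) * f)
      + 6 * 1 * (-1) * kap (g * (ξ * e) * f) := by
    rw [rung_ty_zero, hf.zero_eq]
    simp only [map_smul, map_add, map_sub, map_neg, LinearMap.add_apply, LinearMap.smul_apply,
      LinearMap.sub_apply, LinearMap.neg_apply, om_ty, tp_val, smul_eq_mul, ctK_mix_val, ctK_two, ctK_one]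
    ring
  have hL : f3 ctK (ty 2 g) (ty 1 e) (ty 0 f) = 1 * 1 * (-1) * kap (g * e * f)
      + 1 * 1 * (-1) * kap (g * e * f) := by
    rw [hf.zero_eq]
    simp only [map_sub, map_neg, LinearMap.sub_apply, LinearMap.neg_apply, ctK_mix_val, ctK_two, ctK_one]
    ring
  have h := mm_eq 2 1 0 g e f
  simp only [tp_val] at h
  rw [h, hD, hK, hL]

theorem mm_zero_one_one {e f g : Lam[X]} (he : Std e) (hf : Std f) (hg : Std g) : 36 * mm 0 1 1 g e f
    = (2 * (-1) * -(2 * (-1) * yv (ξ * ((al g) * (al e) * f)))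
      + 2 * (-4 * tElt) * -((-1) * (-1) * yv (ξ * ((al g) * e * f)))
      + 2 * (-2 * yv e) * -((-1) * (-1) * yv (ξ * ((al g) * 1 * f)))
      + (8 * tElt) * (-1) * -((-1) * (-1) * yv (ξ * (g * (al e) * f)))
      + (8 * tElt) * (-4 * tElt) * (yv (ξ * (g * e * f)) - kk1 g e f)
      + (8 * tElt) * (-2 * yv e) * (kk1 g 1 f)
      + (-2 * yv g) * (-1) * -((-1) * (-1) * yv (ξ * (1 * (al e) * f)))
      + (-2 * yv g) * (-4 * tElt) * (yv (ξ * (1 * e * f)) - kk1 1 e f)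
      + (-2 * yv g) * (-2 * yv e) * (kk1 1 1 f))
      - 6 * (6 * (-1) * 1 * ks g (ξ * e) f
      + 6 * (-1) * 1 * kap (g * (ξ * e) * f))
      + 36 * tElt * (1 * (-1) * 1 * ks g e f
      + 1 * (-1) * 1 * kap (g * e * f)) := by
  have hD : f3 ctD (om (Equiv.swap 1 2) ((6 : Lam) • on (rung 0 1) (ty 0 g)))
      (om (Equiv.swap 1 2) ((6 : Lam) • on (rung 0 1) (ty 1 e))) (ty 2 f) = 2 * (-1) * -(2 * (-1) * yv (ξ * ((al g) * (al e) * f)))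
      + 2 * (-4 * tElt) * -((-1) * (-1) * yv (ξ * ((al g) * e * f)))
      + 2 * (-2 * yv e) * -((-1) * (-1) * yv (ξ * ((al g) * 1 * f)))
      + (8 * tElt) * (-1) * -((-1) * (-1) * yv (ξ * (g * (al e) * f)))
      + (8 * tElt) * (-4 * tElt) * (yv (ξ * (g * e * f)) - kk1 g e f)
      + (8 * tElt) * (-2 * yv e) * (kk1 g 1 f)
      + (-2 * yv g) * (-1) * -((-1) * (-1) * yv (ξ * (1 * (al e) * f)))
      + (-2 * yv g) * (-4 * tElt) * (yv (ξ * (1 * e * f)) - kk1 1 e f)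
      + (-2 * yv g) * (-2 * yv e) * (kk1 1 1 f) := by
    rw [rung_zero g, he.rung_one]
    simp only [map_smul, map_add, map_sub, map_neg, LinearMap.add_apply, LinearMap.smul_apply,
      LinearMap.sub_apply, LinearMap.neg_apply, om_ty, tp_val, smul_eq_mul, hg.sym 1, he.sym 1,
      ctD_fst (al g) he.sym.tw hf.tw 0 2,
      ctD_fst (al g) he.tw hf.tw 1 2,
      ctD_fst (al g) std_one.tw hf.tw 2 2,
      ctD_snd hg.tw (al e) hf.tw 1 2,
      ctD_odd hg he hf 1 1 2 (by decide) (by decide) (by decide) (by decide),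
      ctD_even hg std_one hf 1 2 2 (by decide) (by decide) (by decide) (by decide),
      ctD_snd std_one.tw (al e) hf.tw 1 2,
      ctD_odd std_one he hf 1 1 2 (by decide) (by decide) (by decide) (by decide),
      ctD_even std_one std_one hf 1 2 2 (by decide) (by decide) (by decide) (by decide), nu_zero, nu_one, nu_two]
    ring
  have hK : f3 ctK (ty 0 g) (om (Equiv.swap 1 2) ((6 : Lam) • on (rung 0 1) (ty 0 e))) (ty 1 f)
      = 6 * (-1) * 1 * ks g (ξ * e) f
      + 6 * (-1) * 1 * kap (g * (ξ * e) * f) := by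
    rw [rung_ty_zero, hg.zero_eq]
    simp only [map_smul, map_add, map_sub, map_neg, LinearMap.add_apply, LinearMap.smul_apply,
      LinearMap.sub_apply, LinearMap.neg_apply, om_ty, tp_val, smul_eq_mul, ctK_mix_val, ctK_two, ctK_one]
    ring
  have hL : f3 ctK (ty 0 g) (ty 1 e) (ty 1 f) = 1 * (-1) * 1 * ks g e f
      + 1 * (-1) * 1 * kap (g * e * f) := by
    rw [hg.zero_eq]
    simp only [map_sub, map_neg, LinearMap.sub_apply, LinearMap.neg_apply, ctK_mix_val, ctK_two, ctK_one]
    ring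
  have h := mm_eq 0 1 1 g e f
  simp only [tp_val] at h
  rw [h, hD, hK, hL]

theorem mm_one_zero_one {e f g : Lam[X]} (he : Std e) (hf : Std f) (hg : Std g) : 36 * mm 1 0 1 e f g
    = ((-1) * 2 * -(2 * (-1) * yv (ξ * ((al e) * (al f) * g)))
      + (-1) * (8 * tElt) * -((-1) * (-1) * yv (ξ * ((al e) * f * g)))
      + (-1) * (-2 * yv f) * -((-1) * (-1) * yv (ξ * ((al e) * 1 * g)))
      + (-4 * tElt) * 2 * -((-1) * (-1) * yv (ξ * (e * (al f) * g)))
      + (-4 * tElt) * (8 * tElt) * (yv (ξ * (e * f * g)) - kk1 e f g)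
      + (-4 * tElt) * (-2 * yv f) * (yv (ξ * (e * 1 * g)) - kk1 e 1 g)
      + (-2 * yv e) * 2 * -((-1) * (-1) * yv (ξ * (1 * (al f) * g)))
      + (-2 * yv e) * (8 * tElt) * (kk1 1 f g)
      + (-2 * yv e) * (-2 * yv f) * (kk1 1 1 g))
      - 6 * ((-1) * 1 * 1 * kap (e * (al f) * g)
      + (-4 * tElt) * 1 * 1 * ks e f g
      + (-2 * yv f) * 1 * 1 * kap (e * 1 * g))
      + 36 * tElt * ((-1) * 1 * 1 * ks e f g
      + (-1) * 1 * 1 * kap (e * f * g)) := by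
  have hD : f3 ctD (om (Equiv.swap 1 2) ((6 : Lam) • on (rung 0 1) (ty 1 e)))
      (om (Equiv.swap 1 2) ((6 : Lam) • on (rung 0 1) (ty 0 f))) (ty 2 g) = (-1) * 2 * -(2 * (-1) * yv (ξ * ((al e) * (al f) * g)))
      + (-1) * (8 * tElt) * -((-1) * (-1) * yv (ξ * ((al e) * f * g)))
      + (-1) * (-2 * yv f) * -((-1) * (-1) * yv (ξ * ((al e) * 1 * g)))
      + (-4 * tElt) * 2 * -((-1) * (-1) * yv (ξ * (e * (al f) * g)))
      + (-4 * tElt) * (8 * tElt) * (yv (ξ * (e * f * g)) - kk1 e f g)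
      + (-4 * tElt) * (-2 * yv f) * (yv (ξ * (e * 1 * g)) - kk1 e 1 g)
      + (-2 * yv e) * 2 * -((-1) * (-1) * yv (ξ * (1 * (al f) * g)))
      + (-2 * yv e) * (8 * tElt) * (kk1 1 f g)
      + (-2 * yv e) * (-2 * yv f) * (kk1 1 1 g) := by
    rw [he.rung_one, rung_zero f]
    simp only [map_smul, map_add, map_sub, map_neg, LinearMap.add_apply, LinearMap.smul_apply,
      LinearMap.sub_apply, LinearMap.neg_apply, om_ty, tp_val, smul_eq_mul, he.sym 1, hf.sym 1,
      ctD_fst (al e) hf.sym.tw hg.tw 0 2,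
      ctD_fst (al e) hf.tw hg.tw 1 2,
      ctD_fst (al e) std_one.tw hg.tw 1 2,
      ctD_snd he.tw (al f) hg.tw 1 2,
      ctD_odd he hf hg 1 1 2 (by decide) (by decide) (by decide) (by decide),
      ctD_odd he std_one hg 1 1 2 (by decide) (by decide) (by decide) (by decide),
      ctD_snd std_one.tw (al f) hg.tw 2 2,
      ctD_even std_one hf hg 2 1 2 (by decide) (by decide) (by decide) (by decide),
      ctD_even std_one std_one hg 2 1 2 (by decide) (by decide) (by decide) (by decide), nu_zero, nu_one, nu_two]
    ring
  have hK : f3 ctK (ty 1 e) (om (Equiv.swap 1 2) ((6 : Lam) • on (rung 0 1) (ty 1 f))) (ty 1 g)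
      = (-1) * 1 * 1 * kap (e * (al f) * g)
      + (-4 * tElt) * 1 * 1 * ks e f g
      + (-2 * yv f) * 1 * 1 * kap (e * 1 * g) := by
    rw [hf.rung_one]
    simp only [map_smul, map_add, map_sub, map_neg, LinearMap.add_apply, LinearMap.smul_apply,
      LinearMap.sub_apply, LinearMap.neg_apply, om_ty, tp_val, smul_eq_mul, hf.sym 1, hf.sym.ctK, ctK_mix_val, ctK_two, ctK_one]
    ring
  have hL : f3 ctK (ty 1 e) (ty 0 f) (ty 1 g) = (-1) * 1 * 1 * ks e f g
      + (-1) * 1 * 1 * kap (e * f * g) := by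
    rw [hf.zero_eq]
    simp only [map_sub, map_neg, LinearMap.sub_apply, LinearMap.neg_apply, ctK_mix_val, ctK_two, ctK_one]
    ring
  have h := mm_eq 1 0 1 e f g
  simp only [tp_val] at h
  rw [h, hD, hK, hL]

theorem mm_two_zero_two {e f g : Lam[X]} (he : Std e) (hf : Std f) (hg : Std g) : 36 * mm 2 0 2 g f e
    = ((-1) * 2 * -(2 * 2 * yv (ξ * ((al g) * (al f) * e)))
      + (-1) * (8 * tElt) * -((-1) * 2 * yv (ξ * ((al g) * f * e)))
      + (-1) * (-2 * yv f) * -((-1) * 2 * yv (ξ * ((al g) * 1 * e)))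
      + (-4 * tElt) * 2 * -((-1) * 2 * yv (ξ * (g * (al f) * e)))
      + (-4 * tElt) * (8 * tElt) * -((-1) * (-1) * yv (ξ * (g * f * e)))
      + (-4 * tElt) * (-2 * yv f) * -((-1) * (-1) * yv (ξ * (g * 1 * e)))
      + (-2 * yv g) * 2 * -(2 * 2 * yv (ξ * (1 * (al f) * e)))
      + (-2 * yv g) * (8 * tElt) * -((-1) * 2 * yv (ξ * (1 * f * e)))
      + (-2 * yv g) * (-2 * yv f) * -((-1) * 2 * yv (ξ * (1 * 1 * e))))
      - 6 * ((-1) * 1 * 1 * kap (g * (al f) * e)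
      + (-4 * tElt) * 1 * 1 * kap (g * f * e)
      + (-2 * yv f) * 1 * 1 * ks g 1 e)
      + 36 * tElt * ((-1) * 1 * 1 * kap (g * f * e)
      + (-1) * 1 * 1 * ks g f e) := by
  have hD : f3 ctD (om (Equiv.swap 1 2) ((6 : Lam) • on (rung 0 1) (ty 2 g)))
      (om (Equiv.swap 1 2) ((6 : Lam) • on (rung 0 1) (ty 0 f))) (ty 0 e) = (-1) * 2 * -(2 * 2 * yv (ξ * ((al g) * (al f) * e)))
      + (-1) * (8 * tElt) * -((-1) * 2 * yv (ξ * ((al g) * f * e)))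
      + (-1) * (-2 * yv f) * -((-1) * 2 * yv (ξ * ((al g) * 1 * e)))
      + (-4 * tElt) * 2 * -((-1) * 2 * yv (ξ * (g * (al f) * e)))
      + (-4 * tElt) * (8 * tElt) * -((-1) * (-1) * yv (ξ * (g * f * e)))
      + (-4 * tElt) * (-2 * yv f) * -((-1) * (-1) * yv (ξ * (g * 1 * e)))
      + (-2 * yv g) * 2 * -(2 * 2 * yv (ξ * (1 * (al f) * e)))
      + (-2 * yv g) * (8 * tElt) * -((-1) * 2 * yv (ξ * (1 * f * e)))
      + (-2 * yv g) * (-2 * yv f) * -((-1) * 2 * yv (ξ * (1 * 1 * e))) := by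
    rw [hg.rung_two, rung_zero f]
    simp only [map_smul, map_add, map_sub, map_neg, LinearMap.add_apply, LinearMap.smul_apply,
      LinearMap.sub_apply, LinearMap.neg_apply, om_ty, tp_val, smul_eq_mul, hg.sym 1, hf.sym 1,
      ctD_fst (al g) hf.sym.tw he.tw 0 0,
      ctD_fst (al g) hf.tw he.tw 1 0,
      ctD_fst (al g) std_one.tw he.tw 1 0,
      ctD_snd hg.tw (al f) he.tw 1 0,
      ctD_trd hg.tw hf.tw e 1 1,
      ctD_trd hg.tw std_one.tw e 1 1,
      ctD_fst 1 hf.sym.tw he.tw 0 0,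
      ctD_fst 1 hf.tw he.tw 1 0,
      ctD_fst 1 std_one.tw he.tw 1 0, nu_zero, nu_one, nu_two]
    ring
  have hK : f3 ctK (ty 2 g) (om (Equiv.swap 1 2) ((6 : Lam) • on (rung 0 1) (ty 1 f))) (ty 2 e)
      = (-1) * 1 * 1 * kap (g * (al f) * e)
      + (-4 * tElt) * 1 * 1 * kap (g * f * e)
      + (-2 * yv f) * 1 * 1 * ks g 1 e := by
    rw [hf.rung_one]
    simp only [map_smul, map_add, map_sub, map_neg, LinearMap.add_apply, LinearMap.smul_apply,
      LinearMap.sub_apply, LinearMap.neg_apply, om_ty, tp_val, smul_eq_mul, hf.sym 1, hf.sym.ctK, ctK_mix_val, ctK_two, ctK_one]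
    ring
  have hL : f3 ctK (ty 2 g) (ty 0 f) (ty 2 e) = (-1) * 1 * 1 * kap (g * f * e)
      + (-1) * 1 * 1 * ks g f e := by
    rw [hf.zero_eq]
    simp only [map_sub, map_neg, LinearMap.sub_apply, LinearMap.neg_apply, ctK_mix_val, ctK_two, ctK_one]
    ring
  have h := mm_eq 2 0 2 g f e
  simp only [tp_val] at h
  rw [h, hD, hK, hL]

end relation

/-! ### The relation between three standard ladders -/

section three
open Polynomial

theorem three_ks_X_mul (g e f : Lam[X]) (he : Std e) : 3 * ks g (ξ * e) f
    = kap (g * al e * f) + 4 * tElt * ks g e f - yv e * ks g 1 f := by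
  have h := he.sym.ks g f
  have e1 : al e * g * f = g * al e * f := by ring
  rw [ks_swap, e1, ks] at h
  rw [ks, ks, ks, ← h]
  simp only [al, map_add, map_sub, map_smul, LinearMap.add_apply, LinearMap.sub_apply,
    LinearMap.smul_apply, smul_eq_mul]
  ring

theorem yv_three {e f g : Lam[X]} (he : Std e) (hf : Std f) (hg : Std g) :
    81 * yv (ξ * (ξ * (ξ * (e * f * g)))) + 27 * (yv e * yv (ξ * (ξ * (f * g)))
      + yv f * yv (ξ * (ξ * (e * g))) + yv g * yv (ξ * (ξ * (e * f))))
      - 351 * tElt * yv (ξ * (ξ * (e * f * g))) + 392 * tElt ^ 2 * yv (ξ * (e * f * g))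
      - 72 * tElt ^ 2 * (yv e * yv (f * g) + yv f * yv (e * g) + yv g * yv (e * f))
      + 45 * tElt * yv e * yv f * yv g - 28 * tElt ^ 2 * kk1 e f g = 0 := by
  have m := mm_rel e f g
  have m1 := mm_two_one_zero he hf hg
  have m2 := mm_zero_one_one he hf hg
  have m3 := mm_one_zero_one he hf hg
  have m4 := mm_two_zero_two he hf hg
  have m5 := mm_two_zero_two he hg hf
  have m6 := mm_one_zero_one he hg hf
  have k0 := three_ks_X_mul g e f he
  have k1 := ks_val he hf hg
  have k2 := ks_val std_one hf hg
  have k3 := ks_val std_one he hg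
  have k4 := ks_val std_one he hf
  have c1 := kk1_one hf hg
  have c2 := kk1_one he hf
  have c3 := kk1_one std_one hf
  have c4 := kk1_one std_one hg
  have y1 := hg.sym.yv_mul hf
  have y2 := hg.sym.yv_mul he
  have y3 := hf.sym.yv_mul he
  have y4 := he.sym.yv_eq
  have y5 := hf.sym.yv_eq
  have y6 := hg.sym.yv_eq
  have r1 : ks g e f = ks e f g := ks_rot _ _ _
  have r2 : ks g 1 f = ks 1 f g := ks_rot _ _ _
  have r3 : ks g f e = ks e f g := by rw [ks_swap, ks_rot, ks_swap, ks_rot, ks_rot, ks_swap, ks_rot]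
  have r4 : ks g 1 e = ks 1 e g := ks_rot _ _ _
  have r5 : ks f 1 e = ks 1 e f := ks_rot _ _ _
  have r6 : ks f g e = ks e f g := by rw [← ks_rot]
  have r7 : ks e g f = ks e f g := by rw [← r1, ks_swap]
  have q1 : kk1 g e f = kk1 e f g := kk1_rot _ _ _
  have q2 : kk1 g 1 f = kk1 1 f g := kk1_rot _ _ _
  have q3 : kk1 e 1 g = kk1 1 e g := kk1_swap _ _ _
  have q4 : kk1 e 1 f = kk1 1 e f := kk1_swap _ _ _
  have q5 : kk1 e g f = kk1 e f g := by rw [← q1, kk1_swap]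
  have q6 : kk1 1 g f = kk1 1 f g := by rw [← q2, kk1_swap]
  have p2 (a b c : Lam[X]) : a * b * c = a * (b * c) := mul_assoc a b c
  have l (a b c : Lam[X]) : a * (b * c) = b * (a * c) := mul_left_comm a b c
  have p := And.intro (mul_comm g e) <| And.intro (mul_comm g f) <| And.intro (mul_comm f e) <|
    And.intro (mul_comm e ξ) <| And.intro (mul_comm f ξ) (mul_comm g ξ)
  simp only [r1, r2, r3, r4, r5, r6, r7, q1, q2, q3, q4, q5, q6, kap, al, mul_add, mul_sub, add_mul,
    sub_mul, mul_smul_comm, smul_mul_assoc, map_add, map_sub, map_smul, smul_eq_mul, one_mul, mul_one,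
    yv_one] at m1 m2 m3 m4 m5 m6 k0 k1 k2 k3 k4 c1 c2 c3 c4 y1 y2 y3 y4 y5 y6
  simp only [p2, p, l g e, l g f, l f e, l e ξ, l f ξ, l g ξ] at m1 m2 m3 m4 m5 m6 k0 k1 k2 k3 k4 c1 c2 c3 c4 y1 y2 y3 y4 y5 y6 ⊢
  refine nat_cancel 4 (by norm_num) ?_
  push_cast
  linear_combination -36 * m + 2 * m1 + 2 * m2 - m3 - m4 - m5 - m6 + 24 * k0 + 20 * tElt * k1
    - 4 * yv e * k2 - 2 * yv f * k3 - 2 * yv g * k4 - 16 * tElt * yv e * c1 - 8 * tElt * yv g * c2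
    + 2 * yv e * yv g * c3 - 2 * yv e * yv f * c4 + 72 * tElt * yv e * y1 + 92 * tElt * yv f * y2
    + 72 * tElt * yv g * y3 - 24 * yv f * yv g * y4 - 2 * yv e * yv g * y5 - 6 * yv e * yv f * y6
end three

/-! ### The symmetric ladders -/

section symmetric
open Polynomial

/-- A third of the value of a ladder with one more rung. -/
def gv (s : Lam[X]) : Lam := algebraMap ℚ Lam 3⁻¹ * yv (ξ * s)

theorem yv_X_mul (s : Lam[X]) : yv (ξ * s) = 3 * gv s := by
  have h : (3 : Lam) * algebraMap ℚ Lam 3⁻¹ = 1 := by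
    rw [show (3 : Lam) = algebraMap ℚ Lam 3 from (map_ofNat _ 3).symm, ← map_mul]
    norm_num
  rw [gv, ← mul_assoc, h, one_mul]

/-- A sequence of symmetric ladders. -/
def sg : ℕ → Lam[X]
  | 0 => al 1
  | i + 1 => ξ * (ξ * sg i) - (2 * tElt) • (ξ * sg i) + gv (sg i) • 1

theorem sg_sym : ∀ i, Sym (sg i)
  | 0 => std_one.sym
  | i + 1 => by
    have h := sg_sym i
    have hE := h.std.sym
    have e : (9 : Lam) • sg (i + 1) = al ((3 : Lam) • (ξ * sg i) - (2 * tElt) • sg i)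
        - (8 * tElt ^ 2) • sg i := by
      rw [al, map_sub, map_smul, map_smul, h.yv_eq, yv_X_mul, sg]
      simp only [mul_sub, mul_smul_comm, smul_eq_mul]
      module
    intro p
    refine smul_cancel 9 (by norm_num) ?_
    push_cast
    rw [← map_smul, ← map_smul, e, map_sub, map_sub, hE p, map_smul, map_smul, h p]

theorem sg_zero : sg 0 = (3 : Lam) • ξ - tElt • 1 := by
  rw [sg, al, yv_one, mul_one]; module

theorem X_X_sg (i : ℕ) : ξ * (ξ * sg i) = sg (i + 1) + (2 * tElt) • (ξ * sg i) - gv (sg i) • 1 := by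
  rw [sg]; module

theorem X_X_sg_mul (i : ℕ) (q : Lam[X]) : ξ * (ξ * (sg i * q))
    = sg (i + 1) * q + (2 * tElt) • (ξ * (sg i * q)) - gv (sg i) • q := by
  rw [← mul_assoc, ← mul_assoc, mul_assoc ξ, X_X_sg, sub_mul, add_mul, smul_mul_assoc,
    smul_mul_assoc, one_mul, mul_assoc]

theorem yv_X : yv ξ = tElt ^ 2 := by
  have h := (sg_sym 0).yv_eq
  rw [sg_zero, map_sub, map_smul, map_smul, yv_one, smul_eq_mul, smul_eq_mul] at h
  refine nat_cancel 3 (by norm_num) ?_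
  push_cast
  linear_combination h

theorem gv_X : 9 * gv ξ = 3 * gv (sg 0) + tElt ^ 3 := by
  have h := yv_X_mul (sg 0)
  conv_lhs at h => rw [sg_zero]
  simp only [mul_sub, mul_smul_comm, mul_one, map_sub, map_smul, smul_eq_mul, yv_X_mul, yv_X] at h
  linear_combination h

theorem gv_X_X : 3 * gv (ξ * ξ) = tElt * gv (sg 0) + tElt * gv ξ := by
  have h := congrArg yv (X_X_sg 0)
  rw [map_sub, map_add, map_smul, map_smul, (sg_sym 1).yv_eq, yv_X_mul (sg 0), yv_one] at h
  conv_lhs at h => rw [sg_zero]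
  simp only [mul_sub, mul_smul_comm, mul_one, map_sub, map_smul, smul_eq_mul, yv_X_mul] at h
  refine nat_cancel 3 (by norm_num) ?_
  push_cast
  linear_combination h

theorem yv_sg_mul_sg (j k : ℕ) : yv (sg j * sg k) = 9 * gv (sg (j + k)) := by
  induction j generalizing k with
  | zero =>
    rw [sg_zero, sub_mul, smul_mul_assoc, smul_mul_assoc, one_mul, map_sub, map_smul, map_smul,
      (sg_sym k).yv_eq, yv_X_mul, zero_add, smul_eq_mul, smul_zero]
    ring
  | succ j ih =>
    have h : sg (j + 1) * sg k = sg j * sg (k + 1) + gv (sg j) • sg k - gv (sg k) • sg j := by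
      simp only [sg, add_mul, sub_mul, mul_add, mul_sub, smul_mul_assoc, mul_smul_comm, one_mul, mul_one]
      rw [mul_left_comm (sg j) ξ (sg k), mul_left_comm (sg j) ξ (ξ * sg k),
        mul_left_comm (sg j) ξ (sg k), mul_assoc, mul_assoc]
      module
    rw [h, map_sub, map_add, map_smul, map_smul, (sg_sym j).yv_eq, (sg_sym k).yv_eq, ih,
      smul_zero, smul_zero, add_zero, sub_zero, Nat.add_right_comm, add_assoc]

theorem gv_sg_mul_sg (j k : ℕ) : gv (sg j * sg k) = 2 * tElt * gv (sg (j + k)) := by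
  have h := (sg_sym k).yv_mul (sg_sym j).std
  rw [sub_mul, smul_mul_assoc, smul_mul_assoc, map_sub, map_smul, map_smul, yv_sg_mul_sg, mul_assoc,
    yv_X_mul, smul_eq_mul, smul_eq_mul] at h
  refine nat_cancel 9 (by norm_num) ?_
  push_cast
  linear_combination h

theorem gv_relation (j k : ℕ) :
    27 * gv (sg (j + 1)) * gv (sg (k + 1)) - 36 * tElt ^ 2 * (gv (sg j) * gv (sg (k + 1))
        + gv (sg (j + 1)) * gv (sg k)) + (12 * tElt * gv (sg 0) - 32 * tElt ^ 4) * gv (sg j) * gv (sg k)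
      = (27 * gv (sg 0) - 180 * tElt ^ 3) * gv (sg (j + k + 2))
        + (24 * tElt ^ 2 * gv (sg 0) - 160 * tElt ^ 5) * gv (sg (j + k + 1)) := by
  have h := yv_three (sg_sym 0).std (sg_sym j).std (sg_sym k).std
  have hK := (sg_sym j).kk1 (sg_sym 0).std (sg_sym k).std
  have l (a b c : Lam[X]) : a * (b * c) = b * (a * c) := mul_left_comm a b c
  have p := And.intro (mul_comm (sg j) ξ) (mul_comm (sg k) ξ)
  have e1 : j + 1 + k = j + k + 1 := by omega
  have e2 : j + 1 + 1 + k = j + k + 2 := by omega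
  have e3 : j + 1 + 1 + 1 + k = j + k + 3 := by omega
  rw [hK] at h
  simp only [kap, sg_zero, add_mul, sub_mul, mul_add, mul_sub, smul_mul_assoc, mul_smul_comm,
    one_mul, mul_one, mul_assoc, p, l (sg j) ξ, l (sg k) ξ] at h
  simp only [X_X_sg_mul, X_X_sg, add_mul, sub_mul, mul_add, mul_sub, smul_mul_assoc, mul_smul_comm,
    one_mul, mul_one] at h
  simp only [map_add, map_sub, map_smul, smul_eq_mul, yv_sg_mul_sg, (sg_sym _).yv_eq, yv_X_mul,
    gv_sg_mul_sg, yv_one, yv_X, e1, e2, e3] at h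
  refine nat_cancel 729 (by norm_num) ?_
  push_cast
  linear_combination - h + (- 729 * gv (sg j) * gv (sg k) * tElt + 5832 * gv (sg (j + k + 1)) * tElt ^ 2
    + 6561 * gv (sg (j + k + 2))) * gv_X - 6561 * gv (sg j) * gv (sg k) * gv_X_X
end symmetric

/-! ### The symmetry of `P` -/

section symmetryP
open Polynomial

theorem sg_induction {M : Lam[X] → Prop} (hadd : ∀ p q, M p → M q → M (p + q))
    (hsmul : ∀ (a : Lam) p, M p → M (a • p)) (hone : M 1) (hs : ∀ i, M (sg i))
    (hX : ∀ i, M (ξ * sg i)) (p : Lam[X]) : M p := by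
  have sub : ∀ p q, M p → M q → M (p - q) := by
    intro p q hp hq
    rw [sub_eq_add_neg, ← neg_one_smul Lam q]
    exact hadd _ _ hp (hsmul _ _ hq)
  let B : Set Lam[X] := {1} ∪ Set.range sg ∪ Set.range fun i => ξ * sg i
  have hB : ∀ p ∈ Submodule.span Lam B, M p := by
    intro p hp
    induction hp using Submodule.span_induction with
    | mem p hp =>
      rcases hp with (rfl | ⟨i, rfl⟩) | ⟨i, rfl⟩
      exacts [hone, hs i, hX i]
    | zero => rw [← zero_smul Lam 1]; exact hsmul _ _ hone
    | add p q _ _ hp hq => exact hadd _ _ hp hq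
    | smul a p _ hp => exact hsmul _ _ hp
  have m1 : (1 : Lam[X]) ∈ Submodule.span Lam B := Submodule.subset_span (Or.inl (Or.inl rfl))
  have ms : ∀ i, sg i ∈ Submodule.span Lam B :=
    fun i => Submodule.subset_span (Or.inl (Or.inr ⟨i, rfl⟩))
  have mX : ∀ i, ξ * sg i ∈ Submodule.span Lam B := fun i => Submodule.subset_span (Or.inr ⟨i, rfl⟩)
  have mul : ∀ p ∈ Submodule.span Lam B, ξ * p ∈ Submodule.span Lam B := by
    intro p hp
    induction hp using Submodule.span_induction with
    | mem p hp =>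
      rcases hp with (rfl | ⟨i, rfl⟩) | ⟨i, rfl⟩
      · have h : ξ * 1 = algebraMap ℚ Lam 3⁻¹ • (sg 0 + tElt • 1) := by
          have h3 : algebraMap ℚ Lam 3⁻¹ * 3 = 1 := by
            rw [show (3 : Lam) = algebraMap ℚ Lam 3 from (map_ofNat _ 3).symm, ← map_mul]
            norm_num
          rw [sg_zero, sub_add_cancel, smul_smul, h3, one_smul, mul_one]
        rw [h]
        exact Submodule.smul_mem _ _ (add_mem (ms 0) (Submodule.smul_mem _ _ m1))
      · exact mX i
      · show ξ * (ξ * sg i) ∈ _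
        rw [X_X_sg]
        exact sub_mem (add_mem (ms _) (Submodule.smul_mem _ _ (mX i))) (Submodule.smul_mem _ _ m1)
    | zero => rw [mul_zero]; exact zero_mem _
    | add p q _ _ hp hq => rw [mul_add]; exact add_mem hp hq
    | smul a p _ hp => rw [mul_smul_comm]; exact Submodule.smul_mem _ _ hp
  refine hB p ?_
  induction p using Polynomial.induction_on' with
  | add p q hp hq => exact add_mem hp hq
  | monomial n a =>
    rw [← mul_one a, ← smul_eq_mul, ← smul_monomial]
    refine Submodule.smul_mem _ _ ?_
    induction n with
    | zero => exact m1
    | succ n ih => rw [← X_mul_monomial]; exact mul _ ih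

/-- The linear form that takes the `n`-th power of the variable to twice `x_{n + k + 1}`. -/
def xv (k : ℕ) : Lam[X] →ₗ[Lam] Lam :=
  yv ∘ₗ LinearMap.mulLeft Lam (ξ ^ k) + tElt ^ (k + 1) • leval tElt

theorem xv_apply (k : ℕ) (p : Lam[X]) : xv k p = yv (ξ ^ k * p) + tElt ^ (k + 1) * leval tElt p := rfl

theorem yv_X_pow (n : ℕ) : yv (ξ ^ n) = 2 * xElt (n + 1) - tElt ^ (n + 1) := by
  rw [X_pow_eq_monomial, yv_monomial, one_mul, yElt]

theorem xv_X_pow (k n : ℕ) : xv k (ξ ^ n) = 2 * xElt (n + k + 1) := by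
  rw [xv_apply, ← pow_add, yv_X_pow, leval_apply, eval_pow, eval_X, add_comm k n]
  ring

/-- The bilinear extension of `P`. -/
def bp (p q : Lam[X]) : Lam :=
  3 * xv 2 p * xv 4 q - 3 * tElt * xv 1 p * xv 4 q - 9 * tElt * xv 2 p * xv 3 q
    - 6 * tElt ^ 2 * xv 0 p * xv 4 q + 9 * tElt ^ 2 * xv 1 p * xv 3 q
    + 18 * tElt ^ 3 * xv 0 p * xv 3 q - 2 * (xElt 3 + 2 * tElt ^ 3) * xv 1 p * xv 2 q
    + 4 * tElt * (xElt 3 - 4 * tElt ^ 3) * xv 0 p * xv 2 q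
    + 8 * tElt ^ 2 * (tElt ^ 3 - xElt 3) * xv 0 p * xv 1 q
    + 2 * leval tElt p * (3 * tElt ^ 3 * xv 4 q - 9 * tElt ^ 4 * xv 3 q
      + (7 * tElt ^ 3 - xElt 3) * tElt ^ 2 * xv 2 q + 3 * (xElt 3 - tElt ^ 3) * tElt ^ 3 * xv 1 q
      + 2 * (tElt ^ 3 - xElt 3) * tElt ^ 4 * xv 0 q)

theorem ev_polyP (i j : ℕ) : 4 * ev (polyP (i + 1) (j + 1)) = bp (ξ ^ i) (ξ ^ j) := by
  have hT : ev T = tElt := MvPolynomial.aeval_X _ _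
  have hX : ∀ n, ev (X n) = xElt n := fun n => MvPolynomial.aeval_X _ _
  simp only [polyP, bp, map_add, map_sub, map_mul, map_pow, map_ofNat, hT, hX, xv_X_pow, leval_apply,
    eval_pow, eval_X, Nat.reduceAdd, add_assoc, add_zero]
  ring

theorem two_xElt_three : 2 * xElt 3 = 3 * gv ξ + tElt ^ 3 := by
  have h := yv_X_pow 2
  rw [pow_two, yv_X_mul] at h
  linear_combination - h

theorem yv_pow_sg (m i : ℕ) : yv (ξ ^ (m + 2) * sg i) = yv (ξ ^ m * sg (i + 1))
    + 2 * tElt * yv (ξ ^ (m + 1) * sg i) - gv (sg i) * yv (ξ ^ m) := by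
  have e : ξ ^ (m + 2) * sg i = ξ ^ m * (ξ * (ξ * sg i)) := by ring
  rw [e, X_X_sg, mul_sub, mul_add, mul_smul_comm, mul_smul_comm, map_sub, map_add, map_smul,
    map_smul, mul_one, ← mul_assoc, ← pow_succ, smul_eq_mul, smul_eq_mul]

theorem yv_pow_zero : yv (ξ ^ 0) = 3 * tElt := by rw [pow_zero, yv_one]
theorem yv_pow_one : yv (ξ ^ 1) = tElt ^ 2 := by rw [pow_one, yv_X]
theorem yv_pow_two : yv (ξ ^ 2) = 3 * gv ξ := by rw [pow_two, yv_X_mul]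
theorem yv_pow_three : yv (ξ ^ 3) = 3 * gv (ξ * ξ) := by rw [pow_succ', pow_two, yv_X_mul]
theorem yv_pow_four : 3 * yv (ξ ^ 4) = 3 * gv (sg 1) + 5 * tElt ^ 2 * gv (sg 0)
    + 3 * tElt * gv (ξ * ξ) := by
  have h : ξ ^ 3 * sg 0 = (3 : Lam) • ξ ^ 4 - tElt • ξ ^ 3 := by
    rw [sg_zero, mul_sub, mul_smul_comm, mul_smul_comm, mul_one, ← pow_succ]
  have h1 := yv_pow_sg 1 0
  have h2 := yv_pow_sg 0 0
  rw [h, map_sub, map_smul, map_smul] at h1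
  simp only [zero_add, pow_one, pow_zero, one_mul, Nat.reduceAdd, yv_X_mul, yv_one, yv_X,
    (sg_sym _).yv_eq, smul_eq_mul, yv_pow_three] at h1 h2
  linear_combination h1 + 2 * tElt * h2

theorem bp_symm (p q : Lam[X]) : bp p q = bp q p := by
  have hs : ∀ i, yv (ξ ^ 0 * sg i) = 0 ∧ yv (ξ ^ 1 * sg i) = 3 * gv (sg i)
      ∧ yv (ξ ^ 2 * sg i) = 3 * tElt * gv (sg i)
      ∧ yv (ξ ^ 3 * sg i) = 3 * gv (sg (i + 1)) + 5 * tElt ^ 2 * gv (sg i)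
      ∧ yv (ξ ^ 4 * sg i) = 9 * tElt * gv (sg (i + 1)) + 10 * tElt ^ 3 * gv (sg i)
        - 3 * gv (sg i) * gv ξ
      ∧ yv (ξ ^ 5 * sg i) = 3 * gv (sg (i + 2)) + 23 * tElt ^ 2 * gv (sg (i + 1))
        + 20 * tElt ^ 4 * gv (sg i) - 6 * tElt * gv (sg i) * gv ξ
        - 3 * gv (sg i) * gv (ξ * ξ) := by
    have a0 : ∀ i, yv (ξ ^ 0 * sg i) = 0 := fun i => by rw [pow_zero, one_mul, (sg_sym i).yv_eq]
    have a1 : ∀ i, yv (ξ ^ 1 * sg i) = 3 * gv (sg i) := fun i => by rw [pow_one, yv_X_mul]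
    have a2 : ∀ i, yv (ξ ^ 2 * sg i) = 3 * tElt * gv (sg i) := fun i => by
      rw [yv_pow_sg 0, a0, a1, pow_zero, yv_one]; ring
    have a3 : ∀ i, yv (ξ ^ 3 * sg i) = 3 * gv (sg (i + 1)) + 5 * tElt ^ 2 * gv (sg i) := fun i => by
      rw [yv_pow_sg 1, a1, a2, pow_one, yv_X]; ring
    have a4 : ∀ i, yv (ξ ^ 4 * sg i) = 9 * tElt * gv (sg (i + 1)) + 10 * tElt ^ 3 * gv (sg i)
        - 3 * gv (sg i) * gv ξ := fun i => by
      rw [yv_pow_sg 2, a2, a3, yv_pow_two]; ring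
    refine fun i => ⟨a0 i, a1 i, a2 i, a3 i, a4 i, ?_⟩
    rw [yv_pow_sg 3, a3, a4, yv_pow_three]; ring
  have hX : ∀ k i, xv k (ξ * sg i) = yv (ξ ^ (k + 1) * sg i)
      + tElt ^ (k + 2) * leval tElt (sg i) := by
    intro k i
    rw [xv_apply, ← mul_assoc, ← pow_succ, leval_apply, leval_apply, eval_mul, eval_X]
    ring
  have hl : ∀ i, leval tElt (ξ * sg i) = tElt * leval tElt (sg i) := by
    intro i; rw [leval_apply, leval_apply, eval_mul, eval_X]
  have h1 : ∀ k, xv k 1 = yv (ξ ^ k) + tElt ^ (k + 1) := by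
    intro k; rw [xv_apply, leval_apply, eval_one, mul_one, mul_one]
  have hl1 : leval tElt (1 : Lam[X]) = 1 := by rw [leval_apply, eval_one]
  have add : ∀ p q r, bp p r = bp r p → bp q r = bp r q → bp (p + q) r = bp r (p + q) := by
    intro p q r hp hq
    simp only [bp, map_add] at hp hq ⊢
    linear_combination hp + hq
  have smul : ∀ (a : Lam) p r, bp p r = bp r p → bp (a • p) r = bp r (a • p) := by
    intro a p r hp
    simp only [bp, map_smul, smul_eq_mul] at hp ⊢
    linear_combination a * hp
  have b1 : ∀ i, bp 1 (sg i) = bp (sg i) 1 := by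
    intro i
    simp only [bp, hl1, h1, xv_apply, hs, Nat.reduceAdd, yv_pow_zero, yv_pow_one, yv_pow_two, yv_pow_three]
    linear_combination (9 * gv (sg i) * gv ξ - 21 * gv (sg i) * tElt ^ 3) * two_xElt_three
  have b2 : ∀ i, bp 1 (ξ * sg i) = bp (ξ * sg i) 1 := by
    intro i
    have h4 := yv_pow_four
    have hr := gv_relation 0 i
    simp only [zero_add] at hr
    refine nat_cancel 3 (by norm_num) ?_
    push_cast
    simp only [bp, hl1, hl, h1, hX, hs, Nat.reduceAdd, yv_pow_zero, yv_pow_one, yv_pow_two, yv_pow_three]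
    linear_combination 3 * (15 * gv (sg (i + 1)) * tElt ^ 2 - 9 * gv (sg i) * gv ξ * tElt
        + gv (sg i) * tElt ^ 4) * two_xElt_three
      + 3 * (- 3 * gv (sg (i + 1)) + 4 * gv (sg i) * tElt ^ 2) * h4
      + 3 * (24 * gv (sg (i + 1)) * tElt - 9 * gv (sg i) * gv ξ - 11 * gv (sg i) * tElt ^ 3) * gv_X_X
      + (11 * gv (sg (i + 1)) * tElt ^ 2 + 9 * gv (sg (i + 2)) - 4 * gv (sg 0) * gv (sg i) * tElt
        - 3 * gv (sg i) * gv ξ * tElt + 3 * gv (sg i) * tElt ^ 4) * gv_X - hr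
  have b3 : ∀ i j, bp (sg i) (sg j) = bp (sg j) (sg i) := by
    intro i j
    simp only [bp, xv_apply, hs, Nat.reduceAdd]
    ring
  have b4 : ∀ i j, bp (sg i) (ξ * sg j) = bp (ξ * sg j) (sg i) := by
    intro i j
    simp only [bp, hl, hX, xv_apply, hs, Nat.reduceAdd]
    linear_combination (- 9 * gv (sg i) * gv (sg (j + 1)) + 12 * gv (sg i) * gv (sg j) * tElt ^ 2)
      * two_xElt_three
  have b5 : ∀ i j, bp (ξ * sg i) (ξ * sg j) = bp (ξ * sg j) (ξ * sg i) := by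
    intro i j
    have r1 := gv_relation i (j + 1)
    have r2 := gv_relation (i + 1) j
    rw [add_right_comm i 1 j] at r2
    rw [← add_assoc i j 1] at r1
    simp only [add_assoc, Nat.reduceAdd] at r1 r2
    simp only [bp, hl, hX, hs, Nat.reduceAdd]
    linear_combination (gv (sg i) * gv (sg (j + 1)) - gv (sg (i + 1)) * gv (sg j))
      * (9 * tElt * two_xElt_three + 9 * gv_X_X + tElt * gv_X) + r1 - r2
  refine sg_induction (M := fun p => bp p q = bp q p) (fun p q => add p q _) (fun a p => smul a p _)
    ?_ ?_ ?_ p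
  · exact (sg_induction (M := fun q => bp q 1 = bp 1 q) (fun p q => add p q _)
      (fun a p => smul a p _) rfl (fun i => (b1 i).symm) (fun i => (b2 i).symm) q).symm
  · exact fun i => (sg_induction (M := fun q => bp q (sg i) = bp (sg i) q) (fun p q => add p q _)
      (fun a p => smul a p _) (b1 i) (fun j => b3 j i) (fun j => (b4 i j).symm) q).symm
  · exact fun i => (sg_induction (M := fun q => bp q (ξ * sg i) = bp (ξ * sg i) q)
      (fun p q => add p q _) (fun a p => smul a p _) (b2 i) (fun j => b4 j i) (fun j => b5 j i) q).symm

theorem ev_polyP_symm (i j : ℕ) (hi : 1 ≤ i) (hj : 1 ≤ j) : ev (polyP i j) = ev (polyP j i) := by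
  obtain ⟨i, rfl⟩ := Nat.exists_eq_add_of_le' hi
  obtain ⟨j, rfl⟩ := Nat.exists_eq_add_of_le' hj
  refine nat_cancel 4 (by norm_num) ?_
  push_cast
  rw [ev_polyP, ev_polyP, bp_symm]

end symmetryP

/-! ### The relations between the `Q` -/

section relationQ
open Polynomial

/-- The variable of the generating series. -/
abbrev zz : PowerSeries Lam := PowerSeries.X
/-- The constant generating series `t`. -/
abbrev tt : PowerSeries Lam := PowerSeries.C tElt

theorem eq_zero_of_eq_X_mul {ι : Type*} (d : ι → PowerSeries Lam)
    (h : ∀ j, ∃ a b k l, d j = zz * (a * d k + b * d l)) (j : ι) : d j = 0 := by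
  have hd : ∀ n j, zz ^ n ∣ d j := by
    intro n
    induction n with
    | zero => intro j; rw [pow_zero]; exact one_dvd _
    | succ n ih =>
      intro j
      obtain ⟨a, b, k, l, e⟩ := h j
      rw [e, pow_succ']
      exact mul_dvd_mul_left _ (dvd_add (Dvd.dvd.mul_left (ih k) _) (Dvd.dvd.mul_left (ih l) _))
  refine PowerSeries.ext fun n => ?_
  rw [map_zero]
  exact PowerSeries.X_pow_dvd_iff.1 (hd (n + 1) j) n (Nat.lt_succ_self n)

/-- The polynomial of a rung step of the symmetric ladders. -/
def qq : Lam[X] := ξ ^ 2 - (2 * tElt) • ξ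

/-- The generating series of the values of `p * qq ^ i`. -/
def us (p : Lam[X]) : PowerSeries Lam := PowerSeries.mk fun i => yv (p * qq ^ i)

theorem us_smul (a : Lam) (p : Lam[X]) : us (a • p) = PowerSeries.C a * us p := by
  refine PowerSeries.ext fun n => ?_; simp [us]

theorem us_sub (p q : Lam[X]) : us (p - q) = us p - us q := by
  refine PowerSeries.ext fun n => ?_; simp [us, sub_mul]

theorem us_eq (p : Lam[X]) : us p = PowerSeries.C (yv p) + zz * us (p * qq) := by
  refine PowerSeries.ext fun n => ?_
  cases n with
  | zero => simp [us]
  | succ n => simp [us, PowerSeries.coeff_succ_X_mul, PowerSeries.coeff_C, pow_succ', mul_assoc]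

theorem us_X_pow (m : ℕ) : us (ξ ^ m) = PowerSeries.C (yv (ξ ^ m))
    + zz * (us (ξ ^ (m + 2)) - 2 * tt * us (ξ ^ (m + 1))) := by
  have e : ξ ^ m * qq = ξ ^ (m + 2) - (2 * tElt) • ξ ^ (m + 1) := by
    rw [qq, mul_sub, mul_smul_comm, ← pow_add, ← pow_succ]
  rw [us_eq, e, us_sub, us_smul, map_mul, map_ofNat]

/-- The generating series of the values of the symmetric ladders. -/
def ss (p : Lam[X]) : PowerSeries Lam := PowerSeries.mk fun i => yv (p * sg i)

/-- The generating series of the `gv (sg i)`. -/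
def gs : PowerSeries Lam := PowerSeries.mk fun i => gv (sg i)

theorem ss_eq (p : Lam[X]) : ss p = PowerSeries.C (yv (p * sg 0))
    + zz * (ss (p * qq) + gs * PowerSeries.C (yv p)) := by
  refine PowerSeries.ext fun n => ?_
  cases n with
  | zero => simp [ss]
  | succ n =>
    have e : p * sg (n + 1) = p * qq * sg n + gv (sg n) • p := by
      rw [sg, qq, mul_assoc p, sub_mul, smul_mul_assoc, mul_add, mul_smul_comm, mul_one, pow_two,
        mul_assoc ξ]
    simp [ss, gs, PowerSeries.coeff_succ_X_mul, PowerSeries.coeff_C, e]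

theorem ss_eq_us (p : Lam[X]) : ss p = us (p * sg 0) + zz * gs * us p := by
  refine sub_eq_zero.1 (eq_zero_of_eq_X_mul (fun p => ss p - (us (p * sg 0) + zz * gs * us p))
    (fun p => ⟨1, 0, p * qq, p, ?_⟩) p)
  have h1 := ss_eq p
  have h2 := us_eq p
  have h3 := us_eq (p * sg 0)
  rw [mul_right_comm] at h3
  linear_combination h1 - h3 - zz * gs * h2

theorem us_mul_sg_zero (m : ℕ) : us (ξ ^ m * sg 0) = 3 * us (ξ ^ (m + 1)) - tt * us (ξ ^ m) := by
  rw [sg_zero, mul_sub, mul_smul_comm, mul_smul_comm, us_sub, us_smul, us_smul, mul_one, map_ofNat,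
    pow_succ]

theorem isUnit_of_constantCoeff {d : PowerSeries Lam} (n : ℕ) (hn : n ≠ 0)
    (h : PowerSeries.constantCoeff d = n) : IsUnit d := by
  rw [PowerSeries.isUnit_iff_constantCoeff, h, ← map_natCast (algebraMap ℚ Lam)]
  exact (IsUnit.mk0 (n : ℚ) (by exact_mod_cast hn)).map _

theorem us_relation : us (ξ ^ 1) * (1 + zz * tt ^ 2 - zz * (zz * us (ξ ^ 3)))
    + (tt - zz * us (ξ ^ 2)) ^ 2 = 2 * (tt ^ 2 - zz * us (ξ ^ 3)) := by
  have h0 := us_X_pow 0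
  have h1 := us_X_pow 1
  have s0 := ss_eq_us (ξ ^ 0)
  have s1 := ss_eq_us (ξ ^ 1)
  have e0 : ss (ξ ^ 0) = 0 := by refine PowerSeries.ext fun n => ?_; simp [ss, (sg_sym n).yv_eq]
  have e1 : ss (ξ ^ 1) = 3 * gs := by
    refine PowerSeries.ext fun n => ?_
    rw [← map_ofNat (PowerSeries.C (R := Lam)) 3, PowerSeries.coeff_C_mul]
    simp [ss, gs, yv_X_mul]
  rw [us_mul_sg_zero, e0] at s0
  rw [us_mul_sg_zero, e1] at s1
  rw [yv_pow_zero, map_mul, map_ofNat] at h0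
  rw [yv_pow_one, map_pow] at h1
  simp only [zero_add, Nat.reduceAdd] at h0 h1 s0 s1
  set u0 := us (ξ ^ 0)
  set u1 := us (ξ ^ 1)
  set v2 := zz * us (ξ ^ 2) with hv2
  set v3 := zz * us (ξ ^ 3) with hv3
  set w := zz * gs with hw
  obtain ⟨d, hd⟩ : ∃ d, d = 9 - (tt - w - 6 * tt) * (tt - w) * zz := ⟨_, rfl⟩
  have i0 : u0 = 3 * tt + v2 - 2 * tt * zz * u1 := by rw [hv2]; linear_combination h0
  have i1 : v3 = u1 - tt ^ 2 + 2 * tt * v2 := by rw [hv2, hv3]; linear_combination -h1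
  have i2 : 3 * v2 = (tt - w) * zz * u1 + 3 * w := by
    rw [hv2, hw] at *; linear_combination - zz * s1
  have j0 : d * u0 = 9 * (3 * tt + w) := by
    rw [hd]
    linear_combination 9 * i0 + 3 * i2 - (tt - w - 6 * tt) * zz * s0
  have hu : IsUnit d := by
    refine isUnit_of_constantCoeff 9 (by norm_num) ?_
    rw [hd]; simp only [map_sub, map_mul, PowerSeries.constantCoeff_X, mul_zero, sub_zero]; exact map_ofNat _ 9
  have hu3 : IsUnit (3 : PowerSeries Lam) := by
    exact isUnit_of_constantCoeff 3 (by norm_num) (map_ofNat _ 3)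
  have j1 : d * u1 = 3 * (tt - w) * (3 * tt + w) := by
    refine hu3.mul_left_cancel ?_
    linear_combination (tt - w) * j0 - d * s0
  have j2 : d * v2 = (tt - w) ^ 2 * zz * (3 * tt + w) + w * d := by
    refine hu3.mul_left_cancel ?_
    linear_combination d * i2 + (tt - w) * zz * j1
  have j3 : d * v3 = 3 * (tt - w) * (3 * tt + w) - tt ^ 2 * d
      + 2 * tt * ((tt - w) ^ 2 * zz * (3 * tt + w) + w * d) := by
    linear_combination d * i1 + j1 + 2 * tt * j2
  refine (hu.mul hu).mul_left_cancel ?_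
  have k1 : d * d * (u1 * (1 + zz * tt ^ 2 - zz * v3) + (tt - v2) ^ 2)
      = d * u1 * (d + zz * tt ^ 2 * d - zz * (d * v3)) + (tt * d - d * v2) ^ 2 := by ring
  have k2 : d * d * (2 * (tt ^ 2 - v3)) = 2 * d * (tt ^ 2 * d - d * v3) := by ring
  rw [k1, k2, j1, j2, j3, hd]
  ring

theorem ev_T : ev T = tElt := MvPolynomial.aeval_X _ _
theorem ev_X (n : ℕ) : ev (X n) = xElt n := MvPolynomial.aeval_X _ _

/-- The generating series of the `Q^k_{i,j}`, up to powers of `-2`. -/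
def qs (k j : ℕ) : PowerSeries Lam := PowerSeries.mk fun i => (-2) ^ i * ev (polyQ k (i + 1) j)

/-- The generating series of the `Q^k_{i-1,2}`, up to powers of `-2`. -/
def cs (k : ℕ) : PowerSeries Lam := PowerSeries.mk fun i => (-2) ^ i * ev (polyQ k i 2)

theorem cs_eq (k : ℕ) : cs k = tt ^ k - 2 * (zz * qs k 2) := by
  refine PowerSeries.ext fun n => ?_
  rw [← map_pow, ← map_ofNat (PowerSeries.C (R := Lam)) 2, map_sub, PowerSeries.coeff_C_mul]
  cases n with
  | zero => simp [cs, polyQ, ev_T]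
  | succ n =>
    rw [PowerSeries.coeff_succ_X_mul, PowerSeries.coeff_C, if_neg n.succ_ne_zero, cs, qs,
      PowerSeries.coeff_mk, PowerSeries.coeff_mk]
    ring

theorem qs_eq (k j : ℕ) : qs k j = PowerSeries.C (xElt (j + k)) + zz * (qs k (j + 2)
    - 2 * tt * qs k (j + 1) - tt ^ j * qs k 2
    - PowerSeries.C (xElt (j + 2) - tElt ^ (j + 2)) * cs k) := by
  refine PowerSeries.ext fun n => ?_
  have e : 2 * tt * qs k (j + 1) = PowerSeries.C (2 * tElt) * qs k (j + 1) := by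
    rw [map_mul, map_ofNat]
  rw [e, ← map_pow]
  cases n with
  | zero => simp [qs, polyQ, ev_X]
  | succ n =>
    have h2 : (2 : Lam) * algebraMap ℚ Lam (1 / 2) = 1 := by
      rw [show (2 : Lam) = algebraMap ℚ Lam 2 from (map_ofNat _ 2).symm, ← map_mul]
      norm_num
    have hC : ev (MvPolynomial.C (1 / 2)) = algebraMap ℚ Lam (1 / 2) := MvPolynomial.aeval_C _ _
    rw [map_add, PowerSeries.coeff_succ_X_mul, PowerSeries.coeff_C, if_neg n.succ_ne_zero]
    rw [map_sub (PowerSeries.coeff n), map_sub (PowerSeries.coeff n), map_sub (PowerSeries.coeff n),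
      PowerSeries.coeff_C_mul, PowerSeries.coeff_C_mul, PowerSeries.coeff_C_mul]
    simp only [qs, cs, PowerSeries.coeff_mk, polyQ, map_add ev, map_sub ev, map_mul ev, map_pow ev,
      ev_T, ev_X, hC]
    linear_combination (-2) ^ n * (ev (polyQ k (n + 1) (j + 2)) - tElt ^ j * ev (polyQ k (n + 1) 2)
      - (xElt (j + 2) - tElt ^ (j + 2)) * ev (polyQ k n 2)) * h2

theorem two_qs (k j : ℕ) : 2 * qs k (j + 1) = us (ξ ^ (j + k)) - zz * cs k * us (ξ ^ (j + 2))
    + tt ^ (j + 1) * cs k := by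
  refine sub_eq_zero.1 (eq_zero_of_eq_X_mul (fun j => 2 * qs k (j + 1) - (us (ξ ^ (j + k))
    - zz * cs k * us (ξ ^ (j + 2)) + tt ^ (j + 1) * cs k))
    (fun j => ⟨1, -(2 * tt), j + 2, j + 1, ?_⟩) j)
  have h1 := qs_eq k (j + 1)
  have h2 := us_X_pow (j + k)
  have h3 := us_X_pow (j + 2)
  have h4 := cs_eq k
  rw [yv_X_pow, map_sub, map_mul, map_ofNat, map_pow] at h2 h3
  rw [map_sub, map_pow] at h1
  have e1 : j + 2 + k = j + k + 2 := by omega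
  have e2 : j + 1 + k = j + k + 1 := by omega
  have e3 : j + 1 + 2 = j + 3 := by omega
  rw [e2] at h1
  simp only [e1, e2, e3, add_assoc, Nat.reduceAdd] at h1 h2 h3 ⊢
  linear_combination 2 * h1 - h2 + zz * cs k * h3 - tt ^ (j + 1) * h4

theorem ev_polyQ (i : ℕ) : ev (polyQ 1 (i + 1) 1) = ev (polyQ 2 i 2) := by
  have q1 := two_qs 1 0
  have q2 := two_qs 1 1
  have q3 := two_qs 2 1
  have c1 := cs_eq 1
  have c2 := cs_eq 2
  simp only [zero_add, Nat.reduceAdd] at q1 q2 q3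
  have hu : IsUnit (1 + zz * tt ^ 2 - zz * (zz * us (ξ ^ 3))) :=
    isUnit_of_constantCoeff 1 one_ne_zero (by simp)
  have hu2 : IsUnit (2 : PowerSeries Lam) := isUnit_of_constantCoeff 2 two_ne_zero (map_ofNat _ 2)
  have h : qs 1 1 = cs 2 := by
    refine (hu2.mul hu).mul_left_cancel ?_
    linear_combination (1 + zz * tt ^ 2 - zz * (zz * us (ξ ^ 3))) * q1
      + (tt - zz * us (ξ ^ 2)) * (c1 - zz * q2) + us_relation - 2 * (c2 - zz * q3)
  have h' := congrArg (PowerSeries.coeff i) h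
  rw [qs, cs, PowerSeries.coeff_mk, PowerSeries.coeff_mk] at h'
  have hi : IsUnit ((-2 : Lam) ^ i) := by
    refine IsUnit.pow _ (IsUnit.neg ?_)
    rw [show (2 : Lam) = algebraMap ℚ Lam 2 from (map_ofNat _ 2).symm]
    exact (IsUnit.mk0 (2 : ℚ) two_ne_zero).map _
  exact hi.mul_left_cancel h'

end relationQ

/-! ### Degrees -/

section degrees

theorem cls_mem_homog {a : Lam} {G : Graph 3} (h : (a : F 3) = G.cls) {d : ℕ}
    (hG : Nat.card G.V = 2 * d + 1) : a ∈ homog d :=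
  Submodule.subset_span ⟨G, hG, h⟩

theorem mul_mem_homog {d e : ℕ} {a b : Lam} (ha : a ∈ homog d) (hb : b ∈ homog e) :
    a * b ∈ homog (d + e) := by
  have hb' : (b : F 3) ∈ Submodule.span ℚ {c : F 3 | ∃ G : Graph 3, Nat.card G.V = 2 * e + 1
    ∧ c = G.cls} := hb
  have ha' : (a : F 3) ∈ Submodule.span ℚ {c : F 3 | ∃ G : Graph 3, Nat.card G.V = 2 * d + 1
    ∧ c = G.cls} := ha
  show act a b ∈ Submodule.span ℚ {c : F 3 | ∃ G : Graph 3, Nat.card G.V = 2 * (d + e) + 1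
    ∧ c = G.cls}
  refine Submodule.span_induction (p := fun b _ => act a b ∈ Submodule.span ℚ _) ?_ ?_ ?_ ?_ hb'
  · rintro _ ⟨G, hG, rfl⟩
    rw [act_cls a G (att G 0).1]
    refine Submodule.span_induction
      (p := fun c _ => insAt G.p (att G 0).1 c ∈ Submodule.span ℚ _) ?_ ?_ ?_ ?_ ha'
    · rintro _ ⟨H, hH, rfl⟩
      rw [insAt, Ins_cls]
      by_cases hc : Conn (ins (G.p.map (ext (onV (opt (att G 0).1)))) H)
      · rw [rcls_of hc]
        refine Submodule.subset_span ⟨_, ?_, rfl⟩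
        have h1 : Nat.card G.V = Nat.card _ + 1 :=
          (Nat.card_congr (opt (att G 0).1)).trans Finite.card_option
        show Nat.card (_ ⊕ H.V) = _
        rw [Nat.card_sum]
        omega
      · rw [rcls_not hc]; exact zero_mem _
    · rw [map_zero]; exact zero_mem _
    · intro x y _ _ hx hy; rw [map_add]; exact add_mem hx hy
    · intro r x _ hx; rw [map_smul]; exact Submodule.smul_mem _ _ hx
  · rw [map_zero]; exact zero_mem _
  · intro x y _ _ hx hy; rw [map_add]; exact add_mem hx hy
  · intro r x _ hx; rw [map_smul]; exact Submodule.smul_mem _ _ hx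

instance : SetLike.GradedMonoid homog where
  one_mem := cls_mem_homog (G := yGraph) rfl (by simp)
  mul_mem _ _ _ _ := mul_mem_homog

theorem tElt_mem_homog : tElt ∈ homog 1 :=
  cls_mem_homog tElt_val (by show Nat.card (Fin 3) = _; simp)

theorem xElt_mem_homog : ∀ n, xElt n ∈ homog n
  | 0 => zero_mem _
  | n + 1 => cls_mem_homog (xElt_val n) (by
      show Nat.card (Fin (n + 1) ⊕ Fin (n + 2)) = _
      rw [Nat.card_sum, Nat.card_fin, Nat.card_fin]; ring)

theorem ev_mem_homog {p : Poly} {d : ℕ} (h : p.IsWeightedHomogeneous wt d) : ev p ∈ homog d := by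
  rw [ev, MvPolynomial.aeval_def, MvPolynomial.eval₂_eq]
  refine sum_mem fun m hm => ?_
  rw [← Algebra.smul_def, ← h (MvPolynomial.mem_support_iff.1 hm), Finsupp.weight_apply]
  refine Submodule.smul_mem _ _ (SetLike.prod_mem_graded (A := homog) (fun g => m g • wt g) _
    fun g _ => SetLike.pow_mem_graded _ ?_)
  cases g with
  | t => exact tElt_mem_homog
  | x n => exact xElt_mem_homog n

section weights
open MvPolynomial

theorem weight_T_pow (n : ℕ) : (T ^ n).IsWeightedHomogeneous wt n := by
  have h := (isWeightedHomogeneous_X ℚ wt Gen.t).pow n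
  rwa [show n • wt Gen.t = n from Nat.mul_one n] at h

theorem weight_X (n : ℕ) : (X n).IsWeightedHomogeneous wt n := isWeightedHomogeneous_X ℚ wt (Gen.x n)

theorem weight_sub {p q : Poly} {d : ℕ} (hp : p.IsWeightedHomogeneous wt d)
    (hq : q.IsWeightedHomogeneous wt d) : (p - q).IsWeightedHomogeneous wt d :=
  (weightedHomogeneousSubmodule ℚ wt d).sub_mem hp hq

theorem weight_polyP (i j : ℕ) : (polyP i j).IsWeightedHomogeneous wt (i + j + 6) := by
  have hn (n : ℕ) [n.AtLeastTwo] {p : Poly} {d : ℕ} (hp : p.IsWeightedHomogeneous wt d) :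
      ((OfNat.ofNat n : Poly) * p).IsWeightedHomogeneous wt d := by
    have h := (isWeightedHomogeneous_C wt (OfNat.ofNat n : ℚ)).mul hp
    rwa [zero_add, map_ofNat] at h
  have hd {p : Poly} {d e : ℕ} (hp : p.IsWeightedHomogeneous wt d) (h : d = e) :
      p.IsWeightedHomogeneous wt e := h ▸ hp
  have hT : T.IsWeightedHomogeneous wt 1 := isWeightedHomogeneous_X ℚ wt Gen.t
  have h1 := (weight_X 3).add (hn 2 (weight_T_pow 3))
  have h2 := weight_sub (weight_X 3) (hn 4 (weight_T_pow 3))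
  have h3 := weight_sub (weight_T_pow 3) (weight_X 3)
  have h4 := weight_sub (hn 7 (weight_T_pow 3)) (weight_X 3)
  have h5 := weight_sub (weight_X 3) (weight_T_pow 3)
  rw [polyP]
  repeat' first | refine weight_sub ?_ ?_ | refine IsWeightedHomogeneous.add ?_ ?_
  · exact hd ((hn 3 (weight_X _)).mul (weight_X _)) (by omega)
  · exact hd (((hn 3 hT).mul (weight_X _)).mul (weight_X _)) (by omega)
  · exact hd (((hn 9 hT).mul (weight_X _)).mul (weight_X _)) (by omega)
  · exact hd (((hn 6 (weight_T_pow _)).mul (weight_X _)).mul (weight_X _)) (by omega)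
  · exact hd (((hn 9 (weight_T_pow _)).mul (weight_X _)).mul (weight_X _)) (by omega)
  · exact hd (((hn 18 (weight_T_pow _)).mul (weight_X _)).mul (weight_X _)) (by omega)
  · exact hd (((hn 2 h1).mul (weight_X _)).mul (weight_X _)) (by omega)
  · exact hd ((((hn 4 hT).mul h2).mul (weight_X _)).mul (weight_X _)) (by omega)
  · exact hd ((((hn 8 (weight_T_pow _)).mul h3).mul (weight_X _)).mul (weight_X _)) (by omega)
  · exact hd ((hn 3 (weight_T_pow _)).mul (weight_X _)) (by omega)
  · exact hd ((hn 9 (weight_T_pow _)).mul (weight_X _)) (by omega)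
  · exact hd ((h4.mul (weight_T_pow _)).mul (weight_X _)) (by omega)
  · exact hd (((hn 3 h5).mul (weight_T_pow _)).mul (weight_X _)) (by omega)
  · exact hd (((hn 2 h3).mul (weight_T_pow _)).mul (weight_X _)) (by omega)

theorem weight_polyQ (k i : ℕ) : (polyQ k i 2).IsWeightedHomogeneous wt (2 * i + k) ∧
    ∀ j, (polyQ k (i + 1) j).IsWeightedHomogeneous wt (2 * i + j + k) := by
  have hd {p : Poly} {d e : ℕ} (hp : p.IsWeightedHomogeneous wt d) (h : d = e) :
      p.IsWeightedHomogeneous wt e := h ▸ hp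
  have hC := isWeightedHomogeneous_C wt (1 / 2 : ℚ)
  induction i with
  | zero =>
    rw [polyQ]
    refine ⟨hd (weight_T_pow k) (by omega), fun j => ?_⟩
    rw [polyQ]
    exact hd (weight_X _) (by omega)
  | succ i ih =>
    refine ⟨hd (ih.2 2) (by omega), fun j => ?_⟩
    rw [polyQ]
    refine ((weight_sub ?_ ?_).add ?_).add ?_
    · exact hd ((isWeightedHomogeneous_X ℚ wt Gen.t).mul (ih.2 _))
        (by show 1 + _ = _; omega)
    · exact hd (hC.mul (ih.2 _)) (by omega)
    · exact hd ((hC.mul (weight_T_pow _)).mul (ih.2 _)) (by omega)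
    · exact hd ((hC.mul (weight_sub (weight_X _) (weight_T_pow _))).mul ih.1) (by omega)

end weights
end degrees

end Vogel

end

theorem theorem1 :
    -- the graphs themselves represent the elements `t` and `x_n` of `Λ`
    ((Vogel.tElt : Vogel.F 3) = Vogel.tGraph.cls ∧
      ∀ m, (Vogel.xElt (m + 3) : Vogel.F 3) = (Vogel.xGraph (m + 2)).cls) ∧
    -- the relations
    (∀ i j, 1 ≤ i → 1 ≤ j → Vogel.ev (Vogel.polyP i j) = Vogel.ev (Vogel.polyP j i)) ∧
    (∀ i, Vogel.ev (Vogel.polyQ 1 (i + 1) 1) = Vogel.ev (Vogel.polyQ 2 i 2)) ∧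
    -- their homogeneity
    (Vogel.tElt ∈ Vogel.homog 1 ∧ ∀ n, 1 ≤ n → Vogel.xElt n ∈ Vogel.homog n) ∧
    (∀ i j, 1 ≤ i → 1 ≤ j →
      (Vogel.polyP i j).IsWeightedHomogeneous Vogel.wt (i + j + 6) ∧
      Vogel.ev (Vogel.polyP i j) ∈ Vogel.homog (i + j + 6)) ∧
    (∀ i,
      (Vogel.polyQ 1 (i + 1) 1).IsWeightedHomogeneous Vogel.wt (2 * i + 2) ∧
      (Vogel.polyQ 2 i 2).IsWeightedHomogeneous Vogel.wt (2 * i + 2) ∧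
      Vogel.ev (Vogel.polyQ 1 (i + 1) 1) ∈ Vogel.homog (2 * i + 2) ∧
      Vogel.ev (Vogel.polyQ 2 i 2) ∈ Vogel.homog (2 * i + 2)) := by
  refine ⟨⟨Vogel.tElt_val, fun m => Vogel.xElt_val (m + 2)⟩, Vogel.ev_polyP_symm, Vogel.ev_polyQ,
    ⟨Vogel.tElt_mem_homog, fun n _ => Vogel.xElt_mem_homog n⟩,
    fun i j _ _ => ⟨Vogel.weight_polyP i j, Vogel.ev_mem_homog (Vogel.weight_polyP i j)⟩, fun i => ?_⟩
  have h1 : (Vogel.polyQ 1 (i + 1) 1).IsWeightedHomogeneous Vogel.wt (2 * i + 2) :=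
    (Vogel.weight_polyQ 1 i).2 1
  have h2 := (Vogel.weight_polyQ 2 i).1
  exact ⟨h1, h2, Vogel.ev_mem_homog h1, Vogel.ev_mem_homog h2⟩
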